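/- **Model.** A *word RAM with $w$-bit words* runs a fixed finite program (a while program) over finitely many registers and finitely many random-access arrays, all of whose cells hold integers in $[0,2^w)$. Each of the following costs one step: loading a constant, arithmetic, bitwise, shift and comparison instructions on registers, indirect reads and writes of array cells, drawing a fair random bit into a register, the empty instruction, and the test of a conditional or a loop. The machine aborts (does not halt properly) if the result of an instruction does not fit into a word. A program is required to work on every such machine with $w\ge c\log_2(n+2)$, where $c$ is a constant and $n$ is the size of the instance (number of vertices, or dimension of the matrices), and for arbitrary contents of the memory outside of the input. **Matrix multiplication.** Let $\omega$ be a real number such that matrix multiplication takes $O(N^{\omega})$ time in this model: some program computes, for all $N\ge 1$ and all $N\times N$ matrices $A,B$ with entries in $\{0,1\}$, the integer product $AB$ in at most $C_0N^{\omega}$ steps, for a constant $C_0$. **Separators.** A *$k$-separator* of a graph $G$ is a set $S$ of $k'\le k$ vertices such that every connected component of $G-S$ has at most $k-k'$ vertices. **Statement.** There are a program and constants $c,C$ with the following property. Let $G$ be a graph with $n\ge 1$ vertices $0,\dots,n-1$, given by adjacency lists in any order, let $S$ be a $k$-separator of $G$, given by its characteristic vector, and let $H$ be a graph on four vertices that is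 neither $K_4$ nor $\overline{K_4}$, given by its adjacency matrix. On input $(G,S,H)$, 1. for all outcomes of its random bits, the program halts after at most $C\,k^{\omega-1}n$ steps, and it either outputs four vertices of $G$ that form an induced copy of $H$ (together with an isomorphism from $H$ onto this copy) or reports that there is none; 2. if $G$ contains an induced copy of $H$, then with probability at least $1/2$ the program outputs one. In particular the error is one-sided: if $G$ has no induced copy of $H$, the program always reports that there is none. -/

import Mathlib

open MeasureTheory

/-! ### Separators -/

/-- `S` is a `k`-separator of `G`: `S` has `k' ≤ k` vertices and every connected component of `G - S`
has at most `k - k'` vertices. -/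
def IsKSeparator {V : Type*} (G : SimpleGraph V) (k : ℕ) (S : Finset V) : Prop :=
  S.card ≤ k ∧
    ∀ K : (G.induce {v : V | v ∉ S}).ConnectedComponent, K.supp.ncard ≤ k - S.card

/-! ### A randomized word RAM -/

namespace WordRAM

/-- The binary word instructions. The comparisons return `1` for true and `0` for false. -/
inductive BinOp : Type
  | add | sub | mul | div | mod | and | or | xor | shl | shr | lt | eq

/-- The integer value of a binary instruction (before checking that it fits into a word). -/
def BinOp.eval : BinOp → ℕ → ℕ → ℕ
  | .add, x, y => x + y
  | .sub, x, y => x - y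
  | .mul, x, y => x * y
  | .div, x, y => x / y
  | .mod, x, y => x % y
  | .and, x, y => x &&& y
  | .or, x, y => x ||| y
  | .xor, x, y => x ^^^ y
  | .shl, x, y => x <<< y
  | .shr, x, y => x >>> y
  | .lt, x, y => if x < y then 1 else 0
  | .eq, x, y => if x = y then 1 else 0

/-- Programs. Every program is a finite text; registers and arrays are named by fixed numbers
occurring in the text, so a program has finitely many registers and finitely many arrays, while the
cells of an array are addressed indirectly through registers. -/
inductive Prog : Type
  /-- Do nothing. -/
  | skip : Prog
  /-- `r := v` for a fixed number `v`. -/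
  | const (r v : ℕ) : Prog
  /-- `r := x ∘ y` for registers `x`, `y`. -/
  | op (o : BinOp) (r x y : ℕ) : Prog
  /-- `r := a[i]` where `a` is an array and `i` a register. -/
  | load (r a i : ℕ) : Prog
  /-- `a[i] := r` where `a` is an array and `i` a register. -/
  | store (a i r : ℕ) : Prog
  /-- `r :=` a fresh fair random bit. -/
  | flip (r : ℕ) : Prog
  /-- First `p`, then `q`. -/
  | seq (p q : Prog) : Prog
  /-- If register `r` is nonzero then `p` else `q`. -/
  | cond (r : ℕ) (p q : Prog) : Prog
  /-- While register `r` is nonzero do `p`. -/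
  | loop (r : ℕ) (p : Prog) : Prog

/-- The contents of the registers and of the random-access arrays, and the random bits that have not
been consumed yet. -/
structure State : Type where
  reg : ℕ → ℕ
  mem : ℕ → ℕ → ℕ
  coins : ℕ → Bool

namespace State

def setReg (s : State) (r v : ℕ) : State :=
  { s with reg := Function.update s.reg r v }

def setMem (s : State) (a i v : ℕ) : State :=
  { s with mem := Function.update s.mem a (Function.update (s.mem a) i v) }

def setCoins (s : State) (b : ℕ → Bool) : State :=
  { s with coins := b }

/-- All registers and all memory cells hold words of `w` bits. -/
def Fits (s : State) (w : ℕ) : Prop :=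
  (∀ r, s.reg r < 2 ^ w) ∧ ∀ a i, s.mem a i < 2 ^ w

end State

/-- `Exec w p s t s'`: on a word RAM with words of `w` bits, the program `p`, started in state `s`,
halts after `t` steps in state `s'`. Every instruction and every test costs one step. An instruction
whose result does not fit into `w` bits aborts the machine, so that there is no halting run then. -/
inductive Exec (w : ℕ) : Prog → State → ℕ → State → Prop
  | skip (s : State) : Exec w .skip s 1 s
  | const (s : State) (r v : ℕ) (h : v < 2 ^ w) : Exec w (.const r v) s 1 (s.setReg r v)
  | op (s : State) (o : BinOp) (r x y : ℕ) (h : o.eval (s.reg x) (s.reg y) < 2 ^ w) :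
      Exec w (.op o r x y) s 1 (s.setReg r (o.eval (s.reg x) (s.reg y)))
  | load (s : State) (r a i : ℕ) : Exec w (.load r a i) s 1 (s.setReg r (s.mem a (s.reg i)))
  | store (s : State) (a i r : ℕ) : Exec w (.store a i r) s 1 (s.setMem a (s.reg i) (s.reg r))
  | flip (s : State) (r : ℕ) :
      Exec w (.flip r) s 1 ((s.setReg r (s.coins 0).toNat).setCoins fun j => s.coins (j + 1))
  | seq {p q : Prog} {s₁ s₂ s₃ : State} {t u : ℕ} (hp : Exec w p s₁ t s₂)
      (hq : Exec w q s₂ u s₃) : Exec w (.seq p q) s₁ (t + u) s₃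
  | condTrue {r : ℕ} {p q : Prog} {s s' : State} {t : ℕ} (h : s.reg r ≠ 0)
      (hp : Exec w p s t s') : Exec w (.cond r p q) s (t + 1) s'
  | condFalse {r : ℕ} {p q : Prog} {s s' : State} {t : ℕ} (h : s.reg r = 0)
      (hq : Exec w q s t s') : Exec w (.cond r p q) s (t + 1) s'
  | loopStop {r : ℕ} {p : Prog} {s : State} (h : s.reg r = 0) : Exec w (.loop r p) s 1 s
  | loopStep {r : ℕ} {p : Prog} {s₁ s₂ s₃ : State} {t u : ℕ} (h : s₁.reg r ≠ 0)
      (hp : Exec w p s₁ t s₂) (hq : Exec w (.loop r p) s₂ u s₃) :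
      Exec w (.loop r p) s₁ (t + u + 1) s₃

/-- The law of an infinite sequence of independent fair random bits. -/
noncomputable def coinMeasure : Measure (ℕ → Bool) :=
  Measure.infinitePi fun _ : ℕ => (PMF.uniformOfFintype Bool).toMeasure

/-! ### Matrix multiplication -/

/-- Array `a` holds the square matrix `M`, row by row. -/
def HoldsMatrix {N : ℕ} (s : State) (a : ℕ) (M : Matrix (Fin N) (Fin N) ℕ) : Prop :=
  ∀ i j : Fin N, s.mem a (N * (i : ℕ) + (j : ℕ)) = M i j

/-- Matrix multiplication takes `O(N ^ ω)` time: there is a program that computes the integer product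
of any two `N × N` matrices with entries in `{0, 1}` in at most `C * N ^ ω` steps, on every word RAM
whose word size is at least `c * log₂ (N + 2)`, whatever the contents of the memory outside of the
input. (The program computes the product for all values of the random bits, so these are of no use
to it.) -/
def IsMatMulExponent (ω : ℝ) : Prop :=
  ∃ (p : Prog) (c : ℕ) (C : ℝ), ∀ (N : ℕ) (A B : Matrix (Fin N) (Fin N) ℕ), 0 < N →
    (∀ i j, A i j ≤ 1) → (∀ i j, B i j ≤ 1) →
    ∀ (w : ℕ) (s : State), (N + 2) ^ c ≤ 2 ^ w → s.Fits w →
      s.reg 0 = N → HoldsMatrix s 0 A → HoldsMatrix s 1 B →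
      ∃ (t : ℕ) (s' : State), Exec w p s t s' ∧ (t : ℝ) ≤ C * (N : ℝ) ^ ω ∧
        HoldsMatrix s' 2 (A * B)

/-! ### Input and output of the search for an induced copy -/

/-- The arrays `off` and `nbr` are an adjacency list representation of `G`: the neighbours of `v`,
in any order and without repetition, are `nbr[off[v]], …, nbr[off[v + 1] - 1]`. -/
def IsAdjacencyLists {n : ℕ} (G : SimpleGraph (Fin n)) (off nbr : ℕ → ℕ) : Prop :=
  off 0 = 0 ∧ ∀ v : Fin n, off (v : ℕ) ≤ off ((v : ℕ) + 1) ∧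
    Set.BijOn nbr (Set.Ico (off (v : ℕ)) (off ((v : ℕ) + 1)))
      {x : ℕ | ∃ u : Fin n, G.Adj v u ∧ x = (u : ℕ)}

open Classical in
/-- The state holds the input `(G, S, H)`: register `0` holds the number of vertices of `G`, the
arrays `0` and `1` the adjacency lists of `G`, array `2` the characteristic vector of `S`, and
array `3` the adjacency matrix of `H`. Nothing is assumed about the rest of the memory. -/
def HoldsInput {n : ℕ} (s : State) (G : SimpleGraph (Fin n)) (S : Finset (Fin n))
    (H : SimpleGraph (Fin 4)) : Prop :=
  s.reg 0 = n ∧ IsAdjacencyLists G (s.mem 0) (s.mem 1) ∧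
    (∀ v : Fin n, s.mem 2 (v : ℕ) = if v ∈ S then 1 else 0) ∧
    ∀ i j : Fin 4, s.mem 3 (4 * (i : ℕ) + (j : ℕ)) = if H.Adj i j then 1 else 0

/-- The answer "there is no induced copy". -/
def ReportsNone (s : State) : Prop :=
  s.reg 0 = 0

/-- The state presents an induced copy of `H` in `G`: register `0` holds `1`, and the first four cells
of array `0` hold the images of the vertices of `H` under an isomorphism of `H` onto an induced
subgraph of `G`. -/
def ReportsCopy {n : ℕ} (s : State) (G : SimpleGraph (Fin n)) (H : SimpleGraph (Fin 4)) : Prop :=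
  s.reg 0 = 1 ∧ ∃ f : H ↪g G, ∀ i : Fin 4, s.mem 0 (i : ℕ) = (f i : ℕ)

end WordRAM

namespace WordRAM

/-! ### The high-level language and its compilation -/

/-! The program counts labelled induced copies of `H` modulo 24. If two graphs on four vertices
differ only in the adjacency of one pair, then in the sum of their counts that pair is subject to no
condition but distinctness. The sum therefore becomes a sum over the images u, v of the other two
vertices, and the summand depends only on the degrees, the codegree and the adjacency of u and v
(`IsAdj.indCount_flip`). The count for the complete graph is 0 modulo 24, since every vertex set
carrying a copy carries 24 labelled ones. Such flips lead from the complete graph to every graph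
with an edge, so all these counts have the shape `formula`: a sum over edges of a polynomial in
local data, plus multiples of the sum of the squared codegrees and of the square of the degree sum
(`hasFormula`).

The formula is evaluated with the help of the separator. The vertices are ordered with the separator
first and then component by component, and consecutive components are merged into blocks. Separator
and block together have at most 2L vertices, where L ≤ k, and every block but the last has at least
L vertices. Squaring the adjacency matrix of separator plus block gives the codegrees of all pairs
that meet the block, at a total cost of about n/k products of dimension O(k). No edge joins two
blocks. Pairs from different blocks do enter the sum of the squared codegrees, but their common
neighbours lie in the separator. Expanding the square and exchanging the sums leaves a sum over
pairs i, j of separator vertices of the number of common neighbours of i and j in one block times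
their number in the other (`IsBlock.offSum_codeg_sq`). A running table over the separator pairs thus
suffices.

A copy has to be turned into a nonzero count. Let T be the vertex set of a copy. As `H` is neither
complete nor empty, not all 24 relabellings are automorphisms, so the count on T is nonzero modulo
24. For every R disjoint from T, inclusion-exclusion over the subsets of T gives some V ⊆ T with
nonzero count on R ∪ V (`exists_subset_ne_zero`). Hence at least one sixteenth of all vertex sets
have a nonzero count (`card_badSets_le`), and eleven random sets all fail with probability at most
(15/16)^11 < 1/2 (`half_le_coinMeasure`).

A set with nonzero count is reduced to a copy by splitting it into five classes. Four vertices miss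
one of the classes, so by inclusion-exclusion some proper union of classes still has a nonzero count
(`exists_mask_ne_zero`). The sizes shrink geometrically, so the total time is that of one count up
to a constant factor. At the end at most four vertices remain and are tested directly. Only tested
copies are reported, which makes the error one-sided.

That ω ≥ 2 is a consequence of the hypothesis, because N² output cells may have to be overwritten
(`two_le_of_isMatMulExponent`); it lets costs linear in k be absorbed into k^(ω-1). The machine is
handled through a small structured language: `WP` is total correctness of compiled commands within a
time bound. -/

@[simp] theorem State.reg_setReg (s : State) (r v r' : ℕ) :
    (s.setReg r v).reg r' = if r' = r then v else s.reg r' := by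
  simp [State.setReg, Function.update_apply]

@[simp] theorem State.mem_setReg (s : State) (r v : ℕ) : (s.setReg r v).mem = s.mem := rfl

@[simp] theorem State.coins_setReg (s : State) (r v : ℕ) : (s.setReg r v).coins = s.coins := rfl

@[simp] theorem State.reg_setMem (s : State) (a i v : ℕ) : (s.setMem a i v).reg = s.reg := rfl

@[simp] theorem State.coins_setMem (s : State) (a i v : ℕ) : (s.setMem a i v).coins = s.coins := rfl

@[simp] theorem State.mem_setMem (s : State) (a i v a' j : ℕ) :
    (s.setMem a i v).mem a' j = if a' = a then (if j = i then v else s.mem a' j) else s.mem a' j := by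
  by_cases h : a' = a
  · subst h; simp [State.setMem, Function.update_apply]
  · simp [State.setMem, h]

@[simp] theorem State.reg_setCoins (s : State) (b : ℕ → Bool) : (s.setCoins b).reg = s.reg := rfl

@[simp] theorem State.mem_setCoins (s : State) (b : ℕ → Bool) : (s.setCoins b).mem = s.mem := rfl

@[simp] theorem State.coins_setCoins (s : State) (b : ℕ → Bool) : (s.setCoins b).coins = b := rfl

theorem State.Fits.setReg {s : State} {w r v : ℕ} (h : s.Fits w) (hv : v < 2 ^ w) :
    (s.setReg r v).Fits w := by
  refine ⟨fun r' => ?_, h.2⟩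
  rw [State.reg_setReg]; split_ifs
  exacts [hv, h.1 _]

theorem State.Fits.setMem {s : State} {w a i v : ℕ} (h : s.Fits w) (hv : v < 2 ^ w) :
    (s.setMem a i v).Fits w := by
  refine ⟨h.1, fun a' j => ?_⟩
  rw [State.mem_setMem]; split_ifs
  exacts [hv, h.2 _ _, h.2 _ _]

theorem Exec.fits {w : ℕ} (hw : 1 < 2 ^ w) {p : Prog} {s s' : State} {t : ℕ}
    (h : Exec w p s t s') : s.Fits w → s'.Fits w := by
  induction h with
  | skip s => exact id
  | const s r v hv => exact fun hs => hs.setReg hv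
  | op s o r x y ho => exact fun hs => hs.setReg ho
  | load s r _ _ => exact fun hs => hs.setReg (hs.2 _ _)
  | store s a i r => exact fun hs => hs.setMem (hs.1 _)
  | flip s r =>
    intro hs
    have : (s.coins 0).toNat < 2 ^ w := lt_of_le_of_lt (Bool.toNat_le _) hw
    exact hs.setReg this
  | seq _ _ h1 h2 => exact fun hs => h2 (h1 hs)
  | condTrue _ _ h1 => exact h1
  | condFalse _ _ h1 => exact h1
  | loopStop _ => exact id
  | loopStep _ _ _ h1 h2 => exact fun hs => h2 (h1 hs)

/-! ### Running a given program on registers and arrays of its own. -/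

/-- The program working on the registers `2, 5, 8, …` and the arrays `100, 101, …`. -/
def Prog.embed : Prog → Prog
  | .skip => .skip
  | .const r v => .const (3 * r + 2) v
  | .op o r x y => .op o (3 * r + 2) (3 * x + 2) (3 * y + 2)
  | .load r a i => .load (3 * r + 2) (a + 100) (3 * i + 2)
  | .store a i r => .store (a + 100) (3 * i + 2) (3 * r + 2)
  | .flip r => .flip (3 * r + 2)
  | .seq p q => .seq p.embed q.embed
  | .cond r p q => .cond (3 * r + 2) p.embed q.embed
  | .loop r p => .loop (3 * r + 2) p.embed

/-- The state `S` contains the state `s` in the registers and arrays used by embedded programs. -/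
structure State.Embeds (S s : State) : Prop where
  reg : ∀ r, S.reg (3 * r + 2) = s.reg r
  mem : ∀ a, S.mem (a + 100) = s.mem a
  coins : S.coins = s.coins

/-- The parts of the state that embedded programs do not see are the same. -/
def State.SameOutside (S S' : State) : Prop :=
  (∀ r, r % 3 ≠ 2 → S'.reg r = S.reg r) ∧ ∀ a < 100, S'.mem a = S.mem a

theorem State.SameOutside.trans {S S' S'' : State} (h : S.SameOutside S')
    (h' : S'.SameOutside S'') : S.SameOutside S'' :=
  ⟨fun r hr => (h'.1 r hr).trans (h.1 r hr), fun a ha => (h'.2 a ha).trans (h.2 a ha)⟩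

theorem State.Embeds.setReg {S s : State} (h : S.Embeds s) (r v : ℕ) :
    (S.setReg (3 * r + 2) v).Embeds (s.setReg r v) ∧ S.SameOutside (S.setReg (3 * r + 2) v) := by
  refine ⟨⟨fun r' => ?_, h.mem, h.coins⟩, fun r' hr => ?_, fun _ _ => rfl⟩
  · simp [h.reg]
  · rw [State.reg_setReg, if_neg (by omega)]

theorem State.Embeds.setMem {S s : State} (h : S.Embeds s) (a i v : ℕ) :
    (S.setMem (a + 100) i v).Embeds (s.setMem a i v) ∧ S.SameOutside (S.setMem (a + 100) i v) := by
  refine ⟨⟨h.reg, fun a' => ?_, h.coins⟩, fun r' hr => rfl, fun a' ha => ?_⟩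
  · ext j; simp [h.mem]
  · ext j; rw [State.mem_setMem, if_neg (by omega)]

theorem Exec.embed {w : ℕ} {p : Prog} {s s' : State} {t : ℕ} (h : Exec w p s t s') :
    ∀ S : State, S.Embeds s → ∃ S', Exec w p.embed S t S' ∧ S'.Embeds s' ∧ S.SameOutside S' := by
  induction h with
  | skip s => exact fun S h => ⟨S, .skip S, h, fun _ _ => rfl, fun _ _ => rfl⟩
  | const s r v hv => exact fun S h => ⟨_, .const S _ v hv, h.setReg r v⟩
  | op s o r x y ho =>
    intro S h
    have := Exec.op S o (3 * r + 2) (3 * x + 2) (3 * y + 2) (w := w) (by rwa [h.reg, h.reg])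
    rw [h.reg, h.reg] at this
    exact ⟨_, this, h.setReg r _⟩
  | load s r a i =>
    intro S h
    have := Exec.load S (3 * r + 2) (a + 100) (3 * i + 2) (w := w)
    rw [h.reg, h.mem] at this
    exact ⟨_, this, h.setReg r _⟩
  | store s a i r =>
    intro S h
    have := Exec.store S (a + 100) (3 * i + 2) (3 * r + 2) (w := w)
    rw [h.reg, h.reg] at this
    exact ⟨_, this, h.setMem a _ _⟩
  | flip s r =>
    intro S h
    have := Exec.flip S (3 * r + 2) (w := w)
    rw [h.coins] at this
    obtain ⟨h1, h2⟩ := h.setReg r (s.coins 0).toNat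
    exact ⟨_, this, ⟨h1.reg, h1.mem, rfl⟩, h2⟩
  | seq _ _ h1 h2 =>
    intro S h
    obtain ⟨S1, e1, r1, o1⟩ := h1 S h
    obtain ⟨S2, e2, r2, o2⟩ := h2 S1 r1
    exact ⟨S2, .seq e1 e2, r2, o1.trans o2⟩
  | condTrue hr _ h1 =>
    intro S h
    obtain ⟨S1, e1, r1, o1⟩ := h1 S h
    exact ⟨S1, .condTrue (by rwa [h.reg]) e1, r1, o1⟩
  | condFalse hr _ h1 =>
    intro S h
    obtain ⟨S1, e1, r1, o1⟩ := h1 S h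
    exact ⟨S1, .condFalse (by rwa [h.reg]) e1, r1, o1⟩
  | loopStop hr =>
    exact fun S h => ⟨S, .loopStop (by rwa [h.reg]), h, fun _ _ => rfl, fun _ _ => rfl⟩
  | loopStep hr _ _ h1 h2 =>
    intro S h
    obtain ⟨S1, e1, r1, o1⟩ := h1 S h
    obtain ⟨S2, e2, r2, o2⟩ := h2 S1 r1
    exact ⟨S2, .loopStep (by rwa [h.reg]) e1 e2, r2, o1.trans o2⟩

/-- The number of words. -/
def word (w : ℕ) : ℕ := 2 ^ w

theorem State.Fits.reg_lt {s : State} {w : ℕ} (h : s.Fits w) (r : ℕ) : s.reg r < word w := h.1 r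

theorem State.Fits.mem_lt {s : State} {w : ℕ} (h : s.Fits w) (a i : ℕ) : s.mem a i < word w :=
  h.2 a i

/-! ### Expressions and their evaluation. -/

/-- Expressions over registers and arrays. -/
inductive Expr : Type
  | lit (v : ℕ) : Expr
  | var (r : ℕ) : Expr
  | rd (a : ℕ) (i : Expr) : Expr
  | bin (o : BinOp) (x y : Expr) : Expr
  | ite (c x y : Expr) : Expr

namespace Expr

instance : Add Expr := ⟨.bin .add⟩
instance : Sub Expr := ⟨.bin .sub⟩
instance : Mul Expr := ⟨.bin .mul⟩
instance : Div Expr := ⟨.bin .div⟩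
instance : Mod Expr := ⟨.bin .mod⟩
instance (n : ℕ) : OfNat Expr n := ⟨.lit n⟩

/-- The comparison `x < y`, with value `1` or `0`. -/
def lt (x y : Expr) : Expr := .bin .lt x y

/-- The comparison `x = y`, with value `1` or `0`. -/
def eq (x y : Expr) : Expr := .bin .eq x y

def eval (s : State) : Expr → ℕ
  | .lit v => v
  | .var r => s.reg r
  | .rd a i => s.mem a (i.eval s)
  | .bin o x y => o.eval (x.eval s) (y.eval s)
  | .ite c x y => if c.eval s ≠ 0 then x.eval s else y.eval s

/-- Whether a binary operation on words gives a word, where this is not automatic. -/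
def fitsOp (w : ℕ) : BinOp → ℕ → ℕ → Prop
  | .sub, _, _ => True
  | .div, _, _ => True
  | .mod, _, _ => True
  | .shr, _, _ => True
  | .lt, _, _ => True
  | .eq, _, _ => True
  | o, x, y => o.eval x y < word w

/-- All intermediate results fit into a word. -/
def Ok (w : ℕ) (s : State) : Expr → Prop
  | .lit v => v < word w
  | .var _ => True
  | .rd _ i => i.Ok w s
  | .bin o x y => x.Ok w s ∧ y.Ok w s ∧ fitsOp w o (x.eval s) (y.eval s)
  | .ite c x y => c.Ok w s ∧ (c.eval s ≠ 0 → x.Ok w s) ∧ (c.eval s = 0 → y.Ok w s)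

def cost : Expr → ℕ
  | .lit _ => 1
  | .var _ => 1
  | .rd _ i => i.cost + 1
  | .bin _ x y => x.cost + y.cost + 1
  | .ite c x y => c.cost + max x.cost y.cost + 1

/-- Code that evaluates the expression into the `t`-th temporary register. -/
def comp : Expr → ℕ → Prog
  | .lit v, t => .const (3 * t + 1) v
  -- There is no move instruction; `x ||| x = x` copies a register and cannot overflow.
  | .var r, t => .op .or (3 * t + 1) (3 * r) (3 * r)
  | .rd a i, t => .seq (i.comp t) (.load (3 * t + 1) a (3 * t + 1))
  | .bin o x y, t =>
      .seq (.seq (x.comp t) (y.comp (t + 1))) (.op o (3 * t + 1) (3 * t + 1) (3 * (t + 1) + 1))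
  | .ite c x y, t => .seq (c.comp t) (.cond (3 * t + 1) (x.comp t) (y.comp t))

section
variable (s : State) (w : ℕ) (x y c : Expr) (n r a : ℕ)

@[simp] theorem eval_lit : (lit n).eval s = n := rfl
@[simp] theorem eval_ofNat : (ofNat(n) : Expr).eval s = n := rfl
@[simp] theorem eval_var : (var r).eval s = s.reg r := rfl
@[simp] theorem eval_rd : (rd a x).eval s = s.mem a (x.eval s) := rfl
@[simp] theorem eval_add : (x + y).eval s = x.eval s + y.eval s := rfl
@[simp] theorem eval_sub : (x - y).eval s = x.eval s - y.eval s := rfl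
@[simp] theorem eval_mul : (x * y).eval s = x.eval s * y.eval s := rfl
@[simp] theorem eval_div : (x / y).eval s = x.eval s / y.eval s := rfl
@[simp] theorem eval_mod : (x % y).eval s = x.eval s % y.eval s := rfl
@[simp] theorem eval_lt : (lt x y).eval s = if x.eval s < y.eval s then 1 else 0 := rfl
@[simp] theorem eval_eq : (eq x y).eval s = if x.eval s = y.eval s then 1 else 0 := rfl
@[simp] theorem eval_ite :
    (ite c x y).eval s = if c.eval s ≠ 0 then x.eval s else y.eval s := rfl

@[simp] theorem cost_lit : (lit n).cost = 1 := rfl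
@[simp] theorem cost_ofNat : (ofNat(n) : Expr).cost = 1 := rfl
@[simp] theorem cost_var : (var r).cost = 1 := rfl
@[simp] theorem cost_rd : (rd a x).cost = x.cost + 1 := rfl
@[simp] theorem cost_add : (x + y).cost = x.cost + y.cost + 1 := rfl
@[simp] theorem cost_sub : (x - y).cost = x.cost + y.cost + 1 := rfl
@[simp] theorem cost_mul : (x * y).cost = x.cost + y.cost + 1 := rfl
@[simp] theorem cost_div : (x / y).cost = x.cost + y.cost + 1 := rfl
@[simp] theorem cost_mod : (x % y).cost = x.cost + y.cost + 1 := rfl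
@[simp] theorem cost_lt : (lt x y).cost = x.cost + y.cost + 1 := rfl
@[simp] theorem cost_eq : (eq x y).cost = x.cost + y.cost + 1 := rfl
@[simp] theorem cost_ite : (ite c x y).cost = c.cost + max x.cost y.cost + 1 := rfl

theorem eval_lt_ne_zero : (lt x y).eval s ≠ 0 ↔ x.eval s < y.eval s := by simp
theorem eval_lt_eq_zero : (lt x y).eval s = 0 ↔ ¬ x.eval s < y.eval s := by simp

@[simp] theorem ok_lit : (lit n).Ok w s ↔ n < word w := Iff.rfl
@[simp] theorem ok_ofNat : (ofNat(n) : Expr).Ok w s ↔ n < word w := Iff.rfl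
@[simp] theorem ok_var : (var r).Ok w s := trivial
@[simp] theorem ok_rd : (rd a x).Ok w s ↔ x.Ok w s := Iff.rfl
@[simp] theorem ok_add :
    (x + y).Ok w s ↔ x.Ok w s ∧ y.Ok w s ∧ x.eval s + y.eval s < word w := Iff.rfl
@[simp] theorem ok_mul :
    (x * y).Ok w s ↔ x.Ok w s ∧ y.Ok w s ∧ x.eval s * y.eval s < word w := Iff.rfl
@[simp] theorem ok_sub : (x - y).Ok w s ↔ x.Ok w s ∧ y.Ok w s := by
  change _ ∧ _ ∧ True ↔ _; simp
@[simp] theorem ok_div : (x / y).Ok w s ↔ x.Ok w s ∧ y.Ok w s := by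
  change _ ∧ _ ∧ True ↔ _; simp
@[simp] theorem ok_mod : (x % y).Ok w s ↔ x.Ok w s ∧ y.Ok w s := by
  change _ ∧ _ ∧ True ↔ _; simp
@[simp] theorem ok_lt : (lt x y).Ok w s ↔ x.Ok w s ∧ y.Ok w s := by
  change _ ∧ _ ∧ True ↔ _; simp
@[simp] theorem ok_eq : (eq x y).Ok w s ↔ x.Ok w s ∧ y.Ok w s := by
  change _ ∧ _ ∧ True ↔ _; simp
@[simp] theorem ok_ite : (ite c x y).Ok w s ↔
    c.Ok w s ∧ (c.eval s ≠ 0 → x.Ok w s) ∧ (c.eval s = 0 → y.Ok w s) := Iff.rfl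

end

theorem eval_lt_of_ok {w : ℕ} (hw : 1 < word w) {s : State}
    (hs : (∀ r, s.reg r < word w) ∧ ∀ a i, s.mem a i < word w) :
    ∀ e : Expr, e.Ok w s → e.eval s < word w
  | .lit v, h => h
  | .var r, _ => hs.1 r
  | .rd _ _, _ => hs.2 _ _
  | .ite c x y, h => by
    rw [eval_ite]; split_ifs with hc
    · exact eval_lt_of_ok hw hs x (h.2.1 hc)
    · exact eval_lt_of_ok hw hs y (h.2.2 (not_not.1 hc))
  | .bin o x y, h => by
    have hx := eval_lt_of_ok hw hs x h.1
    have h2 := h.2.2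
    have key : ∀ a b : ℕ, a ≤ b → b < word w → a < word w := fun _ _ => lt_of_le_of_lt
    cases o
    case sub => exact key _ _ (Nat.sub_le _ _) hx
    case div => exact key _ _ (Nat.div_le_self _ _) hx
    case mod => exact key _ _ (Nat.mod_le _ _) hx
    case shr => exact key _ _ (Nat.shiftRight_le _ _) hx
    case lt => change (if _ then 1 else 0) < _; split_ifs <;> omega
    case eq => change (if _ then 1 else 0) < _; split_ifs <;> omega
    all_goals exact h2

end Expr

/-- `S` represents the high-level state `s`. -/
structure Rep (S s : State) : Prop where
  reg : ∀ r, S.reg (3 * r) = s.reg r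
  mem : S.mem = s.mem
  coins : S.coins = s.coins

theorem Rep.fits {S s : State} (h : Rep S s) {w : ℕ} (hS : S.Fits w) : s.Fits w :=
  ⟨fun r => h.reg r ▸ hS.1 _, fun a i => h.mem ▸ hS.2 _ _⟩

/-- Evaluation into temporary `t` touches only temporaries from `t` on. Hence a left operand held in
`t` survives the evaluation of the right operand in `t + 1`, and the high-level state is represented
throughout. -/
theorem Expr.exec_comp {w : ℕ} (hw : 1 < word w) {s : State} : ∀ (e : Expr) (t : ℕ) (S : State),
    Rep S s → S.Fits w → e.Ok w s → ∃ k S', Exec w (e.comp t) S k S' ∧ k ≤ e.cost ∧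
      S'.reg (3 * t + 1) = e.eval s ∧ (∀ r, (r % 3 ≠ 1 ∨ r < 3 * t + 1) → S'.reg r = S.reg r) ∧
      S'.mem = S.mem ∧ S'.coins = S.coins
  | .lit v, t, S, _, _, h =>
    ⟨1, _, .const S _ v h, le_rfl, by simp, fun r hr => by simp; omega, rfl, rfl⟩
  | .var r, t, S, hr, hS, h => by
    have := Exec.op S .or (3 * t + 1) (3 * r) (3 * r) (w := w) (by simp [BinOp.eval, hS.1])
    refine ⟨1, _, this, le_rfl, by simp [BinOp.eval, hr.reg], fun r hr => by simp; omega, rfl, rfl⟩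
  | .rd a i, t, S, hr, hS, h => by
    obtain ⟨k, S', e, hk, hv, ho, hm, hc⟩ := exec_comp hw i t S hr hS h
    refine ⟨_, _, .seq e (.load S' _ _ _), by simpa [cost] using hk, ?_, fun r hr => ?_, hm, hc⟩
    · simp [hv, hm, hr.mem]
    · rw [State.reg_setReg, if_neg (by omega), ho r hr]
  | .bin o x y, t, S, hr, hS, h => by
    obtain ⟨k, S', e, hk, hv, ho, hm, hc⟩ := exec_comp hw x t S hr hS h.1
    have hr' : Rep S' s := ⟨fun r => by rw [ho _ (by omega), hr.reg], hm.trans hr.mem,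
      hc.trans hr.coins⟩
    obtain ⟨k', S'', e', hk', hv', ho', hm', hc'⟩ :=
      exec_comp hw y (t + 1) S' hr' (e.fits hw hS) h.2.1
    have h1 : S''.reg (3 * t + 1) = x.eval s := by rw [ho' _ (by omega), hv]
    have := Exec.op S'' o (3 * t + 1) (3 * t + 1) (3 * (t + 1) + 1) (w := w)
      (by rw [h1, hv']; exact Expr.eval_lt_of_ok hw (hr.fits hS) (.bin o x y) h)
    refine ⟨_, _, .seq (.seq e e') this, by simp only [cost]; omega, ?_, fun r hr => ?_,
      hm'.trans hm, hc'.trans hc⟩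
    · simp [h1, hv', Expr.eval]
    · rw [State.reg_setReg, if_neg (by omega), ho' r (by omega), ho r hr]
  | .ite c x y, t, S, hr, hS, h => by
    obtain ⟨k, S', e, hk, hv, ho, hm, hc⟩ := exec_comp hw c t S hr hS h.1
    have hr' : Rep S' s := ⟨fun r => by rw [ho _ (by omega), hr.reg], hm.trans hr.mem,
      hc.trans hr.coins⟩
    by_cases h0 : c.eval s = 0
    · obtain ⟨k', S'', e', hk', hv', ho', hm', hc'⟩ :=
        exec_comp hw y t S' hr' (e.fits hw hS) (h.2.2 h0)
      exact ⟨_, _, .seq e (.condFalse (hv.trans h0) e'), by simp only [cost]; omega,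
        by simp [h0, hv'], fun r hr => (ho' r hr).trans (ho r hr), hm'.trans hm, hc'.trans hc⟩
    · obtain ⟨k', S'', e', hk', hv', ho', hm', hc'⟩ :=
        exec_comp hw x t S' hr' (e.fits hw hS) (h.2.1 h0)
      exact ⟨_, _, .seq e (.condTrue (by rwa [hv]) e'), by simp only [cost]; omega,
        by simp [h0, hv'], fun r hr => (ho' r hr).trans (ho r hr), hm'.trans hm, hc'.trans hc⟩

/-! ### Commands, their compilation and their footprint. -/

/-- High-level commands; `mul r` calls a given program for matrix multiplication, with the dimension
in register `r`. -/
inductive Cmd : Type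
  | skip : Cmd
  | set (r : ℕ) (e : Expr) : Cmd
  | put (a : ℕ) (i e : Expr) : Cmd
  | flip (r : ℕ) : Cmd
  | mul (r : ℕ) : Cmd
  | seq (c d : Cmd) : Cmd
  | ite (e : Expr) (c d : Cmd) : Cmd
  | loop (e : Expr) (c : Cmd) : Cmd

infixr:60 " ;; " => Cmd.seq

namespace Cmd

/-- Compilation, given a program for matrix multiplication. -/
def comp (p : Prog) : Cmd → Prog
  | .skip => .skip
  | .set r e => .seq (e.comp 0) (.op .or (3 * r) 1 1)
  | .put a i e => .seq (.seq (i.comp 0) (e.comp 1)) (.store a 1 4)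
  | .flip r => .flip (3 * r)
  -- Register 2 is register 0 of the embedded program, where the dimension is expected.
  | .mul r => .seq (.op .or 2 (3 * r) (3 * r)) p.embed
  | .seq c d => .seq (c.comp p) (d.comp p)
  | .ite e c d => .seq (e.comp 0) (.cond 1 (c.comp p) (d.comp p))
  -- The condition is evaluated once before the loop and again at the end of every pass, each time
  -- into register 1, the temporary number 0.
  | .loop e c => .seq (e.comp 0) (.loop 1 (.seq (c.comp p) (e.comp 0)))

/-- Whether the command may change register `r`. -/
def wr : Cmd → ℕ → Bool
  | .skip, _ => false
  | .set r' _, r => r == r'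
  | .put _ _ _, _ => false
  | .flip r', r => r == r'
  | .mul _, _ => false
  | .seq c d, r => c.wr r || d.wr r
  | .ite _ c d, r => c.wr r || d.wr r
  | .loop _ c, r => c.wr r

/-- Whether the command may change array `a`. -/
def wa : Cmd → ℕ → Bool
  | .skip, _ => false
  | .set _ _, _ => false
  | .put a' _ _, a => a == a'
  | .flip _, _ => false
  | .mul _, a => Nat.ble 100 a
  | .seq c d, a => c.wa a || d.wa a
  | .ite _ c d, a => c.wa a || d.wa a
  | .loop _ c, a => c.wa a

/-- `for i < rn do c`. -/
def upto (i rn : ℕ) (c : Cmd) : Cmd :=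
  .set i 0 ;; .loop (.lt (.var i) (.var rn)) (c ;; .set i (.var i + 1))

/-- The cost of loop-free code. -/
def cost : Cmd → ℕ
  | .skip => 1
  | .set _ e => e.cost + 1
  | .put _ i e => i.cost + e.cost + 1
  | .flip _ => 1
  -- A dummy value, as for loops below: `vc` is `False` for both.
  | .mul _ => 0
  | .seq c d => c.cost + d.cost
  | .ite e c d => e.cost + 1 + max c.cost d.cost
  | .loop _ _ => 0

/-- The precondition of loop-free code for the postcondition `Q`. -/
def vc (w : ℕ) : Cmd → (State → Prop) → State → Prop
  | .skip, Q, s => Q s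
  | .set r e, Q, s => e.Ok w s ∧ Q (s.setReg r (e.eval s))
  | .put a i e, Q, s => i.Ok w s ∧ e.Ok w s ∧ Q (s.setMem a (i.eval s) (e.eval s))
  | .flip r, Q, s => Q ((s.setReg r (s.coins 0).toNat).setCoins fun j => s.coins (j + 1))
  | .mul _, _, _ => False
  | .seq c d, Q, s => c.vc w (d.vc w Q) s
  | .ite e c d, Q, s => e.Ok w s ∧ (e.eval s ≠ 0 → c.vc w Q s) ∧ (e.eval s = 0 → d.vc w Q s)
  | .loop _ _, _, _ => False

end Cmd

/-- Registers and arrays that the command does not write are the same in both states. -/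
structure Off (c : Cmd) (s s' : State) : Prop where
  reg : ∀ {r}, c.wr r = false → s'.reg r = s.reg r
  mem : ∀ {a}, c.wa a = false → s'.mem a = s.mem a

theorem Off.refl (c : Cmd) (s : State) : Off c s s := ⟨fun _ => rfl, fun _ => rfl⟩

theorem Off.trans {c : Cmd} {s s' s'' : State} (h : Off c s s') (h' : Off c s' s'') :
    Off c s s'' :=
  ⟨fun hr => (h'.reg hr).trans (h.reg hr), fun ha => (h'.mem ha).trans (h.mem ha)⟩

theorem Off.mono {c d : Cmd} {s s' : State} (h : Off c s s')
    (hr : ∀ r, d.wr r = false → c.wr r = false) (ha : ∀ a, d.wa a = false → c.wa a = false) :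
    Off d s s' :=
  ⟨fun h1 => h.reg (hr _ h1), fun h1 => h.mem (ha _ h1)⟩

/-! ### Total correctness within a time bound. -/

/-- Started in a state that represents `s`, the compiled command halts after at most `T` steps in a
state that represents a state with property `Q`. -/
def WP (p : Prog) (w : ℕ) (c : Cmd) (T : ℕ) (Q : State → Prop) (s : State) : Prop :=
  ∀ S, Rep S s → S.Fits w → ∃ t S' s', Exec w (c.comp p) S t S' ∧ t ≤ T ∧ Rep S' s' ∧ Off c s s' ∧
    Q s'

namespace WP

variable {p : Prog} {w : ℕ} {c d : Cmd} {T T' T₁ T₂ : ℕ} {Q R : State → Prop} {s : State}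

/-- The consequence rule. The new postcondition may also use that the final state fits into words
and that unwritten registers and arrays are unchanged, so invariants need not carry such facts. -/
theorem mono (hw : 1 < word w) (h : WP p w c T R s) (hT : T ≤ T')
    (hQ : ∀ s', s'.Fits w → Off c s s' → R s' → Q s') : WP p w c T' Q s := by
  intro S hS hf
  obtain ⟨t, S', s', e, ht, hr, ho, hR⟩ := h S hS hf
  exact ⟨t, S', s', e, ht.trans hT, hr, ho, hQ s' (hr.fits (e.fits hw hf)) ho hR⟩

theorem le (h : WP p w c T Q s) (hT : T ≤ T') : WP p w c T' Q s := by
  intro S hS hf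
  obtain ⟨t, S', s', e, ht, hr⟩ := h S hS hf
  exact ⟨t, S', s', e, ht.trans hT, hr⟩

theorem of_fits (h : s.Fits w → WP p w c T Q s) : WP p w c T Q s :=
  fun S hS hf => h (hS.fits hf) S hS hf

theorem seq (hw : 1 < word w) (h : WP p w c T₁ R s)
    (h' : ∀ s', s'.Fits w → Off c s s' → R s' → WP p w d T₂ Q s') :
    WP p w (c ;; d) (T₁ + T₂) Q s := by
  intro S hS hf
  obtain ⟨t, S', s', e, ht, hr, ho, hR⟩ := h S hS hf
  have hf' := e.fits hw hf
  obtain ⟨u, S'', s'', e', hu, hr', ho', hQ⟩ := h' s' (hr.fits hf') ho hR S' hr hf'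
  refine ⟨t + u, S'', s'', .seq e e', by omega, hr',
    (ho.mono (d := c ;; d) ?_ ?_).trans (ho'.mono ?_ ?_), hQ⟩ <;>
  · intro _ hh
    simp [Cmd.wr, Cmd.wa] at hh
    simp [hh]

theorem ite (hw : 1 < word w) {e : Expr} (he : e.Ok w s) (h₁ : e.eval s ≠ 0 → WP p w c T Q s)
    (h₂ : e.eval s = 0 → WP p w d T Q s) : WP p w (.ite e c d) (e.cost + 1 + T) Q s := by
  intro S hS hf
  obtain ⟨k, S', ex, hk, hv, ho, hm, hc⟩ := e.exec_comp hw 0 S hS hf he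
  have hr' : Rep S' s := ⟨fun r => by rw [ho _ (by omega), hS.reg], hm.trans hS.mem,
    hc.trans hS.coins⟩
  have hf' := ex.fits hw hf
  by_cases h0 : e.eval s = 0
  · obtain ⟨t, S'', s'', ex', ht, hr, hoff, hQ⟩ := h₂ h0 S' hr' hf'
    refine ⟨_, S'', s'', .seq ex (.condFalse (hv.trans h0) ex'), by omega, hr,
      hoff.mono ?_ ?_, hQ⟩ <;>
    · intro _ hh
      simp [Cmd.wr, Cmd.wa] at hh
      simp [hh]
  · obtain ⟨t, S'', s'', ex', ht, hr, hoff, hQ⟩ := h₁ h0 S' hr' hf'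
    refine ⟨_, S'', s'', .seq ex (.condTrue (by rwa [hv]) ex'), by omega, hr,
      hoff.mono ?_ ?_, hQ⟩ <;>
    · intro _ hh
      simp [Cmd.wr, Cmd.wa] at hh
      simp [hh]

theorem skip (h : Q s) : WP p w .skip 1 Q s :=
  fun S hS _ => ⟨1, S, s, .skip S, le_rfl, hS, Off.refl _ _, h⟩

theorem set (hw : 1 < word w) {r : ℕ} {e : Expr} (he : e.Ok w s) (h : Q (s.setReg r (e.eval s))) :
    WP p w (.set r e) (e.cost + 1) Q s := by
  intro S hS hf
  obtain ⟨k, S', ex, hk, hv, ho, hm, hc⟩ := e.exec_comp hw 0 S hS hf he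
  have h1 : S'.reg 1 = e.eval s := hv
  have := Exec.op S' .or (3 * r) 1 1 (w := w) (by simpa [BinOp.eval] using (ex.fits hw hf).1 1)
  refine ⟨_, _, s.setReg r (e.eval s), .seq ex this, by omega,
    ⟨fun r' => ?_, hm.trans hS.mem, hc.trans hS.coins⟩, ⟨fun hr => ?_, fun _ => rfl⟩, h⟩
  · have h2 : S'.reg (3 * r') = s.reg r' := by rw [ho _ (by omega), hS.reg]
    simp [BinOp.eval, h1, h2]
  · simp only [Cmd.wr, beq_eq_false_iff_ne] at hr
    simp [hr]

theorem put (hw : 1 < word w) {a : ℕ} {i e : Expr} (hi : i.Ok w s) (he : e.Ok w s)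
    (h : Q (s.setMem a (i.eval s) (e.eval s))) :
    WP p w (.put a i e) (i.cost + e.cost + 1) Q s := by
  intro S hS hf
  obtain ⟨k, S', ex, hk, hv, ho, hm, hc⟩ := i.exec_comp hw 0 S hS hf hi
  have hr' : Rep S' s := ⟨fun r => by rw [ho _ (by omega), hS.reg], hm.trans hS.mem,
    hc.trans hS.coins⟩
  obtain ⟨k', S'', ex', hk', hv', ho', hm', hc'⟩ := e.exec_comp hw 1 S' hr' (ex.fits hw hf) he
  have h1 : S''.reg 1 = i.eval s := (ho' _ (by omega)).trans hv
  have h2 : S''.reg 4 = e.eval s := hv'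
  have := Exec.store S'' a 1 4 (w := w)
  rw [h1, h2] at this
  refine ⟨_, _, s.setMem a (i.eval s) (e.eval s), .seq (.seq ex ex') this, by omega,
    ⟨fun r' => ?_, ?_, hc'.trans hr'.coins⟩, ⟨fun hr => rfl, fun ha => ?_⟩, h⟩
  · rw [State.reg_setMem, ho' _ (by omega), hr'.reg]; rfl
  · ext a' j; simp [hm', hr'.mem]
  · simp only [Cmd.wa, beq_eq_false_iff_ne] at ha
    ext j; simp [ha]

theorem flip {r : ℕ}
    (h : Q ((s.setReg r (s.coins 0).toNat).setCoins fun j => s.coins (j + 1))) :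
    WP p w (.flip r) 1 Q s := by
  intro S hS hf
  refine ⟨1, _, (s.setReg r (s.coins 0).toNat).setCoins fun j => s.coins (j + 1), .flip S _, le_rfl, ⟨fun r' => ?_, hS.mem, ?_⟩, ⟨fun hr => ?_, fun _ => rfl⟩, h⟩
  · simp [hS.coins, hS.reg]
  · simp [hS.coins]
  · simp only [Cmd.wr, beq_eq_false_iff_ne] at hr
    simp [hr]

/-- Loop-free code. -/
theorem straight (hw : 1 < word w) : ∀ (c : Cmd) {Q : State → Prop} {s : State}, c.vc w Q s →
    WP p w c c.cost Q s
  | .skip, _, _, h => skip h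
  | .set _ _, _, _, h => set hw h.1 h.2
  | .put _ _ _, _, _, h => put hw h.1 h.2.1 h.2.2
  | .flip _, _, _, h => flip h
  | .seq c d, _, _, h => seq hw (straight hw c h) fun _ _ _ h' => straight hw d h'
  | .ite e c d, _, _, h => ite hw h.1
      (fun h0 => (straight hw c (h.2.1 h0)).le (le_max_left _ _))
      (fun h0 => (straight hw d (h.2.2 h0)).le (le_max_right _ _))

/-- Loops, with the time that is left as a parameter of the invariant. -/
theorem while_ (hw : 1 < word w) {e : Expr} (Inv : ℕ → State → Prop)
    (hok : ∀ B s', s'.Fits w → Off c s s' → Inv B s' → e.Ok w s' ∧ (e.eval s' ≠ 0 →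
      ∃ t B', t + (e.cost + 1) + B' ≤ B ∧ WP p w c t (Inv B') s'))
    (B : ℕ) (h : Inv B s) :
    WP p w (.loop e c) (B + e.cost + 1)
      (fun s' => e.eval s' = 0 ∧ ∃ B', Inv B' s') s := by
  intro S hS hf
  obtain ⟨k, S', ex, hk, hv, ho, hm, hc⟩ := e.exec_comp hw 0 S hS hf
    (hok B s (hS.fits hf) (Off.refl _ _) h).1
  have hr' : Rep S' s := ⟨fun r => by rw [ho _ (by omega), hS.reg], hm.trans hS.mem,
    hc.trans hS.coins⟩
  -- This is the statement about the inner machine loop, entered with the value of the condition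
  -- already in register 1. The frame condition relative to the initial state is carried along
  -- because the hypothesis on the invariant may use it.
  suffices key : ∀ B s₁ S₁, Off c s s₁ → Inv B s₁ → Rep S₁ s₁ → S₁.Fits w →
      S₁.reg 1 = e.eval s₁ → ∃ t S' s', Exec w (.loop 1 (.seq (c.comp p) (e.comp 0))) S₁ t S' ∧
        t ≤ B + 1 ∧ Rep S' s' ∧ Off c s s' ∧ e.eval s' = 0 ∧ ∃ B', Inv B' s' by
    obtain ⟨t, S'', s'', ex', ht, hr, hoff, h0, hI⟩ :=
      key B s S' (Off.refl _ _) h hr' (ex.fits hw hf) hv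
    exact ⟨_, _, s'', .seq ex ex', by omega, hr, ⟨hoff.reg, hoff.mem⟩, h0, hI⟩
  intro B
  -- The remaining budget strictly decreases, since each pass pays at least for its test.
  induction B using Nat.strong_induction_on with
  | _ B ih =>
  intro s₁ S₁ ho₁ hI hr₁ hf₁ hv₁
  by_cases h0 : e.eval s₁ = 0
  · exact ⟨1, S₁, s₁, .loopStop (hv₁.trans h0), by omega, hr₁, ho₁, h0, B, hI⟩
  obtain ⟨t, B', hB, hwp⟩ := (hok B s₁ (hr₁.fits hf₁) ho₁ hI).2 h0
  obtain ⟨t₂, S₂, s₂, ex₂, ht₂, hr₂, ho₂, hI₂⟩ := hwp S₁ hr₁ hf₁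
  have hf₂ := ex₂.fits hw hf₁
  have ho₃ := ho₁.trans ho₂
  obtain ⟨k₃, S₃, ex₃, hk₃, hv₃, ho₃', hm₃, hc₃⟩ := e.exec_comp hw 0 S₂ hr₂ hf₂
    (hok B' s₂ (hr₂.fits hf₂) ho₃ hI₂).1
  have hr₃ : Rep S₃ s₂ := ⟨fun r => by rw [ho₃' _ (by omega), hr₂.reg], hm₃.trans hr₂.mem,
    hc₃.trans hr₂.coins⟩
  obtain ⟨t₄, S₄, s₄, ex₄, ht₄, hr₄, ho₄, h₄⟩ :=
    ih B' (by omega) s₂ S₃ ho₃ hI₂ hr₃ (ex₃.fits hw hf₂) hv₃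
  exact ⟨_, S₄, s₄, .loopStep (by rwa [hv₁]) (.seq ex₂ ex₃) ex₄, by omega, hr₄, ho₄, h₄⟩

/-- Counting loops. -/
theorem for_ (hw : 1 < word w) {i rn n : ℕ} (Inv : ℕ → State → Prop) (T : ℕ → ℕ)
    (hi : c.wr i = false) (hrn : c.wr rn = false) (hne : rn ≠ i) (hn : s.reg rn = n)
    (h0 : Inv 0 (s.setReg i 0))
    (hstep : ∀ k < n, ∀ s', s'.Fits w → s'.reg i = k → s'.reg rn = n →
      Off (.upto i rn c) s s' → Inv k s' →
      WP p w c (T k) (fun s'' => Inv (k + 1) (s''.setReg i (k + 1))) s') :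
    WP p w (.upto i rn c) ((∑ k ∈ Finset.range n, (T k + 8)) + 6)
      (fun s' => Inv n s' ∧ s'.reg i = n) s := by
  have hoff0 : Off (.upto i rn c) s (s.setReg i 0) := by
    refine ⟨fun {r} hr => ?_, fun _ => rfl⟩
    have : r ≠ i := by rintro rfl; simp [Cmd.upto, Cmd.wr] at hr
    simp [this]
  have hoff1 : ∀ s', Off (c ;; .set i (.var i + 1)) (s.setReg i 0) s' →
      Off (.upto i rn c) s s' := by
    refine fun s' h => hoff0.trans (h.mono (fun r hr => ?_) (fun r hr => ?_))
    · simp only [Cmd.upto, Cmd.wr, Bool.or_eq_false_iff] at hr ⊢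
      exact hr.2
    · simpa [Cmd.upto, Cmd.wa] using hr
  -- The budget is the sum over the values of the counter still to come. The 8 per round is 4 for
  -- the increment and 4 for the test; the final 6 is 2 for the initialisation and 4 for the last
  -- test.
  have main := while_ (p := p) (w := w) (c := c ;; .set i (.var i + 1)) (s := s.setReg i 0) hw
    (e := .lt (.var i) (.var rn))
    (fun B s' => s'.reg rn = n ∧ s'.reg i ≤ n ∧ Inv (s'.reg i) s' ∧
      B = ∑ k ∈ Finset.Ico (s'.reg i) n, (T k + 8)) ?_
    (∑ k ∈ Finset.range n, (T k + 8)) ?_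
  · have hset : WP p w (.set i 0) 2 (fun s' => s' = s.setReg i 0) s :=
      set hw (by simp; omega) rfl
    have := hset.seq hw (Q := fun s' => Inv n s' ∧ s'.reg i = n) (d := .loop (.lt (.var i) (.var rn)) (c ;; .set i (.var i + 1)))
      (T₂ := ((∑ k ∈ Finset.range n, (T k + 8)) + 4)) fun s' _ _ h => ?_
    · exact this.le (by omega)
    subst h
    refine main.mono hw (by simp [Expr.cost, Expr.lt]) fun s' _ ho h => ?_
    obtain ⟨he, B', h1, h2, h3, -⟩ := h
    rw [Expr.eval_lt_eq_zero] at he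
    have : s'.reg i = n := by
      simp only [Expr.eval_var] at he
      omega
    exact ⟨this ▸ h3, this⟩
  · rintro B s' hf ho ⟨h1, h2, h3, h4⟩
    refine ⟨by simp, fun he => ?_⟩
    have hlt : s'.reg i < n := by
      rw [← h1]; exact (Expr.eval_lt_ne_zero _ _ _).1 he
    rw [← Finset.sum_Ioo_add_eq_sum_Ico hlt] at h4
    refine ⟨T (s'.reg i) + 4, ∑ k ∈ Finset.Ioo (s'.reg i) n, (T k + 8), ?_, ?_⟩
    · rw [h4]; simp [Expr.cost, Expr.lt]; omega
    · refine (hstep _ hlt s' hf rfl h1 (hoff1 s' ho) h3).seq hw fun s'' hf'' ho'' h'' => ?_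
      have hi'' : s''.reg i = s'.reg i := ho''.reg hi
      have hrn'' : s''.reg rn = n := (ho''.reg hrn).trans h1
      refine set hw ?_ ?_
      · have := hf.reg_lt rn
        simp [hi'', hw]; omega
      · simp [hi'', hrn'', hne, h'']
        refine ⟨by omega, ?_⟩
        congr 1
  · exact ⟨by simp [hne, hn], by simp, by simpa using h0, by simp⟩

theorem for_const (hw : 1 < word w) {i rn n : ℕ} (Inv : ℕ → State → Prop) (T : ℕ)
    (hi : c.wr i = false) (hrn : c.wr rn = false) (hne : rn ≠ i) (hn : s.reg rn = n)
    (h0 : Inv 0 (s.setReg i 0))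
    (hstep : ∀ k < n, ∀ s', s'.Fits w → s'.reg i = k → s'.reg rn = n →
      Off (.upto i rn c) s s' → Inv k s' →
      WP p w c T (fun s'' => Inv (k + 1) (s''.setReg i (k + 1))) s') :
    WP p w (.upto i rn c) (n * (T + 8) + 6) (fun s' => Inv n s' ∧ s'.reg i = n) s := by
  have := for_ hw Inv (fun _ => T) hi hrn hne hn h0 hstep
  simpa using this

theorem straight_seq (hw : 1 < word w) {T : ℕ} (hT : c.cost ≤ T)
    (h : c.vc w (fun s' => WP p w d T₂ Q s') s) : WP p w (c ;; d) (T + T₂) Q s :=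
  ((straight hw c h).le hT).seq hw fun _ _ _ h' => h'

theorem straight_le (hw : 1 < word w) (hT : c.cost ≤ T) (h : c.vc w Q s) : WP p w c T Q s :=
  (straight hw c h).le hT

theorem for_straight (hw : 1 < word w) {i rn n : ℕ} (Inv : ℕ → State → Prop) (T : ℕ)
    (hT : c.cost ≤ T) (hi : c.wr i = false) (hrn : c.wr rn = false) (hne : rn ≠ i)
    (hn : s.reg rn = n) (h0 : Inv 0 (s.setReg i 0))
    (hstep : ∀ k < n, ∀ s', s'.Fits w → s'.reg i = k → s'.reg rn = n →
      Off (.upto i rn c) s s' → Inv k s' →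
      c.vc w (fun s'' => Inv (k + 1) (s''.setReg i (k + 1))) s') :
    WP p w (.upto i rn c) (n * (T + 8) + 6) (fun s' => Inv n s' ∧ s'.reg i = n) s :=
  for_const hw Inv T hi hrn hne hn h0 fun k hk s' h1 h2 h3 h4 h5 =>
    (straight hw c (hstep k hk s' h1 h2 h3 h4 h5)).le hT

end WP

/-! ### Calling the program for matrix multiplication. -/

/-- The program `p` multiplies matrices of dimension `N` with entries in `{0, 1}` in at most `τ`
steps. -/
def MulSpec (p : Prog) (w N τ : ℕ) : Prop :=
  ∀ (A B : Matrix (Fin N) (Fin N) ℕ), (∀ i j, A i j ≤ 1) → (∀ i j, B i j ≤ 1) →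
    ∀ s : State, s.Fits w → s.reg 0 = N → HoldsMatrix s 0 A → HoldsMatrix s 1 B →
      ∃ (t : ℕ) (s' : State), Exec w p s t s' ∧ t ≤ τ ∧ HoldsMatrix s' 2 (A * B)

theorem WP.mul {p : Prog} {w N τ r : ℕ} {s : State} {Q : State → Prop} (hp : MulSpec p w N τ)
    (hw : 1 < word w) (hr : s.reg r = N) (f g : ℕ → ℕ → ℕ) (hf : ∀ i j, f i j ≤ 1)
    (hg : ∀ i j, g i j ≤ 1) (hA : ∀ t < N * N, s.mem 100 t = f (t / N) (t % N))
    (hB : ∀ t < N * N, s.mem 101 t = g (t / N) (t % N))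
    (h : ∀ s' : State, s'.reg = s.reg → (∀ a < 100, s'.mem a = s.mem a) →
      (∀ i < N, ∀ j < N, s'.mem 102 (N * i + j) = ∑ l ∈ Finset.range N, f i l * g l j) → Q s') :
    WP p w (.mul r) (τ + 1) Q s := by
  intro S hS hfit
  have hlt : ∀ i j : Fin N, N * (i : ℕ) + j < N * N := fun i j => by
    have h1 : N * ((i : ℕ) + 1) ≤ N * N := Nat.mul_le_mul_left _ i.2
    have h2 := j.2
    rw [Nat.mul_add] at h1; omega
  have hdiv : ∀ i j : Fin N, (N * (i : ℕ) + j) / N = i := fun i j => by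
    rw [Nat.mul_add_div (by have := i.2; omega), Nat.div_eq_of_lt j.2, add_zero]
  have hmod : ∀ i j : Fin N, (N * (i : ℕ) + j) % N = j := fun i j => by
    rw [Nat.mul_add_mod, Nat.mod_eq_of_lt j.2]
  have e1 := Exec.op S .or 2 (3 * r) (3 * r) (w := w) (by simpa [BinOp.eval] using hfit.1 _)
  set S₁ := S.setReg 2 (BinOp.or.eval (S.reg (3 * r)) (S.reg (3 * r))) with hS₁
  have hf₁ : S₁.Fits w := e1.fits hw hfit
  -- This is the machine as the embedded program sees it. Its memory outside the two factors is
  -- whatever earlier code left there, which is why the multiplication program must tolerate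
  -- arbitrary contents.
  let s₀ : State := ⟨fun r => S₁.reg (3 * r + 2), fun a => S₁.mem (a + 100), S₁.coins⟩
  obtain ⟨t, s', e2, ht, hout⟩ := hp (Matrix.of fun i j => f i j) (Matrix.of fun i j => g i j) (fun _ _ => hf _ _)
    (fun _ _ => hg _ _) s₀ ⟨fun r => hf₁.1 _, fun a i => hf₁.2 _ _⟩
    (by simp [s₀, hS₁, BinOp.eval, hS.reg, hr])
    (fun i j => by
      have := hA _ (hlt i j)
      rw [hdiv, hmod] at this
      simpa [s₀, hS₁, hS.mem] using this)
    (fun i j => by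
      have := hB _ (hlt i j)
      rw [hdiv, hmod] at this
      simpa [s₀, hS₁, hS.mem] using this)
  obtain ⟨S', e3, hemb, hso⟩ := e2.embed S₁ ⟨fun _ => rfl, fun _ => rfl, rfl⟩
  have hreg : ∀ r, S'.reg (3 * r) = s.reg r := fun r => by
    rw [hso.1 _ (by omega), hS₁, State.reg_setReg, if_neg (by omega), hS.reg]
  refine ⟨_, S', ⟨s.reg, S'.mem, S'.coins⟩, .seq e1 e3, by omega, ⟨hreg, rfl, rfl⟩,
    ⟨fun _ => rfl, fun {a} ha => ?_⟩, h _ rfl (fun a ha => ?_) fun i hi j hj => ?_⟩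
  · have : a < 100 := by
      by_contra hc
      simp only [Cmd.wa] at ha
      rw [Nat.ble_eq_true_of_le (by omega)] at ha
      simp at ha
    rw [← hS.mem]; exact hso.2 a this
  · rw [← hS.mem]; exact hso.2 a ha
  · have := hout ⟨i, hi⟩ ⟨j, hj⟩
    rw [← hemb.mem] at this
    rw [Matrix.mul_apply] at this
    rw [Finset.sum_range]
    exact this

/-! ### Counting labelled induced copies modulo 24 -/

/-- The adjacency of the graph on four vertices with the given edges. -/
def adj4 (b01 b02 b12 b03 b13 b23 : Bool) : Fin 4 → Fin 4 → Bool :=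
  ![![false, b01, b02, b03], ![b01, false, b12, b13], ![b02, b12, false, b23],
    ![b03, b13, b23, false]]

/-- The number of labelled induced copies of `h` in the graph on `0, …, y - 1` with adjacency
matrix `B`. -/
def indCount (h : Fin 4 → Fin 4 → Bool) (B : ℕ → ℕ → ℕ) (y : ℕ) : ℕ :=
  (Finset.univ.filter fun x : Fin 4 → Fin y =>
    ∀ i j, i ≠ j → x i ≠ x j ∧ (B (x i) (x j) = 1 ↔ h i j = true)).card

theorem indCount_comp (h : Fin 4 → Fin 4 → Bool) (B : ℕ → ℕ → ℕ) (y : ℕ)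
    (σ : Equiv.Perm (Fin 4)) : indCount (fun i j => h (σ i) (σ j)) B y = indCount h B y := by
  unfold indCount
  refine Finset.card_equiv (Equiv.arrowCongr σ (Equiv.refl _)) fun x => ?_
  simp only [Finset.mem_filter, Finset.mem_univ, true_and, Equiv.arrowCongr_apply,
    Equiv.coe_refl, Function.comp_apply, id_eq]
  constructor
  · intro H i j hij
    have := H (σ.symm i) (σ.symm j) (by simpa using hij)
    simpa using this
  · intro H i j hij
    have := H (σ i) (σ j) (by simpa using hij)
    simpa using this

/-- The indicator of being adjacent, or of being distinct and non-adjacent. -/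
def wt (B : ℕ → ℕ → ℕ) (b : Bool) (u v : ℕ) : ZMod 24 :=
  if b then (B u v : ZMod 24) else 1 - (B u v : ZMod 24) - (if u = v then 1 else 0)

/-- The number of common neighbours. -/
def codeg (B : ℕ → ℕ → ℕ) (y u v : ℕ) : ℕ := ∑ x ∈ Finset.range y, B u x * B x v

/-- The degree. -/
def degr (B : ℕ → ℕ → ℕ) (y u : ℕ) : ℕ := ∑ x ∈ Finset.range y, B u x

/-- `B` is the adjacency matrix of a graph. -/
structure IsAdj (B : ℕ → ℕ → ℕ) : Prop where
  le_one : ∀ u v, B u v ≤ 1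
  symm : ∀ u v, B u v = B v u
  irrefl : ∀ u, B u u = 0

section
variable {B : ℕ → ℕ → ℕ} (hB : IsAdj B)
include hB

theorem IsAdj.cases (u v : ℕ) : B u v = 0 ∨ B u v = 1 := by
  have := hB.le_one u v; omega

theorem IsAdj.wt_eq (b : Bool) (u v : ℕ) :
    wt B b u v = if u ≠ v ∧ (B u v = 1 ↔ b = true) then 1 else 0 := by
  unfold wt
  by_cases huv : u = v
  · subst huv; simp [hB.irrefl]
  · rcases hB.cases u v with h | h <;> cases b <;> simp [h, huv]

theorem IsAdj.wt_mul_self (b : Bool) (u v : ℕ) : wt B b u v * wt B b u v = wt B b u v := by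
  rw [hB.wt_eq]; split_ifs <;> simp

theorem IsAdj.wt_mul_not (u v : ℕ) : wt B true u v * wt B false u v = 0 := by
  rw [hB.wt_eq, hB.wt_eq]
  by_cases h : B u v = 1 <;> simp [h]

/-- The indicator of a copy is the product of six pair weights. The factors are grouped so that the
sums over the last two vertices separate once the weight of the pair 2, 3 is gone. -/
theorem IsAdj.indCount_eq (b01 b02 b12 b03 b13 b23 : Bool) (y : ℕ) :
    (indCount (adj4 b01 b02 b12 b03 b13 b23) B y : ZMod 24) =
      ∑ x0 ∈ Finset.range y, ∑ x1 ∈ Finset.range y, ∑ x2 ∈ Finset.range y, ∑ x3 ∈ Finset.range y,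
        wt B b01 x0 x1 * (wt B b02 x0 x2 * wt B b12 x1 x2) * (wt B b03 x0 x3 * wt B b13 x1 x3) *
          wt B b23 x2 x3 := by
  have key : ∀ x : Fin 4 → Fin y,
      (if ∀ i j, i ≠ j → x i ≠ x j ∧ (B (x i) (x j) = 1 ↔ adj4 b01 b02 b12 b03 b13 b23 i j = true)
        then (1 : ZMod 24) else 0) =
        wt B b01 (x 0) (x 1) * (wt B b02 (x 0) (x 2) * wt B b12 (x 1) (x 2)) *
          (wt B b03 (x 0) (x 3) * wt B b13 (x 1) (x 3)) * wt B b23 (x 2) (x 3) := by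
    intro x
    -- A symmetric condition on all ordered pairs amounts to six conditions.
    have hs : ∀ {P : Fin 4 → Fin 4 → Prop}, (∀ i j, P i j ↔ P j i) →
        ((∀ i j, i ≠ j → P i j) ↔ P 0 1 ∧ P 0 2 ∧ P 1 2 ∧ P 0 3 ∧ P 1 3 ∧ P 2 3) := by
      intro P hP
      constructor
      · intro h; refine ⟨h _ _ ?_, h _ _ ?_, h _ _ ?_, h _ _ ?_, h _ _ ?_, h _ _ ?_⟩ <;> decide
      · rintro ⟨h1, h2, h3, h4, h5, h6⟩ i j hij
        fin_cases i <;> fin_cases j <;> first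
          | exact absurd rfl hij
          | assumption
          | (rw [hP]; assumption)
    rw [if_congr (hs fun i j => ?_) rfl rfl]
    · simp only [hB.wt_eq, ite_zero_mul_ite_zero, mul_one, Fin.val_inj, ne_eq]
      exact if_congr ⟨fun ⟨h1, h2, h3, h4, h5, h6⟩ => ⟨⟨⟨h1, h2, h3⟩, h4, h5⟩, h6⟩,
        fun ⟨⟨⟨h1, h2, h3⟩, h4, h5⟩, h6⟩ => ⟨h1, h2, h3, h4, h5, h6⟩⟩ rfl rfl
    · rw [hB.symm (x i) (x j), ne_comm]
      have : adj4 b01 b02 b12 b03 b13 b23 i j = adj4 b01 b02 b12 b03 b13 b23 j i := by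
        fin_cases i <;> fin_cases j <;> rfl
      rw [this]
  rw [indCount, Finset.card_filter]
  push_cast
  simp_rw [key, Finset.sum_range]
  -- One coordinate of the tuple is split off at a time.
  rw [← (Fin.consEquiv fun _ => Fin y).sum_comp, Fintype.sum_prod_type]
  refine Finset.sum_congr rfl fun x0 _ => ?_
  rw [← (Fin.consEquiv fun _ => Fin y).sum_comp, Fintype.sum_prod_type]
  refine Finset.sum_congr rfl fun x1 _ => ?_
  rw [← (Fin.consEquiv fun _ => Fin y).sum_comp, Fintype.sum_prod_type]
  refine Finset.sum_congr rfl fun x2 _ => ?_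
  rw [← (Fin.consEquiv fun _ => Fin y).sum_comp, Fintype.sum_prod_type]
  refine Finset.sum_congr rfl fun x3 _ => ?_
  rw [Fintype.sum_unique]
  rfl

/-- The two weights of the pair 2, 3 add up to 1 off the diagonal and 0 on it. So the sum over x2
and x3 is a product of two single sums minus the terms with x2 = x3. Those vanish unless vertices 2
and 3 are required to see 0 and 1 in the same way. -/
theorem IsAdj.indCount_flip (b01 b02 b12 b03 b13 : Bool) (y : ℕ) :
    (indCount (adj4 b01 b02 b12 b03 b13 true) B y : ZMod 24) +
      indCount (adj4 b01 b02 b12 b03 b13 false) B y =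
    ∑ x0 ∈ Finset.range y, ∑ x1 ∈ Finset.range y, wt B b01 x0 x1 *
      ((∑ x ∈ Finset.range y, wt B b02 x0 x * wt B b12 x1 x) *
        (∑ x ∈ Finset.range y, wt B b03 x0 x * wt B b13 x1 x) -
        if b02 = b03 ∧ b12 = b13 then ∑ x ∈ Finset.range y, wt B b02 x0 x * wt B b12 x1 x
        else 0) := by
  rw [hB.indCount_eq, hB.indCount_eq, ← Finset.sum_add_distrib]
  refine Finset.sum_congr rfl fun x0 _ => ?_
  rw [← Finset.sum_add_distrib]
  refine Finset.sum_congr rfl fun x1 _ => ?_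
  rw [← Finset.sum_add_distrib, Finset.sum_mul_sum]
  have h1 : ∀ x2 ∈ Finset.range y, (∑ x3 ∈ Finset.range y,
      wt B b01 x0 x1 * (wt B b02 x0 x2 * wt B b12 x1 x2) * (wt B b03 x0 x3 * wt B b13 x1 x3) *
        wt B true x2 x3) + (∑ x3 ∈ Finset.range y,
      wt B b01 x0 x1 * (wt B b02 x0 x2 * wt B b12 x1 x2) * (wt B b03 x0 x3 * wt B b13 x1 x3) *
        wt B false x2 x3) = wt B b01 x0 x1 * ((∑ x3 ∈ Finset.range y,
          (wt B b02 x0 x2 * wt B b12 x1 x2) * (wt B b03 x0 x3 * wt B b13 x1 x3)) -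
          (if b02 = b03 ∧ b12 = b13 then wt B b02 x0 x2 * wt B b12 x1 x2 else 0)) := by
    intro x2 h2
    -- On the diagonal, equal requirements give idempotent products, while different ones give a
    -- factor `wt true * wt false = 0`.
    have h3 : (if b02 = b03 ∧ b12 = b13 then wt B b02 x0 x2 * wt B b12 x1 x2 else 0) =
        ∑ x3 ∈ Finset.range y, (wt B b02 x0 x2 * wt B b12 x1 x2) *
          (wt B b03 x0 x3 * wt B b13 x1 x3) * (if x2 = x3 then 1 else 0) := by
      simp only [mul_ite, mul_one, mul_zero, Finset.sum_ite_eq, h2, if_true]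
      have e1 := hB.wt_mul_self b02 x0 x2
      have e2 := hB.wt_mul_self b12 x1 x2
      have n1 := hB.wt_mul_not x0 x2
      have n2 := hB.wt_mul_not x1 x2
      split_ifs with h
      · rw [← h.1, ← h.2]
        linear_combination (-wt B b12 x1 x2 * wt B b12 x1 x2) * e1 - wt B b02 x0 x2 * e2
      · revert h e1 e2
        cases b02 <;> cases b03 <;> cases b12 <;> cases b13 <;> intro e1 e2 h <;>
          first
          | simp at h; done
          | linear_combination (-wt B _ x1 x2 * wt B _ x1 x2) * n1
          | linear_combination (-wt B _ x0 x2 * wt B _ x0 x2) * n2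
          | linear_combination (-wt B true x1 x2 * wt B false x1 x2) * n1
    rw [h3, ← Finset.sum_sub_distrib, Finset.mul_sum, ← Finset.sum_add_distrib]
    refine Finset.sum_congr rfl fun x3 _ => ?_
    simp only [wt, if_true, Bool.false_eq_true, if_false]
    ring
  rw [Finset.sum_congr rfl h1, ← Finset.mul_sum, Finset.sum_sub_distrib]
  congr 2
  split_ifs <;> simp

theorem IsAdj.cast_codeg (y u v : ℕ) :
    (codeg B y u v : ZMod 24) = ∑ x ∈ Finset.range y, (B u x : ZMod 24) * B v x := by
  simp [codeg, hB.symm v]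

/-- Everything reduces to degrees and the codegree by expanding the weight of non-adjacency. The
terms `B u v` come from x = u or x = v, which that weight excludes. -/
theorem IsAdj.sum_wt (b b' : Bool) {y u v : ℕ} (hu : u < y) (hv : v < y) :
    ∑ x ∈ Finset.range y, wt B b u x * wt B b' v x =
      if b then if b' then (codeg B y u v : ZMod 24) else (degr B y u - codeg B y u v - B u v : ZMod 24)
      else if b' then (degr B y v - codeg B y u v - B u v : ZMod 24) else
        (y - 2 - degr B y u - degr B y v + codeg B y u v + 2 * B u v +
          (if u = v then 1 else 0) : ZMod 24) := by
  have e1 : ∀ f : ℕ → ZMod 24, ∑ x ∈ Finset.range y, f x * (if v = x then 1 else 0) = f v := by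
    intro f; simp [hv]
  have e2 : ∀ f : ℕ → ZMod 24, ∑ x ∈ Finset.range y, (if u = x then 1 else 0) * f x = f u := by
    intro f; simp [hu]
  have hd : ∀ u, (degr B y u : ZMod 24) = ∑ x ∈ Finset.range y, (B u x : ZMod 24) := by
    intro u; simp [degr]
  have h1 : ∑ x ∈ Finset.range y, (B u x : ZMod 24) * (if v = x then 1 else 0) = B u v := e1 _
  have h2 : ∑ x ∈ Finset.range y, (if u = x then 1 else 0) * (B v x : ZMod 24) = B u v := by
    rw [e2, hB.symm]
  have h3 : ∑ x ∈ Finset.range y, (1 : ZMod 24) * (if v = x then 1 else 0) = 1 := e1 _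
  have h4 : ∑ x ∈ Finset.range y, (if u = x then 1 else 0) * (1 : ZMod 24) = 1 := e2 _
  have h5 : ∑ x ∈ Finset.range y, (if u = x then 1 else 0) * (if v = x then 1 else 0 : ZMod 24) =
      if u = v then 1 else 0 := by rw [e2]; simp [eq_comm]
  have h6 : ∑ x ∈ Finset.range y, (1 : ZMod 24) = y := by simp
  rw [hB.cast_codeg, hd, hd]
  cases b <;> cases b' <;> simp only [wt, if_true, Bool.false_eq_true, if_false]
  · have : ∀ x, (1 - (B u x : ZMod 24) - (if u = x then 1 else 0)) *
        (1 - (B v x : ZMod 24) - (if v = x then 1 else 0)) =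
        1 - (B u x : ZMod 24) - B v x - (if u = x then 1 else 0) * 1 -
          1 * (if v = x then 1 else 0) + B u x * B v x +
          (B u x : ZMod 24) * (if v = x then 1 else 0) + (if u = x then 1 else 0) * (B v x : ZMod 24)
          + (if u = x then 1 else 0) * (if v = x then 1 else 0) := fun x => by ring
    simp_rw [this, Finset.sum_add_distrib, Finset.sum_sub_distrib, h1, h2, h3, h4, h5, h6]
    ring
  · rw [← h2]
    simp only [← Finset.sum_sub_distrib]
    exact Finset.sum_congr rfl fun x _ => by ring
  · rw [← h1]
    simp only [← Finset.sum_sub_distrib]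
    exact Finset.sum_congr rfl fun x _ => by ring

end

/-! ### Orbits of labelled copies under permutations. -/

theorem exists_perm_of_image_eq {α : Type*} [DecidableEq α] {x z : Fin 4 → α}
    (hz : Function.Injective z) (h : Finset.univ.image z = Finset.univ.image x) :
    ∃ σ : Equiv.Perm (Fin 4), x ∘ σ = z := by
  have h1 : ∀ i, ∃ j, x j = z i := fun i => by
    have : z i ∈ Finset.univ.image x := h ▸ Finset.mem_image_of_mem _ (Finset.mem_univ i)
    simpa using this
  choose σ hσ using h1
  have hinj : Function.Injective σ := fun i j hij => hz (by rw [← hσ, ← hσ, hij])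
  exact ⟨Equiv.ofBijective σ (Finite.injective_iff_bijective.1 hinj), funext hσ⟩

theorem image_comp_perm {α : Type*} [DecidableEq α] (x : Fin 4 → α) (σ : Equiv.Perm (Fin 4)) :
    Finset.univ.image (x ∘ σ) = Finset.univ.image x := by
  rw [← Finset.image_image, Finset.image_univ_equiv]

theorem card_image_comp_perm {α : Type*} [DecidableEq α] {x : Fin 4 → α}
    (hx : Function.Injective x) :
    (Finset.univ.image fun σ : Equiv.Perm (Fin 4) => x ∘ σ).card = 24 := by
  rw [Finset.card_image_of_injective, Finset.card_univ, Fintype.card_perm]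
  · rfl
  · intro σ τ h
    ext i : 1
    exact hx (congrFun h i)

/-- A set of injective tuples that is closed under permutations has size divisible by `24`. -/
theorem card_dvd_of_perm_closed {α : Type*} [DecidableEq α] (s : Finset (Fin 4 → α))
    (hinj : ∀ x ∈ s, Function.Injective x)
    (hperm : ∀ x ∈ s, ∀ σ : Equiv.Perm (Fin 4), x ∘ σ ∈ s) : 24 ∣ s.card := by
  -- The tuples are grouped by their vertex sets; each group is an orbit of 24 tuples.
  rw [Finset.card_eq_sum_card_image (fun x => Finset.univ.image x) s]
  refine Finset.dvd_sum fun T hT => ?_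
  obtain ⟨x, hx, rfl⟩ := Finset.mem_image.1 hT
  have : (s.filter fun z => Finset.univ.image z = Finset.univ.image x) =
      Finset.univ.image fun σ : Equiv.Perm (Fin 4) => x ∘ σ := by
    ext z
    simp only [Finset.mem_filter, Finset.mem_image, Finset.mem_univ, true_and]
    constructor
    · rintro ⟨hz, h⟩
      exact exists_perm_of_image_eq (hinj z hz) h
    · rintro ⟨σ, rfl⟩
      exact ⟨hperm x hx σ, image_comp_perm x σ⟩
  rw [this, card_image_comp_perm (hinj x hx)]

/-! ### Formulas modulo 24, and the flips between graphs on four vertices. -/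

/-- Polynomials in the number of common neighbours and the degrees of two vertices and the number of
vertices. -/
inductive Pol : Type
  | c : Pol
  | x : Pol
  | y : Pol
  | n : Pol
  | k (v : ℕ) : Pol
  | add (p q : Pol) : Pol
  | mul (p q : Pol) : Pol

namespace Pol

instance : Add Pol := ⟨add⟩
instance : Mul Pol := ⟨mul⟩
instance (n : ℕ) : OfNat Pol n := ⟨k n⟩
-- Modulo 24 the number 23 is -1, so no negative coefficients are needed on the machine.
instance : Sub Pol := ⟨fun p q => p + k 23 * q⟩

def ev (c x y n : ZMod 24) : Pol → ZMod 24
  | .c => c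
  | .x => x
  | .y => y
  | .n => n
  | .k v => v
  | .add p q => p.ev c x y n + q.ev c x y n
  | .mul p q => p.ev c x y n * q.ev c x y n

section
variable (c x y n : ZMod 24) (p q : Pol)
@[simp] theorem ev_c : Pol.c.ev c x y n = c := rfl
@[simp] theorem ev_x : Pol.x.ev c x y n = x := rfl
@[simp] theorem ev_y : Pol.y.ev c x y n = y := rfl
@[simp] theorem ev_n : Pol.n.ev c x y n = n := rfl
@[simp] theorem ev_k (v : ℕ) : (Pol.k v).ev c x y n = v := rfl
@[simp] theorem ev_zero : (0 : Pol).ev c x y n = 0 := Nat.cast_zero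
@[simp] theorem ev_one : (1 : Pol).ev c x y n = 1 := Nat.cast_one
@[simp] theorem ev_two : (2 : Pol).ev c x y n = 2 := Nat.cast_ofNat
@[simp] theorem ev_add : (p + q).ev c x y n = p.ev c x y n + q.ev c x y n := rfl
@[simp] theorem ev_mul : (p * q).ev c x y n = p.ev c x y n * q.ev c x y n := rfl
@[simp] theorem ev_sub : (p - q).ev c x y n = p.ev c x y n - q.ev c x y n := by
  change p.ev c x y n + ((23 : ℕ) : ZMod 24) * q.ev c x y n = _
  rw [sub_eq_add_neg, neg_eq_neg_one_mul]
  rfl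
end

end Pol

/-- The value computed from the local data of a graph by the coefficients `F`, `γ`, `δ`. -/
noncomputable def formula (F : Pol) (γ δ : ℕ) (B : ℕ → ℕ → ℕ) (y : ℕ) : ZMod 24 :=
  (∑ u ∈ Finset.range y, ∑ v ∈ Finset.range y,
      (B u v : ZMod 24) * F.ev (codeg B y u v) (degr B y u) (degr B y v) y) +
    γ * (∑ u ∈ Finset.range y, ∑ v ∈ Finset.range y, (codeg B y u v : ZMod 24) ^ 2) +
    δ * (∑ u ∈ Finset.range y, ∑ v ∈ Finset.range y, (B u v : ZMod 24)) ^ 2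

/-- The number of labelled induced copies of `h` modulo `24` is given by a formula. -/
def HasFormula (h : Fin 4 → Fin 4 → Bool) : Prop :=
  ∃ (F : Pol) (γ δ : ℕ), ∀ (B : ℕ → ℕ → ℕ) (y : ℕ), IsAdj B →
    (indCount h B y : ZMod 24) = formula F γ δ B y

theorem HasFormula.comp {h h' : Fin 4 → Fin 4 → Bool} (H : HasFormula h)
    (σ : Equiv.Perm (Fin 4)) (hσ : ∀ i j, h' i j = h (σ i) (σ j)) : HasFormula h' := by
  have : h' = fun i j => h (σ i) (σ j) := by ext i j : 2; exact hσ i j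
  obtain ⟨F, γ, δ, hF⟩ := H
  exact ⟨F, γ, δ, fun B y hB => by rw [this, indCount_comp, hF B y hB]⟩

/-- The start of all flips: the formula 0 works because the labelled complete quadruples are closed
under permutations. -/
theorem hasFormula_top : HasFormula (adj4 true true true true true true) := by
  refine ⟨0, 0, 0, fun B y hB => ?_⟩
  simp only [formula, Pol.ev_zero, mul_zero, Finset.sum_const_zero, Nat.cast_zero, zero_mul,
    add_zero]
  rw [ZMod.natCast_eq_zero_iff]
  have ha : ∀ i j, i ≠ j → adj4 true true true true true true i j = true := by decide
  refine card_dvd_of_perm_closed _ (fun x hx i j hij => ?_) fun x hx σ => ?_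
  · by_contra hne
    exact ((Finset.mem_filter.1 hx).2 i j hne).1 hij
  · refine Finset.mem_filter.2 ⟨Finset.mem_univ _, fun i j hij => ?_⟩
    have hσ : σ i ≠ σ j := σ.injective.ne hij
    have := (Finset.mem_filter.1 hx).2 (σ i) (σ j) hσ
    rw [ha _ _ hσ] at this
    rwa [ha _ _ hij]

/-- The number of vertices with given adjacency to the ends of an edge. -/
def Pol.side (b b' : Bool) : Pol :=
  if b then if b' then .c else .x - .c - 1 else if b' then .y - .c - 1 else .n - .x - .y + .c

/-- The factor `B u v` removes the pairs with `B u v = 0`, in particular u = v. On the remaining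
ones the counts are polynomials in codegree, degrees and the number of vertices, as `formula`
requires. -/
theorem IsAdj.mul_sum_wt {B : ℕ → ℕ → ℕ} (hB : IsAdj B) (b b' : Bool) {y u v : ℕ} (hu : u < y)
    (hv : v < y) :
    (B u v : ZMod 24) * ∑ x ∈ Finset.range y, wt B b u x * wt B b' v x =
      (B u v : ZMod 24) * (Pol.side b b').ev (codeg B y u v) (degr B y u) (degr B y v) y := by
  rw [hB.sum_wt b b' hu hv]
  rcases hB.cases u v with h | h
  · simp [h]
  · have : u ≠ v := by rintro rfl; simp [hB.irrefl] at h
    cases b <;> cases b' <;> simp [h, Pol.side, this]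
    ring

/-- Changing the adjacency of two vertices when the other two are adjacent. -/
theorem HasFormula.flip {b02 b12 b03 b13 b : Bool}
    (H : HasFormula (adj4 true b02 b12 b03 b13 b)) :
    HasFormula (adj4 true b02 b12 b03 b13 !b) := by
  obtain ⟨F, γ, δ, hF⟩ := H
  -- The new formula is the product of the two single sums, minus the diagonal, minus the old
  -- formula; the factors 23 negate the old coefficients.
  refine ⟨(Pol.side b02 b12 * Pol.side b03 b13 -
    if b02 = b03 ∧ b12 = b13 then Pol.side b02 b12 else 0) - F, 23 * γ, 23 * δ,
    fun B y hB => ?_⟩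
  have h1 := hB.indCount_flip true b02 b12 b03 b13 y
  have h2 := hF B y hB
  have h3 : (indCount (adj4 true b02 b12 b03 b13 !b) B y : ZMod 24) =
      (∑ u ∈ Finset.range y, ∑ v ∈ Finset.range y, (B u v : ZMod 24) *
        (Pol.side b02 b12 * Pol.side b03 b13 -
          if b02 = b03 ∧ b12 = b13 then Pol.side b02 b12 else 0).ev
            (codeg B y u v) (degr B y u) (degr B y v) y) -
      indCount (adj4 true b02 b12 b03 b13 b) B y := by
    rw [eq_sub_iff_add_eq]
    have h4 : (indCount (adj4 true b02 b12 b03 b13 !b) B y : ZMod 24) +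
        indCount (adj4 true b02 b12 b03 b13 b) B y =
        (indCount (adj4 true b02 b12 b03 b13 true) B y : ZMod 24) +
          indCount (adj4 true b02 b12 b03 b13 false) B y := by
      cases b
      · rfl
      · exact add_comm _ _
    rw [h4, h1]
    refine Finset.sum_congr rfl fun u hu => Finset.sum_congr rfl fun v hv => ?_
    have hu := Finset.mem_range.1 hu
    have hv := Finset.mem_range.1 hv
    have e1 := hB.mul_sum_wt b02 b12 hu hv
    have e2 := hB.mul_sum_wt b03 b13 hu hv
    rw [show wt B true u v = B u v from rfl, mul_sub, ← mul_assoc, e1, mul_right_comm, e2,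
      mul_right_comm, mul_assoc, Pol.ev_sub, mul_sub, Pol.ev_mul, mul_comm (Pol.ev _ _ _ _ _)]
    congr 1
    split_ifs
    · exact e1
    · simp
  rw [h3, h2]
  have h23 : ((23 : ℕ) : ZMod 24) = -1 := rfl
  simp only [formula, Nat.cast_mul, h23, Pol.ev_sub, mul_sub, Finset.sum_sub_distrib]
  ring

/-- A sum over non-adjacent pairs is not of the form allowed in `formula`. It is traded for the sum
over all pairs, a sum over edges and a diagonal. -/
theorem sum_wt_false (B : ℕ → ℕ → ℕ) (y : ℕ) (f : ℕ → ℕ → ZMod 24) :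
    ∑ u ∈ Finset.range y, ∑ v ∈ Finset.range y, wt B false u v * f u v =
      (∑ u ∈ Finset.range y, ∑ v ∈ Finset.range y, f u v) -
        (∑ u ∈ Finset.range y, ∑ v ∈ Finset.range y, (B u v : ZMod 24) * f u v) -
        ∑ u ∈ Finset.range y, f u u := by
  have : ∑ u ∈ Finset.range y, f u u = ∑ u ∈ Finset.range y, ∑ v ∈ Finset.range y,
      (if u = v then 1 else 0) * f u v := by
    refine Finset.sum_congr rfl fun u hu => ?_
    simp [Finset.mem_range.1 hu]
  simp only [this, ← Finset.sum_sub_distrib]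
  refine Finset.sum_congr rfl fun u _ => Finset.sum_congr rfl fun v _ => ?_
  simp only [wt, Bool.false_eq_true, if_false]
  ring

theorem sum_degr_mul (B : ℕ → ℕ → ℕ) (y : ℕ) (f : ℕ → ZMod 24) : ∑ u ∈ Finset.range y, (degr B y u : ZMod 24) * f u =
    ∑ u ∈ Finset.range y, ∑ v ∈ Finset.range y, (B u v : ZMod 24) * f u := by
  refine Finset.sum_congr rfl fun u _ => ?_
  rw [degr, Nat.cast_sum, Finset.sum_mul]

section
variable {B : ℕ → ℕ → ℕ} (hB : IsAdj B) (y : ℕ)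
include hB

theorem IsAdj.codeg_symm (u v : ℕ) : codeg B y u v = codeg B y v u :=
  Finset.sum_congr rfl fun x _ => by rw [hB.symm u x, hB.symm x v, mul_comm]

theorem IsAdj.codeg_self (u : ℕ) : codeg B y u u = degr B y u :=
  Finset.sum_congr rfl fun x _ => by rw [hB.symm x u]; rcases hB.cases u x with h | h <;> simp [h]

/-- Paths of length two are counted by their middle vertex instead of their ends. -/
theorem IsAdj.sum_codeg_mul (f g : ℕ → ZMod 24) :
    ∑ u ∈ Finset.range y, ∑ v ∈ Finset.range y, (codeg B y u v : ZMod 24) * (f u * g v) =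
      ∑ x ∈ Finset.range y, (∑ u ∈ Finset.range y, (B x u : ZMod 24) * f u) *
        ∑ v ∈ Finset.range y, (B x v : ZMod 24) * g v := by
  simp_rw [Finset.sum_mul_sum]
  rw [Finset.sum_comm (s := Finset.range y) (t := Finset.range y)
    (f := fun x u => ∑ v ∈ Finset.range y, (B x u : ZMod 24) * f u * ((B x v : ZMod 24) * g v))]
  refine Finset.sum_congr rfl fun u _ => ?_
  rw [Finset.sum_comm]
  refine Finset.sum_congr rfl fun v _ => ?_
  rw [codeg, Nat.cast_sum, Finset.sum_mul]
  refine Finset.sum_congr rfl fun x _ => ?_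
  rw [hB.symm u x]; push_cast; ring

/-- Changing the adjacency of two vertices when the other two are not adjacent. -/
theorem IsAdj.indCount_flip_false (b02 b12 b03 b13 : Bool) (f : ℕ → ℕ → ZMod 24)
    (hf : ∀ u < y, ∀ v < y, wt B false u v *
      ((∑ x ∈ Finset.range y, wt B b02 u x * wt B b12 v x) *
        (∑ x ∈ Finset.range y, wt B b03 u x * wt B b13 v x) -
        if b02 = b03 ∧ b12 = b13 then ∑ x ∈ Finset.range y, wt B b02 u x * wt B b12 v x
        else 0) = wt B false u v * f u v) :
    (indCount (adj4 false b02 b12 b03 b13 true) B y : ZMod 24) +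
      indCount (adj4 false b02 b12 b03 b13 false) B y =
      (∑ u ∈ Finset.range y, ∑ v ∈ Finset.range y, f u v) -
        (∑ u ∈ Finset.range y, ∑ v ∈ Finset.range y, (B u v : ZMod 24) * f u v) -
        ∑ u ∈ Finset.range y, f u u := by
  rw [hB.indCount_flip, ← sum_wt_false]
  exact Finset.sum_congr rfl fun u hu => Finset.sum_congr rfl fun v hv =>
    hf u (Finset.mem_range.1 hu) v (Finset.mem_range.1 hv)

end

/-- From the diamond to the 4-cycle, by flipping a pair opposite a non-adjacent one. The summand is
c² - c for the codegree c. Over all pairs, the c² give the coefficient of the squared codegrees, and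
the sum of c as well as the diagonal, where c is the degree, can be rewritten as edge sums. -/
theorem hasFormula_cycle (H : HasFormula (adj4 false true true true true true)) :
    HasFormula (adj4 false true true true true false) := by
  obtain ⟨F, γ, δ, hF⟩ := H
  refine ⟨1 - 2 * .x - (.c * .c - .c) - F, 1 + 23 * γ, 23 * δ, fun B y hB => ?_⟩
  have h1 := hB.indCount_flip_false y true true true true
    (fun u v => (codeg B y u v : ZMod 24) ^ 2 - codeg B y u v) fun u hu v hv => by
      rw [hB.sum_wt true true hu hv]; simp; ring_nf
  have h2 := hF B y hB
  have h3 : ∑ u ∈ Finset.range y, ∑ v ∈ Finset.range y, (codeg B y u v : ZMod 24) =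
      ∑ u ∈ Finset.range y, ∑ v ∈ Finset.range y, (B u v : ZMod 24) * degr B y u := by
    have := hB.sum_codeg_mul y (fun _ => 1) fun _ => 1
    simp only [mul_one] at this
    rw [this, ← sum_degr_mul]
    simp [degr]
  have h4 : ∑ u ∈ Finset.range y, ((codeg B y u u : ZMod 24) ^ 2 - codeg B y u u) =
      ∑ u ∈ Finset.range y, ∑ v ∈ Finset.range y, (B u v : ZMod 24) * (degr B y u - 1) := by
    rw [← sum_degr_mul]
    refine Finset.sum_congr rfl fun u _ => ?_
    rw [hB.codeg_self]; ring
  rw [h4, h2] at h1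
  simp only [Finset.sum_sub_distrib, h3] at h1
  rw [← eq_sub_iff_add_eq'] at h1
  rw [h1]
  have h23 : ((23 : ℕ) : ZMod 24) = -1 := rfl
  simp only [formula, Nat.cast_mul, Nat.cast_add, Nat.cast_one, h23, Pol.ev_sub, Pol.ev_mul,
    Pol.ev_c, Pol.ev_x, Pol.ev_one, Pol.ev_two, mul_sub, Finset.sum_sub_distrib, pow_two]
  have h5 : ∑ u ∈ Finset.range y, ∑ v ∈ Finset.range y, (B u v : ZMod 24) * (2 * degr B y u) =
      2 * ∑ u ∈ Finset.range y, ∑ v ∈ Finset.range y, (B u v : ZMod 24) * degr B y u := by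
    simp_rw [Finset.mul_sum]
    exact Finset.sum_congr rfl fun u _ => Finset.sum_congr rfl fun v _ => by ring
  rw [h5]
  ring

/-- From the path to two disjoint edges. On non-adjacent pairs the summand is (d - c)(d' - c) for
degrees d, d' and codegree c, which vanishes on the diagonal. Over all pairs, the products d d' sum
to the square of the degree sum, each mixed term c d becomes the edge sum of d d', and c² is
allowed. -/
theorem hasFormula_matching (H : HasFormula (adj4 false true false false true true)) :
    HasFormula (adj4 false true false false true false) := by
  obtain ⟨F, γ, δ, hF⟩ := H
  refine ⟨0 - 2 * (.x * .y) - (.x - .c) * (.y - .c) - F, 1 + 23 * γ, 1 + 23 * δ,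
    fun B y hB => ?_⟩
  have h1 := hB.indCount_flip_false y true false false true
    (fun u v => ((degr B y u : ZMod 24) - codeg B y u v) * (degr B y v - codeg B y u v))
    fun u hu v hv => by
      rw [hB.sum_wt true false hu hv, hB.sum_wt false true hu hv]
      rcases hB.cases u v with h | h
      · simp [h]
      · have : u ≠ v := by rintro rfl; simp [hB.irrefl] at h
        simp [h, wt, this]
  have h2 := hF B y hB
  have h3 : ∑ u ∈ Finset.range y, ∑ v ∈ Finset.range y,
      (codeg B y u v : ZMod 24) * (degr B y u : ZMod 24) =
      ∑ u ∈ Finset.range y, ∑ v ∈ Finset.range y,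
        (B u v : ZMod 24) * (degr B y u * degr B y v) := by
    have := hB.sum_codeg_mul y (fun u => degr B y u) fun _ => 1
    simp only [mul_one] at this
    rw [this]
    refine Finset.sum_congr rfl fun u _ => ?_
    rw [mul_comm, degr, Nat.cast_sum, Finset.mul_sum]
    refine Finset.sum_congr rfl fun v _ => ?_
    ring
  have h3' : ∑ u ∈ Finset.range y, ∑ v ∈ Finset.range y,
      (codeg B y u v : ZMod 24) * (degr B y v : ZMod 24) =
      ∑ u ∈ Finset.range y, ∑ v ∈ Finset.range y,
        (B u v : ZMod 24) * (degr B y u * degr B y v) := by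
    rw [Finset.sum_comm, ← h3]
    exact Finset.sum_congr rfl fun u _ => Finset.sum_congr rfl fun v _ => by rw [hB.codeg_symm]
  have h4 : ∑ u ∈ Finset.range y, ((degr B y u : ZMod 24) - codeg B y u u) *
      (degr B y u - codeg B y u u) = 0 :=
    Finset.sum_eq_zero fun u _ => by rw [hB.codeg_self]; ring
  have h5 : (∑ u ∈ Finset.range y, ∑ v ∈ Finset.range y, (B u v : ZMod 24)) ^ 2 =
      ∑ u ∈ Finset.range y, ∑ v ∈ Finset.range y, (degr B y u : ZMod 24) * degr B y v := by
    rw [pow_two, Finset.sum_mul_sum]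
    simp [degr]
  have h6 : ∑ u ∈ Finset.range y, ∑ v ∈ Finset.range y,
      ((degr B y u : ZMod 24) - codeg B y u v) * (degr B y v - codeg B y u v) =
      (∑ u ∈ Finset.range y, ∑ v ∈ Finset.range y, (B u v : ZMod 24)) ^ 2 -
      2 * (∑ u ∈ Finset.range y, ∑ v ∈ Finset.range y,
        (B u v : ZMod 24) * (degr B y u * degr B y v)) +
      ∑ u ∈ Finset.range y, ∑ v ∈ Finset.range y, (codeg B y u v : ZMod 24) ^ 2 := by
    rw [h5, two_mul]
    nth_rewrite 1 [← h3]
    rw [← h3']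
    simp only [← Finset.sum_add_distrib, ← Finset.sum_sub_distrib]
    exact Finset.sum_congr rfl fun u _ => Finset.sum_congr rfl fun v _ => by ring
  rw [h4, h6, h2, ← eq_sub_iff_add_eq'] at h1
  rw [h1]
  have h23 : ((23 : ℕ) : ZMod 24) = -1 := rfl
  have h7 : ∑ u ∈ Finset.range y, ∑ v ∈ Finset.range y,
      (B u v : ZMod 24) * (2 * (degr B y u * degr B y v)) =
      2 * ∑ u ∈ Finset.range y, ∑ v ∈ Finset.range y,
        (B u v : ZMod 24) * (degr B y u * degr B y v) := by
    simp_rw [Finset.mul_sum]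
    exact Finset.sum_congr rfl fun u _ => Finset.sum_congr rfl fun v _ => by ring
  have h8 : ∀ u v, (B u v : ZMod 24) * (0 - 2 * (Pol.x * Pol.y) - (Pol.x - .c) * (.y - .c) - F).ev
      (codeg B y u v) (degr B y u) (degr B y v) y =
      -((B u v : ZMod 24) * (2 * (degr B y u * degr B y v))) -
      (B u v : ZMod 24) * ((degr B y u - codeg B y u v) * (degr B y v - codeg B y u v)) -
      (B u v : ZMod 24) * F.ev (codeg B y u v) (degr B y u) (degr B y v) y := by
    intro u v; simp; ring
  simp only [formula, h8, Nat.cast_mul, Nat.cast_add, Nat.cast_one, h23, Finset.sum_sub_distrib,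
    Finset.sum_neg_distrib, h7]
  ring

/-- All graphs on four vertices but the empty graph. -/
theorem exists_perm_adj4 : ∀ b01 b02 b12 b03 b13 b23 : Bool,
    (b01 || b02 || b12 || b03 || b13 || b23) = true →
    ∃ r ∈ [adj4 true true true true true true, adj4 true true true true true false,
      adj4 true true true true false false, adj4 true true false true false false,
      adj4 true true true false false false, adj4 false true true true true false,
      adj4 true true false false true false, adj4 true true false false false false,
      adj4 false true false false true false, adj4 true false false false false false],
    ∃ i0 i1 i2 i3 : Fin 4, Function.Injective ![i0, i1, i2, i3] ∧ ∀ i j,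
      adj4 b01 b02 b12 b03 b13 b23 i j = r (![i0, i1, i2, i3] i) (![i0, i1, i2, i3] j) := by
  decide +kernel

/-- The flips form a tree rooted at the complete graph: diamond, then paw and 4-cycle; from the paw
the claw and the triangle with an isolated vertex; from the 4-cycle the path on four vertices; from
that the path on three vertices with an isolated one and the matching; from the matching the single
edge. Between flips the graph is relabelled so that the pair to be changed is 2, 3. -/
theorem hasFormula (b01 b02 b12 b03 b13 b23 : Bool)
    (h : (b01 || b02 || b12 || b03 || b13 || b23) = true) :
    HasFormula (adj4 b01 b02 b12 b03 b13 b23) := by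
  have key : ∀ {r r' : Fin 4 → Fin 4 → Bool}, HasFormula r → (∃ i0 i1 i2 i3 : Fin 4,
      Function.Injective ![i0, i1, i2, i3] ∧ ∀ i j,
      r' i j = r (![i0, i1, i2, i3] i) (![i0, i1, i2, i3] j)) → HasFormula r' := by
    rintro r r' hr ⟨i0, i1, i2, i3, hi, h⟩
    exact hr.comp (Equiv.ofBijective _ (Finite.injective_iff_bijective.1 hi)) h
  have top := hasFormula_top
  have dia : HasFormula (adj4 true true true true true false) := top.flip
  have paw : HasFormula (adj4 true true true true false false) :=
    HasFormula.flip (b := true) (key dia (by decide +kernel))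
  have claw : HasFormula (adj4 true true false true false false) :=
    HasFormula.flip (b := true) (key paw (by decide +kernel))
  have k3k1 : HasFormula (adj4 true true true false false false) :=
    HasFormula.flip (b := true) (key paw (by decide +kernel))
  have c4 : HasFormula (adj4 false true true true true false) :=
    hasFormula_cycle (key dia (by decide +kernel))
  have p4 : HasFormula (adj4 true true false false true false) :=
    HasFormula.flip (b := true) (key c4 (by decide +kernel))
  have p3k1 : HasFormula (adj4 true true false false false false) :=
    HasFormula.flip (b := true) (key p4 (by decide +kernel))
  have mat : HasFormula (adj4 false true false false true false) :=
    hasFormula_matching (key p4 (by decide +kernel))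
  have k2 : HasFormula (adj4 true false false false false false) :=
    HasFormula.flip (b := true) (key mat (by decide +kernel))
  obtain ⟨r, hr, h⟩ := exists_perm_adj4 b01 b02 b12 b03 b13 b23 h
  refine key ?_ h
  simp only [List.mem_cons, List.not_mem_nil, or_false] at hr
  rcases hr with rfl | rfl | rfl | rfl | rfl | rfl | rfl | rfl | rfl | rfl <;> assumption

/-! ### The adjacency test -/

notation "rN" => (0 : ℕ)
notation "rS" => (1 : ℕ)
notation "rL" => (2 : ℕ)
notation "rY" => (15 : ℕ)
notation "rSp" => (16 : ℕ)
notation "rBeg" => (17 : ℕ)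
notation "rEnd" => (18 : ℕ)
notation "rDim" => (19 : ℕ)
notation "rSq" => (20 : ℕ)
notation "rT" => (21 : ℕ)
notation "rI" => (22 : ℕ)
notation "rJ" => (23 : ℕ)
notation "rCd" => (24 : ℕ)
notation "rVal" => (25 : ℕ)
notation "rM" => (26 : ℕ)
notation "rQ" => (27 : ℕ)
notation "rAcc" => (28 : ℕ)
notation "rDx" => (29 : ℕ)
notation "rDy" => (30 : ℕ)
notation "rOut" => (31 : ℕ)
notation "aStart" => (7 : ℕ)
notation "aRow" => (8 : ℕ)
notation "aY" => (10 : ℕ)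
notation "aDeg" => (11 : ℕ)
notation "aBase" => (12 : ℕ)
notation "aAcc" => (13 : ℕ)
notation "aLeft" => (100 : ℕ)
notation "aRight" => (101 : ℕ)
notation "aProd" => (102 : ℕ)

/-- The vertices `0, …, n - 1` of a graph with adjacency matrix `A` are ordered in such a way that the
separator consists of the vertices below `S`, and that every component of the rest is an interval,
on which `st` is constant. The table `row` gives access to the adjacency matrix. -/
structure Layout (n S L : ℕ) (st row : ℕ → ℕ) (A : ℕ → ℕ → ℕ) : Prop where
  isAdj : IsAdj A
  S_le : S ≤ n
  L_le : L ≤ n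
  S_le_L : S ≤ L
  sep : ∀ a b, S ≤ a → S ≤ b → a < n → b < n → A a b ≠ 0 → st a = st b
  conv : ∀ a b c, S ≤ a → a ≤ b → b ≤ c → c < n → st a = st c → st b = st a
  small : ∀ a b, S ≤ a → a ≤ b → b < n → st a = st b → S + (b - a) < L
  adj : ∀ a b, a < n → b < n → (if a < S then row (b * L + a) else if b < S then row (a * L + b) else
    if st a = st b then row (a * L + (S + (b - st b))) else 0) = A a b

/-- The state holds the layout. -/
structure HasLayout (s : State) (n S L : ℕ) (st row : ℕ → ℕ) : Prop where
  reg_n : s.reg rN = n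
  reg_S : s.reg rS = S
  reg_L : s.reg rL = L
  mem_st : s.mem aStart = st
  mem_row : s.mem aRow = row

theorem HasLayout.off {c : Cmd} {s s' : State} {n S L : ℕ} {st row : ℕ → ℕ}
    (h : HasLayout s n S L st row) (ho : Off c s s') (h0 : c.wr rN = false) (h1 : c.wr rS = false)
    (h2 : c.wr rL = false) (h3 : c.wa aStart = false) (h4 : c.wa aRow = false) :
    HasLayout s' n S L st row :=
  ⟨(ho.reg h0).trans h.reg_n, (ho.reg h1).trans h.reg_S, (ho.reg h2).trans h.reg_L,
    (ho.mem h3).trans h.mem_st, (ho.mem h4).trans h.mem_row⟩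

@[simp] theorem hasLayout_setReg {s : State} {n S L r v : ℕ} {st row : ℕ → ℕ} (hr : 2 < r) :
    HasLayout (s.setReg r v) n S L st row ↔ HasLayout s n S L st row := by
  have h0 : 0 ≠ r := by omega
  have h1 : 1 ≠ r := by omega
  have h2 : 2 ≠ r := by omega
  constructor <;> rintro ⟨a, b, c, d, e⟩ <;> constructor <;> simp_all

/-- The adjacency test. -/
def adjE (a b : Expr) : Expr :=
  .ite (.lt a (.var rS)) (.rd aRow (b * .var rL + a))
    (.ite (.lt b (.var rS)) (.rd aRow (a * .var rL + b))
      (.ite (.eq (.rd aStart a) (.rd aStart b))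
        (.rd aRow (a * .var rL + (.var rS + (b - .rd aStart b)))) 0))

section
variable {n S L w : ℕ} {st row : ℕ → ℕ} {A : ℕ → ℕ → ℕ} (hl : Layout n S L st row A)
  (hbig : 2000 + 20 * n + 2 * (n * n) ≤ word w)
include hl

theorem adjE_eval {s : State} (hs : HasLayout s n S L st row) {a b : Expr} (ha : a.eval s < n)
    (hb : b.eval s < n) : (adjE a b).eval s = A (a.eval s) (b.eval s) := by
  rw [← hl.adj _ _ ha hb]
  simp only [adjE, Expr.eval_ite, Expr.eval_lt_ne_zero, Expr.eval_rd, Expr.eval_add, Expr.eval_mul,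
    Expr.eval_var, hs.reg_S, hs.reg_L, Expr.eval_eq, hs.mem_st, hs.mem_row, Expr.eval_sub,
    Expr.eval_ofNat]
  simp

include hbig

theorem adjE_ok {s : State} (hs : HasLayout s n S L st row) {a b : Expr} (ha : a.eval s < n)
    (hb : b.eval s < n) (ha' : a.Ok w s) (hb' : b.Ok w s) : (adjE a b).Ok w s := by
  have h1 : ∀ x < n, x * L ≤ n * n := fun x hx => Nat.mul_le_mul hx.le hl.L_le
  have h2 := h1 _ ha
  have h3 := h1 _ hb
  have h4 := hl.S_le
  simp [adjE, hs.reg_S, hs.reg_L, ha', hb', hs.mem_st]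
  omega

end

/-- The position in `aY` of the `e`-th vertex of the current part of the graph. -/
def phiE (e : Expr) : Expr := .ite (.lt e (.var rSp)) e (.var rBeg + (e - .var rSp))

/-- The function computed by `phiE`. -/
def phi (sp β i : ℕ) : ℕ := if i < sp then i else β + (i - sp)

@[simp] theorem phiE_eval (s : State) (e : Expr) :
    (phiE e).eval s = phi (s.reg rSp) (s.reg rBeg) (e.eval s) := by
  simp only [phiE, phi, Expr.eval_ite, Expr.eval_lt_ne_zero, Expr.eval_var, Expr.eval_add,
    Expr.eval_sub]

/-- Write the adjacency matrix of the current part into the arrays for matrix multiplication. -/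
def buildMat : Cmd :=
  .set rSq (.var rDim * .var rDim) ;;
  .upto rT rSq (.put aLeft (.var rT) (adjE (.rd aY (phiE (.var rT / .var rDim)))
      (.rd aY (phiE (.var rT % .var rDim)))) ;;
    .put aRight (.var rT) (.rd aLeft (.var rT)))

theorem buildMat_spec {p : Prog} {w n S L : ℕ} {st row : ℕ → ℕ} {A : ℕ → ℕ → ℕ}
    {N sp β : ℕ} {s : State} (hl : Layout n S L st row A)
    (hbig : 2000 + 20 * n + 2 * (n * n) ≤ word w) (hs : HasLayout s n S L st row)
    (hN : s.reg rDim = N) (hsp : s.reg rSp = sp) (hβ : s.reg rBeg = β) (hNn : N ≤ n)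
    (hφ : ∀ i < N, phi sp β i < n) (hY : ∀ i < N, s.mem aY (phi sp β i) < n) :
    WP p w buildMat (300 * (N * N + 1)) (fun s' => s'.reg rSq = N * N ∧ ∀ t < N * N,
      s'.mem aLeft t = A (s.mem aY (phi sp β (t / N))) (s.mem aY (phi sp β (t % N))) ∧
      s'.mem aRight t = A (s.mem aY (phi sp β (t / N))) (s.mem aY (phi sp β (t % N)))) s := by
  have hw : 1 < word w := by omega
  have hNN : N * N ≤ n * n := Nat.mul_le_mul hNn hNn
  refine WP.le (WP.straight_seq hw (T := 10) (by decide) ⟨?_, ?_⟩)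
    (show 10 + (N * N * (200 + 8) + 6) ≤ _ by omega)
  · simp [hN]; omega
  set s1 := s.setReg rSq (Expr.eval s (.var rDim * .var rDim)) with hs1
  have hl1 : HasLayout s1 n S L st row := by simpa [hs1] using hs
  refine (WP.for_straight hw (n := N * N) (fun k s' => ∀ t < k,
      s'.mem aLeft t = A (s.mem aY (phi sp β (t / N))) (s.mem aY (phi sp β (t % N))) ∧
      s'.mem aRight t = A (s.mem aY (phi sp β (t / N))) (s.mem aY (phi sp β (t % N))))
      200 (by decide) rfl rfl (by decide) (by simp [hs1, hN]) (by simp) ?_).mono hw le_rfl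
      fun s' hf ho h => ⟨(ho.reg rfl).trans (by simp [hs1, hN]), h.1⟩
  intro k hk s' hf hsT _ ho hI
  have hl' := hl1.off ho rfl rfl rfl rfl rfl
  have e1 : s'.reg rDim = N := (ho.reg rfl).trans (by simp [hs1, hN])
  have e2 : s'.reg rSp = sp := (ho.reg rfl).trans (by simp [hs1, hsp])
  have e3 : s'.reg rBeg = β := (ho.reg rfl).trans (by simp [hs1, hβ])
  have e4 : s'.mem aY = s.mem aY := (ho.mem rfl).trans (by simp [hs1])
  have hpos : 0 < N := Nat.pos_of_ne_zero (by rintro rfl; simp at hk)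
  have hd : k / N < N := Nat.div_lt_of_lt_mul hk
  have hm : k % N < N := Nat.mod_lt _ hpos
  have hd' := hφ _ hd
  have hm' := hφ _ hm
  have ok : ∀ e : Expr, e.Ok w s' → e.eval s' < N → (Expr.rd aY (phiE e)).Ok w s' := by
    intro e he he'
    have := hφ _ he'
    simp only [phi] at this
    simp [phiE, he, e2, e3]
    intro h; rw [if_neg (by omega)] at this; omega
  have ev : ∀ e : Expr, (Expr.rd aY (phiE e)).eval s' = s.mem aY (phi sp β (e.eval s')) := by
    intro e; simp [e2, e3, e4]
  have ev1 := adjE_eval hl hl' (a := .rd aY (phiE (.var rT / .var rDim)))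
    (b := .rd aY (phiE (.var rT % .var rDim))) (by rw [ev]; simpa [hsT, e1] using hY _ hd)
    (by rw [ev]; simpa [hsT, e1] using hY _ hm)
  refine ⟨by simp, adjE_ok hl hbig hl' (by rw [ev]; simpa [hsT, e1] using hY _ hd)
    (by rw [ev]; simpa [hsT, e1] using hY _ hm) (ok _ (by simp) (by simpa [hsT, e1] using hd))
    (ok _ (by simp) (by simpa [hsT, e1] using hm)), by simp, by simp, ?_⟩
  rw [ev1, ev, ev]
  intro t ht
  simp only [Expr.eval_var, hsT, Expr.eval_rd, State.mem_setMem, State.reg_setMem, State.mem_setReg,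
    Expr.eval_div, Expr.eval_mod, e1]
  by_cases h : t = k
  · simp [h]
  · simpa [h] using hI t (by omega)

/-! ### Sums over the parts of a graph with a separator -/

open Finset

theorem sum_range_phi {M : Type*} [AddCommMonoid M] (sp β e : ℕ) (f : ℕ → M) :
    ∑ i ∈ range (sp + (e - β)), f (phi sp β i) = ∑ a ∈ range sp, f a + ∑ a ∈ Ico β e, f a := by
  rw [sum_range_add, sum_Ico_eq_sum_range]
  congr 1
  · exact sum_congr rfl fun i hi => by rw [phi, if_pos (mem_range.1 hi)]
  · exact sum_congr rfl fun i hi => by rw [phi, if_neg (by omega), Nat.add_sub_cancel_left]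

theorem sum_range_eq_three {M : Type*} [AddCommMonoid M] {sp β e : ℕ} (h1 : sp ≤ β) (h2 : β ≤ e)
    (f : ℕ → M) :
    ∑ a ∈ range e, f a = ∑ a ∈ range sp, f a + ∑ a ∈ Ico sp β, f a + ∑ a ∈ Ico β e, f a := by
  rw [sum_range_add_sum_Ico f h1, sum_range_add_sum_Ico f h2]

/-- The programs run over pairs with a single counter t, read as the pair of quotient and remainder.
-/
theorem sum_range_mul_div_mod {M : Type*} [AddCommMonoid M] (N N' : ℕ) (f : ℕ → ℕ → M) :
    ∑ t ∈ range (N * N'), f (t / N') (t % N') = ∑ i ∈ range N, ∑ j ∈ range N', f i j := by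
  rcases Nat.eq_zero_or_pos N' with rfl | hpos
  · simp
  induction N with
  | zero => simp
  | succ N ih =>
    rw [Nat.add_mul, one_mul, sum_range_add, ih, sum_range_succ]
    congr 1
    refine sum_congr rfl fun j hj => ?_
    have hj := mem_range.1 hj
    rw [mul_comm N, Nat.mul_add_div hpos, Nat.div_eq_of_lt hj, add_zero, Nat.mul_add_mod,
      Nat.mod_eq_of_lt hj]

theorem sum_comm₂ {ι κ M : Type*} [AddCommMonoid M] (s t : Finset ι) (u v : Finset κ)
    (f : ι → ι → κ → κ → M) :
    ∑ b ∈ s, ∑ a ∈ t, ∑ i ∈ u, ∑ j ∈ v, f a b i j =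
      ∑ i ∈ u, ∑ j ∈ v, ∑ b ∈ s, ∑ a ∈ t, f a b i j := by
  have := sum_comm (s := s ×ˢ t) (t := u ×ˢ v) (f := fun p q => f p.2 p.1 q.1 q.2)
  simpa only [sum_product] using this

/-- Restriction of a function to the pairs that are not both below `sp`. -/
def offPart {M : Type*} [Zero M] (sp : ℕ) (g : ℕ → ℕ → M) (a b : ℕ) : M :=
  if a < sp ∧ b < sp then 0 else g a b

/-- The sum over all pairs below `β` that are not both below `sp`. -/
def offSum {M : Type*} [AddCommMonoid M] (sp β : ℕ) (g : ℕ → ℕ → M) : M :=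
  ∑ a ∈ range β, ∑ b ∈ range β, offPart sp g a b

section
variable {R : Type*} [CommRing R] {sp β e y : ℕ}

theorem offSum_self (g : ℕ → ℕ → R) : offSum sp sp g = 0 :=
  sum_eq_zero fun a ha => sum_eq_zero fun b hb => by
    rw [offPart, if_pos ⟨mem_range.1 ha, mem_range.1 hb⟩]

theorem sum_add_offSum (h : sp ≤ y) (g : ℕ → ℕ → R) :
    ∑ a ∈ range y, ∑ b ∈ range y, g a b =
      offSum sp y g + ∑ a ∈ range sp, ∑ b ∈ range sp, g a b := by
  have : ∑ a ∈ range sp, ∑ b ∈ range sp, g a b =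
      ∑ a ∈ range y, ∑ b ∈ range y, if a < sp ∧ b < sp then g a b else 0 := by
    have hf : (range y).filter (· < sp) = range sp := by
      ext x; simp; omega
    simp_rw [ite_and]
    rw [← hf, sum_filter]
    refine sum_congr rfl fun a _ => ?_
    split_ifs
    · rw [sum_filter]
    · simp
  rw [this, offSum, ← sum_add_distrib]
  refine sum_congr rfl fun a _ => ?_
  rw [← sum_add_distrib]
  refine sum_congr rfl fun b _ => ?_
  rw [offPart]
  split_ifs <;> simp

/-- When the interval from β to e is added, the new pairs either lie inside separator plus interval,
or join an earlier non-separator vertex to the interval, in one of two orders. -/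
theorem offSum_succ (h1 : sp ≤ β) (h2 : β ≤ e) (g : ℕ → ℕ → R) :
    offSum sp e g = offSum sp β g +
      (∑ i ∈ range (sp + (e - β)), ∑ j ∈ range (sp + (e - β)),
        offPart sp g (phi sp β i) (phi sp β j)) +
      (∑ a ∈ Ico sp β, ∑ b ∈ Ico β e, g a b + ∑ a ∈ Ico sp β, ∑ b ∈ Ico β e, g b a) := by
  have e1 : ∑ a ∈ range sp, ∑ b ∈ range sp, offPart sp g a b = 0 := offSum_self g
  have e2 : ∀ a b, sp ≤ a → offPart sp g a b = g a b := fun a b h => by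
    rw [offPart, if_neg (by omega)]
  have e3 : ∀ a b, sp ≤ a → offPart sp g b a = g b a := fun a b h => by
    rw [offPart, if_neg (by omega)]
  have e4 : ∑ a ∈ Ico sp β, ∑ b ∈ Ico β e, g a b =
      ∑ a ∈ Ico sp β, ∑ b ∈ Ico β e, offPart sp g a b :=
    sum_congr rfl fun a ha => sum_congr rfl fun b _ => (e2 a b (mem_Ico.1 ha).1).symm
  have e5 : ∑ a ∈ Ico sp β, ∑ b ∈ Ico β e, g b a =
      ∑ b ∈ Ico β e, ∑ a ∈ Ico sp β, offPart sp g b a := by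
    rw [sum_comm]
    exact sum_congr rfl fun b _ => sum_congr rfl fun a ha => (e3 a b (mem_Ico.1 ha).1).symm
  have e6 : ∑ i ∈ range (sp + (e - β)), ∑ j ∈ range (sp + (e - β)),
      offPart sp g (phi sp β i) (phi sp β j) =
      ∑ a ∈ range sp, (∑ b ∈ range sp, offPart sp g a b + ∑ b ∈ Ico β e, offPart sp g a b) +
      ∑ a ∈ Ico β e, (∑ b ∈ range sp, offPart sp g a b + ∑ b ∈ Ico β e, offPart sp g a b) := by
    rw [sum_range_phi (f := fun a => ∑ j ∈ range (sp + (e - β)), offPart sp g a (phi sp β j))]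
    simp only [sum_range_phi]
  rw [e4, e5, e6]
  simp only [offSum]
  simp only [sum_range_eq_three h1 h2, ← sum_range_add_sum_Ico _ h1, sum_add_distrib, e1]
  ring

end

section
variable {B : ℕ → ℕ → ℕ} {sp β e y : ℕ}

/-- `sp ≤ β ≤ e ≤ y`, and the vertices from `β` to `e` are adjacent only to each other and to the
vertices below `sp`. -/
structure IsBlock (B : ℕ → ℕ → ℕ) (sp β e y : ℕ) : Prop where
  isAdj : IsAdj B
  sp_le : sp ≤ β
  le : β ≤ e
  le_y : e ≤ y
  eq_zero : ∀ a x, β ≤ a → a < e → x < y → sp ≤ x → (x < β ∨ e ≤ x) → B a x = 0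

theorem IsBlock.sum_eq (h : IsBlock B sp β e y) {a : ℕ} (h1 : β ≤ a) (h2 : a < e) (f : ℕ → ℕ) :
    ∑ x ∈ range y, B a x * f x = ∑ x ∈ range sp, B a x * f x + ∑ x ∈ Ico β e, B a x * f x := by
  rw [← sum_range_add_sum_Ico _ h.le_y, sum_range_eq_three h.sp_le h.le]
  have e1 : ∑ x ∈ Ico sp β, B a x * f x = 0 := sum_eq_zero fun x hx => by
    have := mem_Ico.1 hx
    have := h.le
    have := h.le_y
    rw [h.eq_zero a x h1 h2 (by omega) (by omega) (by omega), zero_mul]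
  have e2 : ∑ x ∈ Ico e y, B a x * f x = 0 := sum_eq_zero fun x hx => by
    have := mem_Ico.1 hx
    have := h.le
    have := h.sp_le
    rw [h.eq_zero a x h1 h2 (by omega) (by omega) (by omega), zero_mul]
  rw [e1, e2]; ring

/-- The neighbours of a block vertex lie in the separator or the block. Hence the square of the
small matrix already contains the codegree in the whole graph, provided the pair meets the block. -/
theorem IsBlock.sum_prod (h : IsBlock B sp β e y) {i j : ℕ} (hi : i < sp + (e - β))
    (hj : j < sp + (e - β)) (hij : ¬ (i < sp ∧ j < sp)) :
    ∑ l ∈ range (sp + (e - β)), B (phi sp β i) (phi sp β l) * B (phi sp β l) (phi sp β j) =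
      codeg B y (phi sp β i) (phi sp β j) := by
  rw [sum_range_phi (f := fun l => B (phi sp β i) l * B l (phi sp β j))]
  by_cases hi' : i < sp
  · have h1 : β ≤ phi sp β j := by rw [phi, if_neg (by omega)]; omega
    have h2 : phi sp β j < e := by rw [phi, if_neg (by omega)]; omega
    rw [h.isAdj.codeg_symm, codeg, h.sum_eq h1 h2]
    simp only [h.isAdj.symm _ (phi sp β j), h.isAdj.symm (phi sp β i), mul_comm]
  · have h1 : β ≤ phi sp β i := by rw [phi, if_neg hi']; omega
    have h2 : phi sp β i < e := by rw [phi, if_neg hi']; omega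
    rw [codeg, h.sum_eq h1 h2]

/-- Vertices of an earlier and of the current block have common neighbours only in the separator. -/
theorem IsBlock.codeg_eq (h : IsBlock B sp β e y) {a b : ℕ} (ha : sp ≤ a) (ha' : a < β)
    (hb : β ≤ b) (hb' : b < e) : codeg B y a b = ∑ x ∈ range sp, B a x * B x b := by
  rw [h.isAdj.codeg_symm, codeg, h.sum_eq hb hb']
  have : ∑ x ∈ Ico β e, B b x * B x a = 0 := sum_eq_zero fun x hx => by
    have := mem_Ico.1 hx
    have := h.le_y
    rw [h.eq_zero x a (by omega) (by omega) (by omega) (by omega) (by omega), mul_zero]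
  rw [this, add_zero]
  exact sum_congr rfl fun x _ => by rw [h.isAdj.symm b x, h.isAdj.symm x a, mul_comm]

/-- The number of common neighbours in an interval. -/
def codegIn (B : ℕ → ℕ → ℕ) (β e u v : ℕ) : ℕ := ∑ x ∈ Ico β e, B u x * B x v

/-- For a in earlier blocks and b in the current one, the squared codegree is a double sum over
separator vertices i, j. Summing over a and b first turns it into a product of two common-neighbour
counts of i and j, one in the current block and one in the earlier ones. The factor 2 is for the two
orders of a and b. -/
theorem IsBlock.offSum_codeg_sq (h : IsBlock B sp β e y) :
    offSum sp e (fun a b => (codeg B y a b : ZMod 24) ^ 2) =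
      offSum sp β (fun a b => (codeg B y a b : ZMod 24) ^ 2) +
      (∑ i ∈ range (sp + (e - β)), ∑ j ∈ range (sp + (e - β)),
        offPart sp (fun a b => (codeg B y a b : ZMod 24) ^ 2) (phi sp β i) (phi sp β j)) +
      ∑ i ∈ range sp, ∑ j ∈ range sp,
        2 * ((codegIn B β e i j : ZMod 24) * codegIn B sp β i j) := by
  rw [offSum_succ h.sp_le h.le]
  congr 1
  have h1 : ∑ a ∈ Ico sp β, ∑ b ∈ Ico β e, (codeg B y b a : ZMod 24) ^ 2 =
      ∑ a ∈ Ico sp β, ∑ b ∈ Ico β e, (codeg B y a b : ZMod 24) ^ 2 :=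
    sum_congr rfl fun a _ => sum_congr rfl fun b _ => by rw [h.isAdj.codeg_symm]
  have h2 : ∑ a ∈ Ico sp β, ∑ b ∈ Ico β e, (codeg B y a b : ZMod 24) ^ 2 =
      ∑ i ∈ range sp, ∑ j ∈ range sp, (codegIn B β e i j : ZMod 24) * codegIn B sp β i j := by
    have h3 : ∀ a ∈ Ico sp β, ∀ b ∈ Ico β e, (codeg B y a b : ZMod 24) ^ 2 =
        ∑ i ∈ range sp, ∑ j ∈ range sp,
          ((B i b : ZMod 24) * B b j) * ((B i a : ZMod 24) * B a j) := by
      intro a ha b hb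
      have ha := mem_Ico.1 ha
      have hb := mem_Ico.1 hb
      rw [h.codeg_eq ha.1 ha.2 hb.1 hb.2, pow_two, Nat.cast_sum, sum_mul_sum]
      refine sum_congr rfl fun i _ => sum_congr rfl fun j _ => ?_
      rw [h.isAdj.symm b j, h.isAdj.symm i a]
      push_cast; ring
    rw [sum_congr rfl fun a ha => sum_congr rfl (h3 a ha)]
    simp only [codegIn, Nat.cast_sum, sum_mul_sum, Nat.cast_mul]
    rw [sum_comm, sum_comm₂]
  rw [h1, h2, ← two_mul, mul_sum]
  simp_rw [mul_sum]

/-- Terms weighted by adjacency have no cross part, since no edge joins two blocks. -/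
theorem IsBlock.offSum_mul (h : IsBlock B sp β e y) (f : ℕ → ℕ → ZMod 24) :
    offSum sp e (fun a b => (B a b : ZMod 24) * f a b) =
      offSum sp β (fun a b => (B a b : ZMod 24) * f a b) +
      (∑ i ∈ range (sp + (e - β)), ∑ j ∈ range (sp + (e - β)),
        offPart sp (fun a b => (B a b : ZMod 24) * f a b) (phi sp β i) (phi sp β j)) := by
  rw [offSum_succ h.sp_le h.le]
  have h0 : ∀ a ∈ Ico sp β, ∀ b ∈ Ico β e, B b a = 0 := by
    intro a ha b hb
    have ha := mem_Ico.1 ha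
    have hb := mem_Ico.1 hb
    have := h.le_y
    exact h.eq_zero b a hb.1 hb.2 (by omega) ha.1 (by omega)
  have h1 : ∑ a ∈ Ico sp β, ∑ b ∈ Ico β e, (B a b : ZMod 24) * f a b = 0 :=
    sum_eq_zero fun a ha => sum_eq_zero fun b hb => by
      rw [h.isAdj.symm, h0 a ha b hb]; simp
  have h2 : ∑ a ∈ Ico sp β, ∑ b ∈ Ico β e, (B b a : ZMod 24) * f b a = 0 :=
    sum_eq_zero fun a ha => sum_eq_zero fun b hb => by rw [h0 a ha b hb]; simp
  rw [h1, h2]; ring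

theorem codegIn_add (h1 : sp ≤ β) (h2 : β ≤ e) (u v : ℕ) :
    codegIn B sp e u v = codegIn B sp β u v + codegIn B β e u v :=
  (sum_Ico_consecutive _ h1 h2).symm

theorem codeg_eq_add (h : sp ≤ y) (u v : ℕ) :
    codeg B y u v = codeg B sp u v + codegIn B sp y u v :=
  (sum_range_add_sum_Ico _ h).symm

end

/-! ### Counting in the subgraph on a set of vertices -/

/-- `Y 0 < … < Y (y - 1)` are vertices. -/
structure Part (n y : ℕ) (Y : ℕ → ℕ) : Prop where
  lt : ∀ i < y, Y i < n
  mono : ∀ i j, i < j → j < y → Y i < Y j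

theorem Part.le_apply {n y : ℕ} {Y : ℕ → ℕ} (h : Part n y Y) {i j : ℕ} (hij : i ≤ j) (hj : j < y) :
    Y i + (j - i) ≤ Y j := by
  induction j, hij using Nat.le_induction with
  | base => simp
  | succ j hij ih =>
    have := ih (by omega)
    have := h.mono j (j + 1) (by omega) hj
    omega

theorem Part.le {n y : ℕ} {Y : ℕ → ℕ} (h : Part n y Y) : y ≤ n := by
  by_contra hc
  have := h.le_apply (i := 0) (j := y - 1) (by omega) (by omega)
  have := h.lt (y - 1) (by omega)
  omega

/-- The adjacency matrix of the induced subgraph. -/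
def sub (A : ℕ → ℕ → ℕ) (Y : ℕ → ℕ) (i j : ℕ) : ℕ := A (Y i) (Y j)

theorem IsAdj.sub {A : ℕ → ℕ → ℕ} (h : IsAdj A) (Y : ℕ → ℕ) : IsAdj (sub A Y) :=
  ⟨fun _ _ => h.le_one _ _, fun _ _ => h.symm _ _, fun _ => h.irrefl _⟩

theorem codeg_le {B : ℕ → ℕ → ℕ} (hB : IsAdj B) (y u v : ℕ) : codeg B y u v ≤ y := by
  have : codeg B y u v ≤ ∑ _x ∈ Finset.range y, 1 := Finset.sum_le_sum fun x _ =>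
    (Nat.mul_le_mul (hB.le_one _ _) (hB.le_one _ _))
  simpa using this

/-- The state holds the layout of the graph and the subset of the vertices. -/
structure HasPart (s : State) (n S L : ℕ) (st row : ℕ → ℕ) (y : ℕ) (Y : ℕ → ℕ) : Prop where
  layout : HasLayout s n S L st row
  reg_y : s.reg rY = y
  mem_Y : s.mem aY = Y

theorem HasPart.off {c : Cmd} {s s' : State} {n S L y : ℕ} {st row Y : ℕ → ℕ}
    (h : HasPart s n S L st row y Y) (ho : Off c s s') (h0 : c.wr rN = false)
    (h1 : c.wr rS = false) (h2 : c.wr rL = false) (h3 : c.wa aStart = false)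
    (h4 : c.wa aRow = false) (h5 : c.wr rY = false) (h6 : c.wa aY = false) :
    HasPart s' n S L st row y Y :=
  ⟨h.layout.off ho h0 h1 h2 h3 h4, (ho.reg h5).trans h.reg_y, (ho.mem h6).trans h.mem_Y⟩

theorem HasPart.setReg {s : State} {n S L y : ℕ} {st row Y : ℕ → ℕ}
    (h : HasPart s n S L st row y Y) {r v : ℕ} (hr : 2 < r) (hr' : r ≠ rY) :
    HasPart (s.setReg r v) n S L st row y Y :=
  ⟨(hasLayout_setReg hr).2 h.layout, by simp [h.reg_y, hr'.symm], h.mem_Y⟩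

/-- The number of vertices of the subset in the separator. -/
def countSep : Cmd :=
  .set rSp 0 ;; .upto rT rY (.ite (.lt (.rd aY (.var rT)) (.var rS)) (.set rSp (.var rT + 1)) .skip)

/-- The first `sp` of the vertices `Y 0, …, Y (y - 1)` form the separator. -/
def IsSep (S sp y : ℕ) (Y : ℕ → ℕ) : Prop := sp ≤ y ∧ ∀ i < y, (Y i < S ↔ i < sp)

section
variable {p : Prog} {w n S L y : ℕ} {st row Y : ℕ → ℕ} {A : ℕ → ℕ → ℕ} {s : State}
  (hl : Layout n S L st row A) (hbig : 2000 + 20 * n + 2 * (n * n) ≤ word w) (hY : Part n y Y)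
include hl hbig hY

-- The vertices increase and the separator occupies the lowest positions, so its members form an
-- initial segment; the last index found in it, plus one, is their number.
omit hl in
theorem countSep_spec (hs : HasPart s n S L st row y Y) :
    WP p w countSep (40 * (y + 1)) (fun s' => IsSep S (s'.reg rSp) y Y) s := by
  have hw : 1 < word w := by omega
  refine WP.le (WP.straight_seq hw (T := 2) (by decide) ⟨by simp; omega, ?_⟩)
    (show 2 + (y * (20 + 8) + 6) ≤ _ by omega)
  set s1 := s.setReg rSp (Expr.eval s 0) with hs1
  have hp1 : HasPart s1 n S L st row y Y := hs.setReg (by decide) (by decide)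
  refine (WP.for_straight hw (n := y) (fun k s' => s'.reg rSp ≤ k ∧
    ∀ i < k, (Y i < S ↔ i < s'.reg rSp)) 20 (by decide) rfl rfl (by decide) hp1.reg_y
    (by simp [hs1]) ?_).mono hw le_rfl fun s' hf ho h => h.1
  intro k hk s' hf hsT hsn ho ⟨hI1, hI2⟩
  have hp := hp1.off ho rfl rfl rfl rfl rfl rfl rfl
  have hyn := hY.le
  refine ⟨by simp, fun h => ⟨by simp [hsT]; omega, ?_⟩, fun h => ?_⟩
  · simp only [Expr.eval_lt_ne_zero, Expr.eval_rd, Expr.eval_var, hsT, hp.mem_Y,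
      hp.layout.reg_S] at h
    have : ∀ i < k, Y i < S := fun i hi => (hY.mono i k hi hk).trans h
    simp only [Expr.eval_add, Expr.eval_var, Expr.eval_ofNat, hsT, State.reg_setReg]
    simp only [Nat.reduceEqDiff, reduceIte]
    refine ⟨by simp, fun i hi => ?_⟩
    rcases Nat.lt_succ_iff_lt_or_eq.1 hi with h' | rfl
    · simp [this i h']; omega
    · simp [h]
  · simp only [Expr.eval_lt_eq_zero, Expr.eval_rd, Expr.eval_var, hsT, hp.mem_Y,
      hp.layout.reg_S] at h
    simp only [Cmd.vc, State.reg_setReg]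
    simp only [Nat.reduceEqDiff, reduceIte]
    refine ⟨by omega, fun i hi => ?_⟩
    rcases Nat.lt_succ_iff_lt_or_eq.1 hi with h' | rfl
    · simpa using hI2 i h'
    · simp [h]; omega

omit hl hbig in
theorem Part.rd_ok_lt {e : Expr} (hs : HasPart s n S L st row y Y) (he : e.eval s < y) :
    (Expr.rd aY e).eval s < n ∧ (Expr.rd aY e).eval s = Y (e.eval s) := by
  simp [hs.mem_Y, hY.lt _ he]

theorem sub_eval (hs : HasPart s n S L st row y Y) {a b : Expr} (ha : a.eval s < y)
    (hb : b.eval s < y) (hoa : a.Ok w s) (hob : b.Ok w s) :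
    (adjE (.rd aY a) (.rd aY b)).Ok w s ∧
      (adjE (.rd aY a) (.rd aY b)).eval s = sub A Y (a.eval s) (b.eval s) := by
  obtain ⟨h1, h2⟩ := hY.rd_ok_lt hs ha
  obtain ⟨h3, h4⟩ := hY.rd_ok_lt hs hb
  refine ⟨adjE_ok hl hbig hs.layout h1 h3 (by simpa) (by simpa), ?_⟩
  rw [adjE_eval hl hs.layout h1 h3, h2, h4]; rfl

/-- The degrees of the vertices in the separator. -/
def sepDegrees : Cmd :=
  .upto rI rSp (.set rAcc 0 ;;
    .upto rJ rY (.set rAcc (.var rAcc + adjE (.rd aY (.var rI)) (.rd aY (.var rJ)))) ;;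
    .put aDeg (.var rI) (.var rAcc))

theorem sepDegrees_spec {sp : ℕ} (hs : HasPart s n S L st row y Y) (hsp : s.reg rSp = sp)
    (hspy : sp ≤ y) :
    WP p w sepDegrees (100 * (sp * y + sp + 1))
      (fun s' => ∀ i < sp, s'.mem aDeg i = degr (sub A Y) y i) s := by
  have hw : 1 < word w := by omega
  have hyn := hY.le
  have hA := hl.isAdj.sub Y
  refine WP.le (WP.mono hw (WP.for_const hw (n := sp)
    (fun k s' => ∀ i < k, s'.mem aDeg i = degr (sub A Y) y i) (y * (70 + 8) + 30)
    rfl rfl (by decide) hsp (by simp) ?_) le_rfl fun s' _ _ h => h.1) (by nlinarith)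
  intro k hk s1 hf1 hi1 hsp1 ho1 hI1
  have hp1 := hs.off ho1 rfl rfl rfl rfl rfl rfl rfl
  refine WP.le (WP.straight_seq hw (T := 2) (by decide) ⟨by simp; omega, ?_⟩)
    (show 2 + ((y * (70 + 8) + 6) + 10) ≤ _ by omega)
  set s2 := s1.setReg rAcc (Expr.eval s1 0) with hs2
  have hp2 : HasPart s2 n S L st row y Y := hp1.setReg (by decide) (by decide)
  refine (WP.for_straight hw (n := y) (fun j s' => s'.reg rAcc = ∑ x ∈ Finset.range j, sub A Y k x)
    70 (by decide) rfl rfl (by decide) hp2.reg_y (by simp [hs2]) ?_).seq hw ?_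
  · intro j hj s3 hf3 hi3 _ ho3 hI3
    have hp3 := hp2.off ho3 rfl rfl rfl rfl rfl rfl rfl
    have e1 : s3.reg rI = k := (ho3.reg rfl).trans (by simp [hs2, hi1])
    obtain ⟨h1, h2⟩ := sub_eval hl hbig hY hp3 (a := .var rI) (b := .var rJ)
      (by simp [e1]; omega) (by simp [hi3, hj]) trivial trivial
    have h3 : ∑ x ∈ Finset.range (j + 1), sub A Y k x ≤ j + 1 := by
      refine (Finset.sum_le_card_nsmul _ _ 1 fun x _ => hA.le_one _ _).trans ?_
      simp
    rw [Finset.sum_range_succ] at h3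
    refine ⟨⟨trivial, h1, ?_⟩, ?_⟩
    · change s3.reg rAcc + _ < word w
      rw [h2, hI3]; simp only [Expr.eval_var, e1, hi3]; omega
    · rw [Expr.eval_add, h2]
      simp [hI3, e1, hi3, Finset.sum_range_succ]
  · rintro s3 hf3 ho3 ⟨hI3, -⟩
    refine WP.straight_le hw (by decide) ⟨trivial, trivial, ?_⟩
    have e1 : s3.reg rI = k := (ho3.reg rfl).trans (by simp [hs2, hi1])
    have e2 : s3.mem aDeg = s1.mem aDeg := (ho3.mem rfl).trans (by simp [hs2])
    intro i hi
    simp only [Expr.eval_var, e1, State.mem_setReg, State.mem_setMem, reduceIte, hI3, e2]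
    split_ifs with h
    · rw [h]; rfl
    · exact hI1 i (by omega)

end

/-! ### Accumulators modulo 24, and pairs inside separator plus block. -/

/-- The expression for a polynomial of the local data. -/
def Pol.comp : Pol → Expr
  | .c => .var rCd % 24
  | .x => .var rDx % 24
  | .y => .var rDy % 24
  | .n => .var rY % 24
  | .k v => .lit (v % 24)
  | .add p q => (p.comp + q.comp) % 24
  | .mul p q => (p.comp * q.comp) % 24

theorem Pol.comp_spec {w : ℕ} (hw : 1000 ≤ word w) (s : State) : ∀ F : Pol,
    F.comp.Ok w s ∧ F.comp.eval s < 24 ∧ (F.comp.eval s : ZMod 24) =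
      F.ev (s.reg rCd) (s.reg rDx) (s.reg rDy) (s.reg rY)
  | .c => ⟨by simp [comp]; omega, Nat.mod_lt _ (Nat.succ_pos 23), ZMod.natCast_mod _ _⟩
  | .x => ⟨by simp [comp]; omega, Nat.mod_lt _ (Nat.succ_pos 23), ZMod.natCast_mod _ _⟩
  | .y => ⟨by simp [comp]; omega, Nat.mod_lt _ (Nat.succ_pos 23), ZMod.natCast_mod _ _⟩
  | .n => ⟨by simp [comp]; omega, Nat.mod_lt _ (Nat.succ_pos 23), ZMod.natCast_mod _ _⟩
  | .k v => ⟨by simp [comp]; omega, Nat.mod_lt _ (Nat.succ_pos 23), ZMod.natCast_mod _ _⟩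
  | .add p q => by
    obtain ⟨h1, h2, h3⟩ := comp_spec hw s p
    obtain ⟨h4, h5, h6⟩ := comp_spec hw s q
    refine ⟨by simp [comp, h1, h4]; omega, Nat.mod_lt _ (Nat.succ_pos 23), ?_⟩
    rw [comp, Expr.eval_mod, Expr.eval_ofNat, ZMod.natCast_mod, Expr.eval_add, Nat.cast_add, h3,
      h6]
    rfl
  | .mul p q => by
    obtain ⟨h1, h2, h3⟩ := comp_spec hw s p
    obtain ⟨h4, h5, h6⟩ := comp_spec hw s q
    have : p.comp.eval s * q.comp.eval s ≤ 24 * 24 := Nat.mul_le_mul h2.le h5.le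
    refine ⟨by simp [comp, h1, h4]; omega, Nat.mod_lt _ (Nat.succ_pos 23), ?_⟩
    rw [comp, Expr.eval_mod, Expr.eval_ofNat, ZMod.natCast_mod, Expr.eval_mul, Nat.cast_mul, h3,
      h6]
    rfl

/-- The accumulators of the sums over pairs of vertices, modulo `24`. -/
structure Accs (s : State) (v m q : ZMod 24) : Prop where
  val_lt : s.reg rVal < 24
  m_lt : s.reg rM < 24
  q_lt : s.reg rQ < 24
  val : (s.reg rVal : ZMod 24) = v
  m : (s.reg rM : ZMod 24) = m
  q : (s.reg rQ : ZMod 24) = q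

theorem Accs.congr {s s' : State} {v m q v' m' q' : ZMod 24} (h : Accs s v m q)
    (h1 : s'.reg rVal = s.reg rVal) (h2 : s'.reg rM = s.reg rM) (h3 : s'.reg rQ = s.reg rQ)
    (h4 : v = v') (h5 : m = m') (h6 : q = q') : Accs s' v' m' q' := by
  subst h4 h5 h6
  exact ⟨h1 ▸ h.val_lt, h2 ▸ h.m_lt, h3 ▸ h.q_lt, h1 ▸ h.val, h2 ▸ h.m, h3 ▸ h.q⟩

/-- Account for one pair of adjacent vertices. -/
def edgeStep (F : Pol) : Cmd :=
  .set rM ((.var rM + 1) % 24) ;; .set rVal ((.var rVal + F.comp) % 24)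

theorem edgeStep_vc {w : ℕ} (hw : 1000 ≤ word w) {F : Pol} {s : State} {v m q : ZMod 24}
    {Q : State → Prop} (h : Accs s v m q)
    (hQ : ∀ s', (∀ r, r ≠ rM → r ≠ rVal → s'.reg r = s.reg r) → s'.mem = s.mem →
      Accs s' (v + F.ev (s.reg rCd) (s.reg rDx) (s.reg rDy) (s.reg rY)) (m + 1) q → Q s') :
    (edgeStep F).vc w Q s := by
  have h1 := h.m_lt
  have h2 := h.val_lt
  set s1 := s.setReg rM (Expr.eval s ((.var rM + 1) % 24)) with hs1
  have e1 : s1.reg rVal = s.reg rVal := by simp [hs1]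
  obtain ⟨h3, h4, h5⟩ := Pol.comp_spec hw s1 F
  refine ⟨by simp; omega, ?_, ?_⟩
  · rw [← hs1]
    simp [h3]; omega
  · rw [← hs1]
    refine hQ _ (fun r hr hr' => ?_) rfl ⟨?_, ?_, ?_, ?_, ?_, ?_⟩
    · simp [hs1, hr, hr']
    · simpa using Nat.mod_lt _ (by decide)
    · simpa [hs1] using Nat.mod_lt _ (by decide)
    · simpa [hs1] using h.q_lt
    · simp only [Expr.eval_mod, Expr.eval_ofNat, Expr.eval_add, Expr.eval_var, State.reg_setReg,
        reduceIte, ZMod.natCast_mod, Nat.cast_add, h5, e1, h.val]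
      simp [hs1]
    · simp [hs1, h.m]
    · simpa [hs1] using h.q

/-- The degree of a vertex of the current part. -/
def degE (e : Expr) : Expr :=
  -- For a block vertex the degree is the diagonal entry of the squared adjacency matrix; for
  -- separator vertices that entry would count only part of the neighbours, so a table is used.
  .ite (.lt e (.var rSp)) (.rd aDeg e) (.rd aProd (.var rDim * e + e))

/-- Account for one pair of vertices of the current part. -/
def pairBody (F : Pol) : Cmd :=
  .set rI (.var rT / .var rDim) ;; .set rJ (.var rT % .var rDim) ;;
  .ite (.lt (.var rI) (.var rSp) * .lt (.var rJ) (.var rSp)) .skip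
    (.set rCd (.rd aProd (.var rT)) ;;
     .set rQ ((.var rQ + .var rCd % 24 * (.var rCd % 24)) % 24) ;;
     .ite (adjE (.rd aY (phiE (.var rI))) (.rd aY (phiE (.var rJ))))
       (.set rDx (degE (.var rI)) ;; .set rDy (degE (.var rJ)) ;; edgeStep F) .skip)

/-- The contribution of a pair of vertices. -/
noncomputable def edgeVal (F : Pol) (B : ℕ → ℕ → ℕ) (y a b : ℕ) : ZMod 24 :=
  F.ev (codeg B y a b) (degr B y a) (degr B y b) y

theorem offPart_mul {sp a b : ℕ} {f : ℕ → ℕ → ZMod 24} (h : ¬ (a < sp ∧ b < sp)) :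
    offPart sp f a b = f a b := if_neg h

theorem phi_lt_iff {sp β i : ℕ} (h : sp ≤ β) : phi sp β i < sp ↔ i < sp := by
  unfold phi; split_ifs <;> omega

theorem mul_add_self_lt {N i j : ℕ} (hi : i < N) (hj : j < N) : N * i + j < N * N := by
  have h1 : N * (i + 1) ≤ N * N := Nat.mul_le_mul_left _ hi
  rw [Nat.mul_add] at h1; omega

theorem pairBody_cost (F : Pol) : (pairBody F).cost ≤ 200 + F.comp.cost := by
  simp only [pairBody, edgeStep, degE, adjE, phiE, Cmd.cost, Expr.cost_ofNat,
    Expr.cost_var, Expr.cost_rd, Expr.cost_add, Expr.cost_sub, Expr.cost_mul, Expr.cost_div,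
    Expr.cost_mod, Expr.cost_lt, Expr.cost_eq, Expr.cost_ite]
  omega

section
variable {p : Prog} {w n S L y sp β e : ℕ} {st row Y : ℕ → ℕ} {A : ℕ → ℕ → ℕ} {s : State}
  (hl : Layout n S L st row A) (hbig : 2000 + 20 * n + 2 * (n * n) ≤ word w) (hY : Part n y Y)
  (hb : IsBlock (sub A Y) sp β e y)
include hl hbig hY hb

/-- Pairs inside the separator are skipped: the product counts only those of their common neighbours
that lie in the current part. They are treated after all blocks, by `sepBody`. -/
theorem pairBody_vc (F : Pol) (hs : HasPart s n S L st row y Y) (hsp : s.reg rSp = sp)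
    (hβ : s.reg rBeg = β) (hdim : s.reg rDim = sp + (e - β))
    (hdeg : ∀ i < sp, s.mem aDeg i = degr (sub A Y) y i)
    (hprod : ∀ i < sp + (e - β), ∀ j < sp + (e - β), ¬ (i < sp ∧ j < sp) →
      s.mem aProd ((sp + (e - β)) * i + j) = codeg (sub A Y) y (phi sp β i) (phi sp β j))
    {t : ℕ} (ht : t < (sp + (e - β)) * (sp + (e - β))) (hst : s.reg rT = t)
    {v m q : ZMod 24} (ha : Accs s v m q) {Q : State → Prop}
    (hQ : ∀ s', Accs s'
      (v + offPart sp (fun a b => (sub A Y a b : ZMod 24) * edgeVal F (sub A Y) y a b)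
        (phi sp β (t / (sp + (e - β)))) (phi sp β (t % (sp + (e - β)))))
      (m + offPart sp (fun a b => (sub A Y a b : ZMod 24) * 1)
        (phi sp β (t / (sp + (e - β)))) (phi sp β (t % (sp + (e - β)))))
      (q + offPart sp (fun a b => (codeg (sub A Y) y a b : ZMod 24) ^ 2)
        (phi sp β (t / (sp + (e - β)))) (phi sp β (t % (sp + (e - β))))) → Q s') :
    (pairBody F).vc w Q s := by
  have hA := hl.isAdj.sub Y
  have hyn := hY.le
  have hle := hb.le
  have hley := hb.le_y
  have hspβ := hb.sp_le
  set N := sp + (e - β) with hN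
  have hpos : 0 < N := Nat.pos_of_ne_zero (by rintro h; simp [h] at ht)
  have hi : t / N < N := Nat.div_lt_of_lt_mul ht
  have hj : t % N < N := Nat.mod_lt _ hpos
  have htij : N * (t / N) + t % N = t := Nat.div_add_mod t N
  generalize hi0 : t / N = i at *
  generalize hj0 : t % N = j at *
  set s2 := (s.setReg rI i).setReg rJ j with hs2
  have hp2 : HasPart s2 n S L st row y Y :=
    (hs.setReg (by decide) (by decide)).setReg (by decide) (by decide)
  suffices h : (Cmd.ite (.lt (.var rI) (.var rSp) * .lt (.var rJ) (.var rSp)) .skip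
    (.set rCd (.rd aProd (.var rT)) ;;
     .set rQ ((.var rQ + .var rCd % 24 * (.var rCd % 24)) % 24) ;;
     .ite (adjE (.rd aY (phiE (.var rI))) (.rd aY (phiE (.var rJ))))
       (.set rDx (degE (.var rI)) ;; .set rDy (degE (.var rJ)) ;; edgeStep F) .skip)).vc w Q s2 by
    refine ⟨by simp, by simp, ?_⟩
    have : (s.setReg rI (Expr.eval s (.var rT / .var rDim))).setReg rJ (Expr.eval
        (s.setReg rI (Expr.eval s (.var rT / .var rDim))) (.var rT % .var rDim)) = s2 := by
      simp [hs2, hst, hdim, hi0, hj0]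
    rw [this]; exact h
  have g1 : s2.reg rI = i := by simp [hs2]
  have g2 : s2.reg rJ = j := by simp [hs2]
  have g3 : s2.reg rSp = sp := by simp [hs2, hsp]
  have ha2 : Accs s2 v m q := ha.congr (by simp [hs2]) (by simp [hs2]) (by simp [hs2]) rfl rfl rfl
  have hφ : ∀ i < N, phi sp β i < y := by intro i hi; unfold phi; split_ifs <;> omega
  refine ⟨?_, fun hboth => ?_, fun hboth => ?_⟩
  · simp [g1, g2, g3]; split_ifs <;> omega
  · refine hQ _ (ha2.congr rfl rfl rfl ?_ ?_ ?_) <;>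
    · have : i < sp ∧ j < sp := by
        simp [g1, g2, g3] at hboth; omega
      rw [offPart, if_pos (by rwa [phi_lt_iff hspβ, phi_lt_iff hspβ]), add_zero]
  have hnb : ¬ (i < sp ∧ j < sp) := by
    rintro ⟨h1, h2⟩; simp [g1, g2, g3, h1, h2] at hboth
  have hnb' : ¬ (phi sp β i < sp ∧ phi sp β j < sp) := by
    rwa [phi_lt_iff hspβ, phi_lt_iff hspβ]
  rw [offPart_mul hnb', offPart_mul hnb', offPart_mul hnb'] at hQ
  have hcd : s2.mem aProd (s2.reg rT) = codeg (sub A Y) y (phi sp β i) (phi sp β j) := by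
    rw [← hprod i hi j hj hnb, htij]; simp [hs2, hst]
  set C := codeg (sub A Y) y (phi sp β i) (phi sp β j) with hC
  have hC24 : C % 24 * (C % 24) ≤ 23 * 23 := Nat.mul_le_mul (by omega) (by omega)
  set q' := (s.reg rQ + C % 24 * (C % 24)) % 24 with hq'
  set s3 := (s2.setReg rCd C).setReg rQ q' with hs3
  have ha3 : Accs s3 v m (q + (C : ZMod 24) ^ 2) := by
    refine ⟨by simpa [hs3] using ha2.val_lt, by simpa [hs3] using ha2.m_lt, ?_,
      by simpa [hs3] using ha2.val, by simpa [hs3] using ha2.m, ?_⟩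
    · simpa [hs3, hq'] using Nat.mod_lt _ (by decide)
    · simp only [hs3, State.reg_setReg, reduceIte, hq', ZMod.natCast_mod, Nat.cast_add,
        Nat.cast_mul, ha.q]
      ring
  have hp3 : HasPart s3 n S L st row y Y :=
    (hp2.setReg (by decide) (by decide)).setReg (by decide) (by decide)
  have g5 : s3.reg rI = i := by simp [hs3, g1]
  have g6 : s3.reg rJ = j := by simp [hs3, g2]
  have g7 : s3.reg rSp = sp := by simp [hs3, g3]
  have g8 : s3.reg rBeg = β := by simp [hs3, hs2, hβ]
  have ha0 := ha.q_lt
  have hev : ∀ r, s3.reg r < N → (phiE (.var r)).eval s3 < y ∧ (phiE (.var r)).Ok w s3 ∧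
      (phiE (.var r)).eval s3 = phi sp β (s3.reg r) := by
    intro r hr
    have := hφ _ hr
    refine ⟨by simpa [g7, g8] using this, ?_, by simp [g7, g8]⟩
    simp only [phiE, Expr.ok_ite, Expr.ok_lt, Expr.ok_var, Expr.ok_add, Expr.ok_sub, and_self,
      true_and, Expr.eval_lt_eq_zero, Expr.eval_sub, Expr.eval_var, g7, g8, implies_true]
    intro h
    rw [phi, if_neg h] at this; omega
  obtain ⟨u1, u2, u3⟩ := hev rI (by rwa [g5])
  obtain ⟨u4, u5, u6⟩ := hev rJ (by rwa [g6])
  obtain ⟨u7, u8⟩ := sub_eval hl hbig hY hp3 u1 u4 u2 u5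
  rw [u3, u6, g5, g6] at u8
  suffices h : (Cmd.ite (adjE (.rd aY (phiE (.var rI))) (.rd aY (phiE (.var rJ))))
       (.set rDx (degE (.var rI)) ;; .set rDy (degE (.var rJ)) ;; edgeStep F) .skip).vc w Q s3 by
    refine ⟨trivial, ?_, ?_⟩
    · have hcd' : s.mem aProd (s.reg rT) = C := by simpa [hs2] using hcd
      simp [hcd', hs2]; omega
    · have : (s2.setReg rCd (Expr.eval s2 (.rd aProd (.var rT)))).setReg rQ (Expr.eval
          (s2.setReg rCd (Expr.eval s2 (.rd aProd (.var rT))))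
          ((.var rQ + .var rCd % 24 * (.var rCd % 24)) % 24)) = s3 := by
        rw [Expr.eval_rd, Expr.eval_var, hcd]
        simp [hs3, hs2, hq']
      rw [this]; exact h
  refine ⟨u7, fun h => ?_, fun h => ?_⟩
  · have hadj : sub A Y (phi sp β i) (phi sp β j) = 1 := by
      rw [u8] at h; have := hA.le_one (phi sp β i) (phi sp β j); omega
    have hNN : N * N ≤ n * n := Nat.mul_le_mul (by omega) (by omega)
    have hdegE : ∀ (s' : State) (r : ℕ), s'.reg r < N → s'.reg rSp = sp → s'.reg rDim = N →
        s'.mem = s.mem → (degE (.var r)).Ok w s' ∧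
        (degE (.var r)).eval s' = degr (sub A Y) y (phi sp β (s'.reg r)) := by
      intro s' r hr h1 h2 h3
      constructor
      · have h5 : N * s'.reg r + s'.reg r < N * N := mul_add_self_lt hr hr
        simp [degE, h1, h2]; omega
      · by_cases hc : s'.reg r < sp
        · simp [degE, h1, hc, h3, hdeg, phi]
        · have := hprod _ hr _ hr (by omega)
          rw [hA.codeg_self] at this
          simp [degE, h1, hc, h3, h2, this]
    obtain ⟨d1, d2⟩ := hdegE s3 rI (by rwa [g5]) g7 (by simp [hs3, hs2, hdim]) rfl
    set s4 := s3.setReg rDx ((degE (.var rI)).eval s3) with hs4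
    obtain ⟨d3, d4⟩ := hdegE s4 rJ (by simp [hs4, g6, hj]) (by simp [hs4, g7])
      (by simp [hs4, hs3, hs2, hdim]) rfl
    refine ⟨d1, d3, edgeStep_vc (by omega) (ha3.congr ?_ ?_ ?_ rfl rfl rfl) fun s5 _ _ h5 =>
      hQ _ ?_⟩
    · simp
    · simp
    · simp
    · convert h5 using 2
      · rw [hadj, Nat.cast_one, one_mul, edgeVal]
        have e1 : s4.reg rCd = C := by simp [hs4, hs3]
        have e2 : s4.reg rY = y := by simp [hs4, hs3, hs2, hs.reg_y]
        have e3 : s4.reg rJ = j := by simp [hs4, g6]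
        have e4 : s4.reg rDx = degr (sub A Y) y (phi sp β i) := by simp [hs4, d2, g5]
        rw [← hs4, d4, e3]
        simp [e1, e2, e4, hC]
      · simp [hadj]
  · have hadj : sub A Y (phi sp β i) (phi sp β j) = 0 := by rw [← u8]; exact h
    refine hQ _ (ha3.congr rfl rfl rfl ?_ ?_ rfl) <;> simp [hadj]

end

/-- Account for all pairs of vertices of the current part. -/
def pairLoop (F : Pol) : Cmd := .upto rT rSq (pairBody F)

/-! ### Pairs across blocks, and the step for one block. -/

/-- Account for pairs of vertices of the earlier parts and the current part. -/
def crossBody : Cmd :=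
  .set rI (.var rT / .var rSp) ;; .set rJ (.var rT % .var rSp) ;;
  -- For two separator vertices the product counts common neighbours in separator plus block;
  -- subtracting those in the separator leaves the ones in the block.
  .set rCd (.rd aProd (.var rDim * .var rI + .var rJ) - .rd aBase (.var rT)) ;;
  .set rQ ((.var rQ + 2 * (.var rCd % 24 * (.rd aAcc (.var rT) % 24))) % 24) ;;
  -- The table is updated only after its old value, belonging to the earlier blocks, has been used.
  .put aAcc (.var rT) (.rd aAcc (.var rT) + .var rCd)

def crossLoop : Cmd := .set rSq (.var rSp * .var rSp) ;; .upto rT rSq crossBody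

/-- Account for the part between `rBeg` and `rEnd`. -/
def partStep (F : Pol) : Cmd :=
  .set rDim (.var rSp + (.var rEnd - .var rBeg)) ;; buildMat ;; .mul rDim ;; pairLoop F ;;
    crossLoop ;; .set rBeg (.var rEnd)

/-- The state after the parts below `β` have been accounted for. -/
structure Upto (F : Pol) (B : ℕ → ℕ → ℕ) (sp y β : ℕ) (s : State) : Prop where
  reg_sp : s.reg rSp = sp
  reg_beg : s.reg rBeg = β
  deg : ∀ i < sp, s.mem aDeg i = degr B y i
  base : ∀ t < sp * sp, s.mem aBase t = codeg B sp (t / sp) (t % sp)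
  acc : ∀ t < sp * sp, s.mem aAcc t = codegIn B sp β (t / sp) (t % sp)
  accs : Accs s (offSum sp β fun a b => (B a b : ZMod 24) * edgeVal F B y a b)
    (offSum sp β fun a b => (B a b : ZMod 24) * 1)
    (offSum sp β fun a b => (codeg B y a b : ZMod 24) ^ 2)

theorem codegIn_le {B : ℕ → ℕ → ℕ} (hB : IsAdj B) (β e u v : ℕ) : codegIn B β e u v ≤ e := by
  have : codegIn B β e u v ≤ ∑ _x ∈ Ico β e, 1 := sum_le_sum fun x _ =>
    (Nat.mul_le_mul (hB.le_one _ _) (hB.le_one _ _))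
  simp at this; omega

section
variable {p : Prog} {w n S L y sp β e : ℕ} {st row Y : ℕ → ℕ} {A : ℕ → ℕ → ℕ} {s : State}
  (hl : Layout n S L st row A) (hbig : 2000 + 20 * n + 2 * (n * n) ≤ word w) (hY : Part n y Y)
  (hb : IsBlock (sub A Y) sp β e y)
include hl hbig hY hb

theorem pairLoop_spec (F : Pol) (hs : HasPart s n S L st row y Y) (hsp : s.reg rSp = sp)
    (hβ : s.reg rBeg = β) (hdim : s.reg rDim = sp + (e - β))
    (hsq : s.reg rSq = (sp + (e - β)) * (sp + (e - β)))
    (hdeg : ∀ i < sp, s.mem aDeg i = degr (sub A Y) y i)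
    (hprod : ∀ i < sp + (e - β), ∀ j < sp + (e - β), ¬ (i < sp ∧ j < sp) →
      s.mem aProd ((sp + (e - β)) * i + j) = codeg (sub A Y) y (phi sp β i) (phi sp β j))
    {v m q : ZMod 24} (ha : Accs s v m q) :
    WP p w (pairLoop F) ((sp + (e - β)) * (sp + (e - β)) * (200 + F.comp.cost + 8) + 6)
      (fun s' => Accs s'
      (v + ∑ i ∈ range (sp + (e - β)), ∑ j ∈ range (sp + (e - β)),
        offPart sp (fun a b => (sub A Y a b : ZMod 24) * edgeVal F (sub A Y) y a b)
        (phi sp β i) (phi sp β j))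
      (m + ∑ i ∈ range (sp + (e - β)), ∑ j ∈ range (sp + (e - β)),
        offPart sp (fun a b => (sub A Y a b : ZMod 24) * 1) (phi sp β i) (phi sp β j))
      (q + ∑ i ∈ range (sp + (e - β)), ∑ j ∈ range (sp + (e - β)),
        offPart sp (fun a b => (codeg (sub A Y) y a b : ZMod 24) ^ 2)
        (phi sp β i) (phi sp β j))) s := by
  have hw : 1 < word w := by omega
  simp only [← sum_range_mul_div_mod]
  set N := sp + (e - β) with hN
  refine WP.mono hw (WP.for_straight hw (n := N * N) (fun k s' => Accs s'
    (v + ∑ t ∈ range k,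
        offPart sp (fun a b => (sub A Y a b : ZMod 24) * edgeVal F (sub A Y) y a b)
        (phi sp β (t / N)) (phi sp β (t % N)))
      (m + ∑ t ∈ range k,
        offPart sp (fun a b => (sub A Y a b : ZMod 24) * 1) (phi sp β (t / N)) (phi sp β (t % N)))
      (q + ∑ t ∈ range k,
        offPart sp (fun a b => (codeg (sub A Y) y a b : ZMod 24) ^ 2)
        (phi sp β (t / N)) (phi sp β (t % N)))) (200 + F.comp.cost) (pairBody_cost F) rfl rfl
    (by decide) hsq ?_ ?_) le_rfl fun s' _ _ h => h.1
  · exact ha.congr (by simp) (by simp) (by simp) (by simp) (by simp) (by simp)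
  · intro k hk s' hf hT _ ho hI
    refine pairBody_vc hl hbig hY hb F (hs.off ho rfl rfl rfl rfl rfl rfl rfl)
      ((ho.reg rfl).trans hsp) ((ho.reg rfl).trans hβ) ((ho.reg rfl).trans hdim) ?_ ?_ hk hT hI ?_
    · intro i hi; rw [ho.mem rfl]; exact hdeg i hi
    · intro i hi j hj hij; rw [ho.mem rfl]; exact hprod i hi j hj hij
    · intro s'' h
      refine h.congr (by simp) (by simp) (by simp) ?_ ?_ ?_ <;>
      · rw [sum_range_succ]; ring

theorem crossLoop_spec (hsp : s.reg rSp = sp) (hdim : s.reg rDim = sp + (e - β))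
    (hprod : ∀ i < sp, ∀ j < sp, s.mem aProd ((sp + (e - β)) * i + j) =
      codeg (sub A Y) sp i j + codegIn (sub A Y) β e i j)
    (hbase : ∀ t < sp * sp, s.mem aBase t = codeg (sub A Y) sp (t / sp) (t % sp))
    (hacc : ∀ t < sp * sp, s.mem aAcc t = codegIn (sub A Y) sp β (t / sp) (t % sp))
    {v m q : ZMod 24} (ha : Accs s v m q) :
    WP p w crossLoop (10 + (sp * sp * (60 + 8) + 6)) (fun s' => Accs s' v m
      (q + ∑ i ∈ range sp, ∑ j ∈ range sp,
        2 * ((codegIn (sub A Y) β e i j : ZMod 24) * codegIn (sub A Y) sp β i j)) ∧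
      ∀ t < sp * sp, s'.mem aAcc t = codegIn (sub A Y) sp e (t / sp) (t % sp)) s := by
  have hw : 1 < word w := by omega
  have hyn := hY.le
  have hle := hb.le
  have hley := hb.le_y
  have hspβ := hb.sp_le
  have hsq : sp * sp ≤ n * n := Nat.mul_le_mul (by omega) (by omega)
  simp only [← sum_range_mul_div_mod]
  refine WP.straight_seq hw (by decide) ⟨by simp [hsp]; omega, ?_⟩
  refine WP.mono hw (WP.for_straight hw (n := sp * sp) (fun k s' => Accs s' v m
      (q + ∑ t ∈ range k, 2 * ((codegIn (sub A Y) β e (t / sp) (t % sp) : ZMod 24) *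
        codegIn (sub A Y) sp β (t / sp) (t % sp))) ∧
      (∀ t < sp * sp, k ≤ t → s'.mem aAcc t = codegIn (sub A Y) sp β (t / sp) (t % sp)) ∧
      ∀ t < k, s'.mem aAcc t = codegIn (sub A Y) sp e (t / sp) (t % sp)) 60 (by decide) rfl rfl
    (by decide) (by simp [hsp]) ?_ ?_) le_rfl fun s' _ _ h => ⟨h.1.1, h.1.2.2⟩
  · refine ⟨ha.congr ?_ ?_ ?_ rfl rfl ?_, ?_, by simp⟩
    · simp
    · simp
    · simp
    · simp
    · intro t ht _; simpa using hacc t ht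
  · intro k hk s' hf hT _ ho ⟨hI1, hI2, hI3⟩
    have e1 : s'.reg rSp = sp := (ho.reg rfl).trans (by simp [hsp])
    have e2 : s'.reg rDim = sp + (e - β) := (ho.reg rfl).trans (by simp [hdim])
    have e3 : s'.mem aProd = s.mem aProd := (ho.mem rfl).trans (by simp)
    have e4 : s'.mem aBase = s.mem aBase := (ho.mem rfl).trans (by simp)
    have hpos : 0 < sp := Nat.pos_of_ne_zero (by rintro h; simp [h] at hk)
    have hi : k / sp < sp := Nat.div_lt_of_lt_mul hk
    have hj : k % sp < sp := Nat.mod_lt _ hpos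
    have h1 := hprod _ hi _ hj
    have h2 := hbase k hk
    have h3 := hI2 k hk le_rfl
    have h4 : (sp + (e - β)) * (k / sp) + k % sp < (sp + (e - β)) * (sp + (e - β)) :=
      mul_add_self_lt (by omega) (by omega)
    have h5 : (sp + (e - β)) * (sp + (e - β)) ≤ n * n := Nat.mul_le_mul (by omega) (by omega)
    have h6 := codegIn_add (B := sub A Y) hb.sp_le hb.le (k / sp) (k % sp)
    have h7 := codegIn_le (hl.isAdj.sub Y) sp e (k / sp) (k % sp)
    generalize hki : k / sp = i at *
    generalize hkj : k % sp = j at *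
    generalize hc : codegIn (sub A Y) β e i j = c at *
    generalize ha : codegIn (sub A Y) sp β i j = a at *
    have hca : c % 24 * (a % 24) ≤ 23 * 23 := Nat.mul_le_mul (by omega) (by omega)
    have hq := hI1.q_lt
    refine ⟨by simp, by simp, ?_, ?_, by simp, ?_, ?_⟩
    · simp [e1, e2, hT, hki, hkj]; omega
    · simp [e1, e2, e3, e4, hT, hki, hkj, h1, h2, h3]; omega
    · simp [e1, e2, e3, e4, hT, hki, hkj, h1, h2, h3]; omega
    · simp only [Expr.eval_var, Expr.eval_div, Expr.eval_mod, Expr.eval_sub, Expr.eval_rd,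
        Expr.eval_add, Expr.eval_mul, Expr.eval_ofNat, State.reg_setReg, State.mem_setReg,
        Nat.reduceEqDiff, reduceIte, e1, e2, e3, e4, hT, hki, hkj, h1, h2, h3]
      refine ⟨⟨?_, ?_, ?_, ?_, ?_, ?_⟩, fun t ht hkt => ?_, fun t ht => ?_⟩
      · simpa using hI1.val_lt
      · simpa using hI1.m_lt
      · simpa using Nat.mod_lt _ (by decide)
      · simpa using hI1.val
      · simpa using hI1.m
      · rw [sum_range_succ, ← add_assoc, ← hI1.q]
        simp [hki, hkj, hc, ha]
      · simp [show t ≠ k by omega, hI2 t ht (by omega)]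
      · by_cases htk : t = k
        · simp [htk, hki, hkj]; omega
        · simp [htk, hI3 t (by omega)]

theorem partStep_spec (F : Pol) {Λ : ℕ} (hpos : 0 < sp + (e - β)) (hΛ : sp + (e - β) ≤ Λ)
    (hmul : MulSpec p w (sp + (e - β)) (Λ * (sp + (e - β))))
    (hs : HasPart s n S L st row y Y) (hu : Upto F (sub A Y) sp y β s) (he : s.reg rEnd = e) :
    WP p w (partStep F) ((1000 + F.comp.cost) * (Λ * (sp + (e - β))))
      (Upto F (sub A Y) sp y e) s := by
  have hw : 1 < word w := by omega
  have hyn := hY.le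
  have hle := hb.le
  have hley := hb.le_y
  have hspβ := hb.sp_le
  have hA := hl.isAdj.sub Y
  set N := sp + (e - β) with hN
  -- All loops over pairs cost O(N²), which `Λ * N`, the cost of the multiplication, dominates.
  have hNN : N * N ≤ Λ * N := Nat.mul_le_mul_right _ hΛ
  have hspsp : sp * sp ≤ N * N := Nat.mul_le_mul (by omega) (by omega)
  have h1N : 1 ≤ N * N := Nat.mul_pos hpos hpos
  have hφ : ∀ i < N, phi sp β i < y := by intro i hi; unfold phi; split_ifs <;> omega
  refine WP.le (WP.straight_seq hw (T := 10) (by decide) ⟨?_, ?_⟩) (T := 10 +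
    (300 * (N * N + 1) + (Λ * N + 1 + ((N * N * (200 + F.comp.cost + 8) + 6) +
      ((10 + (sp * sp * (60 + 8) + 6)) + 10))))) ?_
  · simp [hu.reg_sp, he, hu.reg_beg]; omega
  swap
  · nlinarith [Nat.mul_le_mul_left F.comp.cost hNN]
  set s1 := s.setReg rDim (Expr.eval s (.var rSp + (.var rEnd - .var rBeg))) with hs1
  have hp1 : HasPart s1 n S L st row y Y := hs.setReg (by decide) (by decide)
  have d1 : s1.reg rDim = N := by simp [hs1, hu.reg_sp, he, hu.reg_beg, hN]
  have hY1 : ∀ i < N, s1.mem aY (phi sp β i) < n := fun i hi => by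
    rw [hp1.mem_Y]; exact hY.lt _ (hφ i hi)
  refine (buildMat_spec hl hbig hp1.layout d1 (sp := sp) (β := β) (by simp [hs1, hu.reg_sp])
    (by simp [hs1, hu.reg_beg]) (by omega) (fun i hi => (hφ i hi).trans_le hyn) hY1).seq hw ?_
  rintro s2 hf2 ho2 ⟨hsq2, hm2⟩
  have hp2 := hp1.off ho2 rfl rfl rfl rfl rfl rfl rfl
  rw [hp1.mem_Y] at hm2
  have d2 : s2.reg rDim = N := (ho2.reg rfl).trans d1
  refine (WP.mul (Q := fun s' => s'.reg = s2.reg ∧ (∀ a < 100, s'.mem a = s2.mem a) ∧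
      ∀ i < N, ∀ j < N, s'.mem aProd (N * i + j) = ∑ l ∈ range N,
        sub A Y (phi sp β i) (phi sp β l) * sub A Y (phi sp β l) (phi sp β j)) hmul hw d2
    (fun i j => sub A Y (phi sp β i) (phi sp β j)) (fun i j => sub A Y (phi sp β i) (phi sp β j))
    (fun _ _ => hA.le_one _ _) (fun _ _ => hA.le_one _ _) (fun t ht => (hm2 t ht).1)
    (fun t ht => (hm2 t ht).2) fun s' h1 h2 h3 => ⟨h1, h2, h3⟩).seq hw ?_
  rintro s3 hf3 ho3 ⟨hr3, hm3, hprod3⟩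
  have hp3 := hp2.off ho3 rfl rfl rfl rfl rfl rfl rfl
  have d3 : s3.reg rDim = N := by rw [hr3, d2]
  have q3 : s3.reg rSq = N * N := by rw [hr3, hsq2]
  have t3 : s3.reg rSp = sp := by rw [hr3, ho2.reg rfl]; simp [hs1, hu.reg_sp]
  have b3 : s3.reg rBeg = β := by rw [hr3, ho2.reg rfl]; simp [hs1, hu.reg_beg]
  have en3 : s3.reg rEnd = e := by rw [hr3, ho2.reg rfl]; simp [hs1, he]
  have dg3 : s3.mem aDeg = s.mem aDeg := by rw [hm3 _ (by decide), ho2.mem rfl]; simp [hs1]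
  have ba3 : s3.mem aBase = s.mem aBase := by rw [hm3 _ (by decide), ho2.mem rfl]; simp [hs1]
  have ac3 : s3.mem aAcc = s.mem aAcc := by rw [hm3 _ (by decide), ho2.mem rfl]; simp [hs1]
  have ha3 := hu.accs.congr (s' := s3) (by rw [hr3, ho2.reg rfl]; simp [hs1])
    (by rw [hr3, ho2.reg rfl]; simp [hs1]) (by rw [hr3, ho2.reg rfl]; simp [hs1]) rfl rfl rfl
  refine (pairLoop_spec hl hbig hY hb F hp3 t3 b3 d3 q3 (fun i hi => by rw [dg3]; exact hu.deg i hi)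
    (fun i hi j hj hij => by rw [hprod3 i hi j hj, hb.sum_prod hi hj hij]) ha3).seq hw ?_
  rintro s4 hf4 ho4 ha4
  refine (crossLoop_spec hl hbig hY hb (e := e) (β := β) ((ho4.reg rfl).trans t3) ((ho4.reg rfl).trans d3)
    (fun i hi j hj => ?_) (fun t ht => ?_) (fun t ht => ?_) ha4).seq hw ?_
  · rw [ho4.mem rfl, hprod3 i (by omega) j (by omega),
      sum_range_phi (f := fun l => sub A Y (phi sp β i) l * sub A Y l (phi sp β j)), phi, phi,
      if_pos hi, if_pos hj]
    rfl
  · rw [ho4.mem rfl, ba3]; exact hu.base t ht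
  · rw [ho4.mem rfl, ac3]; exact hu.acc t ht
  · rintro s5 hf5 ho5 ⟨ha5, hacc5⟩
    refine WP.straight_le hw (by decide) ⟨trivial, ?_⟩
    refine ⟨?_, ?_, fun i hi => ?_, fun t ht => ?_, fun t ht => ?_, ?_⟩
    · simp [ho5.reg, ho4.reg, Cmd.wr, pairLoop, crossLoop, pairBody, edgeStep, Cmd.upto, crossBody, t3]
    · simp [ho5.reg, ho4.reg, Cmd.wr, pairLoop, crossLoop, pairBody, edgeStep, Cmd.upto, crossBody, en3]
    · rw [State.mem_setReg, ho5.mem rfl, ho4.mem rfl, dg3]; exact hu.deg i hi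
    · rw [State.mem_setReg, ho5.mem rfl, ho4.mem rfl, ba3]; exact hu.base t ht
    · exact hacc5 t ht
    · refine ha5.congr (by simp) (by simp) (by simp) (hb.offSum_mul _).symm
        (hb.offSum_mul _).symm hb.offSum_codeg_sq.symm

end

/-! ### Data of the separator alone. -/

/-- Prepare the count: degrees and common neighbours in the separator. -/
def initCount : Cmd :=
  countSep ;; sepDegrees ;;
  (.set rVal 0 ;; .set rM 0 ;; .set rQ 0 ;; .set rBeg (.var rSp) ;; .set rDim (.var rSp)) ;;
  -- The multiplication program is specified for positive dimension only.
  .ite (.var rSp) (buildMat ;; .mul rDim) .skip ;;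
  .set rSq (.var rSp * .var rSp) ;;
  .upto rT rSq (.put aBase (.var rT) (.rd aProd (.var rT)) ;; .put aAcc (.var rT) 0)

theorem sep_le {S sp y n : ℕ} {Y : ℕ → ℕ} (hY : Part n y Y) (h : IsSep S sp y Y) : sp ≤ S := by
  rcases Nat.eq_zero_or_pos sp with rfl | hpos
  · omega
  have h1 := hY.le_apply (i := 0) (j := sp - 1) (by omega) (by have := h.1; omega)
  have h2 := (h.2 (sp - 1) (by have := h.1; omega)).2 (by omega)
  omega

section
variable {p : Prog} {w n S L y sp β e Λ : ℕ} {st row Y : ℕ → ℕ} {A : ℕ → ℕ → ℕ} {s : State}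
  (hl : Layout n S L st row A) (hbig : 2000 + 20 * n + 2 * (n * n) ≤ word w) (hY : Part n y Y)
  (hmul : ∀ N, 0 < N → N ≤ 2 * L → N ≤ n → MulSpec p w N (Λ * N)) (hΛ : 2 * L ≤ Λ)

-- With the empty block from sp to sp the current part is the separator itself, so the code for
-- blocks also yields the codegrees inside the separator that are subtracted later.
include hl hbig hY hmul hΛ in
theorem initCount_spec (F : Pol) (hs : HasPart s n S L st row y Y) :
    WP p w initCount (2000 * (y * Λ + y + 1)) (fun s' => ∃ sp, IsSep S sp y Y ∧
      Upto F (sub A Y) sp y sp s') s := by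
  have hw : 1 < word w := by omega
  have hyn := hY.le
  have hA := hl.isAdj.sub Y
  refine WP.of_fits fun hf => ?_
  have hsple : ∀ sp, IsSep S sp y Y → sp ≤ y ∧ sp ≤ L := fun sp h =>
    ⟨h.1, (sep_le hY h).trans hl.S_le_L⟩
  suffices key : ∀ s1, s1.Fits w → Off countSep s s1 → IsSep S (s1.reg rSp) y Y →
      WP p w (sepDegrees ;; (.set rVal 0 ;; .set rM 0 ;; .set rQ 0 ;; .set rBeg (.var rSp) ;;
        .set rDim (.var rSp)) ;; .ite (.var rSp) (buildMat ;; .mul rDim) .skip ;;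
        .set rSq (.var rSp * .var rSp) ;;
        .upto rT rSq (.put aBase (.var rT) (.rd aProd (.var rT)) ;; .put aAcc (.var rT) 0))
        (1900 * (y * Λ + y + 1))
        (fun s' => ∃ sp, IsSep S sp y Y ∧ Upto F (sub A Y) sp y sp s') s1 by
    exact ((countSep_spec hbig hY hs).seq hw key).le (by nlinarith [Nat.zero_le (y * Λ)])
  intro s1 hf1 ho1 hsep
  obtain ⟨hspy, hspL⟩ := hsple _ hsep
  generalize hsp : s1.reg rSp = sp at *
  have hp1 := hs.off ho1 rfl rfl rfl rfl rfl rfl rfl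
  have hspsp : sp * sp ≤ n * n := Nat.mul_le_mul (by omega) (by omega)
  have hspΛ : sp * sp ≤ y * Λ := Nat.mul_le_mul (by omega) (by omega)
  have hspy' : sp * y ≤ y * Λ := by rw [mul_comm]; exact Nat.mul_le_mul_left _ (by omega)
  have hspΛ' : Λ * sp ≤ y * Λ := by rw [mul_comm]; exact Nat.mul_le_mul_right _ hspy
  refine WP.le ((sepDegrees_spec hl hbig hY hp1 hsp hspy).seq hw (T₂ := 20 + ((3 +
    (300 * (sp * sp + 1) + (Λ * sp + 1))) + (10 + (sp * sp * (20 + 8) + 6)))) ?_) (by nlinarith)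
  intro s2 hf2 ho2 hdeg
  have hp2 := hp1.off ho2 rfl rfl rfl rfl rfl rfl rfl
  have e2 : s2.reg rSp = sp := (ho2.reg rfl).trans hsp
  refine WP.straight_seq hw (by decide) ?_
  simp only [Cmd.vc, Expr.ok_ofNat, Expr.ok_var, Expr.eval_ofNat, Expr.eval_var, State.reg_setReg,
    Nat.reduceEqDiff, reduceIte, e2, true_and]
  refine ⟨by omega, by omega, by omega, ?_⟩
  set s3 := ((((s2.setReg rVal 0).setReg rM 0).setReg rQ 0).setReg rBeg sp).setReg rDim sp with hs3
  have hp3 : HasPart s3 n S L st row y Y :=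
    ((((hp2.setReg (by decide) (by decide)).setReg (by decide) (by decide)).setReg (by decide)
      (by decide)).setReg (by decide) (by decide)).setReg (by decide) (by decide)
  have a3 : s3.reg rSp = sp := by simp [hs3, e2]
  have b3 : s3.reg rDim = sp := by simp [hs3]
  have c3 : s3.reg rBeg = sp := by simp [hs3]
  have hφ : ∀ i < sp, phi sp sp i = i := fun i hi => if_pos hi
  refine WP.seq hw (R := fun s' => ∀ t < sp * sp, s'.mem aProd t =
      codeg (sub A Y) sp (t / sp) (t % sp)) (WP.le (WP.ite (T := 300 * (sp * sp + 1) + (Λ * sp + 1)) hw trivial (fun h => ?_) fun h => ?_)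
    (by simp only [Expr.cost_var]; omega)) ?_
  · have hpos : 0 < sp := by
      rw [Expr.eval_var, a3] at h; omega
    refine (buildMat_spec hl hbig hp3.layout b3 (sp := sp) (β := sp) a3 c3 (by omega)
      (fun i hi => by rw [hφ i hi]; omega) (fun i hi => by
        rw [hφ i hi, hp3.mem_Y]; exact hY.lt _ (by omega))).seq hw ?_
    rintro s4 hf4 ho4 ⟨-, hm4⟩
    rw [hp3.mem_Y] at hm4
    have key : ∀ t < sp * sp, A (Y (phi sp sp (t / sp))) (Y (phi sp sp (t % sp))) =
        sub A Y (t / sp) (t % sp) := fun t ht => by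
      rw [hφ _ (Nat.div_lt_of_lt_mul ht), hφ _ (Nat.mod_lt _ hpos)]; rfl
    refine WP.mul (hmul sp hpos (by omega) (by omega)) hw ((ho4.reg rfl).trans b3) (sub A Y)
      (sub A Y) (fun _ _ => hA.le_one _ _) (fun _ _ => hA.le_one _ _)
      (fun t ht => by rw [(hm4 t ht).1, key t ht]) (fun t ht => by rw [(hm4 t ht).2, key t ht])
      fun s' _ _ h3 t ht => ?_
    have := h3 _ (Nat.div_lt_of_lt_mul ht) _ (Nat.mod_lt t hpos)
    rwa [Nat.div_add_mod] at this
  · have : sp = 0 := by rw [Expr.eval_var, a3] at h; omega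
    exact (WP.skip (by simp [this])).le (by omega)
  intro s4 hf4 ho4 hprod
  have a4 : s4.reg rSp = sp := (ho4.reg rfl).trans a3
  refine WP.straight_seq hw (by decide) ⟨by simp [a4]; omega, ?_⟩
  refine WP.mono hw (WP.for_straight hw (n := sp * sp) (fun k s' => ∀ t < k, s'.mem aBase t =
      codeg (sub A Y) sp (t / sp) (t % sp) ∧ s'.mem aAcc t = 0) 20 (by decide) rfl rfl
      (by decide) (by simp [a4]) (by simp) ?_) le_rfl ?_
  · intro k hk s' _ hT _ ho hI
    refine ⟨trivial, trivial, trivial, by simp; omega, fun t ht => ?_⟩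
    have e : s'.mem aProd k = codeg (sub A Y) sp (k / sp) (k % sp) := by
      rw [ho.mem rfl, State.mem_setReg, hprod k hk]
    by_cases htk : t = k
    · simp [hT, htk, e]
    · simpa [hT, htk] using hI t (by omega)
  · rintro s5 hf5 ho5 ⟨hI, -⟩
    have r5 : ∀ r, r ≠ rSq → r ≠ rT → r ≠ rDim → r ≠ rAcc → s5.reg r = s3.reg r := by
      intro r h1 h2 h3 h4
      rw [ho5.reg, State.reg_setReg, if_neg h1, ho4.reg] <;>
        simp [Cmd.wr, Cmd.upto, buildMat, h1, h2]
    have m5 : ∀ a, a ≠ aBase → a ≠ aAcc → a < 100 → s5.mem a = s2.mem a := by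
      intro a h1 h2 h3
      rw [ho5.mem, State.mem_setReg, ho4.mem] <;>
        simp [Cmd.wa, Cmd.upto, buildMat, h1, h2, hs3]
      exact ⟨⟨by omega, by omega⟩, by rw [← Bool.not_eq_true, Nat.ble_eq]; omega⟩
    refine ⟨sp, hsep, ?_, ?_, fun i hi => ?_, fun t ht => (hI t ht).1, fun t ht => ?_, ?_⟩
    · rw [r5 _ (by decide) (by decide) (by decide) (by decide), a3]
    · rw [r5 _ (by decide) (by decide) (by decide) (by decide), c3]
    · rw [m5 _ (by decide) (by decide) (by decide)]; exact hdeg i hi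
    · rw [(hI t ht).2, codegIn, Ico_self, sum_empty]
    · simp only [offSum_self]
      constructor <;> rw [r5 _ (by decide) (by decide) (by decide) (by decide)] <;> simp [hs3]

/-! ### Cutting the vertices outside the separator into blocks. -/

/-- No component has vertices on both sides of position `β`. -/
def Aligned (st Y : ℕ → ℕ) (sp y β : ℕ) : Prop :=
  β = sp ∨ y ≤ β ∨ st (Y β) ≠ st (Y (β - 1))

-- A component is an interval of positions and the chosen vertices increase. A component with
-- vertices on both sides of a cut would therefore contain the two vertices next to the cut.
include hl hY in
theorem isBlock_of_aligned (hsep : IsSep S sp y Y) (h1 : sp ≤ β) (h2 : β ≤ e) (h3 : e ≤ y)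
    (hβ : Aligned st Y sp y β) (he : Aligned st Y sp y e) : IsBlock (sub A Y) sp β e y := by
  have mono : ∀ i j, i ≤ j → j < y → Y i ≤ Y j := fun i j h h' => by
    have := hY.le_apply h h'; omega
  have big : ∀ i, sp ≤ i → i < y → S ≤ Y i := fun i h h' => by
    by_contra hc
    have := (hsep.2 i h').1 (by omega)
    omega
  refine ⟨hl.isAdj.sub Y, h1, h2, h3, fun a x ha ha' hx hx' hcase => ?_⟩
  by_contra hne
  have hst := hl.sep _ _ (big a (by omega) (by omega)) (big x hx' hx) (hY.lt a (by omega))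
    (hY.lt x hx) hne
  rcases hcase with h | h
  · rcases hβ with hβ | hβ | hβ
    · omega
    · omega
    · have e1 := hl.conv (Y x) (Y (β - 1)) (Y a) (big x hx' hx) (mono _ _ (by omega) (by omega))
        (mono _ _ (by omega) (by omega)) (hY.lt a (by omega)) hst.symm
      have e2 := hl.conv (Y x) (Y β) (Y a) (big x hx' hx) (mono _ _ (by omega) (by omega))
        (mono _ _ (by omega) (by omega)) (hY.lt a (by omega)) hst.symm
      exact hβ (e2.trans e1.symm)
  · rcases he with he | he | he
    · omega
    · omega
    · have e1 := hl.conv (Y a) (Y (e - 1)) (Y x) (big a (by omega) (by omega))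
        (mono _ _ (by omega) (by omega)) (mono _ _ (by omega) (by omega)) (hY.lt x hx) hst
      have e2 := hl.conv (Y a) (Y e) (Y x) (big a (by omega) (by omega))
        (mono _ _ (by omega) (by omega)) (mono _ _ (by omega) (by omega)) (hY.lt x hx) hst
      exact he (e2.trans e1.symm)

/-- Whether the current part has to go on beyond position `e`. -/
def Goes (st Y : ℕ → ℕ) (L y β e : ℕ) : Prop := e < y ∧ (e < β + L ∨ st (Y e) = st (Y (e - 1)))

/-- The test for `Goes`. -/
def goesE : Expr :=
  .ite (.lt (.var rEnd) (.var rY)) (.ite (.lt (.var rEnd) (.var rBeg + .var rL)) 1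
    (.eq (.rd aStart (.rd aY (.var rEnd))) (.rd aStart (.rd aY (.var rEnd - 1))))) 0

/-- Find the end of the current part. -/
def findEnd : Cmd :=
  .set rEnd (.var rBeg + 1) ;; .loop goesE (.set rEnd (.var rEnd + 1))

-- A block takes L vertices and then goes on to the end of the current component. The overshoot
-- stays inside one component, whose extent together with the separator is below L; so separator
-- plus block has at most 2L vertices, and the block has at least L unless the vertices are
-- exhausted.
include hl hY in
theorem exists_end (hsep : IsSep S sp y Y) (h1 : sp ≤ β) (h2 : β < y) :
    ∃ e, β < e ∧ e ≤ y ∧ (∀ x, β < x → x < e → Goes st Y L y β x) ∧ ¬ Goes st Y L y β e ∧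
      Aligned st Y sp y e ∧ sp + (e - β) ≤ 2 * L ∧ (e = y ∨ β + L ≤ e) := by
  classical
  have hex : ∃ e, β < e ∧ ¬ Goes st Y L y β e := ⟨y, h2, fun h => by have := h.1; omega⟩
  have hsp := (sep_le hY hsep).trans hl.S_le_L
  refine ⟨Nat.find hex, (Nat.find_spec hex).1, ?_, fun x hx hx' => ?_, (Nat.find_spec hex).2, ?_⟩
  · exact Nat.find_min' hex ⟨h2, fun h => by have := h.1; omega⟩
  · have := Nat.find_min hex hx'
    tauto
  have hlt := (Nat.find_spec hex).1
  have hno := (Nat.find_spec hex).2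
  have hgo : ∀ x, β < x → x < Nat.find hex → Goes st Y L y β x := fun x hx hx' => by
    have := Nat.find_min hex hx'
    tauto
  have hle : Nat.find hex ≤ y := Nat.find_min' hex ⟨h2, fun h => by have := h.1; omega⟩
  generalize Nat.find hex = e at *
  simp only [Goes, not_and_or, not_or] at hno
  refine ⟨?_, ?_, by omega⟩
  · rcases hno with h | h
    · exact Or.inr (Or.inl (by omega))
    · exact Or.inr (Or.inr h.2)
  · by_cases h : e ≤ β + L
    · omega
    have big : ∀ i, sp ≤ i → i < y → S ≤ Y i := fun i h h' => by
      by_contra hc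
      have := (hsep.2 i h').1 (by omega)
      omega
    have hL : 0 < L := by
      have := hl.small (Y β) (Y β) (big β h1 h2) le_rfl (hY.lt _ h2) rfl
      omega
    -- From position β + L - 1 on, the block is prolonged only within one component.
    have key : ∀ j, β + L - 1 + j < e → st (Y (β + L - 1)) = st (Y (β + L - 1 + j)) := by
      intro j
      induction j with
      | zero => intro _; rfl
      | succ j ih =>
        intro hj
        have := hgo (β + L - 1 + (j + 1)) (by omega) hj
        rcases this.2 with h' | h'
        · omega
        · rw [ih (by omega), h']; rfl
    have h3 := key (e - (β + L)) (by omega)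
    have h4 : β + L - 1 + (e - (β + L)) = e - 1 := by omega
    rw [h4] at h3
    have h5 := hY.le_apply (i := β + L - 1) (j := e - 1) (by omega) (by omega)
    have h6 := hl.small (Y (β + L - 1)) (Y (e - 1)) (big _ (by omega) (by omega)) (by omega)
      (hY.lt _ (by omega)) h3
    have := sep_le hY hsep
    omega

include hl hbig hY in
theorem findEnd_spec (hs : HasPart s n S L st row y Y) (hβ : s.reg rBeg = β) (h1 : β < e)
    (h2 : e ≤ y) (h3 : ∀ x, β < x → x < e → Goes st Y L y β x) (h4 : ¬ Goes st Y L y β e) :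
    WP p w findEnd (100 * (e - β)) (fun s' => s'.reg rEnd = e) s := by
  classical
  have hw : 1 < word w := by omega
  have hyn := hY.le
  have hLn := hl.L_le
  refine WP.le (T := 10 + (50 * (e - β) + 30)) (WP.straight_seq hw (by decide)
    ⟨by simp [hβ]; omega, ?_⟩) (by omega)
  set s1 := s.setReg rEnd (Expr.eval s (.var rBeg + 1)) with hs1
  have hp1 : HasPart s1 n S L st row y Y := hs.setReg (by decide) (by decide)
  have hc : goesE.cost + 1 ≤ 30 := by decide
  have ev : ∀ s', Off (.set rEnd (.var rEnd + 1)) s1 s' →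
      (goesE.eval s' ≠ 0 ↔ Goes st Y L y β (s'.reg rEnd)) := by
    intro s' ho
    have hp := hp1.off ho rfl rfl rfl rfl rfl rfl rfl
    have b : s'.reg rBeg = β := (ho.reg rfl).trans (by simp [hs1, hβ])
    simp only [goesE, Goes, Expr.eval_ite, Expr.eval_lt_ne_zero, Expr.eval_var, Expr.eval_add,
      Expr.eval_ofNat, Expr.eval_eq, Expr.eval_rd, Expr.eval_sub, hp.reg_y, hp.mem_Y,
      hp.layout.mem_st, hp.layout.reg_L, b]
    split_ifs <;> simp_all
  refine WP.mono hw (WP.while_ hw (fun B s' => β < s'.reg rEnd ∧ s'.reg rEnd ≤ e ∧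
    B = 50 * (e - s'.reg rEnd)) ?_ (50 * (e - (β + 1))) ?_) (by omega) ?_
  · rintro B s' hf ho ⟨hI1, hI2, rfl⟩
    have hp := hp1.off ho rfl rfl rfl rfl rfl rfl rfl
    have b : s'.reg rBeg = β := (ho.reg rfl).trans (by simp [hs1, hβ])
    refine ⟨?_, fun h => ?_⟩
    · simp [goesE, b, hp.layout.reg_L]; omega
    · have hg := (ev s' ho).1 h
      have hlt : s'.reg rEnd < e := lt_of_le_of_ne hI2 fun h => h4 (h ▸ hg)
      refine ⟨4, 50 * (e - (s'.reg rEnd + 1)), by omega, ?_⟩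
      refine WP.straight_le hw (by decide) ⟨by simp; omega, ?_⟩
      simp; omega
  · simp [hs1, hβ]; omega
  · rintro s' hf ho ⟨h0, B', hI1, hI2, -⟩
    by_contra hne
    exact (ev s' ⟨ho.reg, ho.mem⟩).2 (h3 _ hI1 (by omega)) h0

/-- Account for all parts. -/
def mainLoop (F : Pol) : Cmd := .loop (.lt (.var rBeg) (.var rY)) (findEnd ;; partStep F)

-- A block of length d costs Λ(sp + d) up to a constant. Except for the last block d ≥ L ≥ sp, so
-- the dimensions add up to at most twice the number of vertices; the last block is charged once for
-- all vertices.
include hl hbig hY hmul hΛ in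
theorem mainLoop_spec (F : Pol) (hs : HasPart s n S L st row y Y) (hsep : IsSep S sp y Y)
    (hu : Upto F (sub A Y) sp y sp s) :
    WP p w (mainLoop F) ((6000 + 4 * F.comp.cost) * (Λ * y) + 4) (Upto F (sub A Y) sp y y) s := by
  have hw : 1 < word w := by omega
  have hyn := hY.le
  have hspy := hsep.1
  have hspL : sp ≤ L := (sep_le hY hsep).trans hl.S_le_L
  set K := 1000 + F.comp.cost with hK
  -- If Λ = 0 then L = 0, and there is no chosen vertex outside the separator. The budget below
  -- needs Λ > 0 to pay for the loop tests.
  rcases Nat.eq_zero_or_pos Λ with hΛ0 | hΛpos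
  · have hy : y = sp := by
      by_contra hne
      obtain ⟨e, h1, h2, -, -, -, h6, -⟩ := exists_end hl hY hsep (β := sp) le_rfl (by omega)
      omega
    refine WP.mono hw (WP.while_ hw (fun B s' => Upto F (sub A Y) sp y sp s' ∧ s'.reg rY = y) ?_ 0
      ⟨hu, hs.reg_y⟩) (by simp [Expr.lt, Expr.cost]) ?_
    · rintro B s' hf ho ⟨hI1, hI2⟩
      refine ⟨by simp, fun h => ?_⟩
      rw [Expr.eval_lt_ne_zero] at h
      simp [hI1.reg_beg, hI2, hy] at h
    · rintro s' - - ⟨-, -, h, -⟩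
      subst hy; exact h
  -- The budget has a part proportional to the vertices left and a reserve for the last block. The
  -- extra 200 covers the search for the end of a block and the loop test.
  refine WP.mono hw (WP.while_ hw (fun B s' => ∃ β, sp ≤ β ∧ β ≤ y ∧ Aligned st Y sp y β ∧
    Upto F (sub A Y) sp y β s' ∧ B = (K + 200) * Λ * (2 * (y - β)) + if β < y then K * Λ * y else 0)
    ?_ ((K + 200) * Λ * (2 * (y - sp)) + if sp < y then K * Λ * y else 0)
    ⟨sp, le_rfl, hspy, Or.inl rfl, hu, rfl⟩) ?_ ?_
  · rintro B s' hf ho ⟨β, hβ1, hβ2, hal, hI, rfl⟩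
    have hp := hs.off ho rfl rfl rfl rfl rfl rfl rfl
    refine ⟨by simp, fun h => ?_⟩
    rw [Expr.eval_lt_ne_zero] at h
    simp only [Expr.eval_var, hI.reg_beg, hp.reg_y] at h
    obtain ⟨e, h1, h2, h3, h4, h5, h6, h7⟩ := exists_end hl hY hsep hβ1 h
    have hb := isBlock_of_aligned hl hY hsep hβ1 h1.le h2 hal h5
    refine ⟨100 * (e - β) + K * (Λ * (sp + (e - β))),
      (K + 200) * Λ * (2 * (y - e)) + (if e < y then K * Λ * y else 0), ?_, ?_⟩
    rotate_left
    · refine (findEnd_spec hl hbig hY hp hI.reg_beg h1 h2 h3 h4).seq hw fun s2 hf2 ho2 he => ?_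
      have hp2 := hp.off ho2 rfl rfl rfl rfl rfl rfl rfl
      have hI2 : Upto F (sub A Y) sp y β s2 :=
        ⟨(ho2.reg rfl).trans hI.reg_sp, (ho2.reg rfl).trans hI.reg_beg,
          fun i hi => by rw [ho2.mem rfl]; exact hI.deg i hi,
          fun i hi => by rw [ho2.mem rfl]; exact hI.base i hi,
          fun i hi => by rw [ho2.mem rfl]; exact hI.acc i hi,
          hI.accs.congr (ho2.reg rfl) (ho2.reg rfl) (ho2.reg rfl) rfl rfl rfl⟩
      refine WP.mono hw (partStep_spec hl hbig hY hb F (by omega) (by omega)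
        (hmul _ (by omega) (by omega) (by omega)) hp2 hI2 he) le_rfl fun s3 _ _ h3 => ?_
      exact ⟨e, by omega, h2, h5, h3, rfl⟩
    · rw [if_pos h]
      obtain ⟨d, rfl⟩ : ∃ d, e = β + d := ⟨e - β, by omega⟩
      obtain ⟨f, rfl⟩ : ∃ f, y = β + d + f := ⟨y - (β + d), by omega⟩
      have hd : 1 ≤ d := by omega
      have hdΛ : d ≤ Λ * d := Nat.le_mul_of_pos_left _ hΛpos
      have e1 : β + d - β = d := by omega
      have e2 : β + d + f - β = d + f := by omega
      have e3 : β + d + f - (β + d) = f := by omega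
      rw [e1, e2, e3]
      have hcost : (Expr.lt (.var rBeg) (.var rY)).cost + 1 = 4 := rfl
      rw [hcost]
      split_ifs with hlt
      · have hspd : sp ≤ d := by omega
        have : K * (Λ * (sp + d)) ≤ K * (Λ * (2 * d)) := by gcongr; omega
        nlinarith
      · have : K * (Λ * (sp + d)) ≤ K * (Λ * (β + d + f)) :=
          Nat.mul_le_mul_left _ (Nat.mul_le_mul_left _ (by omega))
        nlinarith
  · have : (if sp < y then K * Λ * y else 0) ≤ K * Λ * y := by split_ifs <;> simp
    have h2 : (K + 200) * Λ * (2 * (y - sp)) ≤ (K + 200) * Λ * (2 * y) := by gcongr; omega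
    have hcost : (Expr.lt (.var rBeg) (.var rY)).cost + 1 = 4 := rfl
    rw [add_assoc _ _ 1, hcost]
    have h3 : (6000 + 4 * F.comp.cost) * (Λ * y) = (2000 + K + 3 * K) * (Λ * y) := by rw [hK]; ring
    rw [h3]
    nlinarith [Nat.zero_le (Λ * y)]
  · rintro s' hf ho ⟨h0, B', β, h1, h2, h3, h4, -⟩
    have hp := hs.off ho rfl rfl rfl rfl rfl rfl rfl
    rw [Expr.eval_lt_eq_zero] at h0
    simp only [Expr.eval_var, h4.reg_beg, hp.reg_y] at h0
    obtain rfl : β = y := by omega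
    exact h4

end

/-! ### Pairs inside the separator, and the complete count. -/

/-- Account for a pair of vertices in the separator. -/
def sepBody (F : Pol) : Cmd :=
  .set rI (.var rT / .var rSp) ;; .set rJ (.var rT % .var rSp) ;;
  .set rCd (.rd aBase (.var rT) + .rd aAcc (.var rT)) ;;
  .set rDx (.rd aDeg (.var rI)) ;; .set rDy (.rd aDeg (.var rJ)) ;;
  .set rQ ((.var rQ + .var rCd % 24 * (.var rCd % 24)) % 24) ;;
  .ite (adjE (.rd aY (.var rI)) (.rd aY (.var rJ))) (edgeStep F) .skip

/-- Account for the pairs of vertices in the separator, and combine the sums. -/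
def finish (F : Pol) (γ δ : ℕ) : Cmd :=
  .set rSq (.var rSp * .var rSp) ;; .upto rT rSq (sepBody F) ;;
  .set rOut ((.var rVal + .lit (γ % 24) * .var rQ + .lit (δ % 24) * (.var rM * .var rM % 24)) % 24)

/-- Count the labelled induced copies modulo `24` in the graph induced on a part of the vertices. -/
def count (F : Pol) (γ δ : ℕ) : Cmd := initCount ;; mainLoop F ;; finish F γ δ

section
variable {p : Prog} {w n S L y sp Λ : ℕ} {st row Y : ℕ → ℕ} {A : ℕ → ℕ → ℕ} {s : State}
  (hl : Layout n S L st row A) (hbig : 2000 + 20 * n + 2 * (n * n) ≤ word w) (hY : Part n y Y)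

theorem sepBody_cost (F : Pol) : (sepBody F).cost ≤ 150 + F.comp.cost := by
  simp only [sepBody, edgeStep, adjE, Cmd.cost, Expr.cost_ofNat,
    Expr.cost_var, Expr.cost_rd, Expr.cost_add, Expr.cost_sub, Expr.cost_mul, Expr.cost_div,
    Expr.cost_mod, Expr.cost_lt, Expr.cost_eq, Expr.cost_ite]
  omega

include hl hbig hY

/-- After all blocks the running table counts the common neighbours outside the separator, so adding
those inside it gives the full codegrees of separator pairs. -/
theorem finish_spec (F : Pol) (γ δ : ℕ) (hs : HasPart s n S L st row y Y) (hsp : sp ≤ y)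
    (hu : Upto F (sub A Y) sp y y s) :
    WP p w (finish F γ δ) (50 + (sp * sp * (150 + F.comp.cost + 8) + 6))
      (fun s' => s'.reg rOut < 24 ∧ (s'.reg rOut : ZMod 24) = formula F γ δ (sub A Y) y) s := by
  have hw : 1 < word w := by omega
  have hyn := hY.le
  have hA := hl.isAdj.sub Y
  have hspsp : sp * sp ≤ n * n := Nat.mul_le_mul (by omega) (by omega)
  have hu1 := hu.accs
  refine WP.le (T := 10 + ((sp * sp * (150 + F.comp.cost + 8) + 6) + 30))
    (WP.straight_seq hw (by decide) ⟨by simp [hu.reg_sp]; omega, ?_⟩) (by omega)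
  set s1 := s.setReg rSq (Expr.eval s (.var rSp * .var rSp)) with hs1
  have hp1 : HasPart s1 n S L st row y Y := hs.setReg (by decide) (by decide)
  -- Each of the three double sums is split into the pairs already accounted for and the separator
  -- pairs, the latter in the order of the loop.
  have form : formula F γ δ (sub A Y) y =
      (offSum sp y (fun a b => (sub A Y a b : ZMod 24) * edgeVal F (sub A Y) y a b) +
        ∑ t ∈ range (sp * sp), (sub A Y (t / sp) (t % sp) : ZMod 24) *
          edgeVal F (sub A Y) y (t / sp) (t % sp)) +
      γ * (offSum sp y (fun a b => (codeg (sub A Y) y a b : ZMod 24) ^ 2) +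
        ∑ t ∈ range (sp * sp), (codeg (sub A Y) y (t / sp) (t % sp) : ZMod 24) ^ 2) +
      δ * (offSum sp y (fun a b => (sub A Y a b : ZMod 24) * 1) +
        ∑ t ∈ range (sp * sp), (sub A Y (t / sp) (t % sp) : ZMod 24) * 1) ^ 2 := by
    rw [sum_range_mul_div_mod (f := fun i j => (sub A Y i j : ZMod 24) *
        edgeVal F (sub A Y) y i j),
      sum_range_mul_div_mod (f := fun i j => (codeg (sub A Y) y i j : ZMod 24) ^ 2),
      sum_range_mul_div_mod (f := fun i j => (sub A Y i j : ZMod 24) * 1),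
      ← sum_add_offSum hsp, ← sum_add_offSum hsp, ← sum_add_offSum hsp]
    simp only [mul_one]
    rfl
  refine (WP.for_straight hw (n := sp * sp) (fun k s' => Accs s'
      (offSum sp y (fun a b => (sub A Y a b : ZMod 24) * edgeVal F (sub A Y) y a b) +
        ∑ t ∈ range k, (sub A Y (t / sp) (t % sp) : ZMod 24) *
          edgeVal F (sub A Y) y (t / sp) (t % sp))
      (offSum sp y (fun a b => (sub A Y a b : ZMod 24) * 1) +
        ∑ t ∈ range k, (sub A Y (t / sp) (t % sp) : ZMod 24) * 1)
      (offSum sp y (fun a b => (codeg (sub A Y) y a b : ZMod 24) ^ 2) +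
        ∑ t ∈ range k, (codeg (sub A Y) y (t / sp) (t % sp) : ZMod 24) ^ 2))
    (150 + F.comp.cost) (sepBody_cost F) rfl rfl (by decide) (by simp [hs1, hu.reg_sp]) ?_ ?_).seq
    hw ?_
  · exact hu1.congr (by simp [hs1]) (by simp [hs1]) (by simp [hs1]) (by simp) (by simp) (by simp)
  · intro k hk s' hf hT _ ho hI
    have hp := hp1.off ho rfl rfl rfl rfl rfl rfl rfl
    have e1 : s'.reg rSp = sp := (ho.reg rfl).trans (by simp [hs1, hu.reg_sp])
    have e2 : ∀ i < sp, s'.mem aDeg i = degr (sub A Y) y i := fun i hi => by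
      rw [ho.mem rfl, hs1, State.mem_setReg, hu.deg i hi]
    have hpos : 0 < sp := Nat.pos_of_ne_zero (by rintro h; simp [h] at hk)
    have hi : k / sp < sp := Nat.div_lt_of_lt_mul hk
    have hj : k % sp < sp := Nat.mod_lt _ hpos
    have e3 : s'.mem aBase k + s'.mem aAcc k = codeg (sub A Y) y (k / sp) (k % sp) := by
      rw [ho.mem rfl, ho.mem rfl, hs1, State.mem_setReg, hu.base k hk, hu.acc k hk,
        ← codeg_eq_add hsp]
    have hc := codeg_le hA y (k / sp) (k % sp)
    simp only [sum_range_succ, ← add_assoc]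
    have dx := e2 _ hi
    have dy := e2 _ hj
    generalize hki : k / sp = i at *
    generalize hkj : k % sp = j at *
    generalize hcd : codeg (sub A Y) y i j = c at *
    have hcc : c % 24 * (c % 24) ≤ 23 * 23 := Nat.mul_le_mul (by omega) (by omega)
    have hq := hI.q_lt
    simp only [sepBody, Cmd.vc, Expr.ok_div, Expr.ok_var, Expr.ok_mod, Expr.ok_add, Expr.ok_rd,
      Expr.ok_mul, Expr.ok_ofNat, Expr.eval_var, Expr.eval_div, Expr.eval_mod, Expr.eval_rd,
      Expr.eval_add, Expr.eval_mul, Expr.eval_ofNat, State.reg_setReg, State.mem_setReg,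
      Nat.reduceEqDiff, reduceIte, hT, e1, hki, hkj, e3, dx, dy, true_and, and_true]
    refine ⟨by omega, by omega, ?_⟩
    set s2 := (((((s'.setReg rI i).setReg rJ j).setReg rCd c).setReg rDx
      (degr (sub A Y) y i)).setReg rDy (degr (sub A Y) y j)).setReg rQ
      ((s'.reg rQ + c % 24 * (c % 24)) % 24) with hs2
    have hp2 : HasPart s2 n S L st row y Y :=
      (((((hp.setReg (by decide) (by decide)).setReg (by decide) (by decide)).setReg (by decide)
      (by decide)).setReg (by decide) (by decide)).setReg (by decide) (by decide)).setReg
      (by decide) (by decide)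
    obtain ⟨u1, u2⟩ := sub_eval hl hbig hY hp2 (a := .var rI) (b := .var rJ)
      (by simp [hs2]; omega) (by simp [hs2]; omega) trivial trivial
    have u3 : (adjE (.rd aY (.var rI)) (.rd aY (.var rJ))).eval s2 = sub A Y i j := by
      rw [u2]; simp [hs2]
    have ha2 : Accs s2 _ _ _ := Accs.mk (s := s2) (by simpa [hs2] using hI.val_lt)
      (by simpa [hs2] using hI.m_lt) (by simpa [hs2] using Nat.mod_lt _ (by decide))
      (by simpa [hs2] using hI.val) (by simpa [hs2] using hI.m) (by
        simp only [hs2, State.reg_setReg, reduceIte, ZMod.natCast_mod, Nat.cast_add, Nat.cast_mul,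
          hI.q]
        rfl)
    refine ⟨u1, fun h => ?_, fun h => ?_⟩
    · have hadj : sub A Y i j = 1 := by
        rw [u3] at h; have := hA.le_one i j; omega
      refine edgeStep_vc (by omega) ha2 fun s3 _ _ h3 => h3.congr (by simp) (by simp) (by simp)
        ?_ ?_ (by rw [pow_two])
      · rw [hadj, Nat.cast_one, one_mul, edgeVal, hcd]
        simp [hs2, hp.reg_y]
      · simp [hadj]
    · have hadj : sub A Y i j = 0 := by rw [← u3]; exact h
      refine ha2.congr (by simp) (by simp) (by simp) ?_ ?_ (by rw [pow_two]) <;>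
        simp [hadj]
  · rintro s2 hf2 ho2 ⟨hI, -⟩
    have h1 := hI.val_lt
    have h2 := hI.m_lt
    have h3 := hI.q_lt
    have h4 : s2.reg rM * s2.reg rM ≤ 23 * 23 := Nat.mul_le_mul (by omega) (by omega)
    have h5 : γ % 24 * s2.reg rQ ≤ 23 * 23 := Nat.mul_le_mul (by omega) (by omega)
    have h6 : δ % 24 * (s2.reg rM * s2.reg rM % 24) ≤ 23 * 23 := Nat.mul_le_mul (by omega) (by omega)
    refine WP.straight_le hw (by simp [Cmd.cost]) ⟨?_, ?_, ?_⟩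
    · simp; omega
    · simpa using Nat.mod_lt _ (by decide)
    · simp only [Expr.eval_mod, Expr.eval_ofNat, Expr.eval_add, Expr.eval_mul, Expr.eval_var,
        Expr.eval_lit, State.reg_setReg, reduceIte, ZMod.natCast_mod, Nat.cast_add, Nat.cast_mul,
        hI.val, hI.m, hI.q]
      rw [form, pow_two (_ + _ : ZMod 24)]

theorem count_spec (F : Pol) (γ δ : ℕ)
    (hmul : ∀ N, 0 < N → N ≤ 2 * L → N ≤ n → MulSpec p w N (Λ * N)) (hΛ : 2 * L ≤ Λ)
    (hs : HasPart s n S L st row y Y) :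
    WP p w (count F γ δ) ((9000 + 5 * F.comp.cost) * (y * Λ + y + 1))
      (fun s' => s'.reg rOut < 24 ∧ (s'.reg rOut : ZMod 24) = formula F γ δ (sub A Y) y) s := by
  have hw : 1 < word w := by omega
  have key : ∀ sp, IsSep S sp y Y → sp * sp ≤ y * Λ := fun sp h =>
    Nat.mul_le_mul h.1 (by have := (sep_le hY h).trans hl.S_le_L; omega)
  refine WP.le (T := 2000 * (y * Λ + y + 1) + (((6000 + 4 * F.comp.cost) * (Λ * y) + 4) +
    (50 + (y * Λ * (150 + F.comp.cost + 8) + 6)))) ?_ (by nlinarith)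
  refine (initCount_spec hl hbig hY hmul hΛ F hs).seq hw ?_
  rintro s1 hf1 ho1 ⟨sp, hsep, hu⟩
  have hp1 := hs.off ho1 rfl rfl rfl rfl rfl rfl rfl
  refine (mainLoop_spec hl hbig hY hmul hΛ F hp1 hsep hu).seq hw ?_
  intro s2 hf2 ho2 hu2
  have hp2 := hp1.off ho2 rfl rfl rfl rfl rfl rfl rfl
  refine (finish_spec hl hbig hY F γ δ hp2 hsep.1 hu2).le ?_
  have := Nat.mul_le_mul_right (150 + F.comp.cost + 8) (key sp hsep)
  omega

end

/-! ### Breadth-first search outside of the separator -/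

open Classical in
/-- The number of vertices below `m` in the separator. -/
noncomputable def sepCount (sep : ℕ → Prop) (m : ℕ) : ℕ := ((range m).filter sep).card

theorem sepCount_succ_of_pos {sep : ℕ → Prop} {m : ℕ} (h : sep m) :
    sepCount sep (m + 1) = sepCount sep m + 1 := by
  simp [sepCount, range_add_one, filter_insert, h]

theorem sepCount_succ_of_neg {sep : ℕ → Prop} {m : ℕ} (h : ¬ sep m) :
    sepCount sep (m + 1) = sepCount sep m := by
  simp [sepCount, range_add_one, filter_insert, h]

theorem sepCount_le (sep : ℕ → Prop) (m : ℕ) : sepCount sep m ≤ m := by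
  classical
  exact (card_filter_le _ _).trans (by simp)

/-- A graph on `0, …, n - 1` with a `k`-separator; `conn` is connectedness outside of the
separator. -/
structure IsInstance (n k : ℕ) (adj : ℕ → ℕ → Prop) (sep : ℕ → Prop) (conn : ℕ → ℕ → Prop) :
    Prop where
  adj_lt : ∀ {u v}, adj u v → u < n ∧ v < n
  symm : ∀ {u v}, adj u v → adj v u
  irrefl : ∀ {u}, ¬ adj u u
  equiv : Equivalence conn
  conn_of_adj : ∀ {u v}, adj u v → ¬ sep u → ¬ sep v → conn u v
  card_le : ∀ T : Finset ℕ, (∀ v ∈ T, v < n ∧ ¬ sep v) → (∀ u ∈ T, ∀ v ∈ T, conn u v) →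
    sepCount sep n + T.card ≤ k

/-- Adjacency lists. -/
structure IsLists (adj : ℕ → ℕ → Prop) (n : ℕ) (off nbr : ℕ → ℕ) : Prop where
  le : ∀ v < n, off v ≤ off (v + 1)
  bij : ∀ v < n, Set.BijOn nbr (Set.Ico (off v) (off (v + 1))) {u | adj v u}

section
variable {n k : ℕ} {adj : ℕ → ℕ → Prop} {sep : ℕ → Prop} {conn : ℕ → ℕ → Prop} {off nbr : ℕ → ℕ}

theorem IsLists.adj_nbr (h : IsLists adj n off nbr) {v x : ℕ} (hv : v < n) (h1 : off v ≤ x)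
    (h2 : x < off (v + 1)) : adj v (nbr x) := (h.bij v hv).mapsTo ⟨h1, h2⟩

theorem IsLists.exists_nbr (h : IsLists adj n off nbr) {v u : ℕ} (hv : v < n) (hu : adj v u) :
    ∃ x, off v ≤ x ∧ x < off (v + 1) ∧ nbr x = u := by
  obtain ⟨x, hx, rfl⟩ := (h.bij v hv).surjOn hu
  exact ⟨x, hx.1, hx.2, rfl⟩

theorem IsLists.image_card (h : IsLists adj n off nbr) {v : ℕ} (hv : v < n) :
    ((Ico (off v) (off (v + 1))).image nbr).card = off (v + 1) - off v := by
  rw [card_image_of_injOn, Nat.card_Ico]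
  simpa using (h.bij v hv).injOn

theorem IsLists.length_le (h : IsLists adj n off nbr) (hI : IsInstance n k adj sep conn) {v : ℕ}
    (hv : v < n) : off (v + 1) - off v ≤ n := by
  rw [← h.image_card hv, ← card_range n]
  refine card_le_card fun u hu => ?_
  obtain ⟨x, hx, rfl⟩ := mem_image.1 hu
  have := mem_Ico.1 hx
  exact mem_range.2 (hI.adj_lt (h.adj_nbr hv this.1 this.2)).2

/-- A neighbour of a vertex outside the separator lies in the separator or in the component of the
vertex, and these have at most k vertices together. The bound makes the search take O(kn) steps. -/
theorem IsLists.length_le_of_not_sep (h : IsLists adj n off nbr)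
    (hI : IsInstance n k adj sep conn) {v : ℕ} (hv : v < n) (hs : ¬ sep v) :
    off (v + 1) - off v ≤ k := by
  classical
  rw [← h.image_card hv]
  set T := (range n).filter fun u => ¬ sep u ∧ conn v u
  have hT := hI.card_le T (fun u hu => by
    have := mem_filter.1 hu
    exact ⟨mem_range.1 this.1, this.2.1⟩) fun u hu u' hu' => hI.equiv.trans
      (hI.equiv.symm (mem_filter.1 hu).2.2) (mem_filter.1 hu').2.2
  refine le_trans ((card_le_card (t := (range n).filter sep ∪ T) fun u hu => ?_).trans
    (card_union_le _ _)) (by unfold sepCount at hT; convert hT)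
  obtain ⟨x, hx, rfl⟩ := mem_image.1 hu
  have hx := mem_Ico.1 hx
  have ha := h.adj_nbr hv hx.1 hx.2
  have hn := (hI.adj_lt ha).2
  by_cases hsu : sep (nbr x)
  · exact mem_union_left _ (mem_filter.2 ⟨mem_range.2 hn, hsu⟩)
  · exact mem_union_right _ (mem_filter.2 ⟨mem_range.2 hn, hsu, hI.conn_of_adj ha hs hsu⟩)

/-- The distinct vertices `ord 0, …, ord (tail - 1)`, with their positions (plus one) in `pos`. -/
structure Listed (n tail : ℕ) (ord pos : ℕ → ℕ) : Prop where
  ord_lt : ∀ i < tail, ord i < n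
  pos_ord : ∀ i < tail, pos (ord i) = i + 1
  ord_pos : ∀ v < n, pos v ≠ 0 → ∃ i < tail, ord i = v

namespace Listed

variable {tail : ℕ} {ord pos ord' pos' : ℕ → ℕ}

theorem inj (h : Listed n tail ord pos) {i j : ℕ} (hi : i < tail) (hj : j < tail)
    (hij : ord i = ord j) : i = j := by
  have h1 := h.pos_ord i hi
  have h2 := h.pos_ord j hj
  rw [hij] at h1; omega

theorem push (h : Listed n tail ord pos) {u : ℕ} (hu : u < n) (hpos : pos u = 0)
    (h1 : ∀ i, ord' i = if i = tail then u else ord i)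
    (h2 : ∀ v, pos' v = if v = u then tail + 1 else pos v) : Listed n (tail + 1) ord' pos' := by
  refine ⟨fun i hi => ?_, fun i hi => ?_, fun v hv hv' => ?_⟩
  · rw [h1]; split_ifs
    · exact hu
    · exact h.ord_lt i (by omega)
  · rw [h1]; split_ifs with hi'
    · rw [h2, if_pos rfl, hi']
    · have := h.pos_ord i (by omega)
      rw [h2, if_neg (by rintro hc; rw [hc] at this; omega), this]
  · by_cases hvu : v = u
    · exact ⟨tail, by omega, by rw [h1, if_pos rfl, hvu]⟩
    · rw [h2, if_neg hvu] at hv'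
      obtain ⟨i, hi, hiv⟩ := h.ord_pos v hv hv'
      exact ⟨i, by omega, by rw [h1, if_neg (by omega), hiv]⟩

theorem image_subset (h : Listed n tail ord pos) : (range tail).image ord ⊆ range n := by
  intro v hv
  obtain ⟨i, hi, rfl⟩ := mem_image.1 hv
  exact mem_range.2 (h.ord_lt i (mem_range.1 hi))

theorem card_image (h : Listed n tail ord pos) : ((range tail).image ord).card = tail := by
  rw [card_image_of_injOn, card_range]
  exact fun i hi j hj => h.inj (by simpa using hi) (by simpa using hj)

theorem tail_le (h : Listed n tail ord pos) : tail ≤ n := by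
  rw [← h.card_image, ← card_range n]
  exact card_le_card h.image_subset

theorem tail_eq (h : Listed n tail ord pos) (hall : ∀ v < n, pos v ≠ 0) : tail = n := by
  refine le_antisymm h.tail_le ?_
  rw [← h.card_image, ← card_range n, card_range]
  nth_rw 1 [← card_range n]
  refine card_le_card fun v hv => ?_
  obtain ⟨i, hi, rfl⟩ := h.ord_pos v (mem_range.1 hv) (hall v (mem_range.1 hv))
  exact mem_image_of_mem _ (mem_range.2 hi)

end Listed

/-- The invariant of the breadth-first search: the vertices at positions below `S` are those of the
separator, those from `head` on are waiting, all vertices below `r` have been found, and `st` is the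
position of the first vertex of the component. -/
structure Bfs (n S : ℕ) (adj : ℕ → ℕ → Prop) (sep : ℕ → Prop) (conn : ℕ → ℕ → Prop)
    (head tail r : ℕ) (ord pos st : ℕ → ℕ) : Prop extends Listed n tail ord pos where
  S_le : S ≤ head
  head_le : head ≤ tail
  r_le : r ≤ n
  sep_iff : ∀ i < tail, (sep (ord i) ↔ i < S)
  pos_sep : ∀ v < n, sep v → pos v ≠ 0
  st_le : ∀ i, S ≤ i → i < tail → S ≤ st i ∧ st i ≤ i ∧ st (st i) = st i
  st_mono : ∀ i j, S ≤ i → i ≤ j → j < tail → st i ≤ st j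
  conn_of_eq : ∀ i j, S ≤ i → i < tail → S ≤ j → j < tail → st i = st j → conn (ord i) (ord j)
  queue : ∀ i, head ≤ i → i < tail → st i = st head
  closed : ∀ i, S ≤ i → i < head → ∀ u, adj (ord i) u → ∃ j < tail, ord j = u ∧ (S ≤ j → st j = st i)
  seen : ∀ v < r, pos v ≠ 0

namespace Bfs

variable {S head tail r : ℕ} {ord pos st ord' pos' st' : ℕ → ℕ}

/-- Common core of two cases: σ is the first position of the component that the new vertex joins,
namely `st head` for a neighbour of the head and `tail` for a new root. -/
theorem push_aux (hI : IsInstance n k adj sep conn)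
    (h : Bfs n S adj sep conn head tail r ord pos st) {u σ : ℕ} (hu : u < n) (hpos : pos u = 0)
    (h1 : ∀ i, ord' i = if i = tail then u else ord i)
    (h2 : ∀ v, pos' v = if v = u then tail + 1 else pos v)
    (h3 : ∀ i, st' i = if i = tail then σ else st i)
    (hσ1 : S ≤ σ) (hσ2 : σ ≤ tail) (hσ3 : σ < tail → st σ = σ)
    (hmono : ∀ i, S ≤ i → i < tail → st i ≤ σ)
    (hconn : ∀ i, S ≤ i → i < tail → st i = σ → conn (ord i) u)
    (hqueue : ∀ i, head ≤ i → i < tail → st i = σ) :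
    Bfs n S adj sep conn head (tail + 1) r ord' pos' st' := by
  have hS := h.S_le
  have hh := h.head_le
  have o1 : ∀ i < tail, ord' i = ord i := fun i hi => by rw [h1, if_neg (by omega)]
  have o2 : ord' tail = u := by rw [h1, if_pos rfl]
  have s1 : ∀ i < tail, st' i = st i := fun i hi => by rw [h3, if_neg (by omega)]
  have s2 : st' tail = σ := by rw [h3, if_pos rfl]
  have p1 : ∀ v, pos v ≠ 0 → pos' v ≠ 0 := fun v hv => by rw [h2]; split_ifs <;> omega
  have hs : ¬ sep u := fun hs => h.pos_sep u hu hs hpos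
  have hlt : ∀ i, i < tail + 1 → i < tail ∨ i = tail := fun i hi => by omega
  refine ⟨h.toListed.push hu hpos h1 h2, hS, by omega, h.r_le, ?_,
    fun v hv hv' => p1 v (h.pos_sep v hv hv'), ?_, ?_, ?_, ?_, ?_, fun v hv => p1 v (h.seen v hv)⟩
  · intro i hi
    rcases hlt i hi with hi | rfl
    · rw [o1 i hi]; exact h.sep_iff i hi
    · rw [o2]; exact ⟨fun h => absurd h hs, fun h => by omega⟩
  · intro i hSi hi
    rcases hlt i hi with hi | rfl
    · have := h.st_le i hSi hi
      rw [s1 i hi, s1 (st i) (by omega)]; exact this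
    · rw [s2]
      refine ⟨hσ1, hσ2, ?_⟩
      rcases hσ2.lt_or_eq with h' | h'
      · rw [s1 _ h', hσ3 h']
      · rw [h', s2, h']
  · intro i j hSi hij hj
    rcases hlt j hj with hj | rfl
    · rw [s1 i (by omega), s1 j hj]; exact h.st_mono i j hSi hij hj
    · rw [s2]
      rcases hlt i (by omega) with hi | rfl
      · rw [s1 i hi]; exact hmono i hSi hi
      · rw [s2]
  · intro i j hSi hi hSj hj hij
    rcases hlt i hi with hi | rfl <;> rcases hlt j hj with hj | rfl
    · rw [s1 i hi, s1 j hj] at hij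
      rw [o1 i hi, o1 j hj]; exact h.conn_of_eq i j hSi hi hSj hj hij
    · rw [s1 i hi, s2] at hij
      rw [o1 i hi, o2]; exact hconn i hSi hi hij
    · rw [s1 j hj, s2] at hij
      rw [o1 j hj, o2]; exact hI.equiv.symm (hconn j hSj hj hij.symm)
    · exact hI.equiv.refl _
  · have hq : ∀ i, head ≤ i → i < tail + 1 → st' i = σ := fun i hi hi' => by
      rcases hlt i hi' with hi' | rfl
      · rw [s1 i hi']; exact hqueue i hi hi'
      · exact s2
    intro i hi hi'
    rw [hq i hi hi', hq head le_rfl (by omega)]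
  · intro i hSi hi v hv
    rw [o1 i (by omega)] at hv
    obtain ⟨j, hj, hjv, hst⟩ := h.closed i hSi hi v hv
    refine ⟨j, by omega, by rw [o1 j hj, hjv], fun h' => ?_⟩
    rw [s1 j hj, s1 i (by omega)]; exact hst h'

theorem push_root (hI : IsInstance n k adj sep conn)
    (h : Bfs n S adj sep conn tail tail r ord pos st) {u : ℕ} (hu : u < n) (hpos : pos u = 0)
    (h1 : ∀ i, ord' i = if i = tail then u else ord i)
    (h2 : ∀ v, pos' v = if v = u then tail + 1 else pos v)
    (h3 : ∀ i, st' i = if i = tail then tail else st i) :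
    Bfs n S adj sep conn tail (tail + 1) r ord' pos' st' :=
  h.push_aux hI hu hpos h1 h2 h3 h.S_le le_rfl (fun h => by omega)
    (fun i hi hi' => by have := h.st_le i hi hi'; omega)
    (fun i hi hi' hi'' => by have := h.st_le i hi hi'; omega) (fun i hi hi' => by omega)

theorem push_nbr (hI : IsInstance n k adj sep conn)
    (h : Bfs n S adj sep conn head tail r ord pos st) (hlt : head < tail) {u : ℕ}
    (hpos : pos u = 0) (hadj : adj (ord head) u)
    (h1 : ∀ i, ord' i = if i = tail then u else ord i)
    (h2 : ∀ v, pos' v = if v = u then tail + 1 else pos v)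
    (h3 : ∀ i, st' i = if i = tail then st head else st i) :
    Bfs n S adj sep conn head (tail + 1) r ord' pos' st' := by
  have hu := (hI.adj_lt hadj).2
  have hS := h.S_le
  have hst := h.st_le head hS hlt
  refine h.push_aux hI hu hpos h1 h2 h3 hst.1 (by omega) (fun _ => hst.2.2) ?_ ?_
    (fun i hi hi' => h.queue i hi hi')
  · intro i hi hi'
    rcases le_total i head with h' | h'
    · exact h.st_mono i head hi h' hlt
    · exact (h.queue i h' hi').le
  · intro i hi hi' hst'
    refine hI.equiv.trans (h.conn_of_eq i head hi hi' hS hlt hst') (hI.conn_of_adj hadj ?_ ?_)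
    · rw [h.sep_iff head hlt]; omega
    · exact fun hs => h.pos_sep u hu hs hpos

/-- A neighbour found earlier has already been processed or is waiting. In the first case its own
closed neighbourhood contains the head, with the same start; in the second the whole queue shares
one start. Only separator vertices are exempt. -/
theorem nbr_found (h : Bfs n S adj sep conn head tail r ord pos st)
    (hI : IsInstance n k adj sep conn) (hlt : head < tail) {u : ℕ} (hadj : adj (ord head) u)
    (hpos : pos u ≠ 0) : ∃ j < tail, ord j = u ∧ (S ≤ j → st j = st head) := by
  obtain ⟨j, hj, rfl⟩ := h.ord_pos u (hI.adj_lt hadj).2 hpos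
  refine ⟨j, hj, rfl, fun hSj => ?_⟩
  rcases lt_or_ge j head with h' | h'
  · obtain ⟨i, hi, hij, hst⟩ := h.closed j hSj h' _ (hI.symm hadj)
    have := h.inj hi hlt hij
    subst this
    exact (hst h.S_le).symm
  · exact h.queue j h' hj

theorem pop (h : Bfs n S adj sep conn head tail r ord pos st) (hlt : head < tail)
    (hn : ∀ u, adj (ord head) u → ∃ j < tail, ord j = u ∧ (S ≤ j → st j = st head)) :
    Bfs n S adj sep conn (head + 1) tail r ord pos st where
  toListed := h.toListed
  S_le := by have := h.S_le; omega
  head_le := hlt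
  r_le := h.r_le
  sep_iff := h.sep_iff
  pos_sep := h.pos_sep
  st_le := h.st_le
  st_mono := h.st_mono
  conn_of_eq := h.conn_of_eq
  queue i hi hi' := by rw [h.queue i (by omega) hi', h.queue (head + 1) (by omega) (by omega)]
  closed i hi hi' := by
    rcases Nat.lt_succ_iff_lt_or_eq.1 hi' with h' | rfl
    · exact h.closed i hi h'
    · exact hn
  seen := h.seen

theorem next (h : Bfs n S adj sep conn head tail r ord pos st) (hr : r < n) (hpos : pos r ≠ 0) :
    Bfs n S adj sep conn head tail (r + 1) ord pos st :=
  { h with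
    r_le := hr
    seen := fun v hv => by
      rcases Nat.lt_succ_iff_lt_or_eq.1 hv with h' | rfl
      · exact h.seen v h'
      · exact hpos }

theorem tail_eq_of_done (h : Bfs n S adj sep conn head tail n ord pos st) : tail = n :=
  h.toListed.tail_eq h.seen

theorem st_eq_of_le (h : Bfs n S adj sep conn head tail r ord pos st) {a b c : ℕ} (ha : S ≤ a)
    (hab : a ≤ b) (hbc : b ≤ c) (hc : c < tail) (hac : st a = st c) : st b = st a := by
  have h1 := h.st_mono a b ha hab (by omega)
  have h2 := h.st_mono b c (by omega) hbc hc
  omega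

/-- Positions between two with the same start have that start too, so the whole interval lies in one
component and the separator property bounds its length. -/
theorem card_le (h : Bfs n (sepCount sep n) adj sep conn head tail r ord pos st)
    (hI : IsInstance n k adj sep conn) {a b : ℕ} (ha : sepCount sep n ≤ a)
    (hb : b < tail) (hst : st a = st b) : sepCount sep n + (b + 1 - a) ≤ k := by
  have hT := hI.card_le ((Ico a (b + 1)).image ord) (fun v hv => ?_) fun u hu v hv => ?_
  · rwa [card_image_of_injOn, Nat.card_Ico] at hT
    intro i hi j hj hij
    simp at hi hj
    exact h.inj (by omega) (by omega) hij
  · obtain ⟨i, hi, rfl⟩ := mem_image.1 hv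
    have := mem_Ico.1 hi
    refine ⟨h.ord_lt i (by omega), ?_⟩
    rw [h.sep_iff i (by omega)]; omega
  · obtain ⟨i, hi, rfl⟩ := mem_image.1 hu
    obtain ⟨j, hj, rfl⟩ := mem_image.1 hv
    have hi := mem_Ico.1 hi
    have hj := mem_Ico.1 hj
    refine h.conn_of_eq i j (by omega) (by omega) (by omega) (by omega) ?_
    rw [h.st_eq_of_le ha hi.1 (by omega) hb hst, h.st_eq_of_le ha hj.1 (by omega) hb hst]

end Bfs

end

-- The program for the breadth-first search.

notation "rHead" => (3 : ℕ)
notation "rTail" => (4 : ℕ)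
notation "rRoot" => (5 : ℕ)
notation "rVtx" => (6 : ℕ)
notation "rOff" => (7 : ℕ)
notation "rLen" => (8 : ℕ)
notation "rX" => (9 : ℕ)
notation "rU" => (10 : ℕ)
notation "rCnt" => (11 : ℕ)
notation "aOff" => (0 : ℕ)
notation "aNbr" => (1 : ℕ)
notation "aSep" => (2 : ℕ)
notation "aRnd" => (4 : ℕ)
notation "aOrd" => (5 : ℕ)
notation "aPos" => (6 : ℕ)

open Classical in
/-- The state holds the graph and the separator. -/
structure HasInput (s : State) (n : ℕ) (adj : ℕ → ℕ → Prop) (sep : ℕ → Prop) : Prop where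
  reg_n : s.reg rN = n
  lists : IsLists adj n (s.mem aOff) (s.mem aNbr)
  mem_sep : ∀ v < n, s.mem aSep v = if sep v then 1 else 0

theorem HasInput.off {c : Cmd} {s s' : State} {n : ℕ} {adj : ℕ → ℕ → Prop} {sep : ℕ → Prop}
    (h : HasInput s n adj sep) (ho : Off c s s') (h0 : c.wr rN = false) (h1 : c.wa aOff = false)
    (h2 : c.wa aNbr = false) (h3 : c.wa aSep = false) : HasInput s' n adj sep :=
  ⟨(ho.reg h0).trans h.reg_n, by rw [ho.mem h1, ho.mem h2]; exact h.lists,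
    by rw [ho.mem h3]; exact h.mem_sep⟩

theorem HasInput.setReg {s : State} {n : ℕ} {adj : ℕ → ℕ → Prop} {sep : ℕ → Prop}
    (h : HasInput s n adj sep) {r v : ℕ} (hr : r ≠ rN) : HasInput (s.setReg r v) n adj sep :=
  ⟨by simp [hr.symm, h.reg_n], h.lists, h.mem_sep⟩

/-- Draw `m * n` random bits. -/
def drawCoins (m : ℕ) : Cmd :=
  .set rCnt (.lit m * .var rN) ;; .upto rT rCnt (.flip rU ;; .put aRnd (.var rT) (.var rU))

theorem drawCoins_spec {p : Prog} {w n m : ℕ} {s : State} (hw : 1 < word w) (hm : m < word w)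
    (hmn : m * n < word w) (hn : s.reg rN = n) :
    WP p w (drawCoins m) (20 * (m * n + 1))
      (fun s' => ∀ t < m * n, s'.mem aRnd t = (s.coins t).toNat) s := by
  refine WP.le (T := 4 + (m * n * (10 + 8) + 6)) (WP.straight_seq hw
    (by simp [Cmd.cost]) ⟨by simp [hn, hm, hmn], ?_⟩) (by omega)
  refine WP.mono hw (WP.for_straight hw (n := m * n) (fun k s' => (∀ j, s'.coins j = s.coins (j + k)) ∧
    ∀ t < k, s'.mem aRnd t = (s.coins t).toNat) 10 (by decide) rfl rfl (by decide) (by simp [hn])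
    (by simp) ?_) le_rfl fun s' _ _ h => h.1.2
  rintro k hk s' hf hT _ ho ⟨hI1, hI2⟩
  refine ⟨trivial, trivial, fun j => ?_, fun t ht => ?_⟩
  · simp [hI1]; congr 1; omega
  · by_cases h : t = k
    · simp [hT, h, hI1]
    · simpa [hT, h] using hI2 t (by omega)

/-- Append the vertex in register `rU` to the list, with the entry `e` of `aStart`. -/
def push (e : Expr) : Cmd :=
  .put aStart (.var rTail) e ;; .put aOrd (.var rTail) (.var rU) ;;
  .put aPos (.var rU) (.var rTail + 1) ;; .set rTail (.var rTail + 1)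

theorem push_vc {w : ℕ} {e : Expr} {s : State} {Q : State → Prop} (he : e.Ok w s)
    (ht : s.reg rTail + 1 < word w)
    (hQ : ∀ s' : State, s'.reg rTail = s.reg rTail + 1 → (∀ r, r ≠ rTail → s'.reg r = s.reg r) →
      (∀ a, a ≠ aStart → a ≠ aOrd → a ≠ aPos → s'.mem a = s.mem a) →
      (∀ i, s'.mem aOrd i = if i = s.reg rTail then s.reg rU else s.mem aOrd i) →
      (∀ v, s'.mem aPos v = if v = s.reg rU then s.reg rTail + 1 else s.mem aPos v) →
      (∀ i, s'.mem aStart i = if i = s.reg rTail then e.eval s else s.mem aStart i) → Q s') :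
    (push e).vc w Q s := by
  refine ⟨trivial, he, trivial, trivial, trivial, ?_, ?_, ?_⟩
  · simp; omega
  · simp; omega
  · refine hQ _ (by simp) (fun r hr => by simp [hr]) (fun a h1 h2 h3 => ?_) (fun i => by simp)
      (fun i => by simp) (fun i => by simp)
    ext j; simp [h1, h2, h3]

/-- List the vertices of the separator. -/
def listSep : Cmd :=
  .upto rT rN (.put aPos (.var rT) 0) ;; .set rTail 0 ;;
  .upto rU rN (.ite (.rd aSep (.var rU)) (push 0) .skip) ;; .set rS (.var rTail)

section
variable {p : Prog} {w n k : ℕ} {adj : ℕ → ℕ → Prop} {sep : ℕ → Prop} {conn : ℕ → ℕ → Prop}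
  {s : State} (hI : IsInstance n k adj sep conn) (hbig : 2000 + 20 * n + 2 * (n * n) ≤ word w)
include hI hbig

omit hI in
theorem listSep_spec (hs : HasInput s n adj sep) :
    WP p w listSep (100 * (n + 1)) (fun s' => s'.reg rS = sepCount sep n ∧
      s'.reg rTail = sepCount sep n ∧
      Listed n (sepCount sep n) (s'.mem aOrd) (s'.mem aPos) ∧
      (∀ i < sepCount sep n, sep (s'.mem aOrd i)) ∧ ∀ v < n, (s'.mem aPos v ≠ 0 ↔ sep v)) s := by
  classical
  have hw : 1 < word w := by omega
  refine WP.le (T := (n * (5 + 8) + 6) + (2 + ((n * (30 + 8) + 6) + 5))) ?_ (by omega)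
  refine (WP.for_straight hw (n := n) (fun k s' => ∀ v < k, s'.mem aPos v = 0) 5 (by decide) rfl rfl
    (by decide) hs.reg_n (by simp) ?_).seq hw ?_
  · intro k hk s' _ hT _ _ hI'
    refine ⟨trivial, by simp; omega, fun v hv => ?_⟩
    by_cases h : v = k
    · simp [hT, h]
    · simpa [hT, h] using hI' v (by omega)
  rintro s1 hf1 ho1 ⟨hz, -⟩
  have hp1 := hs.off ho1 rfl rfl rfl rfl
  refine WP.straight_seq hw (by decide) ⟨by simp; omega, ?_⟩
  refine (WP.for_straight hw (n := n) (fun k s' => s'.reg rTail = sepCount sep k ∧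
    Listed n (sepCount sep k) (s'.mem aOrd) (s'.mem aPos) ∧
    (∀ i < sepCount sep k, sep (s'.mem aOrd i)) ∧ ∀ v < n, (s'.mem aPos v ≠ 0 ↔ v < k ∧ sep v)) 30
    (by decide) rfl rfl (by decide) (by simp [hp1.reg_n]) ?_ ?_).seq hw ?_
  · refine ⟨by simp [sepCount], ⟨by simp [sepCount], by simp [sepCount], fun v hv h => ?_⟩,
      by simp [sepCount], fun v hv => ?_⟩
    · simp [hz v hv] at h
    · simp [hz v hv]
  · rintro k hk s2 hf2 hU hn2 ho2 ⟨h1, h2, h3, h4⟩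
    have e1 : s2.mem aSep k = if sep k then 1 else 0 := by
      rw [ho2.mem rfl, State.mem_setReg, hp1.mem_sep k hk]
    refine ⟨trivial, fun h => push_vc (by simp; omega) ?_ ?_, fun h => ?_⟩
    · have := h2.tail_le; omega
    · have hsep : sep k := by
        by_contra hc; simp [hU, e1, hc] at h
      have hpos : s2.mem aPos k = 0 := by
        by_contra hc; have := (h4 k hk).1 hc; omega
      intro s3 r1 r2 m1 m2 m3 _
      rw [hU, h1] at m2 m3
      simp only [State.mem_setReg, State.reg_setReg, sepCount_succ_of_pos hsep]
      refine ⟨by simp [r1, h1], h2.push hk hpos m2 m3, fun i hi => ?_, fun v hv => ?_⟩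
      · rw [m2]; split_ifs with hi'
        · exact hsep
        · exact h3 i (by omega)
      · rw [m3]; split_ifs with hv'
        · simp [hv', hsep]
        · rw [h4 v hv]
          constructor
          · rintro ⟨a, b⟩; exact ⟨by omega, b⟩
          · rintro ⟨a, b⟩; exact ⟨by omega, b⟩
    · have hsep : ¬ sep k := by
        intro hc; simp [hU, e1, hc] at h
      simp only [Cmd.vc, State.mem_setReg, State.reg_setReg, sepCount_succ_of_neg hsep]
      refine ⟨by simp [h1], h2, h3, fun v hv => ?_⟩
      rw [h4 v hv]
      constructor
      · rintro ⟨a, b⟩; exact ⟨by omega, b⟩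
      · rintro ⟨a, b⟩
        refine ⟨lt_of_le_of_ne (by omega) ?_, b⟩
        rintro rfl; exact hsep b
  · rintro s2 hf2 ho2 ⟨⟨h1, h2, h3, h4⟩, -⟩
    refine WP.straight_le hw (by decide) ⟨trivial, by simp [h1], by simp [h1], h2, h3, fun v hv => ?_⟩
    rw [State.mem_setReg, h4 v hv]
    exact ⟨fun h => h.2, fun h => ⟨hv, h⟩⟩

/-- Process the vertex at the head of the queue. -/
def scanNbrs : Cmd :=
  (.set rVtx (.rd aOrd (.var rHead)) ;; .set rOff (.rd aOff (.var rVtx)) ;;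
    .set rLen (.rd aOff (.var rVtx + 1) - .var rOff)) ;;
  .upto rX rLen (.set rU (.rd aNbr (.var rOff + .var rX)) ;;
    .ite (.rd aPos (.var rU)) .skip (push (.rd aStart (.var rHead)))) ;;
  .set rHead (.var rHead + 1)

/-- Start from the next vertex, unless it has been found. -/
def nextRoot : Cmd :=
  .set rU (.var rRoot) ;; .ite (.rd aPos (.var rU)) .skip (push (.var rTail)) ;;
  .set rRoot (.var rRoot + 1)

/-- Breadth-first search. -/
def bfs : Cmd :=
  (.set rHead (.var rS) ;; .set rRoot 0) ;;
  -- As head ≤ tail and root ≤ n, this one comparison fails exactly when the queue is empty and all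
  -- roots have been tried.
  .loop (.lt (.var rHead + .var rRoot) (.var rTail + .var rN))
    (.ite (.lt (.var rHead) (.var rTail)) scanNbrs nextRoot)

theorem scanNbrs_spec (hs : HasInput s n adj sep) {head tail r : ℕ}
    (h1 : s.reg rHead = head) (h2 : s.reg rTail = tail) (h3 : s.reg rRoot = r)
    (hlt : head < tail)
    (hb : Bfs n (sepCount sep n) adj sep conn head tail r (s.mem aOrd) (s.mem aPos) (s.mem aStart)) :
    WP p w scanNbrs (100 * (k + 1)) (fun s' => s'.reg rHead = head + 1 ∧ s'.reg rRoot = r ∧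
      Bfs n (sepCount sep n) adj sep conn (head + 1) (s'.reg rTail) r (s'.mem aOrd) (s'.mem aPos)
        (s'.mem aStart)) s := by
  have hw : 1 < word w := by omega
  have htn := hb.toListed.tail_le
  have hvn := hb.ord_lt head hlt
  set v := s.mem aOrd head with hv
  have hsv : ¬ sep v := by rw [hb.sep_iff head hlt]; have := hb.S_le; omega
  set d := s.mem aOff (v + 1) - s.mem aOff v with hd
  have hdk : d ≤ k := hs.lists.length_le_of_not_sep hI hvn hsv
  have hle := hs.lists.le v hvn
  refine WP.of_fits fun hf => WP.le (T := 20 + ((d * (40 + 8) + 6) + 5))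
    (WP.straight_seq hw (by decide) ?_) (by omega)
  simp only [Cmd.vc, Expr.ok_rd, Expr.ok_var, Expr.eval_rd, Expr.eval_var, State.reg_setReg,
    State.mem_setReg, Nat.reduceEqDiff, reduceIte, Expr.ok_sub, Expr.ok_add, Expr.ok_ofNat,
    Expr.eval_ofNat, Expr.eval_sub, Expr.eval_add, h1, ← hv, true_and, and_true]
  refine ⟨by omega, ?_⟩
  rw [← hd]
  set s1 := ((s.setReg rVtx v).setReg rOff (s.mem aOff v)).setReg rLen d with hs1
  have hp1 : HasInput s1 n adj sep := ((hs.setReg (by decide)).setReg (by decide)).setReg (by decide)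
  -- Besides the search invariant, each neighbour scanned so far has a position, in the separator or
  -- with the start of the head. This is what closes the head when it leaves the queue.
  refine (WP.for_straight hw (n := d) (fun x s' => head < s'.reg rTail ∧ s'.mem aOrd head = v ∧
    Bfs n (sepCount sep n) adj sep conn head (s'.reg rTail) r (s'.mem aOrd) (s'.mem aPos)
      (s'.mem aStart) ∧ ∀ y < x, ∃ j < s'.reg rTail, s'.mem aOrd j = s.mem aNbr (s.mem aOff v + y) ∧
        (sepCount sep n ≤ j → s'.mem aStart j = s'.mem aStart head)) 40
    (by decide) rfl rfl (by decide) (by simp [hs1]) ?_ ?_).seq hw ?_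
  · simp [hs1, h2, hlt, hb, hv]
  · rintro x hx s2 hf2 hX _ ho2 ⟨hI1, hI2, hI3, hI4⟩
    have e1 : s2.reg rOff = s.mem aOff v := (ho2.reg rfl).trans (by simp [hs1])
    have e2 : s2.mem aNbr = s.mem aNbr := (ho2.mem rfl).trans (by simp [hs1])
    have e3 : s2.reg rHead = head := (ho2.reg rfl).trans (by simp [hs1, h1])
    have hfit := hf.mem_lt aOff (v + 1)
    set u := s.mem aNbr (s.mem aOff v + x) with hu
    have hadj : adj v u := hs.lists.adj_nbr hvn (by omega) (by omega)
    have hun := (hI.adj_lt hadj).2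
    have htn2 := hI3.toListed.tail_le
    refine ⟨by simp [e1, hX]; omega, trivial, fun h => ?_, fun h => ?_⟩
    · simp [e1, e2, hX, ← hu] at h
      simp only [Cmd.vc, State.mem_setReg, State.reg_setReg, Nat.reduceEqDiff, reduceIte]
      refine ⟨hI1, hI2, hI3, fun y hy => ?_⟩
      rcases Nat.lt_succ_iff_lt_or_eq.1 hy with h' | rfl
      · exact hI4 y h'
      · exact hI3.nbr_found hI hI1 (by rw [hI2]; exact hadj) h
    · simp [e1, e2, hX, ← hu] at h
      refine push_vc (by simp) (by simp; omega) ?_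
      intro s3 r1 r2 m1 m2 m3 m4
      simp [e1, e2, e3, hX, ← hu] at r1 m2 m3 m4
      simp only [State.mem_setReg, State.reg_setReg, Nat.reduceEqDiff, reduceIte, r1]
      have m2' : s3.mem aOrd head = v := by rw [m2, if_neg (by omega), hI2]
      have m4' : s3.mem aStart head = s2.mem aStart head := by rw [m4, if_neg (by omega)]
      refine ⟨by omega, m2', hI3.push_nbr hI hI1 h (by rw [hI2]; exact hadj) m2 m3 m4, fun y hy => ?_⟩
      rcases Nat.lt_succ_iff_lt_or_eq.1 hy with h' | rfl
      · obtain ⟨j, hj, hj1, hj2⟩ := hI4 y h'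
        refine ⟨j, by omega, by rw [m2, if_neg (by omega), hj1], fun h'' => ?_⟩
        rw [m4, if_neg (by omega), m4', hj2 h'']
      · exact ⟨s2.reg rTail, by omega, by rw [m2, if_pos rfl], fun _ => by
          rw [m4, if_pos rfl, m4']⟩
  · rintro s2 hf2 ho2 ⟨⟨hI1, hI2, hI3, hI4⟩, -⟩
    have e3 : s2.reg rHead = head := (ho2.reg rfl).trans (by simp [hs1, h1])
    have e4 : s2.reg rRoot = r := (ho2.reg rfl).trans (by simp [hs1, h3])
    refine WP.straight_le hw (by decide) ⟨by simp [e3]; omega, by simp [e3], by simp [e4], ?_⟩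
    simp only [State.mem_setReg, State.reg_setReg, Nat.reduceEqDiff, reduceIte]
    refine hI3.pop hI1 fun u hu => ?_
    rw [hI2] at hu
    obtain ⟨x, hx1, hx2, rfl⟩ := hs.lists.exists_nbr hvn hu
    obtain ⟨j, hj⟩ := hI4 (x - s.mem aOff v) (by omega)
    rw [Nat.add_sub_cancel' hx1] at hj
    exact ⟨j, hj⟩

theorem nextRoot_vc {head tail r : ℕ}
    (h1 : s.reg rHead = head) (h2 : s.reg rTail = tail) (h3 : s.reg rRoot = r)
    (hlt : head = tail) (hr : r < n)
    (hb : Bfs n (sepCount sep n) adj sep conn head tail r (s.mem aOrd) (s.mem aPos) (s.mem aStart)) :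
    nextRoot.vc w (fun s' => s'.reg rHead = head ∧ s'.reg rRoot = r + 1 ∧
      Bfs n (sepCount sep n) adj sep conn head (s'.reg rTail) (r + 1) (s'.mem aOrd) (s'.mem aPos)
        (s'.mem aStart)) s := by
  subst hlt
  have htn := hb.toListed.tail_le
  refine ⟨trivial, trivial, fun h => ⟨by simp [h3]; omega, ?_⟩, fun h => push_vc trivial
    (by simp; omega) ?_⟩
  · simp [h3] at h
    simp [h1, h2, h3]
    exact hb.next hr h
  · simp [h3] at h
    intro s' r1 r2 m1 m2 m3 m4
    simp [h2, h3] at r1 m2 m3 m4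
    have e1 : s'.reg rRoot = r := by rw [r2 _ (by decide)]; simp [h3]
    have e2 : s'.reg rHead = head := by rw [r2 _ (by decide)]; simp [h1]
    refine ⟨by simp [e1]; omega, by simp [e2], by simp [e1], ?_⟩
    simp only [State.mem_setReg, State.reg_setReg, Nat.reduceEqDiff, reduceIte, r1]
    exact (hb.push_root hI hr h m2 m3 m4).next hr (by rw [m3, if_pos rfl]; omega)

theorem bfs_spec (hs : HasInput s n adj sep) (h1 : s.reg rS = sepCount sep n)
    (h2 : s.reg rTail = sepCount sep n)
    (hlist : Listed n (sepCount sep n) (s.mem aOrd) (s.mem aPos))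
    (hsep : ∀ i < sepCount sep n, sep (s.mem aOrd i))
    (hpos : ∀ v < n, (s.mem aPos v ≠ 0 ↔ sep v)) :
    WP p w bfs (20 + 2 * n * (100 * (k + 1) + 20)) (fun s' => s'.reg rS = sepCount sep n ∧
      Bfs n (sepCount sep n) adj sep conn n n n (s'.mem aOrd) (s'.mem aPos) (s'.mem aStart)) s := by
  have hw : 1 < word w := by omega
  have hSn := sepCount_le sep n
  refine WP.le (T := 4 + (2 * n * (100 * (k + 1) + 20) + 10)) (WP.straight_seq hw (by decide)
    ⟨trivial, by simp; omega, ?_⟩) (by omega)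
  set s1 := (s.setReg rHead (Expr.eval s (.var rS))).setReg rRoot
    (Expr.eval (s.setReg rHead (Expr.eval s (.var rS))) 0) with hs1
  have hp1 : HasInput s1 n adj sep := (hs.setReg (by decide)).setReg (by decide)
  refine WP.mono hw (WP.while_ hw (fun B s' => ∃ head tail r, s'.reg rHead = head ∧
      s'.reg rTail = tail ∧ s'.reg rRoot = r ∧ Bfs n (sepCount sep n) adj sep conn head tail r
        (s'.mem aOrd) (s'.mem aPos) (s'.mem aStart) ∧
      B = ((n - head) + (n - r)) * (100 * (k + 1) + 20)) ?_
      ((n - sepCount sep n + (n - 0)) * (100 * (k + 1) + 20)) ?_) ?_ ?_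
  · rintro B s2 hf2 ho2 ⟨head, tail, r, e1, e2, e3, hb, rfl⟩
    have hp2 := hp1.off ho2 rfl rfl rfl rfl
    have htn := hb.toListed.tail_le
    have hht := hb.head_le
    have hrn := hb.r_le
    refine ⟨by simp [e1, e2, e3, hp2.reg_n]; omega, fun h => ?_⟩
    rw [Expr.eval_lt_ne_zero] at h
    simp only [Expr.eval_add, Expr.eval_var, e1, e2, e3, hp2.reg_n] at h
    have hc : (Expr.lt (.var rHead + .var rRoot) (.var rTail + .var rN)).cost + 1 = 8 := rfl
    rw [hc]
    -- Each pass advances either the head or the root, so `(n - head) + (n - r)` drops by one.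
    refine ⟨4 + 100 * (k + 1), ((n - head) + (n - r) - 1) * (100 * (k + 1) + 20), ?_, ?_⟩
    · obtain ⟨m, hm⟩ : ∃ m, (n - head) + (n - r) = m + 1 := ⟨n - head + (n - r) - 1, by omega⟩
      rw [hm, Nat.add_sub_cancel]
      nlinarith
    · refine WP.ite (T := 100 * (k + 1)) hw (by simp) (fun h' => ?_) fun h' => ?_
      · rw [Expr.eval_lt_ne_zero] at h'
        simp only [Expr.eval_var, e1, e2] at h'
        refine WP.mono hw (scanNbrs_spec hI hbig hp2 e1 e2 e3 h' hb) le_rfl ?_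
        rintro s3 _ _ ⟨a1, a2, a3⟩
        exact ⟨head + 1, _, r, a1, rfl, a2, a3, by congr 1; omega⟩
      · rw [Expr.eval_lt_eq_zero] at h'
        simp only [Expr.eval_var, e1, e2] at h'
        refine WP.mono hw (WP.straight hw _ (nextRoot_vc hI hbig e1 e2 e3 (by omega) (by omega) hb))
          (le_trans (b := 100) (by decide) (by omega)) ?_
        rintro s3 _ _ ⟨a1, a2, a3⟩
        exact ⟨head, _, r + 1, a1, rfl, a2, a3, by congr 1; omega⟩
  · refine ⟨sepCount sep n, sepCount sep n, 0, by simp [hs1, h1], by simp [hs1, h2], by simp [hs1],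
      ?_, rfl⟩
    have hvac : ∀ i, sepCount sep n ≤ i → i < sepCount sep n → False := fun i _ _ => by omega
    exact ⟨hlist, le_rfl, le_rfl, by omega, fun i hi => ⟨fun _ => hi, fun _ => hsep i hi⟩,
      fun v hv hv' => (hpos v hv).2 hv', fun i a b => (hvac i a b).elim,
      fun i j a b c => by omega, fun i j a b => (hvac i a b).elim, fun i a b => (hvac i a b).elim,
      fun i a b => (hvac i a b).elim, fun v hv => by omega⟩
  · have hc : (Expr.lt (.var rHead + .var rRoot) (.var rTail + .var rN)).cost + 1 = 8 := rfl
    rw [add_assoc _ _ 1, hc]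
    have : (n - sepCount sep n + (n - 0)) * (100 * (k + 1) + 20) ≤ 2 * n * (100 * (k + 1) + 20) :=
      Nat.mul_le_mul_right _ (by omega)
    omega
  · rintro s2 hf2 ho2 ⟨h0, B', head, tail, r, e1, e2, e3, hb, -⟩
    have hp2 := hp1.off ho2 rfl rfl rfl rfl
    rw [Expr.eval_lt_eq_zero] at h0
    simp only [Expr.eval_add, Expr.eval_var, e1, e2, e3, hp2.reg_n] at h0
    have htn := hb.toListed.tail_le
    have hht := hb.head_le
    have hrn := hb.r_le
    obtain rfl : r = n := by omega
    obtain rfl := hb.tail_eq_of_done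
    obtain rfl : head = tail := by omega
    exact ⟨(ho2.reg rfl).trans (by simp [hs1, h1]), hb⟩

end

/-! ### A compressed adjacency table with n rows and L columns. -/

/-- The column of the table `aRow` for the vertex at position `b`. -/
def col (S : ℕ) (st : ℕ → ℕ) (b : ℕ) : ℕ := if b < S then b else S + (b - st b)

/-- Whether the pair of positions is represented in the row of `a`. -/
def Hit (S : ℕ) (st : ℕ → ℕ) (a b : ℕ) : Prop := b < S ∨ (S ≤ a ∧ S ≤ b ∧ st a = st b)

open Classical in
/-- The adjacency matrix with respect to an order of the vertices. -/
noncomputable def ordAdj (n : ℕ) (adj : ℕ → ℕ → Prop) (ord : ℕ → ℕ) (a b : ℕ) : ℕ :=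
  if a < n ∧ b < n ∧ adj (ord a) (ord b) then 1 else 0

/-- Compute the number of columns of the table. -/
def maxWidth : Cmd :=
  .set rL (.var rS) ;;
  .upto rT rN (.ite (.lt (.var rT) (.var rS)) .skip
    (.set rU (.var rS + (.var rT + 1 - .rd aStart (.var rT))) ;;
      .ite (.lt (.var rL) (.var rU)) (.set rL (.var rU)) .skip))

def clearRows : Cmd :=
  .set rCnt (.var rN * .var rL) ;; .upto rT rCnt (.put aRow (.var rT) 0)

def fillBody : Cmd :=
  .set rU (.rd aPos (.rd aNbr (.var rOff + .var rX)) - 1) ;;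
  .ite (.lt (.var rU) (.var rS)) (.put aRow (.var rI * .var rL + .var rU) 1)
    -- An edge from a separator vertex to one outside is recorded in the row of the latter only.
    (.ite (.lt (.var rI) (.var rS)) .skip
      (.put aRow (.var rI * .var rL + (.var rS + (.var rU - .rd aStart (.var rU)))) 1))

def fillRows : Cmd :=
  .upto rI rN ((.set rVtx (.rd aOrd (.var rI)) ;; .set rOff (.rd aOff (.var rVtx)) ;;
    .set rLen (.rd aOff (.var rVtx + 1) - .var rOff)) ;; .upto rX rLen fillBody)

/-- Draw the random bits, order the vertices, and prepare the table for the adjacency test. -/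
def prepare (m : ℕ) : Cmd :=
  drawCoins m ;; listSep ;; bfs ;; maxWidth ;; clearRows ;; fillRows

/-- For the time of filling the table: only the separator vertices, at most k in number, may have
more than k neighbours. -/
theorem sum_ite_lt_le (n S X : ℕ) : ∑ a ∈ range n, (if a < S then X else 0) ≤ S * X := by
  rw [← sum_filter, sum_const, smul_eq_mul]
  refine Nat.mul_le_mul_right _ ?_
  exact (card_le_card (t := range S) fun a ha => mem_range.2 (mem_filter.1 ha).2).trans_eq
    (card_range S)

section
variable {p : Prog} {w n k : ℕ} {adj : ℕ → ℕ → Prop} {sep : ℕ → Prop} {conn : ℕ → ℕ → Prop}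
  {s : State} (hI : IsInstance n k adj sep conn) (hbig : 2000 + 20 * n + 2 * (n * n) ≤ word w)

include hI in
theorem isAdj_ordAdj (ord : ℕ → ℕ) : IsAdj (ordAdj n adj ord) := by
  refine ⟨fun u v => ?_, fun u v => ?_, fun u => ?_⟩
  · unfold ordAdj; split_ifs <;> omega
  · have : (u < n ∧ v < n ∧ adj (ord u) (ord v)) ↔ (v < n ∧ u < n ∧ adj (ord v) (ord u)) :=
      ⟨fun h => ⟨h.2.1, h.1, hI.symm h.2.2⟩, fun h => ⟨h.2.1, h.1, hI.symm h.2.2⟩⟩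
    classical
    exact if_congr this rfl rfl
  · simp [ordAdj, hI.irrefl]

/-- `L` columns suffice. -/
structure IsWidth (n S L : ℕ) (st : ℕ → ℕ) : Prop where
  le_n : L ≤ n
  S_le : S ≤ L
  le : ∀ a, S ≤ a → a < n → S + (a + 1 - st a) ≤ L

/-- If one of the two vertices is in the separator, the row of the other has a column for it. If
neither is, they are adjacent only when they share a component, and then the offset in the component
is the column. -/
theorem layout_of_bfs {L : ℕ} {ord pos st row : ℕ → ℕ} (hI : IsInstance n k adj sep conn)
    (hb : Bfs n (sepCount sep n) adj sep conn n n n ord pos st)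
    (hL : IsWidth n (sepCount sep n) L st)
    (hrow : ∀ a < n, ∀ b < n, Hit (sepCount sep n) st a b →
      row (a * L + col (sepCount sep n) st b) = ordAdj n adj ord a b) :
    Layout n (sepCount sep n) L st row (ordAdj n adj ord) := by
  have hA := isAdj_ordAdj hI ord
  have hst : ∀ a b, sepCount sep n ≤ a → sepCount sep n ≤ b → a < n → b < n →
      ordAdj n adj ord a b ≠ 0 → st a = st b := by
    intro a b ha hb' han hbn hab
    have : adj (ord a) (ord b) := by
      by_contra hc; simp [ordAdj, hc] at hab
    obtain ⟨j, hj, hjb, h⟩ := hb.closed a ha han _ this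
    obtain rfl := hb.toListed.inj hj hbn hjb
    exact (h hb').symm
  refine ⟨hA, sepCount_le sep n, hL.le_n, hL.S_le, hst, ?_, ?_, ?_⟩
  · intro a b c ha hab hbc hc hac
    exact hb.st_eq_of_le ha hab hbc hc hac
  · intro a b ha hab hbn hab'
    have h1 := hL.le b (by omega) hbn
    have h2 := hb.st_le a ha (by omega)
    omega
  · intro a b ha hb'
    split_ifs with h1 h2 h3
    · have := hrow b hb' a ha (Or.inl h1)
      rw [col, if_pos h1] at this
      rw [this, hA.symm]
    · have := hrow a ha b hb' (Or.inl h2)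
      rwa [col, if_pos h2] at this
    · have := hrow a ha b hb' (Or.inr ⟨by omega, by omega, h3⟩)
      rwa [col, if_neg h2] at this
    · by_contra hc
      exact h3 (hst a b (by omega) (by omega) ha hb' (Ne.symm hc))

include hI hbig

/-- The number k is not part of the input. The width L is computed from the components found, and
the separator property gives L ≤ k. -/
theorem maxWidth_spec (hs : HasInput s n adj sep) (h1 : s.reg rS = sepCount sep n)
    {ord pos : ℕ → ℕ}
    (hb : Bfs n (sepCount sep n) adj sep conn n n n ord pos (s.mem aStart)) :
    WP p w maxWidth (60 * (n + 1)) (fun s' => IsWidth n (sepCount sep n) (s'.reg rL) (s.mem aStart) ∧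
      s'.reg rL ≤ k) s := by
  have hw : 1 < word w := by omega
  have hSk : sepCount sep n ≤ k := by
    have := hI.card_le ∅ (by simp) (by simp)
    simpa using this
  have hSn := sepCount_le sep n
  refine WP.le (T := 2 + (n * (40 + 8) + 6)) (WP.straight_seq hw (by decide) ⟨trivial, ?_⟩) (by omega)
  set s1 := s.setReg rL (Expr.eval s (.var rS)) with hs1
  refine WP.mono hw (WP.for_straight hw (n := n) (fun t s' => s'.reg rL ≤ n ∧
    sepCount sep n ≤ s'.reg rL ∧ (∀ a, sepCount sep n ≤ a → a < t →
      sepCount sep n + (a + 1 - s.mem aStart a) ≤ s'.reg rL) ∧ s'.reg rL ≤ k) 40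
    (by decide) rfl rfl (by decide) (by simp [hs1, hs.reg_n]) ?_ ?_) le_rfl ?_
  · simp [hs1, h1, hSn, hSk]
  · rintro a ha s2 hf2 hT _ ho2 ⟨i1, i2, i3, i4⟩
    have e1 : s2.reg rS = sepCount sep n := (ho2.reg rfl).trans (by simp [hs1, h1])
    have e2 : s2.mem aStart = s.mem aStart := (ho2.mem rfl).trans (by simp [hs1])
    refine ⟨by simp, fun h => ?_, fun h => ?_⟩
    · rw [Expr.eval_lt_ne_zero] at h
      simp only [Expr.eval_var, hT, e1] at h
      simp only [Cmd.vc, State.reg_setReg, Nat.reduceEqDiff, reduceIte]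
      exact ⟨i1, i2, fun b hb hb' => i3 b hb (by omega), i4⟩
    · rw [Expr.eval_lt_eq_zero] at h
      simp only [Expr.eval_var, hT, e1] at h
      have hsa := hb.st_le a (by omega) ha
      have hka := hb.card_le hI (a := s.mem aStart a) (b := a) hsa.1 ha hsa.2.2
      simp [Cmd.vc, hT, e1, e2]
      refine ⟨by omega, fun h' => ⟨by omega, fun b hb hb' => ?_, by omega⟩,
        fun h' => ⟨i1, i2, fun b hb hb' => ?_, i4⟩⟩
      · by_cases hba : b = a
        · subst hba; omega
        · have := i3 b hb (by omega); omega
      · by_cases hba : b = a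
        · subst hba; omega
        · have := i3 b hb (by omega); omega
  · rintro s2 hf2 ho2 ⟨⟨i1, i2, i3, i4⟩, -⟩
    exact ⟨⟨i1, i2, i3⟩, i4⟩

omit hI in
theorem clearRows_spec {L : ℕ} (h0 : s.reg rN = n) (h1 : s.reg rL = L) (hLn : L ≤ n) :
    WP p w clearRows (30 * (n * L + 1)) (fun s' => ∀ t < n * L, s'.mem aRow t = 0) s := by
  have hw : 1 < word w := by omega
  have hnL : n * L ≤ n * n := Nat.mul_le_mul_left _ hLn
  refine WP.le (T := 5 + (n * L * (5 + 8) + 6)) (WP.straight_seq hw (by decide)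
    ⟨by simp [h0, h1]; omega, ?_⟩) (by omega)
  refine WP.mono hw (WP.for_straight hw (n := n * L) (fun k s' => ∀ t < k, s'.mem aRow t = 0) 5
    (by decide) rfl rfl (by decide) (by simp [h0, h1]) (by simp) ?_) le_rfl fun _ _ _ h => h.1
  intro k hk s' _ hT _ _ hI'
  refine ⟨trivial, by simp; omega, fun v hv => ?_⟩
  by_cases h : v = k
  · simp [hT, h]
  · simpa [hT, h] using hI' v (by omega)

omit hI hbig in
theorem mul_add_inj {L a a' c c' : ℕ} (hc : c < L) (hc' : c' < L) (h : a * L + c = a' * L + c') :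
    a = a' ∧ c = c' := by
  have h1 : (a * L + c) / L = a := by
    rw [mul_comm, Nat.mul_add_div (by omega), Nat.div_eq_of_lt hc, add_zero]
  have h2 : (a' * L + c') / L = a' := by
    rw [mul_comm, Nat.mul_add_div (by omega), Nat.div_eq_of_lt hc', add_zero]
  have : a = a' := by rw [← h1, ← h2, h]
  subst this
  exact ⟨rfl, by omega⟩

/-- The table starts at zero, so only neighbours have to be written. Separator rows take up to n
steps each and the others up to k, which is O(nk) altogether. -/
theorem fillRows_spec {L : ℕ} (hs : HasInput s n adj sep) (h1 : s.reg rS = sepCount sep n)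
    (h2 : s.reg rL = L) (hb : Bfs n (sepCount sep n) adj sep conn n n n (s.mem aOrd) (s.mem aPos)
      (s.mem aStart)) (hL : IsWidth n (sepCount sep n) L (s.mem aStart))
    (hz : ∀ t < n * L, s.mem aRow t = 0) :
    WP p w fillRows (200 * ((n + 1) * (k + 1))) (fun s' => ∀ a < n, ∀ b < n,
      Hit (sepCount sep n) (s.mem aStart) a b → s'.mem aRow (a * L +
        col (sepCount sep n) (s.mem aStart) b) = ordAdj n adj (s.mem aOrd) a b) s := by
  have hw : 1 < word w := by omega
  set S := sepCount sep n with hS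
  set st := s.mem aStart with hst
  set ord := s.mem aOrd with hord
  have hSk : S ≤ k := by
    have := hI.card_le ∅ (by simp) (by simp)
    simpa using this
  have hcol : ∀ b < n, col S st b < L := by
    intro b hbn
    unfold col
    split_ifs with h
    · have := hL.S_le; omega
    · have := hL.le b (by omega) hbn
      have := hb.st_le b (by omega) hbn
      omega
  -- Within one row, vertices of the separator use columns below S and vertices of the component of
  -- the row use distinct columns from S on, so nothing is overwritten.
  have hcolinj : ∀ a b b', b < n → b' < n → Hit S st a b → Hit S st a b' →
      col S st b = col S st b' → b = b' := by
    intro a b b' hb1 hb2 hh hh' hc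
    simp only [Hit] at hh hh'
    unfold col at hc
    split_ifs at hc with h3 h4 h4
    · exact hc
    · omega
    · omega
    · have := hb.st_le b (by omega) hb1
      have := hb.st_le b' (by omega) hb2
      omega
  have hidx : ∀ a < n, ∀ b < n, a * L + col S st b < n * L := by
    intro a ha b hb'
    have h3 : (a + 1) * L ≤ n * L := Nat.mul_le_mul_right _ ha
    have := hcol b hb'
    rw [Nat.add_mul] at h3; omega
  have hnL : n * L ≤ n * n := Nat.mul_le_mul_left _ hL.le_n
  refine WP.mono hw (WP.for_ hw (n := n) (fun i s' => ∀ a < n, ∀ b < n, Hit S st a b →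
      s'.mem aRow (a * L + col S st b) = if a < i then ordAdj n adj ord a b else 0)
    (fun a => 30 + ((if a < S then n else 0) * (70 + 8) + k * (70 + 8) + 6)) rfl rfl (by decide)
    hs.reg_n ?_ ?_) ?_ ?_
  · intro a ha b hb' _
    simpa using hz _ (hidx a ha b hb')
  · intro i hi s1 hf1 hT1 _ ho1 hinv
    have hp1 := hs.off ho1 rfl rfl rfl rfl
    have e1 : s1.mem aOrd = ord := ho1.mem rfl
    have e2 : s1.mem aPos = s.mem aPos := ho1.mem rfl
    have e3 : s1.mem aStart = st := ho1.mem rfl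
    have e4 : s1.reg rS = S := (ho1.reg rfl).trans h1
    have e5 : s1.reg rL = L := (ho1.reg rfl).trans h2
    set v := ord i with hv
    have hvn : v < n := hb.ord_lt i hi
    set d := s1.mem aOff (v + 1) - s1.mem aOff v with hd
    have hle := hp1.lists.le v hvn
    have hdle : d ≤ (if i < S then n else 0) + k := by
      split_ifs with h
      · have := hp1.lists.length_le hI hvn; omega
      · have := hp1.lists.length_le_of_not_sep hI hvn (by rw [hb.sep_iff i hi]; omega)
        omega
    refine WP.le (T := 30 + (d * (70 + 8) + 6)) (WP.straight_seq hw (by decide) ?_) ?_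
    swap
    · have := Nat.mul_le_mul_right (70 + 8) hdle
      rw [Nat.add_mul] at this; omega
    simp only [Cmd.vc, Expr.ok_rd, Expr.ok_var, Expr.eval_rd, Expr.eval_var, State.reg_setReg,
      State.mem_setReg, Nat.reduceEqDiff, reduceIte, Expr.ok_sub, Expr.ok_add, Expr.ok_ofNat,
      Expr.eval_ofNat, Expr.eval_sub, Expr.eval_add, hT1, e1, ← hv, true_and, and_true]
    refine ⟨by omega, ?_⟩
    rw [← hd]
    set s2 := ((s1.setReg rVtx v).setReg rOff (s1.mem aOff v)).setReg rLen d with hs2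
    classical
    obtain ⟨Seen, hSeen⟩ : ∃ P : ℕ → ℕ → Prop, ∀ x b, P x b ↔
      ∃ y < x, s1.mem aNbr (s1.mem aOff v + y) = ord b := ⟨_, fun _ _ => Iff.rfl⟩
    refine WP.mono hw (WP.for_straight hw (n := d) (fun x s' => ∀ a < n, ∀ b < n, Hit S st a b →
      s'.mem aRow (a * L + col S st b) = if a < i then ordAdj n adj ord a b else
        if a = i ∧ Seen x b then 1 else 0) 70
      (by decide) rfl rfl (by decide) (by simp [hs2]) ?_ ?_) le_rfl ?_
    · intro a ha b hb' hh
      have : ¬ Seen 0 b := by rw [hSeen]; simp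
      simpa [hs2, this] using hinv a ha b hb' hh
    · intro x hx s3 hf3 hX _ ho3 hinv3
      have f1 : s3.reg rOff = s1.mem aOff v := (ho3.reg rfl).trans (by simp [hs2])
      have f2 : s3.mem aNbr = s1.mem aNbr := (ho3.mem rfl).trans (by simp [hs2])
      have f3 : s3.mem aPos = s.mem aPos := (ho3.mem rfl).trans (by simp [hs2, e2])
      have f4 : s3.reg rS = S := (ho3.reg rfl).trans (by simp [hs2, e4])
      have f5 : s3.reg rI = i := (ho3.reg rfl).trans (by simp [hs2, hT1])
      have f6 : s3.reg rL = L := (ho3.reg rfl).trans (by simp [hs2, e5])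
      have f7 : s3.mem aStart = st := (ho3.mem rfl).trans (by simp [hs2, e3])
      have hfit := hf1.mem_lt aOff (v + 1)
      set u := s1.mem aNbr (s1.mem aOff v + x) with hu
      have hadj : adj v u := hp1.lists.adj_nbr hvn (by omega) (by omega)
      have hun := (hI.adj_lt hadj).2
      obtain ⟨j, hj, hju, hjst⟩ : ∃ j < n, ord j = u ∧ (i < S ∨ j < S ∨ st j = st i) := by
        obtain ⟨j, hj, hju⟩ := hb.ord_pos u hun (hb.seen u hun)
        refine ⟨j, hj, hju, ?_⟩
        by_cases hiS : i < S
        · exact Or.inl hiS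
        · obtain ⟨j', hj', hju', h⟩ := hb.closed i (by omega) hi u hadj
          obtain rfl := hb.toListed.inj hj hj' (hju.trans hju'.symm)
          by_cases hjS : j < S
          · exact Or.inr (Or.inl hjS)
          · exact Or.inr (Or.inr (h (by omega)))
      have hpu : s.mem aPos u = j + 1 := by rw [← hju]; exact hb.pos_ord j hj
      have hij := hidx i hi j hj
      have step : ∀ a < n, ∀ b < n, Hit S st a b → (a = i ∧ b = j → False) →
          ((if a < i then ordAdj n adj ord a b else
            if a = i ∧ Seen x b then 1 else 0) =
          (if a < i then ordAdj n adj ord a b else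
            if a = i ∧ Seen (x + 1) b then 1 else 0)) := by
        intro a ha b hb' _ hne
        have : (a = i ∧ Seen x b) ↔ (a = i ∧ Seen (x + 1) b) := by
          rw [hSeen, hSeen]
          refine and_congr_right fun hai => ⟨fun ⟨y, hy, h⟩ => ⟨y, by omega, h⟩, fun ⟨y, hy, h⟩ => ?_⟩
          rcases Nat.lt_succ_iff_lt_or_eq.1 hy with h' | rfl
          · exact ⟨y, h', h⟩
          · exact (hne ⟨hai, hb.toListed.inj hb' hj (by rw [hju, hu, h])⟩).elim
        simp only [this]
      have fin : ∀ f : ℕ → ℕ, Hit S st i j → (∀ t, f t =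
          if t = i * L + col S st j then 1 else s3.mem aRow t) →
          ∀ a < n, ∀ b < n, Hit S st a b → f (a * L + col S st b) =
            if a < i then ordAdj n adj ord a b else
            if a = i ∧ Seen (x + 1) b then 1 else 0 := by
        intro f hhij h4 a ha b hb' hh
        rw [h4]
        by_cases c1 : a * L + col S st b = i * L + col S st j
        · obtain ⟨rfl, hc⟩ := mul_add_inj (hcol b hb') (hcol j hj) c1
          obtain rfl := hcolinj a b j hb' hj hh hhij hc
          have : Seen (x + 1) b := (hSeen _ _).2 ⟨x, by omega, by rw [hju]⟩
          simp [this]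
        · rw [if_neg c1, hinv3 a ha b hb' hh,
            step a ha b hb' hh (by rintro ⟨rfl, rfl⟩; exact c1 rfl)]
      have hiL : i * L ≤ n * L := Nat.mul_le_mul_right _ hi.le
      simp [fillBody, Cmd.vc, f1, f2, f3, f4, f5, f6, f7, hX, ← hu, hpu]
      refine ⟨⟨by omega, by omega⟩, fun hjS => ⟨by omega, by omega, ?_⟩, fun hjS => ⟨fun hiS => ?_,
        fun hiS => ⟨?_, by omega, ?_⟩⟩⟩
      · refine fin (fun t => if t = i * L + j then 1 else s3.mem aRow t) (Or.inl hjS) fun t => ?_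
        simp [col, hjS]
      · intro a ha b hb' hh
        rw [hinv3 a ha b hb' hh, step a ha b hb' hh]
        rintro ⟨rfl, rfl⟩
        simp only [Hit] at hh; omega
      · have : i * L + col S st j = i * L + (S + (j - st j)) := by rw [col, if_neg (by omega)]
        omega
      · refine fin (fun t => if t = i * L + (S + (j - st j)) then 1 else s3.mem aRow t)
          (Or.inr ⟨by omega, by omega, by omega⟩) fun t => ?_
        simp [col, show ¬ j < S by omega]
    · rintro s3 hf3 ho3 ⟨hinv3, -⟩ a ha b hb' hh
      have := hinv3 a ha b hb' hh
      simp only [this]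
      have hA : a = i → (Seen d b ↔ adj (ord a) (ord b)) := by
        rintro rfl
        rw [← hv, hSeen]
        constructor
        · rintro ⟨y, hy, h⟩
          rw [← h]; exact hp1.lists.adj_nbr hvn (by omega) (by omega)
        · intro h
          obtain ⟨y, hy1, hy2, hy⟩ := hp1.lists.exists_nbr hvn h
          exact ⟨y - s1.mem aOff v, by omega, by rw [Nat.add_sub_cancel' hy1, hy]⟩
      by_cases hai : a = i
      · have hA := hA hai
        subst hai
        simp [hA, ordAdj, hi, hb']
      · have : a < i ↔ a < i + 1 := by omega
        simp [hai, this]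
  · have : ∑ a ∈ range n, (30 + ((if a < S then n else 0) * (70 + 8) + k * (70 + 8) + 6) + 8) =
        (∑ a ∈ range n, if a < S then n else 0) * 78 + n * (k * 78 + 44) := by
      rw [sum_mul]
      simp only [sum_add_distrib, sum_const, card_range, smul_eq_mul]
      ring
    rw [this]
    have h5 := (sum_ite_lt_le n S n).trans (Nat.mul_le_mul_right n hSk)
    nlinarith
  · rintro s2 _ _ ⟨h3, -⟩ a ha b hb' hh
    rw [h3 a ha b hb' hh, if_pos ha]

end

/-! ### Copies in sets of vertices -/

/-- `X 0 < … < X (x - 1)` are the elements of `T`. -/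
structure Enum (T : Finset ℕ) (x : ℕ) (X : ℕ → ℕ) : Prop where
  mono : ∀ i j, i < j → j < x → X i < X j
  image : (range x).image X = T

namespace Enum

variable {T : Finset ℕ} {x : ℕ} {X X' : ℕ → ℕ}

theorem mem (h : Enum T x X) {i : ℕ} (hi : i < x) : X i ∈ T := by
  rw [← h.image]; exact mem_image_of_mem _ (mem_range.2 hi)

theorem exists_eq (h : Enum T x X) {u : ℕ} (hu : u ∈ T) : ∃ i < x, X i = u := by
  rw [← h.image] at hu
  obtain ⟨i, hi, rfl⟩ := mem_image.1 hu
  exact ⟨i, mem_range.1 hi, rfl⟩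

theorem inj (h : Enum T x X) {i j : ℕ} (hi : i < x) (hj : j < x) (hij : X i = X j) : i = j := by
  rcases lt_trichotomy i j with h' | h' | h'
  · have := h.mono i j h' hj; omega
  · exact h'
  · have := h.mono j i h' hi; omega

theorem card (h : Enum T x X) : T.card = x := by
  rw [← h.image, card_image_of_injOn, card_range]
  exact fun i hi j hj => h.inj (by simpa using hi) (by simpa using hj)

theorem part (h : Enum T x X) {n : ℕ} (hT : T ⊆ range n) : Part n x X :=
  ⟨fun _ hi => mem_range.1 (hT (h.mem hi)), h.mono⟩

theorem push (h : Enum T x X) {u : ℕ} (hu : ∀ v ∈ T, v < u)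
    (h1 : ∀ i, X' i = if i = x then u else X i) : Enum (insert u T) (x + 1) X' := by
  have o1 : ∀ i < x, X' i = X i := fun i hi => by rw [h1, if_neg (by omega)]
  have o2 : X' x = u := by rw [h1, if_pos rfl]
  refine ⟨fun i j hij hj => ?_, ?_⟩
  · rcases Nat.lt_succ_iff_lt_or_eq.1 hj with hj | rfl
    · rw [o1 i (by omega), o1 j hj]; exact h.mono i j hij hj
    · rw [o1 i hij, o2]; exact hu _ (h.mem hij)
  · rw [range_add_one, image_insert, o2, ← h.image]
    congr 1
    exact image_congr fun i hi => o1 i (by simpa using hi)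

theorem congr (h : Enum T x X) (h1 : ∀ i < x, X' i = X i) : Enum T x X' := by
  refine ⟨fun i j hij hj => ?_, ?_⟩
  · rw [h1 i (by omega), h1 j hj]; exact h.mono i j hij hj
  · rw [← h.image]
    exact image_congr fun i hi => h1 i (by simpa using hi)

end Enum

/-- The labelled induced copies of `h` in `T`. -/
def copies (h : Fin 4 → Fin 4 → Bool) (A : ℕ → ℕ → ℕ) (T : Finset ℕ) : Finset (Fin 4 → ℕ) :=
  (Fintype.piFinset fun _ => T).filter fun f =>
    ∀ i j, i ≠ j → f i ≠ f j ∧ (A (f i) (f j) = 1 ↔ h i j = true)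

theorem mem_copies {h : Fin 4 → Fin 4 → Bool} {A : ℕ → ℕ → ℕ} {T : Finset ℕ} {f : Fin 4 → ℕ} :
    f ∈ copies h A T ↔ (∀ i, f i ∈ T) ∧
      ∀ i j, i ≠ j → f i ≠ f j ∧ (A (f i) (f j) = 1 ↔ h i j = true) := by
  simp [copies]

theorem Enum.indCount_eq {T : Finset ℕ} {x : ℕ} {X : ℕ → ℕ} (hT : Enum T x X)
    (h : Fin 4 → Fin 4 → Bool) (A : ℕ → ℕ → ℕ) :
    indCount h (sub A X) x = (copies h A T).card := by
  refine card_bij (fun f _ i => X (f i)) (fun f hf => ?_) (fun f _ g _ hfg => ?_) fun f hf => ?_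
  · have hf := (mem_filter.1 hf).2
    refine mem_copies.2 ⟨fun i => hT.mem (f i).2, fun i j hij => ⟨fun hc => ?_, (hf i j hij).2⟩⟩
    exact (hf i j hij).1 (Fin.ext (hT.inj (f i).2 (f j).2 hc))
  · ext i
    exact hT.inj (f i).2 (g i).2 (congrFun hfg i)
  · obtain ⟨h1, h2⟩ := mem_copies.1 hf
    choose g hg hgf using fun i => hT.exists_eq (h1 i)
    refine ⟨fun i => ⟨g i, hg i⟩, mem_filter.2 ⟨mem_univ _, fun i j hij => ⟨fun hc => ?_, ?_⟩⟩,
      funext hgf⟩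
    · refine (h2 i j hij).1 ?_
      rw [← hgf, ← hgf, Fin.mk.inj_iff.1 hc]
    · simpa only [sub, hgf] using (h2 i j hij).2

theorem four_le_card {h : Fin 4 → Fin 4 → Bool} {A : ℕ → ℕ → ℕ} {T : Finset ℕ} {f : Fin 4 → ℕ}
    (hf : f ∈ copies h A T) : 4 ≤ T.card := by
  obtain ⟨h1, h2⟩ := mem_copies.1 hf
  have : Function.Injective f := fun i j hij => by
    by_contra hc; exact (h2 i j hc).1 hij
  calc 4 = (univ.image f).card := by rw [card_image_of_injective _ this]; simp
    _ ≤ T.card := card_le_card fun v hv => by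
      obtain ⟨i, -, rfl⟩ := mem_image.1 hv
      exact h1 i

/-! ### Shrinking a set while its count stays nonzero. -/

/-- Whether the index `i` is selected by the bit mask. -/
def Sel (mask i : ℕ) : Prop := (mask >>> (i % 5)) % 2 ≠ 0

instance (mask i : ℕ) : Decidable (Sel mask i) := inferInstanceAs (Decidable (_ ≠ _))

/-- The elements whose indices are selected by the bit mask. -/
def selSet (X : ℕ → ℕ) (x mask : ℕ) : Finset ℕ := ((range x).filter (Sel mask)).image X

theorem selSet_subset {T : Finset ℕ} {x : ℕ} {X : ℕ → ℕ} (hT : Enum T x X) (mask : ℕ) :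
    selSet X x mask ⊆ T := by
  rw [← hT.image]
  exact image_subset_image (filter_subset _ _)

/-- The five bits of the mask describe the complement of J. As J is nonempty, the full mask 31 does
not occur. -/
theorem exists_mask (J : Finset (Fin 5)) (hJ : J.Nonempty) :
    ∃ mask < 31, ∀ j : Fin 5, Sel mask j ↔ j ∉ J := by
  revert J; decide

theorem exists_not_sel (mask : ℕ) (h : mask < 31) : ∃ j : Fin 5, ¬ Sel mask j := by
  interval_cases mask <;> decide

theorem sel_mod (mask i : ℕ) : Sel mask (i % 5) ↔ Sel mask i := by
  simp [Sel]

/-- Some residue class modulo 5 is dropped entirely, and each class contains at least ⌊x / 5⌋ of the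
indices below x. -/
theorem card_selSet_le (X : ℕ → ℕ) (x mask : ℕ) (h : mask < 31) :
    (selSet X x mask).card + x / 5 ≤ x := by
  obtain ⟨j, hj⟩ := exists_not_sel mask h
  have h1 : (selSet X x mask).card ≤ ((range x).filter (Sel mask)).card := card_image_le
  have h2 : ((range x).filter (Sel mask)).card + ((range x).filter fun i => ¬ Sel mask i).card = x := by
    rw [card_filter_add_card_filter_not, card_range]
  have h3 : (range (x / 5)).card ≤ ((range x).filter fun i => ¬ Sel mask i).card := by
    refine card_le_card_of_injOn (fun i => 5 * i + j) (fun i hi => ?_) fun i _ i' _ h => ?_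
    · have hi : i < x / 5 := by simpa using hi
      refine mem_filter.2 ⟨mem_range.2 (by have := j.2; dsimp only; omega), ?_⟩
      rw [← sel_mod, Nat.mul_add_mod, Nat.mod_eq_of_lt j.2]
      exact hj
    · simp at h; exact h
  rw [card_range] at h3
  omega

/-- The four vertices of a copy miss one of five residue classes of indices. So all copies form the
union over j of the copies avoiding class j, and inclusion-exclusion writes their number as an
alternating sum of the counts on proper unions of classes. If all of these vanish, so does the
total. -/
theorem exists_mask_ne_zero {T : Finset ℕ} {x : ℕ} {X : ℕ → ℕ} (hT : Enum T x X)
    {h : Fin 4 → Fin 4 → Bool} {A : ℕ → ℕ → ℕ} (hne : ((copies h A T).card : ZMod 24) ≠ 0) :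
    ∃ mask < 31, ((copies h A (selSet X x mask)).card : ZMod 24) ≠ 0 := by
  by_contra! hc
  apply hne
  let B : Fin 5 → Finset (Fin 4 → ℕ) := fun j =>
    copies h A (((range x).filter fun i => i % 5 ≠ (j : ℕ)).image X)
  -- Avoiding all classes in J means lying in the set selected by the mask of the complement.
  have hinter : ∀ J : Finset (Fin 5), (hJ : J.Nonempty) → ∃ mask < 31,
      J.inf' hJ B = copies h A (selSet X x mask) := by
    intro J hJ
    obtain ⟨mask, hm, hmask⟩ := exists_mask J hJ
    refine ⟨mask, hm, ?_⟩
    ext f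
    rw [mem_inf']
    simp only [B, mem_copies, selSet]
    constructor
    · intro hall
      obtain ⟨j0, hj0⟩ := hJ
      refine ⟨fun i => ?_, (hall j0 hj0).2⟩
      obtain ⟨k, hk, hkf⟩ := mem_image.1 ((hall j0 hj0).1 i)
      have hkx := mem_range.1 (mem_filter.1 hk).1
      refine mem_image.2 ⟨k, mem_filter.2 ⟨(mem_filter.1 hk).1, ?_⟩, hkf⟩
      rw [← sel_mod, show k % 5 = ((⟨k % 5, Nat.mod_lt _ (by decide)⟩ : Fin 5) : ℕ) from rfl, hmask]
      intro hmem
      obtain ⟨k', hk', hkf'⟩ := mem_image.1 ((hall _ hmem).1 i)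
      have := hT.inj hkx (mem_range.1 (mem_filter.1 hk').1) (hkf.trans hkf'.symm)
      subst this
      exact (mem_filter.1 hk').2 rfl
    · rintro ⟨h1, h2⟩ j hj
      refine ⟨fun i => ?_, h2⟩
      obtain ⟨k, hk, hkf⟩ := mem_image.1 (h1 i)
      refine mem_image.2 ⟨k, mem_filter.2 ⟨(mem_filter.1 hk).1, fun hkj => ?_⟩, hkf⟩
      have := (mem_filter.1 hk).2
      rw [← sel_mod, hkj, hmask] at this
      exact this hj
  have hunion : copies h A T = univ.biUnion B := by
    ext f
    simp only [mem_biUnion, mem_univ, true_and]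
    constructor
    · intro hf
      obtain ⟨h1, h2⟩ := mem_copies.1 hf
      choose g hg hgf using fun i => hT.exists_eq (h1 i)
      -- Pigeonhole: four indices cannot hit five classes.
      obtain ⟨j, hj⟩ : ∃ j : Fin 5, ∀ i : Fin 4, g i % 5 ≠ j := by
        by_contra! hall
        choose e he using hall
        have : Function.Injective e := fun a b hab => by
          apply Fin.ext; rw [← he a, ← he b, hab]
        simpa using Fintype.card_le_of_injective e this
      refine ⟨j, mem_copies.2 ⟨fun i => mem_image.2 ⟨g i, mem_filter.2 ⟨mem_range.2 (hg i), hj i⟩,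
        hgf i⟩, h2⟩⟩
    · rintro ⟨j, hf⟩
      obtain ⟨h1, h2⟩ := mem_copies.1 hf
      refine mem_copies.2 ⟨fun i => ?_, h2⟩
      obtain ⟨k, hk, hkf⟩ := mem_image.1 (h1 i)
      rw [← hkf]
      exact hT.mem (mem_range.1 (mem_filter.1 hk).1)
  have := inclusion_exclusion_card_biUnion (univ : Finset (Fin 5)) B
  rw [hunion]
  have hcast : ((univ.biUnion B).card : ZMod 24) = (((univ.biUnion B).card : ℤ) : ZMod 24) := by
    simp
  rw [hcast, this, Int.cast_sum]
  refine sum_eq_zero fun J _ => ?_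
  obtain ⟨mask, hm, hm'⟩ := hinter J.1 (mem_filter.1 J.2).2
  rw [hm', Int.cast_mul, Int.cast_natCast, hc mask hm, mul_zero]

-- Drawing a random set and shrinking it.

notation "rTrial" => (32 : ℕ)
notation "rSize" => (33 : ℕ)
notation "rMask" => (34 : ℕ)
notation "rBest" => (35 : ℕ)
notation "rFound" => (36 : ℕ)
notation "rK" => (37 : ℕ)
notation "rTrials" => (38 : ℕ)
notation "rMasks" => (39 : ℕ)
notation "rTup" => (40 : ℕ)
notation "rF0" => (41 : ℕ)
notation "rF1" => (42 : ℕ)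
notation "rF2" => (43 : ℕ)
notation "rF3" => (44 : ℕ)
notation "aH" => (3 : ℕ)
notation "aX" => (9 : ℕ)

/-- The state holds what has been prepared. -/
structure Ready (s : State) (n S L : ℕ) (st row ord rnd hm : ℕ → ℕ) : Prop where
  layout : HasLayout s n S L st row
  mem_ord : s.mem aOrd = ord
  mem_rnd : s.mem aRnd = rnd
  mem_h : s.mem aH = hm

theorem Ready.off {c : Cmd} {s s' : State} {n S L : ℕ} {st row ord rnd hm : ℕ → ℕ}
    (h : Ready s n S L st row ord rnd hm) (ho : Off c s s') (hc : (c.wr rN || c.wr rS || c.wr rL ||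
      c.wa aStart || c.wa aRow || c.wa aOrd || c.wa aRnd || c.wa aH) = false) :
    Ready s' n S L st row ord rnd hm := by
  simp only [Bool.or_eq_false_iff] at hc
  obtain ⟨⟨⟨⟨⟨⟨⟨h0, h1⟩, h2⟩, h3⟩, h4⟩, h5⟩, h6⟩, h7⟩ := hc
  exact ⟨h.layout.off ho h0 h1 h2 h3 h4, (ho.mem h5).trans h.mem_ord, (ho.mem h6).trans h.mem_rnd,
    (ho.mem h7).trans h.mem_h⟩

theorem Ready.setReg {s : State} {n S L : ℕ} {st row ord rnd hm : ℕ → ℕ}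
    (h : Ready s n S L st row ord rnd hm) {r v : ℕ} (hr : 2 < r) :
    Ready (s.setReg r v) n S L st row ord rnd hm :=
  ⟨(hasLayout_setReg hr).2 h.layout, h.mem_ord, h.mem_rnd, h.mem_h⟩

/-- The random set of vertices of a trial. -/
def initSet : Cmd :=
  .set rSize 0 ;; .upto rK rN (.ite (.rd aRnd (.var rTrial * .var rN + .rd aOrd (.var rK)))
    (.put aX (.var rSize) (.var rK) ;; .set rSize (.var rSize + 1)) .skip)

/-- The test whether the index in register `rK` is selected by the bit mask. -/
def selE : Expr := .bin .shr (.var rMask) (.var rK % 5) % 2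

@[simp] theorem selE_eval (s : State) : selE.eval s = (s.reg rMask >>> (s.reg rK % 5)) % 2 := rfl

theorem selE_ok {w : ℕ} {s : State} (hw : 5 < word w) : selE.Ok w s := by
  rw [selE, Expr.ok_mod]
  refine ⟨⟨trivial, by simpa using hw, trivial⟩, ?_⟩
  simp; omega

/-- The subset given by the bit mask. -/
def selectSet : Cmd :=
  .set rY 0 ;; .upto rK rSize (.ite selE
    (.put aY (.var rY) (.rd aX (.var rK)) ;; .set rY (.var rY + 1)) .skip)

section
variable {p : Prog} {w n S L Λ : ℕ} {st row ord rnd hm : ℕ → ℕ} {A : ℕ → ℕ → ℕ} {s : State}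
  (hl : Layout n S L st row A) (hbig : 2000 + 20 * n + 2 * (n * n) ≤ word w)
  (hord : ∀ a < n, ord a < n)

/-- The random set of the trial `t`. -/
def rndSet (n : ℕ) (ord rnd : ℕ → ℕ) (t : ℕ) : Finset ℕ :=
  (range n).filter fun a => rnd (t * n + ord a) ≠ 0

include hbig hord in
theorem initSet_spec (hs : Ready s n S L st row ord rnd hm) {t : ℕ} (ht : s.reg rTrial = t)
    (ht' : t < 19) :
    WP p w initSet (50 * (n + 1)) (fun s' => Enum (rndSet n ord rnd t) (s'.reg rSize)
      (s'.mem aX)) s := by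
  have hw : 1 < word w := by omega
  refine WP.le (T := 2 + (n * (30 + 8) + 6)) (WP.straight_seq hw (by decide) ⟨by simp; omega, ?_⟩)
    (by omega)
  set s1 := s.setReg rSize (Expr.eval s 0) with hs1
  have hs1' : Ready s1 n S L st row ord rnd hm := hs.setReg (by decide)
  refine WP.mono hw (WP.for_straight hw (n := n) (fun k s' => Enum ((range k).filter
    fun a => rnd (t * n + ord a) ≠ 0) (s'.reg rSize) (s'.mem aX)) 30 (by decide) rfl rfl
    (by decide) hs1'.layout.reg_n ?_ ?_) le_rfl fun _ _ _ h => h.1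
  · exact ⟨by simp [hs1], by simp [hs1]⟩
  · intro k hk s2 hf2 hK hn2 ho2 hinv
    have hs2 := hs1'.off ho2 rfl
    have e1 : s2.reg rTrial = t := (ho2.reg rfl).trans (by simp [hs1, ht])
    have h1 := hord k hk
    have h2 : t * n ≤ 18 * n := Nat.mul_le_mul_right _ (by omega)
    have hx : s2.reg rSize ≤ k := by
      rw [← hinv.card]; exact (card_filter_le _ _).trans (by simp)
    refine ⟨?_, fun h => ⟨trivial, trivial, ?_, ?_⟩, fun h => ?_⟩
    · simp [e1, hn2, hs2.mem_ord, hK]; omega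
    · simp; omega
    · simp [e1, hn2, hs2.mem_ord, hK, hs2.mem_rnd] at h
      simp only [State.reg_setReg, State.mem_setReg, reduceIte, Nat.reduceEqDiff, State.reg_setMem,
        Expr.eval_add, Expr.eval_var, Expr.eval_ofNat, range_add_one]
      rw [filter_insert, if_pos h]
      refine hinv.push (fun v hv => mem_range.1 (mem_filter.1 hv).1) fun i => ?_
      simp [hK]
    · simp [e1, hn2, hs2.mem_ord, hK, hs2.mem_rnd] at h
      simp only [Cmd.vc, State.reg_setReg, State.mem_setReg, reduceIte, Nat.reduceEqDiff,
        range_add_one]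
      rw [filter_insert, if_neg (by simp [h])]
      exact hinv

include hbig in
theorem selectSet_spec {T : Finset ℕ} {x mask : ℕ} {X : ℕ → ℕ} (hx : s.reg rSize = x)
    (hX : s.mem aX = X) (hm : s.reg rMask = mask) (hT : Enum T x X) (hTn : T ⊆ range n) :
    WP p w selectSet (50 * (x + 1)) (fun s' => Enum (selSet X x mask) (s'.reg rY)
      (s'.mem aY)) s := by
  have hw : 1 < word w := by omega
  have hxn := (hT.part hTn).le
  refine WP.le (T := 2 + (x * (30 + 8) + 6)) (WP.straight_seq hw (by decide) ⟨by simp; omega, ?_⟩)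
    (by omega)
  set s1 := s.setReg rY (Expr.eval s 0) with hs1
  refine WP.mono hw (WP.for_straight hw (n := x) (fun k s' => Enum (((range k).filter
    (Sel mask)).image X) (s'.reg rY) (s'.mem aY)) 30 (by decide) rfl rfl
    (by decide) (by simp [hs1, hx]) ?_ ?_) le_rfl fun _ _ _ h => h.1
  · exact ⟨by simp [hs1], by simp [hs1]⟩
  · intro k hk s2 hf2 hK hn2 ho2 hinv
    have e1 : s2.reg rMask = mask := (ho2.reg rfl).trans (by simp [hs1, hm])
    have e2 : s2.mem aX = X := (ho2.mem rfl).trans (by simp [hs1, hX])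
    have hy : s2.reg rY ≤ k := by
      rw [← hinv.card]; exact card_image_le.trans ((card_filter_le _ _).trans (by simp))
    refine ⟨selE_ok (by omega), fun h => ⟨trivial, trivial, ?_, ?_⟩, fun h => ?_⟩
    · simp; omega
    · rw [selE_eval, e1, hK] at h
      simp only [State.reg_setReg, State.mem_setReg, reduceIte, Nat.reduceEqDiff, State.reg_setMem,
        Expr.eval_add, Expr.eval_var, Expr.eval_ofNat, range_add_one]
      rw [filter_insert, if_pos (show Sel mask k from h), image_insert]
      refine hinv.push (fun v hv => ?_) fun i => ?_
      · obtain ⟨j, hj, rfl⟩ := mem_image.1 hv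
        exact hT.mono j k (mem_range.1 (mem_filter.1 hj).1) hk
      · simp [hK, e2]
    · rw [selE_eval, e1, hK] at h
      simp only [Cmd.vc, State.reg_setReg, State.mem_setReg, reduceIte, Nat.reduceEqDiff,
        range_add_one]
      rw [filter_insert, if_neg (by rw [Sel]; omega)]
      exact hinv

/-- Try a bit mask. -/
def tryMask (F : Pol) (γ δ : ℕ) : Cmd :=
  selectSet ;; count F γ δ ;; .ite (.var rOut) (.set rBest (.var rMask)) .skip

/-- Replace the set by a smaller one. -/
def shrinkStep (F : Pol) (γ δ : ℕ) : Cmd :=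
  -- The default mask 0 selects the empty set, so the set shrinks even if no mask gives a nonzero
  -- count. The loop tries the masks 0 to 30 and keeps the last success.
  (.set rBest 0 ;; .set rMasks 31) ;; .upto rMask rMasks (tryMask F γ δ) ;;
  .set rMask (.var rBest) ;; selectSet ;;
  .upto rK rY (.put aX (.var rK) (.rd aY (.var rK))) ;; .set rSize (.var rY)

def shrink (F : Pol) (γ δ : ℕ) : Cmd := .loop (.lt 4 (.var rSize)) (shrinkStep F γ δ)

variable {h : Fin 4 → Fin 4 → Bool} {F : Pol} {γ δ : ℕ}
  (hF : ∀ B y, IsAdj B → (indCount h B y : ZMod 24) = formula F γ δ B y)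
  (hmul : ∀ N, 0 < N → N ≤ 2 * L → N ≤ n → MulSpec p w N (Λ * N)) (hΛ : 2 * L ≤ Λ)

include hl hbig hF hmul hΛ

theorem shrinkStep_spec (hs : Ready s n S L st row ord rnd hm)
    {T : Finset ℕ} {x : ℕ} {X : ℕ → ℕ} (hx : s.reg rSize = x)
    (hX : s.mem aX = X) (hT : Enum T x X) (hTn : T ⊆ range n) :
    WP p w (shrinkStep F γ δ) (40 * ((9000 + 5 * F.comp.cost) * (x * Λ + x + 1))) (fun s' =>
      ∃ mask < 31, Enum (selSet X x mask) (s'.reg rSize) (s'.mem aX) ∧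
        (((copies h A T).card : ZMod 24) ≠ 0 →
          ((copies h A (selSet X x mask)).card : ZMod 24) ≠ 0)) s := by
  have hw : 1 < word w := by omega
  have hxn := (hT.part hTn).le
  set K := 9000 + 5 * F.comp.cost with hK
  refine WP.le (T := 4 + ((31 * ((50 * (x + 1) + (K * (x * Λ + x + 1) + 5)) + 8) + 6) + (2 +
    (50 * (x + 1) + ((x * (10 + 8) + 6) + 2))))) (WP.straight_seq hw (by decide)
      ⟨by simp; omega, by simp; omega, ?_⟩) ?_
  swap
  · have : 9000 * (x * Λ + x + 1) ≤ K * (x * Λ + x + 1) := Nat.mul_le_mul_right _ (by omega)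
    have h3 : x + 1 ≤ x * Λ + x + 1 := by omega
    omega
  set s1 := (s.setReg rBest (Expr.eval s 0)).setReg rMasks
    (Expr.eval (s.setReg rBest (Expr.eval s 0)) 31) with hs1
  have hs1' : Ready s1 n S L st row ord rnd hm := (hs.setReg (by decide)).setReg (by decide)
  refine (WP.for_const hw (n := 31) (fun k s' => s'.reg rBest < 31 ∧ ((∃ mask < k,
    ((copies h A (selSet X x mask)).card : ZMod 24) ≠ 0) →
    ((copies h A (selSet X x (s'.reg rBest))).card : ZMod 24) ≠ 0)) _ (by rfl) (by rfl) (by decide)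
    (by simp [hs1]) (by simp [hs1]) ?_).seq hw ?_
  · rintro k hk s2 hf2 hM _ ho2 ⟨hI1, hI2⟩
    have hs2 := hs1'.off ho2 rfl
    have e1 : s2.reg rSize = x := (ho2.reg rfl).trans (by simp [hs1, hx])
    have e2 : s2.mem aX = X := (ho2.mem rfl).trans (by simp [hs1, hX])
    refine (selectSet_spec hbig e1 e2 hM hT hTn).seq hw ?_
    intro s3 hf3 ho3 hE
    have hs3 := hs2.off ho3 rfl
    have hsub := selSet_subset hT k
    have hyx : s3.reg rY ≤ x := by
      have := card_le_card hsub; rw [hE.card, hT.card] at this; exact this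
    refine WP.seq hw (WP.le (count_spec hl hbig (hE.part (hsub.trans hTn)) F γ δ hmul hΛ
      ⟨hs3.layout, rfl, rfl⟩) (by gcongr)) ?_
    rintro s4 hf4 ho4 ⟨hlt, hval⟩
    rw [← hF _ _ (hl.isAdj.sub _), hE.indCount_eq] at hval
    have e3 : s4.reg rBest = s2.reg rBest := (ho4.reg rfl).trans (ho3.reg rfl)
    have e4 : s4.reg rMask = k := (ho4.reg rfl).trans ((ho3.reg rfl).trans hM)
    refine WP.straight_le hw (by decide) ⟨trivial, fun h0 => ⟨trivial, ?_⟩, fun h0 => ?_⟩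
    · simp only [Expr.eval_var] at h0
      simp [e4]
      refine ⟨by omega, fun mask hm hne hc => ?_⟩
      rw [hc, ZMod.natCast_eq_zero_iff] at hval
      exact h0 (Nat.eq_zero_of_dvd_of_lt hval hlt)
    · simp only [Expr.eval_var] at h0
      simp only [Cmd.vc, State.reg_setReg, Nat.reduceEqDiff, reduceIte, e3]
      refine ⟨hI1, ?_⟩
      rintro ⟨mask, hm, hne⟩
      rcases Nat.lt_succ_iff_lt_or_eq.1 hm with h' | rfl
      · exact hI2 ⟨mask, h', hne⟩
      · rw [h0] at hval; exact (hne hval.symm).elim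
  rintro s2 hf2 ho2 ⟨⟨hI1, hI2⟩, -⟩
  refine WP.straight_seq hw (by decide) ⟨trivial, ?_⟩
  have e1 : s2.reg rSize = x := (ho2.reg rfl).trans (by simp [hs1, hx])
  have e2 : s2.mem aX = X := (ho2.mem rfl).trans (by simp [hs1, hX])
  refine (selectSet_spec hbig (s := s2.setReg rMask (Expr.eval s2 (.var rBest)))
    (mask := s2.reg rBest) (by simpa using e1) (by simpa using e2) (by simp) hT hTn).seq hw ?_
  intro s3 hf3 ho3 hE
  have hsub := selSet_subset hT (s2.reg rBest)
  have hyx : s3.reg rY ≤ x := by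
    have := card_le_card hsub; rw [hE.card, hT.card] at this; exact this
  refine WP.seq hw (WP.le (WP.for_straight hw (n := s3.reg rY) (fun k s' => ∀ i < k, s'.mem aX i =
    s3.mem aY i) 10 (by decide) rfl rfl (by decide) rfl (by simp) ?_)
    (Nat.add_le_add_right (Nat.mul_le_mul_right _ hyx) _)) ?_
  · intro k hk s4 hf4 hK _ ho4 hinv
    refine ⟨trivial, trivial, fun i hi => ?_⟩
    have e3 : s4.mem aY = s3.mem aY := ho4.mem rfl
    by_cases hik : i = k
    · simp [hK, hik, e3]
    · simpa [hK, hik] using hinv i (by omega)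
  · rintro s4 hf4 ho4 ⟨hinv, -⟩
    refine WP.straight_le hw (by decide) ⟨trivial, s2.reg rBest, hI1, ?_, fun hne =>
      hI2 (exists_mask_ne_zero hT hne)⟩
    have e3 : s4.reg rY = s3.reg rY := ho4.reg rfl
    simp only [Expr.eval_var, State.reg_setReg, reduceIte, e3, State.mem_setReg]
    exact hE.congr hinv

/-- A round on x vertices costs at most `D * x` and leaves at most 8x/9 of them, so a budget of `9 *
D` per vertex pays for all rounds. -/
theorem shrink_spec (hs : Ready s n S L st row ord rnd hm)
    {T : Finset ℕ} (hT : Enum T (s.reg rSize) (s.mem aX)) (hTn : T ⊆ range n) :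
    WP p w (shrink F γ δ) (9 * (100 * ((9000 + 5 * F.comp.cost) * (Λ + 1))) * n + 4) (fun s' =>
      ∃ T', T' ⊆ range n ∧ Enum T' (s'.reg rSize) (s'.mem aX) ∧ s'.reg rSize ≤ 4 ∧
        (((copies h A T).card : ZMod 24) ≠ 0 → ((copies h A T').card : ZMod 24) ≠ 0)) s := by
  have hw : 1 < word w := by omega
  set K := 9000 + 5 * F.comp.cost with hK
  set D := 100 * (K * (Λ + 1)) with hD
  refine WP.mono hw (WP.while_ hw (fun B s' => ∃ T', T' ⊆ range n ∧
    Enum T' (s'.reg rSize) (s'.mem aX) ∧ (((copies h A T).card : ZMod 24) ≠ 0 →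
      ((copies h A T').card : ZMod 24) ≠ 0) ∧ 9 * D * s'.reg rSize ≤ B) ?_ (9 * D * s.reg rSize)
    ⟨T, hTn, hT, id, le_rfl⟩) ?_ ?_
  · rintro B s1 hf1 ho1 ⟨T', h1, h2, h3, hB⟩
    refine ⟨by simp; omega, fun hlt => ?_⟩
    rw [Expr.eval_lt_ne_zero] at hlt
    simp only [Expr.eval_ofNat, Expr.eval_var] at hlt
    have hs1 := hs.off ho1 rfl
    set x := s1.reg rSize with hx
    refine ⟨_, 9 * D * (x - x / 5), ?_, WP.mono hw (shrinkStep_spec hl hbig hF hmul hΛ hs1 hx.symm rfl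
      h2 h1) le_rfl ?_⟩
    · have hc : (Expr.lt 4 (.var rSize)).cost + 1 = 4 := rfl
      rw [hc, ← hK]
      have e1 : 40 * (K * (x * Λ + x + 1)) + 4 ≤ D * x := by
        have : x * Λ + x + 1 ≤ 2 * ((Λ + 1) * x) := by nlinarith
        have h5 : K * (x * Λ + x + 1) ≤ K * (2 * ((Λ + 1) * x)) := Nat.mul_le_mul_left _ this
        have h6 : 1 ≤ K * ((Λ + 1) * x) := Nat.mul_pos (by omega) (Nat.mul_pos (by omega) (by omega))
        have h7 : D * x = 100 * (K * ((Λ + 1) * x)) := by rw [hD]; ring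
        have h8 : K * (2 * ((Λ + 1) * x)) = 2 * (K * ((Λ + 1) * x)) := by ring
        omega
      -- This holds because x ≥ 5; x = 9 is the extreme case.
      have e2 : 9 * (x - x / 5) ≤ 8 * x := by omega
      have e3 : 9 * D * (x - x / 5) ≤ 8 * (D * x) := by
        calc 9 * D * (x - x / 5) = D * (9 * (x - x / 5)) := by ring
          _ ≤ D * (8 * x) := Nat.mul_le_mul_left _ e2
          _ = 8 * (D * x) := by ring
      have e4 : 9 * D * x = 9 * (D * x) := by ring
      omega
    · rintro s2 hf2 ho2 ⟨mask, hm, h5, h6⟩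
      refine ⟨_, (selSet_subset h2 mask).trans h1, h5, fun hne => h6 (h3 hne), ?_⟩
      have := card_selSet_le (s1.mem aX) x mask hm
      rw [h5.card] at this
      exact Nat.mul_le_mul_left _ (by omega)
  · have : s.reg rSize ≤ n := (hT.part hTn).le
    have hc : (Expr.lt 4 (.var rSize)).cost + 1 = 4 := rfl
    rw [add_assoc _ _ 1, hc]
    exact Nat.add_le_add_right (Nat.mul_le_mul_left _ this) _
  · rintro s1 hf1 ho1 ⟨h0, B, T', h1, h2, h3, -⟩
    rw [Expr.eval_lt_eq_zero] at h0
    simp only [Expr.eval_ofNat, Expr.eval_var] at h0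
    exact ⟨T', h1, h2, by omega, h3⟩

end

/-! ### Direct search among four vertices. -/

/-- The test whether the vertices in the registers `a` and `b` are as required by the entry `i` of
the matrix. -/
def pairE (a b i : ℕ) : Expr :=
  .ite (.eq (.var a) (.var b)) 0 (.eq (adjE (.var a) (.var b)) (.rd aH (.lit i)))

/-- The test whether four vertices form a copy. -/
def copyE : Expr :=
  -- The numbers 1, 2, 3, 6, 7, 11 are the places 4i + j of the entries with i < j.
  pairE rF0 rF1 1 * pairE rF0 rF2 2 * pairE rF0 rF3 3 * pairE rF1 rF2 6 * pairE rF1 rF3 7 *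
    pairE rF2 rF3 11

/-- Test the four vertices that are encoded by register `rK`. -/
def tryTuple : Cmd :=
  (.set rF0 (.rd aX (.var rK % 4)) ;; .set rF1 (.rd aX (.var rK / 4 % 4)) ;;
    .set rF2 (.rd aX (.var rK / 16 % 4)) ;; .set rF3 (.rd aX (.var rK / 64 % 4))) ;;
  -- The answer overwrites the offsets of the adjacency lists in array 0; from here on the table
  -- `aRow` is used instead. The images are translated from positions back to vertices.
  .ite copyE (.put 0 0 (.rd aOrd (.var rF0)) ;; .put 0 1 (.rd aOrd (.var rF1)) ;;
    .put 0 2 (.rd aOrd (.var rF2)) ;; .put 0 3 (.rd aOrd (.var rF3)) ;; .set rFound 1) .skip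

/-- Search for a copy among at most four vertices. -/
def brute : Cmd :=
  .ite (.eq (.var rSize) 4) (.set rTup 256 ;; .upto rK rTup tryTuple) .skip

/-- The answer in the state is not wrong. -/
def Sound (n : ℕ) (h : Fin 4 → Fin 4 → Bool) (A : ℕ → ℕ → ℕ) (ord : ℕ → ℕ) (s : State) : Prop :=
  s.reg rFound = 0 ∨
    s.reg rFound = 1 ∧ ∃ f ∈ copies h A (range n), ∀ i : Fin 4, s.mem 0 i = ord (f i)

/-- The four vertices encoded by a number. -/
def tup (X : ℕ → ℕ) (k : ℕ) : Fin 4 → ℕ := ![X (k % 4), X (k / 4 % 4), X (k / 16 % 4), X (k / 64 % 4)]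

theorem exists_tup {T : Finset ℕ} {X : ℕ → ℕ} (hT : Enum T 4 X) {f : Fin 4 → ℕ}
    (hf : ∀ i, f i ∈ T) : ∃ k < 256, tup X k = f := by
  choose g hg hgf using fun i => hT.exists_eq (hf i)
  have h0 := hg 0
  have h1 := hg 1
  have h2 := hg 2
  have h3 := hg 3
  refine ⟨g 0 + 4 * g 1 + 16 * g 2 + 64 * g 3, by omega, ?_⟩
  have e0 : (g 0 + 4 * g 1 + 16 * g 2 + 64 * g 3) % 4 = g 0 := by omega
  have e1 : (g 0 + 4 * g 1 + 16 * g 2 + 64 * g 3) / 4 % 4 = g 1 := by omega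
  have e2 : (g 0 + 4 * g 1 + 16 * g 2 + 64 * g 3) / 16 % 4 = g 2 := by omega
  have e3 : (g 0 + 4 * g 1 + 16 * g 2 + 64 * g 3) / 64 % 4 = g 3 := by omega
  ext i
  rw [tup, e0, e1, e2, e3, ← hgf]
  fin_cases i <;> rfl

section
variable {p : Prog} {w n S L Λ : ℕ} {st row ord rnd hm : ℕ → ℕ} {A : ℕ → ℕ → ℕ} {s : State}
  {h : Fin 4 → Fin 4 → Bool}
  (hl : Layout n S L st row A) (hbig : 2000 + 20 * n + 2 * (n * n) ≤ word w)
  (hsymm : ∀ i j, h i j = h j i) (hhm : ∀ i j : Fin 4, hm (4 * i + j) = (h i j).toNat)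

include hl

theorem pairE_eval (hs : Ready s n S L st row ord rnd hm) {a b i : ℕ} (ha : s.reg a < n)
    (hb : s.reg b < n) : (pairE a b i).eval s =
      if s.reg a ≠ s.reg b ∧ A (s.reg a) (s.reg b) = hm i then 1 else 0 := by
  have e := adjE_eval hl hs.layout (a := .var a) (b := .var b) ha hb
  simp only [pairE, Expr.eval_ite, Expr.eval_eq, e, Expr.eval_var, Expr.eval_rd, hs.mem_h,
    Expr.eval_lit, Expr.eval_ofNat]
  by_cases h1 : s.reg a = s.reg b <;> simp [h1]

include hbig in
theorem pairE_ok (hs : Ready s n S L st row ord rnd hm) {a b i : ℕ} (ha : s.reg a < n)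
    (hb : s.reg b < n) (hi : i < 12) : (pairE a b i).Ok w s := by
  have e := adjE_ok hl hbig hs.layout (a := .var a) (b := .var b) ha hb trivial trivial
  simp [pairE, e]
  omega

include hbig in
theorem copyE_ok (hs : Ready s n S L st row ord rnd hm) (h0 : s.reg rF0 < n) (h1 : s.reg rF1 < n)
    (h2 : s.reg rF2 < n) (h3 : s.reg rF3 < n) : copyE.Ok w s := by
  have hle : ∀ a b i, s.reg a < n → s.reg b < n → (pairE a b i).eval s ≤ 1 := fun a b i ha hb => by
    rw [pairE_eval hl hs ha hb]; split_ifs <;> omega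
  have e1 := hle _ _ 1 h0 h1
  have e2 := hle _ _ 2 h0 h2
  have e3 := hle _ _ 3 h0 h3
  have e4 := hle _ _ 6 h1 h2
  have e5 := hle _ _ 7 h1 h3
  have e6 := hle _ _ 11 h2 h3
  have m2 := Nat.mul_le_mul e1 e2
  have m3 := Nat.mul_le_mul m2 e3
  have m4 := Nat.mul_le_mul m3 e4
  have m5 := Nat.mul_le_mul m4 e5
  have m6 := Nat.mul_le_mul m5 e6
  simp only [copyE, Expr.ok_mul, Expr.eval_mul]
  refine ⟨⟨⟨⟨⟨pairE_ok hl hbig hs h0 h1 (by decide), pairE_ok hl hbig hs h0 h2 (by decide), ?_⟩,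
    pairE_ok hl hbig hs h0 h3 (by decide), ?_⟩, pairE_ok hl hbig hs h1 h2 (by decide), ?_⟩,
    pairE_ok hl hbig hs h1 h3 (by decide), ?_⟩, pairE_ok hl hbig hs h2 h3 (by decide), ?_⟩
  all_goals omega

include hsymm hhm in
theorem copyE_eval (hs : Ready s n S L st row ord rnd hm) {f : Fin 4 → ℕ} (hf : ∀ i, f i < n)
    (h0 : s.reg rF0 = f 0) (h1 : s.reg rF1 = f 1) (h2 : s.reg rF2 = f 2) (h3 : s.reg rF3 = f 3) :
    copyE.eval s ≠ 0 ↔ ∀ i j, i ≠ j → f i ≠ f j ∧ (A (f i) (f j) = 1 ↔ h i j = true) := by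
  have g0 : s.reg rF0 < n := h0 ▸ hf 0
  have g1 : s.reg rF1 < n := h1 ▸ hf 1
  have g2 : s.reg rF2 < n := h2 ▸ hf 2
  have g3 : s.reg rF3 < n := h3 ▸ hf 3
  have key : ∀ i j : Fin 4, A (f i) (f j) = hm (4 * i + j) ↔ (A (f i) (f j) = 1 ↔ h i j = true) := by
    intro i j
    have := hl.isAdj.le_one (f i) (f j)
    rw [hhm]
    cases h i j <;> simp <;> omega
  have flip : ∀ i j, (f i ≠ f j ∧ (A (f i) (f j) = 1 ↔ h i j = true)) →
      (f j ≠ f i ∧ (A (f j) (f i) = 1 ↔ h j i = true)) := fun i j hh => by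
    rw [hsymm j i, hl.isAdj.symm (f j) (f i)]; exact ⟨hh.1.symm, hh.2⟩
  have pe : ∀ {a b} i, s.reg a < n → s.reg b < n → ((pairE a b i).eval s ≠ 0 ↔
      s.reg a ≠ s.reg b ∧ A (s.reg a) (s.reg b) = hm i) := fun i ha hb => by
    rw [pairE_eval hl hs ha hb]; simp
  rw [copyE]
  simp only [Expr.eval_mul, mul_ne_zero_iff]
  rw [pe 1 g0 g1, pe 2 g0 g2, pe 3 g0 g3, pe 6 g1 g2, pe 7 g1 g3, pe 11 g2 g3, h0, h1, h2, h3]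
  have k01 := key 0 1
  have k02 := key 0 2
  have k03 := key 0 3
  have k12 := key 1 2
  have k13 := key 1 3
  have k23 := key 2 3
  norm_num at k01 k02 k03 k12 k13 k23
  rw [k01, k02, k03, k12, k13, k23]
  constructor
  · rintro ⟨⟨⟨⟨⟨p01, p02⟩, p03⟩, p12⟩, p13⟩, p23⟩
    have := flip _ _ p01
    have := flip _ _ p02
    have := flip _ _ p03
    have := flip _ _ p12
    have := flip _ _ p13
    have := flip _ _ p23
    intro i j hij
    fin_cases i <;> fin_cases j <;> first | exact (hij rfl).elim | assumption
  · intro hh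
    exact ⟨⟨⟨⟨⟨hh 0 1 (by decide), hh 0 2 (by decide)⟩, hh 0 3 (by decide)⟩, hh 1 2 (by decide)⟩,
      hh 1 3 (by decide)⟩, hh 2 3 (by decide)⟩

include hbig hsymm hhm

/-- The answer is written only after the test has succeeded, so `Sound` is kept whatever the counts
were. This makes the error one-sided. Once a copy has been found the flag stays set. -/
theorem brute_spec (hs : Ready s n S L st row ord rnd hm) (hG : Sound n h A ord s)
    {T : Finset ℕ} (hT : Enum T (s.reg rSize) (s.mem aX)) (hTn : T ⊆ range n)
    (h4 : s.reg rSize ≤ 4) :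
    WP p w brute 200000 (fun s' => Sound n h A ord s' ∧ (s.reg rFound = 1 → s'.reg rFound = 1) ∧
      ((copies h A T).Nonempty → s'.reg rFound = 1)) s := by
  have hw : 1 < word w := by omega
  refine WP.le (WP.ite hw (by simp; omega) (T := 2 + (256 * (700 + 8) + 6)) (fun h0 => ?_)
    fun h0 => ?_) (by simp)
  swap
  · refine WP.straight_le hw (by decide) ⟨hG, id, fun ⟨f, hf⟩ => ?_⟩
    have := four_le_card hf
    rw [hT.card] at this
    have h5 : s.reg rSize = 4 := by omega
    simp [h5] at h0
  have h4 : s.reg rSize = 4 := by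
    by_contra hc; simp [hc] at h0
  rw [h4] at hT
  have hX : ∀ k, ∀ i, tup (s.mem aX) k i ∈ T := by
    intro k i
    fin_cases i
    · exact hT.mem (Nat.mod_lt _ (by decide))
    · exact hT.mem (Nat.mod_lt _ (by decide))
    · exact hT.mem (Nat.mod_lt _ (by decide))
    · exact hT.mem (Nat.mod_lt _ (by decide))
  refine WP.straight_seq hw (by decide) ⟨by simp; omega, ?_⟩
  set s1 := s.setReg rTup (Expr.eval s 256) with hs1
  have hs1' : Ready s1 n S L st row ord rnd hm := hs.setReg (by decide)
  refine WP.mono hw (WP.for_straight hw (n := 256) (fun k s' => Sound n h A ord s' ∧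
    (s.reg rFound = 1 → s'.reg rFound = 1) ∧
      ∀ k' < k, tup (s.mem aX) k' ∈ copies h A T → s'.reg rFound = 1) 700 (by decide) rfl rfl
    (by decide) (by simp [hs1]) ?_ ?_) le_rfl ?_
  · refine ⟨?_, by simp [hs1], by simp⟩
    simpa [Sound, hs1] using hG
  · rintro k hk s2 hf2 hK hn2 ho2 ⟨hS2, hp2, hI2⟩
    have hs2 := hs1'.off ho2 rfl
    have eX : s2.mem aX = s.mem aX := ho2.mem rfl
    refine ⟨by simp; omega, by simp; omega, by simp; omega, by simp; omega, ?_⟩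
    generalize hs3 : (((s2.setReg rF0 _).setReg rF1 _).setReg rF2 _).setReg rF3 _ = s3
    have hs3' : Ready s3 n S L st row ord rnd hm := by
      rw [← hs3]
      exact (((hs2.setReg (by decide)).setReg (by decide)).setReg (by decide)).setReg (by decide)
    have f0 : s3.reg rF0 = tup (s.mem aX) k 0 := by rw [← hs3]; simp [tup, hK, eX]
    have f1 : s3.reg rF1 = tup (s.mem aX) k 1 := by rw [← hs3]; simp [tup, hK, eX]
    have f2 : s3.reg rF2 = tup (s.mem aX) k 2 := by rw [← hs3]; simp [tup, hK, eX]
    have f3 : s3.reg rF3 = tup (s.mem aX) k 3 := by rw [← hs3]; simp [tup, hK, eX]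
    have f4 : s3.reg rFound = s2.reg rFound := by rw [← hs3]; simp
    have f5 : s3.mem 0 = s2.mem 0 := by rw [← hs3]; rfl
    have hlt : ∀ i, tup (s.mem aX) k i < n := fun i => mem_range.1 (hTn (hX k i))
    have hev := copyE_eval hl hsymm hhm hs3' hlt f0 f1 f2 f3
    refine ⟨copyE_ok hl hbig hs3' (f0 ▸ hlt 0) (f1 ▸ hlt 1) (f2 ▸ hlt 2) (f3 ▸ hlt 3),
      fun h1 => ?_, fun h1 => ?_⟩
    · have hc := mem_copies.2 ⟨fun i => mem_range.2 (hlt i), hev.1 h1⟩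
      simp only [Cmd.vc, Expr.ok_ofNat, Expr.ok_rd, Expr.ok_var]
      refine ⟨by omega, trivial, by omega, trivial, by omega, trivial, by omega, trivial, by omega,
        Or.inr ⟨by simp, _, hc, fun i => ?_⟩, by simp, by simp⟩
      fin_cases i <;> simp [f0, f1, f2, f3, hs3'.mem_ord]
    · refine ⟨?_, ?_, fun k' hk' hc => ?_⟩
      · simpa [Sound, f4, f5] using hS2
      · simpa [f4] using hp2
      · rcases Nat.lt_succ_iff_lt_or_eq.1 hk' with h' | rfl
        · simpa [f4] using hI2 k' h' hc
        · exact ((hev.2 (mem_copies.1 hc).2) h1).elim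
  · rintro s' - - ⟨⟨h1, h2, h3⟩, -⟩
    refine ⟨h1, h2, fun ⟨f, hf⟩ => ?_⟩
    obtain ⟨k, hk, rfl⟩ := exists_tup hT (mem_copies.1 hf).1
    exact h3 k hk hf

end

/-! ### Repeated trials. -/

/-- One trial. -/
def trial (F : Pol) (γ δ : ℕ) : Cmd := initSet ;; shrink F γ δ ;; brute

/-- Several trials, and the answer. -/
def trials (m : ℕ) (F : Pol) (γ δ : ℕ) : Cmd :=
  (.set rFound 0 ;; .set rTrials (.lit m)) ;; .upto rTrial rTrials (trial F γ δ) ;;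
    .set 0 (.var rFound)

section
variable {p : Prog} {w n S L Λ : ℕ} {st row ord rnd hm : ℕ → ℕ} {A : ℕ → ℕ → ℕ} {s : State}
  {h : Fin 4 → Fin 4 → Bool}
  (hl : Layout n S L st row A) (hbig : 2000 + 20 * n + 2 * (n * n) ≤ word w)
  (hord : ∀ a < n, ord a < n)
  (hsymm : ∀ i j, h i j = h j i) (hhm : ∀ i j : Fin 4, hm (4 * i + j) = (h i j).toNat)
  {F : Pol} {γ δ : ℕ} (hF : ∀ B y, IsAdj B → (indCount h B y : ZMod 24) = formula F γ δ B y)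
  (hmul : ∀ N, 0 < N → N ≤ 2 * L → N ≤ n → MulSpec p w N (Λ * N)) (hΛ : 2 * L ≤ Λ)

include hl hbig hord hsymm hhm hF hmul hΛ

/-- If the random set has a nonzero count, so has the shrunken set, which then contains a copy. The
bound 19 on the number of trials keeps the indices of the random bits below the `20 * n` in `hbig`.
-/
theorem trial_spec (hs : Ready s n S L st row ord rnd hm) (hG : Sound n h A ord s) {t : ℕ}
    (ht : s.reg rTrial = t) (ht' : t < 19) :
    WP p w (trial F γ δ) (300000 * ((9000 + 5 * F.comp.cost) * (Λ + 1) * (n + 1)))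
      (fun s' => Sound n h A ord s' ∧ (s.reg rFound = 1 → s'.reg rFound = 1) ∧
      (((copies h A (rndSet n ord rnd t)).card : ZMod 24) ≠ 0 → s'.reg rFound = 1)) s := by
  have hw : 1 < word w := by omega
  refine WP.le ((initSet_spec hbig hord hs ht ht').seq hw (T₂ :=
    9 * (100 * ((9000 + 5 * F.comp.cost) * (Λ + 1))) * n + 4 + 200000) ?_) ?_
  · intro s1 hf1 ho1 hE
    have hs1 := hs.off ho1 rfl
    have e1 : s1.reg rFound = s.reg rFound := ho1.reg rfl
    have e0 : s1.mem 0 = s.mem 0 := ho1.mem rfl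
    refine (shrink_spec hl hbig hF hmul hΛ hs1 hE (filter_subset _ _)).seq hw ?_
    rintro s2 hf2 ho2 ⟨T', h1, h2, h3, h4⟩
    have hs2 := hs1.off ho2 rfl
    have e2 : s2.reg rFound = s1.reg rFound := ho2.reg rfl
    have e3 : s2.mem 0 = s1.mem 0 := ho2.mem rfl
    refine WP.mono hw (brute_spec hl hbig hsymm hhm hs2 ?_ h2 h1 h3) le_rfl ?_
    · rw [Sound, e2, e1, e3, e0]; exact hG
    · rintro s3 - - ⟨h5, h6, h7⟩
      refine ⟨h5, fun h0 => h6 (e2.trans (e1.trans h0)), fun hne => h7 ?_⟩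
      rw [← card_pos]
      refine Nat.pos_of_ne_zero fun hc => h4 hne ?_
      rw [hc, Nat.cast_zero]
  · set D := (9000 + 5 * F.comp.cost) * (Λ + 1) with hD
    have h1 : 9000 ≤ D := by
      rw [hD]; exact (Nat.le_mul_of_pos_right _ (by omega)).trans' (by omega)
    have h2 : 9000 * (n + 1) ≤ D * (n + 1) := Nat.mul_le_mul_right _ h1
    have h3 : D * (n + 1) = D * n + D := by ring
    have h4 : 9 * (100 * D) * n = 900 * (D * n) := by ring
    rw [h4]
    clear_value D
    generalize D * n = x at h3 ⊢
    generalize D * (n + 1) = y at h2 h3 ⊢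
    linarith

theorem trials_spec (hs : Ready s n S L st row ord rnd hm) {m : ℕ} (hm19 : m ≤ 19) :
    WP p w (trials m F γ δ)
      (m * (300001 * ((9000 + 5 * F.comp.cost) * (Λ + 1) * (n + 1))) + 20)
      (fun s' => (s'.reg 0 = 0 ∨ s'.reg 0 = 1 ∧ ∃ f ∈ copies h A (range n), ∀ i : Fin 4,
          s'.mem 0 i = ord (f i)) ∧
        ∀ t < m, ((copies h A (rndSet n ord rnd t)).card : ZMod 24) ≠ 0 → s'.reg 0 = 1) s := by
  have hw : 1 < word w := by omega
  set D := (9000 + 5 * F.comp.cost) * (Λ + 1) * (n + 1) with hD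
  have hD1 : 9000 ≤ D := by
    rw [hD, mul_assoc]
    exact (Nat.le_mul_of_pos_right _ (Nat.mul_pos (by omega) (by omega))).trans' (by omega)
  refine WP.le (T := 4 + ((m * (300000 * D + 8) + 6) + 2)) ?_ ?_
  · refine WP.straight_seq hw (by simp [Cmd.cost]) ⟨by simp; omega, by simp; omega, ?_⟩
    set s1 := (s.setReg rFound (Expr.eval s 0)).setReg rTrials
      (Expr.eval (s.setReg rFound (Expr.eval s 0)) (.lit m)) with hs1
    have hs1' : Ready s1 n S L st row ord rnd hm := (hs.setReg (by decide)).setReg (by decide)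
    refine (WP.for_const hw (n := m) (fun k s' => Sound n h A ord s' ∧ ∀ t < k,
      ((copies h A (rndSet n ord rnd t)).card : ZMod 24) ≠ 0 → s'.reg rFound = 1) _ (by rfl)
      (by rfl) (by decide) (by simp [hs1]) ?_ ?_).seq hw ?_
    · simp [Sound, hs1]
    · rintro k hk s2 hf2 hK hn2 ho2 ⟨hS, hI⟩
      refine WP.mono hw (trial_spec hl hbig hord hsymm hhm hF hmul hΛ (hs1'.off ho2 rfl) hS hK
        (by omega)) le_rfl ?_
      rintro s3 - - ⟨h1, h2, h3⟩
      refine ⟨by simpa [Sound] using h1, fun t ht hne => ?_⟩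
      rcases Nat.lt_succ_iff_lt_or_eq.1 ht with h' | rfl
      · simpa using h2 (hI t h' hne)
      · simpa using h3 hne
    · rintro s2 - - ⟨⟨h1, h2⟩, -⟩
      exact WP.straight_le hw (by decide) ⟨trivial, by simpa [Sound] using h1, by simpa using h2⟩
  · have : m * (300000 * D + 8) ≤ m * (300001 * D) := Nat.mul_le_mul_left _ (by omega)
    omega

end

/-- The order of the vertices enters only as some bijection `ord` from positions to vertices; all
counting is done on positions. -/
theorem prepare_spec {p : Prog} {w n k m : ℕ} {adj : ℕ → ℕ → Prop} {sep : ℕ → Prop}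
    {conn : ℕ → ℕ → Prop} {s : State} (hI : IsInstance n k adj sep conn)
    (hbig : 2000 + 20 * n + 2 * (n * n) ≤ word w) (hm : m ≤ 19) (hs : HasInput s n adj sep) :
    WP p w (prepare m) (2000 * ((n + 1) * (k + 1))) (fun s' => ∃ L st row ord,
      Ready s' n (sepCount sep n) L st row ord (s'.mem aRnd) (s.mem aH) ∧
      Layout n (sepCount sep n) L st row (ordAdj n adj ord) ∧ L ≤ k ∧
      (∀ a < n, ord a < n) ∧ (∀ v < n, ∃ a < n, ord a = v) ∧
      (∀ a < n, ∀ b < n, ord a = ord b → a = b) ∧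
      ∀ t < m * n, s'.mem aRnd t = (s.coins t).toNat) s := by
  have hw : 1 < word w := by omega
  have hmn : m * n ≤ 19 * n := Nat.mul_le_mul_right _ hm
  refine WP.le (T := 20 * (m * n + 1) + (100 * (n + 1) + (20 + 2 * n * (100 * (k + 1) + 20) +
    (60 * (n + 1) + (30 * (n * k + 1) + 200 * ((n + 1) * (k + 1))))))) ?_ ?_
  swap
  · have h1 : 2 * n * (100 * (k + 1) + 20) = 200 * (n * k) + 240 * n := by ring
    have h2 : (n + 1) * (k + 1) = n * k + n + k + 1 := by ring
    omega
  refine (drawCoins_spec hw (by omega) (by omega) hs.reg_n).seq hw ?_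
  intro s1 hf1 ho1 hrnd
  have hs1 := hs.off ho1 rfl rfl rfl rfl
  refine (listSep_spec hbig hs1).seq hw ?_
  rintro s2 hf2 ho2 ⟨h1, h2, h3, h4, h5⟩
  have hs2 := hs1.off ho2 rfl rfl rfl rfl
  refine (bfs_spec hI hbig hs2 h1 h2 h3 h4 h5).seq hw ?_
  rintro s3 hf3 ho3 ⟨h6, hb⟩
  have hs3 := hs2.off ho3 rfl rfl rfl rfl
  refine (maxWidth_spec hI hbig hs3 h6 hb).seq hw ?_
  rintro s4 hf4 ho4 ⟨hL, hLk⟩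
  have hs4 := hs3.off ho4 rfl rfl rfl rfl
  have est : s4.mem aStart = s3.mem aStart := ho4.mem rfl
  have eord : s4.mem aOrd = s3.mem aOrd := ho4.mem rfl
  have epos : s4.mem aPos = s3.mem aPos := ho4.mem rfl
  have eS : s4.reg rS = sepCount sep n := (ho4.reg rfl).trans h6
  rw [← est] at hL
  rw [← est, ← eord, ← epos] at hb
  refine WP.seq hw (WP.le (clearRows_spec hbig hs4.reg_n rfl hL.le_n) (by gcongr)) ?_
  intro s5 hf5 ho5 hz
  have hs5 := hs4.off ho5 rfl rfl rfl rfl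
  have est5 : s5.mem aStart = s4.mem aStart := ho5.mem rfl
  have eord5 : s5.mem aOrd = s4.mem aOrd := ho5.mem rfl
  have epos5 : s5.mem aPos = s4.mem aPos := ho5.mem rfl
  have eS5 : s5.reg rS = sepCount sep n := (ho5.reg rfl).trans eS
  have eL5 : s5.reg rL = s4.reg rL := ho5.reg rfl
  rw [← est5] at hL
  rw [← est5, ← eord5, ← epos5] at hb
  refine WP.mono hw (fillRows_spec hI hbig hs5 eS5 eL5 hb hL hz) le_rfl ?_
  intro s6 hf6 ho6 hrow
  have hs6 := hs5.off ho6 rfl rfl rfl rfl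
  have er : s6.mem aRnd = s1.mem aRnd :=
    (ho6.mem rfl).trans <| (ho5.mem rfl).trans <| (ho4.mem rfl).trans <| (ho3.mem rfl).trans <|
      ho2.mem rfl
  have eh : s6.mem aH = s.mem aH :=
    (ho6.mem rfl).trans <| (ho5.mem rfl).trans <| (ho4.mem rfl).trans <| (ho3.mem rfl).trans <|
      (ho2.mem rfl).trans <| ho1.mem rfl
  refine ⟨s4.reg rL, s5.mem aStart, s6.mem aRow, s5.mem aOrd,
    ⟨⟨hs6.reg_n, (ho6.reg rfl).trans eS5, (ho6.reg rfl).trans eL5, ho6.mem rfl, rfl⟩, ho6.mem rfl,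
      rfl, eh⟩, layout_of_bfs hI hb hL hrow, hLk, fun a ha => ?_, fun v hv => ?_,
      fun a ha b hb' => hb.toListed.inj ha hb', ?_⟩
  · exact (hb.ord_lt a ha)
  · exact hb.ord_pos v hv (hb.seen v hv)
  · rw [er]; exact hrnd

/-! ### Many vertex sets have a nonzero count. -/

theorem exists_perm_apply_eq {α : Type*} [DecidableEq α] {i j i' j' : α} (hij : i ≠ j)
    (hij' : i' ≠ j') : ∃ σ : Equiv.Perm α, σ i = i' ∧ σ j = j' := by
  -- A transposition moves i to i'; a second one corrects the image of j and fixes i'.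
  refine ⟨Equiv.swap (Equiv.swap i i' j) j' * Equiv.swap i i', ?_, by simp⟩
  rw [Equiv.Perm.mul_apply, Equiv.swap_apply_left]
  refine Equiv.swap_apply_of_ne_of_ne (fun hc => hij ?_) hij'
  have h1 := congrArg (Equiv.swap i i') hc
  rwa [Equiv.swap_apply_right, Equiv.swap_apply_self] at h1

section
variable {h : Fin 4 → Fin 4 → Bool} {A : ℕ → ℕ → ℕ} {f : Fin 4 → ℕ}

theorem injective_of_mem_copies {T : Finset ℕ} (hf : f ∈ copies h A T) : Function.Injective f :=
  fun i j hij => by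
    by_contra hc; exact ((mem_copies.1 hf).2 i j hc).1 hij

theorem mem_copies_image {T : Finset ℕ} (hf : f ∈ copies h A T) :
    f ∈ copies h A (univ.image f) :=
  mem_copies.2 ⟨fun i => mem_image_of_mem _ (mem_univ i), (mem_copies.1 hf).2⟩

theorem card_image_of_mem_copies {T : Finset ℕ} (hf : f ∈ copies h A T) :
    (univ.image f).card = 4 := by
  rw [card_image_of_injective _ (injective_of_mem_copies hf)]; simp

theorem copies_image_subset (hf : f ∈ copies h A (univ.image f)) :
    copies h A (univ.image f) ⊆ univ.image fun σ : Equiv.Perm (Fin 4) => f ∘ σ := by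
  intro g hg
  have h1 : univ.image g ⊆ univ.image f := fun v hv => by
    obtain ⟨i, -, rfl⟩ := mem_image.1 hv
    exact (mem_copies.1 hg).1 i
  have h2 : univ.image g = univ.image f := eq_of_subset_of_card_le h1 (by
    rw [card_image_of_mem_copies hf, card_image_of_mem_copies hg])
  obtain ⟨σ, rfl⟩ := exists_perm_of_image_eq (injective_of_mem_copies hg) h2
  exact mem_image_of_mem _ (mem_univ σ)

/-- The number of automorphisms of a graph on four vertices that is neither complete nor empty is not
divisible by `24`. -/
theorem card_copies_image_ne_zero (hf : f ∈ copies h A (univ.image f))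
    (h1 : ∃ i j, i ≠ j ∧ h i j = true) (h0 : ∃ i j, i ≠ j ∧ h i j = false) :
    ((copies h A (univ.image f)).card : ZMod 24) ≠ 0 := by
  rw [Ne, ZMod.natCast_eq_zero_iff]
  intro hdvd
  have hsub := copies_image_subset hf
  have hcard : (univ.image fun σ : Equiv.Perm (Fin 4) => f ∘ σ).card ≤
      (copies h A (univ.image f)).card := by
    rw [card_image_comp_perm (injective_of_mem_copies hf)]
    exact Nat.le_of_dvd (card_pos.2 ⟨f, hf⟩) hdvd
  -- If 24 divided the count, all relabellings of the copy would be copies, including one that puts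
  -- an adjacent pair of `h` in the place of a non-adjacent one.
  have heq := eq_of_subset_of_card_le hsub hcard
  obtain ⟨i, j, hij, ht⟩ := h1
  obtain ⟨i', j', hij', hf'⟩ := h0
  obtain ⟨σ, hi, hj⟩ := exists_perm_apply_eq hij hij'
  have hσ : f ∘ σ ∈ copies h A (univ.image f) := by
    rw [heq]; exact mem_image_of_mem _ (mem_univ σ)
  have e1 := ((mem_copies.1 hσ).2 i j hij).2.2 ht
  rw [Function.comp_apply, Function.comp_apply, hi, hj] at e1
  have e2 := ((mem_copies.1 hf).2 _ _ hij').2.1 e1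
  rw [hf'] at e2
  exact Bool.false_ne_true e2

/-- Inclusion-exclusion over the subsets of T, the vertex set of the copy. The copies in R ∪ T that
use all of T are the copies on T itself, whose number is nonzero modulo 24, and that number is an
alternating sum of the counts on the sets R ∪ V. -/
theorem exists_subset_ne_zero (hf : f ∈ copies h A (univ.image f))
    (h1 : ∃ i j, i ≠ j ∧ h i j = true) (h0 : ∃ i j, i ≠ j ∧ h i j = false) {R : Finset ℕ}
    (hR : Disjoint R (univ.image f)) : ∃ V ⊆ univ.image f, ((copies h A (R ∪ V)).card : ZMod 24) ≠ 0 := by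
  by_contra! hc
  set T := univ.image f with hT
  apply card_copies_image_ne_zero hf h1 h0
  let B : ℕ → Finset (Fin 4 → ℕ) := fun u => copies h A (R ∪ T.erase u)
  have hinter : ∀ J : Finset ℕ, (hJ : J.Nonempty) → J ⊆ T →
      J.inf' hJ B = copies h A (R ∪ T \ J) := by
    intro J hJ hJT
    ext g
    rw [mem_inf']
    simp only [B, mem_copies, mem_union, mem_erase, mem_sdiff]
    constructor
    · intro hall
      obtain ⟨j0, hj0⟩ := hJ
      refine ⟨fun i => ?_, (hall j0 hj0).2⟩
      rcases (hall j0 hj0).1 i with hi | hi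
      · exact Or.inl hi
      · by_cases hiJ : g i ∈ J
        · rcases (hall _ hiJ).1 i with hi' | hi'
          · exact Or.inl hi'
          · exact (hi'.1 rfl).elim
        · exact Or.inr ⟨hi.2, hiJ⟩
    · rintro ⟨h2, h3⟩ j hj
      refine ⟨fun i => ?_, h3⟩
      rcases h2 i with hi | hi
      · exact Or.inl hi
      · exact Or.inr ⟨fun hij => hi.2 (hij ▸ hj), hi.1⟩
  -- A copy in R ∪ T either omits some vertex of T or, having four vertices, has T as its vertex
  -- set.
  have hunion : copies h A (R ∪ T) = T.biUnion B ∪ copies h A T := by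
    ext g
    simp only [mem_union, mem_biUnion]
    constructor
    · intro hg
      obtain ⟨h2, h3⟩ := mem_copies.1 hg
      by_cases hTg : T ⊆ univ.image g
      · right
        have : T = univ.image g := eq_of_subset_of_card_le hTg (by
          rw [card_image_of_mem_copies hg, card_image_of_mem_copies hf])
        rw [this]
        exact mem_copies_image hg
      · left
        obtain ⟨u, hu, hug⟩ := not_subset.1 hTg
        refine ⟨u, hu, mem_copies.2 ⟨fun i => ?_, h3⟩⟩
        rcases mem_union.1 (h2 i) with hi | hi
        · exact mem_union_left _ hi
        · exact mem_union_right _ (mem_erase.2 ⟨fun hc => hug (hc ▸ mem_image_of_mem _ (mem_univ i)),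
            hi⟩)
    · rintro (⟨u, hu, hg⟩ | hg)
      · refine mem_copies.2 ⟨fun i => ?_, (mem_copies.1 hg).2⟩
        exact union_subset_union_right (erase_subset _ _) ((mem_copies.1 hg).1 i)
      · exact mem_copies.2 ⟨fun i => mem_union_right _ ((mem_copies.1 hg).1 i), (mem_copies.1 hg).2⟩
  have hdisj : Disjoint (T.biUnion B) (copies h A T) := by
    rw [disjoint_left]
    intro g hg hg'
    obtain ⟨u, hu, hgu⟩ := mem_biUnion.1 hg
    obtain ⟨σ, -, rfl⟩ := mem_image.1 (copies_image_subset hf hg')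
    have : u ∈ univ.image (f ∘ σ) := by rw [image_comp_perm]; exact hu
    obtain ⟨i, -, hi⟩ := mem_image.1 this
    rcases mem_union.1 ((mem_copies.1 hgu).1 i) with h2 | h2
    · rw [hi] at h2; exact disjoint_left.1 hR h2 hu
    · exact (mem_erase.1 h2).1 hi
  have hB : ((T.biUnion B).card : ZMod 24) = 0 := by
    have hcast : ((T.biUnion B).card : ZMod 24) = (((T.biUnion B).card : ℤ) : ZMod 24) := by simp
    rw [hcast, inclusion_exclusion_card_biUnion, Int.cast_sum]
    refine sum_eq_zero fun J _ => ?_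
    have hJ := mem_filter.1 J.2
    rw [hinter _ hJ.2 (mem_powerset.1 hJ.1), Int.cast_mul, Int.cast_natCast,
      hc _ sdiff_subset, mul_zero]
  have := hc T subset_rfl
  rwa [hunion, card_union_of_disjoint hdisj, Nat.cast_add, hB, zero_add] at this

/-- The sets on which the number of copies is divisible by `24`. -/
def badSets (h : Fin 4 → Fin 4 → Bool) (A : ℕ → ℕ → ℕ) (n : ℕ) : Finset (Finset ℕ) :=
  (range n).powerset.filter fun U => ((copies h A U).card : ZMod 24) = 0

/-- Each of the 2^(n-4) sets R outside the copy is completed to a set R ∪ V with nonzero count.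
Removing the vertices of the copy recovers R, so these sets are distinct and make up a sixteenth of
all sets. -/
theorem card_badSets_le {n : ℕ} (hf : f ∈ copies h A (range n))
    (h1 : ∃ i j, i ≠ j ∧ h i j = true) (h0 : ∃ i j, i ≠ j ∧ h i j = false) :
    16 * (badSets h A n).card ≤ 15 * 2 ^ n := by
  have hf' := mem_copies_image hf
  have hTn : univ.image f ⊆ range n := fun v hv => by
    obtain ⟨i, -, rfl⟩ := mem_image.1 hv
    exact (mem_copies.1 hf).1 i
  have hcard := card_image_of_mem_copies hf
  have hV : ∀ R : Finset ℕ, ∃ V ⊆ univ.image f, Disjoint R (univ.image f) →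
      ((copies h A (R ∪ V)).card : ZMod 24) ≠ 0 := fun R => by
    by_cases hR : Disjoint R (univ.image f)
    · obtain ⟨V, h2, h3⟩ := exists_subset_ne_zero hf' h1 h0 hR
      exact ⟨V, h2, fun _ => h3⟩
    · exact ⟨∅, empty_subset _, fun hc => (hR hc).elim⟩
  choose V hV hVne using hV
  set T := univ.image f with hT
  have hn : 4 ≤ n := by
    have := card_le_card hTn; rwa [hcard, card_range] at this
  have hgood : 2 ^ (n - 4) ≤ ((range n).powerset.filter fun U =>
      ¬ ((copies h A U).card : ZMod 24) = 0).card := by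
    have hc : (range n \ T).powerset.card = 2 ^ (n - 4) := by
      rw [card_powerset, card_sdiff_of_subset hTn, hcard, card_range]
    rw [← hc]
    refine card_le_card_of_injOn (fun R => R ∪ V R) (fun R hR => ?_) fun R hR R' hR' heq => ?_
    · have hR := mem_powerset.1 (mem_coe.1 hR)
      refine mem_filter.2 ⟨mem_powerset.2 (union_subset (hR.trans sdiff_subset)
        ((hV R).trans hTn)), hVne R (disjoint_left.2 fun v hv hvT =>
          (mem_sdiff.1 (hR hv)).2 hvT)⟩
    · have hR := mem_powerset.1 (mem_coe.1 hR)
      have hR' := mem_powerset.1 (mem_coe.1 hR')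
      have key : ∀ R, R ⊆ range n \ T → (R ∪ V R) \ T = R := fun R hR => by
        rw [union_sdiff_distrib, sdiff_eq_empty_iff_subset.2 (hV R), union_empty,
          sdiff_eq_self_of_disjoint]
        exact disjoint_left.2 fun v hv hvT => (mem_sdiff.1 (hR hv)).2 hvT
      rw [← key R hR, ← key R' hR']
      exact congrArg (· \ T) heq
  have hsum := card_filter_add_card_filter_not (s := (range n).powerset)
    (fun U => ((copies h A U).card : ZMod 24) = 0)
  rw [card_powerset, card_range] at hsum
  have hpow : 2 ^ n = 16 * 2 ^ (n - 4) := by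
    rw [show (16 : ℕ) = 2 ^ 4 by norm_num, ← pow_add]; congr 1; omega
  rw [badSets]
  omega

end

/-! ### Random sets -/

/-- The random set of the trial `t`. -/
def coinSet (n : ℕ) (b : ℕ → Bool) (t : ℕ) : Finset ℕ := (range n).filter fun v => b (t * n + v) = true

instance : IsProbabilityMeasure coinMeasure := by
  unfold coinMeasure; infer_instance

theorem coinMeasure_cylinder (N : ℕ) (c : ℕ → Bool) :
    coinMeasure (Set.pi (range N) fun i => {c i}) = (2⁻¹ : ENNReal) ^ N := by
  rw [coinMeasure, Measure.infinitePi_pi _ fun _ _ => measurableSet_singleton _]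
  simp

/-- A union bound over the |X|^m sequences of sets: each determines the first mn bits and has
probability 2^(-mn). Neither independence of the trials nor measurability has to be discussed. -/
theorem coinMeasure_forall_mem_le (n m : ℕ) (X : Finset (Finset ℕ)) :
    coinMeasure {b | ∀ t < m, coinSet n b t ∈ X} ≤ (X.card : ENNReal) ^ m * 2⁻¹ ^ (m * n) := by
  classical
  let c : (Fin m → Finset ℕ) → ℕ → Bool := fun x i =>
    if ht : i / n < m then decide (i % n ∈ x ⟨i / n, ht⟩) else false
  have hsub : {b | ∀ t < m, coinSet n b t ∈ X} ⊆
      ⋃ x ∈ Fintype.piFinset fun _ : Fin m => X, Set.pi (range (m * n)) fun i => {c x i} := by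
    intro b hb
    refine Set.mem_biUnion (x := fun t : Fin m => coinSet n b t)
      (Finset.mem_coe.2 (Fintype.mem_piFinset.2 fun t => hb t t.2)) fun i hi => ?_
    have hi : i < m * n := by simpa using hi
    have hn : 0 < n := Nat.pos_of_ne_zero fun h0 => by simp [h0] at hi
    have ht : i / n < m := Nat.div_lt_of_lt_mul (by rwa [mul_comm])
    simp only [c, dif_pos ht, coinSet, mem_filter, mem_range, Nat.mod_lt _ hn, true_and,
      Set.mem_singleton_iff, Nat.div_add_mod']
    simp
  calc coinMeasure {b | ∀ t < m, coinSet n b t ∈ X} ≤ _ := measure_mono hsub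
    _ ≤ ∑ x ∈ Fintype.piFinset fun _ : Fin m => X,
        coinMeasure (Set.pi (range (m * n)) fun i => {c x i}) := measure_biUnion_finset_le _ _
    _ = (X.card : ENNReal) ^ m * 2⁻¹ ^ (m * n) := by
      simp only [coinMeasure_cylinder, sum_const, Fintype.card_piFinset, prod_const, card_univ,
        Fintype.card_fin, nsmul_eq_mul, Nat.cast_pow]

/-- Outside E all eleven random sets are bad, which has probability at most (15/16)^11. Eleven is
the least exponent for which this is at most 1/2. -/
theorem half_le_coinMeasure {h : Fin 4 → Fin 4 → Bool} {A : ℕ → ℕ → ℕ} {f : Fin 4 → ℕ} {n : ℕ}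
    (hf : f ∈ copies h A (range n))
    (h1 : ∃ i j, i ≠ j ∧ h i j = true) (h0 : ∃ i j, i ≠ j ∧ h i j = false) {E : Set (ℕ → Bool)}
    (hE : ∀ b, ∀ t < 11, ((copies h A (coinSet n b t)).card : ZMod 24) ≠ 0 → b ∈ E) :
    1 / 2 ≤ coinMeasure E := by
  have hbad : coinMeasure Eᶜ ≤ 1 / 2 := by
    calc coinMeasure Eᶜ ≤ coinMeasure {b | ∀ t < 11, coinSet n b t ∈ badSets h A n} := by
          refine measure_mono fun b hb t ht => mem_filter.2 ⟨mem_powerset.2 (filter_subset _ _), ?_⟩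
          by_contra hc
          exact hb (hE b t ht hc)
      _ ≤ _ := coinMeasure_forall_mem_le n 11 _
      _ ≤ 1 / 2 := by
        have hle := card_badSets_le hf h1 h0
        have hle' : ((badSets h A n).card : ENNReal) ≤ 16⁻¹ * 15 * 2 ^ n := by
          have : (16 : ENNReal) * (badSets h A n).card ≤ 15 * 2 ^ n := by exact_mod_cast hle
          rw [mul_assoc]
          calc ((badSets h A n).card : ENNReal) = 16⁻¹ * (16 * (badSets h A n).card) := by
                rw [← mul_assoc, ENNReal.inv_mul_cancel (by simp) (by simp), one_mul]
            _ ≤ _ := by gcongr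
        have h2 : (2 : ENNReal) * 2⁻¹ = 1 := ENNReal.mul_inv_cancel (by simp) (by simp)
        calc ((badSets h A n).card : ENNReal) ^ 11 * 2⁻¹ ^ (11 * n)
            ≤ (16⁻¹ * 15 * 2 ^ n) ^ 11 * 2⁻¹ ^ (11 * n) := by gcongr
          _ = (16⁻¹ * 15) ^ 11 * ((2 * 2⁻¹) ^ n) ^ 11 := by
            rw [mul_comm 11 n, pow_mul, mul_pow, mul_pow, mul_pow, mul_pow, mul_assoc]
          _ = (16 ^ 11)⁻¹ * 15 ^ 11 := by
            rw [h2, one_pow, one_pow, mul_one, mul_pow, ENNReal.inv_pow]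
          _ ≤ 1 / 2 := by
            rw [one_div, ENNReal.inv_mul_le_iff (by simp) (by simp), ← div_eq_mul_inv,
              ENNReal.le_div_iff_mul_le (by simp) (by simp)]
            norm_num
  -- Subadditivity suffices here, so E need not be measurable.
  have huniv : (1 : ENNReal) ≤ coinMeasure E + coinMeasure Eᶜ := by
    rw [← measure_univ (μ := coinMeasure), ← Set.union_compl_self E]
    exact measure_union_le _ _
  have : (1 : ENNReal) / 2 + 1 / 2 ≤ coinMeasure E + 1 / 2 := by
    rw [ENNReal.add_halves]; exact huniv.trans (by gcongr)
  exact (ENNReal.add_le_add_iff_right (by simp)).1 this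

/-! ### The exponent of matrix multiplication -/

/-- Only a store changes memory, one cell per step; so the time bounds the number of changed cells.
-/
theorem Exec.exists_changed {w : ℕ} {p : Prog} {s s' : State} {t : ℕ} (h : Exec w p s t s') :
    ∃ D : Finset (ℕ × ℕ), D.card ≤ t ∧ ∀ a i, (a, i) ∉ D → s'.mem a i = s.mem a i := by
  induction h with
  | seq hp hq ih₁ ih₂ =>
    obtain ⟨D₁, hc₁, h₁⟩ := ih₁
    obtain ⟨D₂, hc₂, h₂⟩ := ih₂
    refine ⟨D₁ ∪ D₂, (card_union_le _ _).trans (by omega), fun a i hi => ?_⟩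
    rw [mem_union, not_or] at hi
    rw [h₂ a i hi.2, h₁ a i hi.1]
  | loopStep h hp hq ih₁ ih₂ =>
    obtain ⟨D₁, hc₁, h₁⟩ := ih₁
    obtain ⟨D₂, hc₂, h₂⟩ := ih₂
    refine ⟨D₁ ∪ D₂, (card_union_le _ _).trans (by omega), fun a i hi => ?_⟩
    rw [mem_union, not_or] at hi
    rw [h₂ a i hi.2, h₁ a i hi.1]
  | condTrue h hp ih =>
    obtain ⟨D, hc, hD⟩ := ih
    exact ⟨D, by omega, hD⟩
  | condFalse h hp ih =>
    obtain ⟨D, hc, hD⟩ := ih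
    exact ⟨D, by omega, hD⟩
  | store s a i r =>
    refine ⟨{(a, s.reg i)}, by simp, fun a' i' hi => ?_⟩
    simp only [mem_singleton, Prod.mk.injEq, not_and] at hi
    by_cases ha : a' = a
    · subst ha; simp [State.setMem, hi rfl]
    · simp [State.setMem, ha]
  | _ => exact ⟨∅, by simp, fun _ _ _ => rfl⟩

theorem pow_le_two_pow (m c w : ℕ) (h : m * c ≤ w) : m ^ c ≤ 2 ^ w :=
  calc m ^ c ≤ (2 ^ m) ^ c := Nat.pow_le_pow_left Nat.lt_two_pow_self.le c
    _ = 2 ^ (m * c) := (pow_mul _ _ _).symm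
    _ ≤ 2 ^ w := Nat.pow_le_pow_right (by decide) h

/-- Multiply zero matrices on a machine whose output array is filled with ones. All N² output cells
must be overwritten, so N² ≤ C N^ω for every N ≥ 1. -/
theorem two_le_of_isMatMulExponent {ω : ℝ} (h : IsMatMulExponent ω) : 2 ≤ ω := by
  obtain ⟨p, c, C, h⟩ := h
  have key : ∀ N : ℕ, 0 < N → (N : ℝ) ^ (2 : ℝ) ≤ C * (N : ℝ) ^ ω := by
    intro N hN
    set w := (N + 2) * c + N + 1 with hw
    have hlt : N < 2 ^ w := Nat.lt_two_pow_self.trans_le (Nat.pow_le_pow_right (by decide) (by omega))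
    obtain ⟨t, s', hex, ht, hM⟩ := h N 0 0 hN (by simp) (by simp) w
      ⟨fun _ => N, fun a _ => if a = 2 then 1 else 0, fun _ => false⟩
      (pow_le_two_pow _ _ _ (by omega)) ⟨fun _ => hlt, fun a i => by dsimp only; split_ifs <;> omega⟩ rfl (fun i j => rfl)
      fun i j => rfl
    refine le_trans ?_ ht
    obtain ⟨D, hD, hch⟩ := hex.exists_changed
    have hsub : (univ : Finset (Fin N × Fin N)).card ≤ D.card := by
      refine card_le_card_of_injOn (fun q => (2, N * (q.1 : ℕ) + q.2)) (fun q _ => ?_)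
        fun q _ q' _ heq => ?_
      · by_contra hc
        have h1 := hch _ _ hc
        rw [hM q.1 q.2] at h1
        simp at h1
      · simp only [Prod.mk.injEq, true_and] at heq
        have h1 : (q.1 : ℕ) = q'.1 := by
          have := congrArg (· / N) heq
          simpa [Nat.mul_add_div hN, Nat.div_eq_of_lt q.2.2, Nat.div_eq_of_lt q'.2.2] using this
        have h2 : (q.2 : ℕ) = q'.2 := by rw [h1] at heq; omega
        exact Prod.ext (Fin.ext h1) (Fin.ext h2)
    rw [card_univ, Fintype.card_prod, Fintype.card_fin] at hsub
    rw [Real.rpow_two, sq]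
    exact_mod_cast hsub.trans hD
  by_contra! hlt
  -- If ω < 2, then N^(2-ω) tends to infinity and exceeds C.
  have hlim := (tendsto_rpow_atTop (sub_pos.2 hlt)).comp
    (tendsto_natCast_atTop_atTop (R := ℝ))
  obtain ⟨N, hN, hN0⟩ := ((hlim.eventually_gt_atTop C).and (Filter.eventually_gt_atTop 0)).exists
  have hpos : (0 : ℝ) < N := by exact_mod_cast hN0
  have h1 := key N hN0
  have h2 : (N : ℝ) ^ (2 : ℝ) = (N : ℝ) ^ (2 - ω) * (N : ℝ) ^ ω := by
    rw [← Real.rpow_add hpos]; congr 1; ring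
  rw [h2] at h1
  exact absurd (le_of_mul_le_mul_right h1 (Real.rpow_pos_of_pos hpos _)) (not_le.2 hN)

/-- The cost C N^ω is written as a rate of order N^(ω-1) times N. For N ≤ 2k the rate is at most a
natural number Λ of order k^(ω-1), so the costs of all blocks can be added through their dimensions.
-/
theorem exists_mulSpec {ω : ℝ} (h : IsMatMulExponent ω) : ∃ (p : Prog) (c : ℕ) (C : ℝ), 0 ≤ C ∧
    ∀ k : ℕ, 0 < k → ∃ Λ : ℕ, 2 * k ≤ Λ ∧ (Λ : ℝ) ≤ C * (k : ℝ) ^ (ω - 1) ∧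
      ∀ w n : ℕ, (n + 2) ^ c ≤ 2 ^ w → ∀ N, 0 < N → N ≤ 2 * k → N ≤ n → MulSpec p w N (Λ * N) := by
  have hω := two_le_of_isMatMulExponent h
  obtain ⟨p, c, C, h⟩ := h
  -- The factor 2^(ω-1) is for dimensions up to 2k, and the 2 ensures 2k ≤ Λ because k ≤ k^(ω-1).
  -- The constant C is not assumed to be nonnegative.
  set D := max C 0 * 2 ^ (ω - 1) + 2 with hD
  have hC0 : 0 ≤ max C 0 * 2 ^ (ω - 1) := by positivity
  refine ⟨p, c, D + 1, by linarith, fun k hk => ?_⟩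
  have hk1 : (1 : ℝ) ≤ k := by exact_mod_cast hk
  have hkω : (k : ℝ) ≤ (k : ℝ) ^ (ω - 1) := by
    simpa using Real.rpow_le_rpow_of_exponent_le hk1 (by linarith : (1 : ℝ) ≤ ω - 1)
  refine ⟨⌈D * (k : ℝ) ^ (ω - 1)⌉₊, ?_, ?_, ?_⟩
  · have : ((2 * k : ℕ) : ℝ) ≤ ⌈D * (k : ℝ) ^ (ω - 1)⌉₊ := by
      refine le_trans ?_ (Nat.le_ceil _)
      push_cast
      have : 2 * (k : ℝ) ^ (ω - 1) ≤ D * (k : ℝ) ^ (ω - 1) := by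
        gcongr; linarith
      linarith
    exact_mod_cast this
  · have : 0 ≤ D * (k : ℝ) ^ (ω - 1) := mul_nonneg (by linarith) (by positivity)
    have := (Nat.ceil_lt_add_one this).le
    nlinarith
  · intro w n hw N hN hNk hNn A B hA hB s hs h0 h1 h2
    obtain ⟨t, s', hex, ht, hM⟩ := h N A B hN hA hB w s
      ((Nat.pow_le_pow_left (by omega) c).trans hw) hs h0 h1 h2
    refine ⟨t, s', hex, ?_, hM⟩
    have hN0 : (0 : ℝ) < N := by exact_mod_cast hN
    have h3 : (N : ℝ) ^ ω = (N : ℝ) ^ (ω - 1) * N := by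
      rw [← Real.rpow_add_one hN0.ne']; congr 1; ring
    have h4 : (N : ℝ) ^ (ω - 1) ≤ 2 ^ (ω - 1) * (k : ℝ) ^ (ω - 1) := by
      rw [← Real.mul_rpow (by norm_num) (by linarith)]
      exact Real.rpow_le_rpow hN0.le (by exact_mod_cast hNk) (by linarith)
    have h5 : (t : ℝ) ≤ ⌈D * (k : ℝ) ^ (ω - 1)⌉₊ * N := by
      calc (t : ℝ) ≤ C * (N : ℝ) ^ ω := ht
        _ ≤ max C 0 * (N : ℝ) ^ ω := by gcongr; exact le_max_left _ _
        _ = max C 0 * (N : ℝ) ^ (ω - 1) * N := by rw [h3]; ring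
        _ ≤ max C 0 * (2 ^ (ω - 1) * (k : ℝ) ^ (ω - 1)) * N := by gcongr
        _ ≤ D * (k : ℝ) ^ (ω - 1) * N := by
          rw [← mul_assoc]
          gcongr
          linarith
        _ ≤ _ := by gcongr; exact Nat.le_ceil _
    exact_mod_cast h5

/-! ### The program -/

/-- Branch on an entry of the matrix. -/
def branch (i : ℕ) (f : Bool → Cmd) : Cmd := .ite (.rd aH (.lit i)) (f true) (f false)

/-- Branch on the graph on four vertices. -/
def dispatch (d : (Fin 6 → Bool) → Cmd) : Cmd :=
  branch 1 fun b0 => branch 2 fun b1 => branch 6 fun b2 => branch 3 fun b3 => branch 7 fun b4 =>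
    branch 11 fun b5 => d ![b0, b1, b2, b3, b4, b5]

/-- The graph given by six bits. -/
def bitGraph (x : Fin 6 → Bool) : Fin 4 → Fin 4 → Bool := adj4 (x 0) (x 1) (x 2) (x 3) (x 4) (x 5)

theorem branch_spec {p : Prog} {w i T : ℕ} {f : Bool → Cmd} {Q : State → Prop} {s : State} {b : Bool}
    (hw : 1 < word w) (hi : i < word w) (hb : s.mem aH i = b.toNat) (h : WP p w (f b) T Q s) :
    WP p w (branch i f) (3 + T) Q s := by
  refine WP.ite (e := .rd aH (.lit i)) hw hi (fun h0 => ?_) fun h0 => ?_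
  · rw [Expr.eval_rd, Expr.eval_lit, hb] at h0
    cases b
    · exact (h0 rfl).elim
    · exact h
  · rw [Expr.eval_rd, Expr.eval_lit, hb] at h0
    cases b
    · exact h
    · simp at h0

theorem dispatch_spec {p : Prog} {w T : ℕ} {d : (Fin 6 → Bool) → Cmd} {Q : State → Prop} {s : State}
    {x : Fin 6 → Bool} (hw : 11 < word w)
    (hx : ∀ i j : Fin 4, s.mem aH (4 * i + j) = (bitGraph x i j).toNat) (h : WP p w (d x) T Q s) :
    WP p w (dispatch d) (18 + T) Q s := by
  have hx' : x = ![x 0, x 1, x 2, x 3, x 4, x 5] := by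
    ext i; fin_cases i <;> rfl
  rw [hx'] at h
  refine WP.le (branch_spec (by omega) (by omega) (hx 0 1) <|
    branch_spec (by omega) (by omega) (hx 0 2) <| branch_spec (by omega) (by omega) (hx 1 2) <|
    branch_spec (by omega) (by omega) (hx 0 3) <| branch_spec (by omega) (by omega) (hx 1 3) <|
    branch_spec (by omega) (by omega) (hx 2 3) h) (by omega)

/-- The coefficients of the formula are part of the program text, so there is one program for each
of the 64 bit patterns. Their formulas need only exist, and finiteness bounds the costs by a common
K. -/
theorem exists_cmds : ∃ (d : (Fin 6 → Bool) → Cmd) (K : ℕ), ∀ x : Fin 6 → Bool,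
    (∃ i j, i ≠ j ∧ bitGraph x i j = true) → ∃ F γ δ, d x = trials 11 F γ δ ∧ F.comp.cost ≤ K ∧
      ∀ B y, IsAdj B → (indCount (bitGraph x) B y : ZMod 24) = formula F γ δ B y := by
  have key : ∀ x : Fin 6 → Bool, ∃ q : Pol × ℕ × ℕ, (∃ i j, i ≠ j ∧ bitGraph x i j = true) →
      ∀ B y, IsAdj B → (indCount (bitGraph x) B y : ZMod 24) = formula q.1 q.2.1 q.2.2 B y := by
    intro x
    by_cases hx : (x 0 || x 1 || x 2 || x 3 || x 4 || x 5) = true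
    · obtain ⟨F, γ, δ, h⟩ := hasFormula _ _ _ _ _ _ hx
      exact ⟨⟨F, γ, δ⟩, fun _ => h⟩
    -- For the empty graph any coefficients do; this pattern is excluded by the hypothesis.
    · obtain ⟨F, γ, δ, -⟩ := hasFormula true true true true true true rfl
      refine ⟨⟨F, γ, δ⟩, fun ⟨i, j, hij, h⟩ => False.elim ?_⟩
      simp only [Bool.or_eq_true, not_or, Bool.not_eq_true] at hx
      simp only [bitGraph, hx] at h
      exact (by decide : ∀ i j, ¬ adj4 false false false false false false i j = true) i j h
  choose q hq using key
  refine ⟨fun x => trials 11 (q x).1 (q x).2.1 (q x).2.2, univ.sup fun x => (q x).1.comp.cost,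
    fun x hx => ⟨_, _, _, rfl, le_sup (f := fun x => (q x).1.comp.cost) (mem_univ x), hq x hx⟩⟩

/-- The search for an induced copy. -/
def search (d : (Fin 6 → Bool) → Cmd) : Cmd := prepare 11 ;; dispatch d

section
variable {n : ℕ} {adj : ℕ → ℕ → Prop} {ord : ℕ → ℕ} {h : Fin 4 → Fin 4 → Bool}
  (hord : ∀ a < n, ord a < n)

theorem ordAdj_eq_one {a b : ℕ} (ha : a < n) (hb : b < n) :
    ordAdj n adj ord a b = 1 ↔ adj (ord a) (ord b) := by
  simp [ordAdj, ha, hb]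

include hord

theorem comp_mem_copies (hinj : ∀ a < n, ∀ b < n, ord a = ord b → a = b) {T T' : Finset ℕ}
    (hT : T ⊆ range n) {f : Fin 4 → ℕ} (hfT : ∀ i, f i ∈ T → ord (f i) ∈ T')
    (hf : f ∈ copies h (ordAdj n adj ord) T) :
    (fun i => ord (f i)) ∈ copies h (ordAdj n adj id) T' := by
  obtain ⟨h1, h2⟩ := mem_copies.1 hf
  have hn : ∀ i, f i < n := fun i => mem_range.1 (hT (h1 i))
  refine mem_copies.2 ⟨fun i => hfT i (h1 i), fun i j hij => ⟨fun hc =>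
    (h2 i j hij).1 (hinj _ (hn i) _ (hn j) hc), ?_⟩⟩
  rw [ordAdj_eq_one (hord _ (hn i)) (hord _ (hn j)), ← (h2 i j hij).2,
    ordAdj_eq_one (hn i) (hn j)]
  rfl

/-- The random bits belong to vertices, not to positions. After transport along the bijection `ord`,
the count is that on `coinSet`, which does not mention the order; so the probability can be
estimated without knowing it. -/
theorem card_copies_rndSet (hsurj : ∀ v < n, ∃ a < n, ord a = v)
    (hinj : ∀ a < n, ∀ b < n, ord a = ord b → a = b) {m t : ℕ} (ht : t < m) {rnd : ℕ → ℕ}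
    {b : ℕ → Bool} (hrnd : ∀ i < m * n, rnd i = (b i).toNat) :
    (copies h (ordAdj n adj ord) (rndSet n ord rnd t)).card =
      (copies h (ordAdj n adj id) (coinSet n b t)).card := by
  have hlt : ∀ v < n, t * n + v < m * n := fun v hv => by
    calc t * n + v < t * n + n := by omega
      _ = (t + 1) * n := by ring
      _ ≤ m * n := Nat.mul_le_mul_right _ ht
  have hmem : ∀ a, a ∈ rndSet n ord rnd t ↔ a < n ∧ ord a ∈ coinSet n b t := by
    intro a
    simp only [rndSet, coinSet, mem_filter, mem_range]
    refine and_congr_right fun ha => ?_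
    rw [hrnd _ (hlt _ (hord a ha))]
    simp [hord a ha]
  have hsub : rndSet n ord rnd t ⊆ range n := filter_subset _ _
  refine card_bij (fun f _ i => ord (f i)) (fun f hf => comp_mem_copies hord hinj hsub
    (fun i hi => ((hmem _).1 hi).2) hf) (fun f hf g hg hfg => ?_) fun g hg => ?_
  · ext i
    exact hinj _ (mem_range.1 (hsub ((mem_copies.1 hf).1 i))) _
      (mem_range.1 (hsub ((mem_copies.1 hg).1 i))) (congrFun hfg i)
  · obtain ⟨h1, h2⟩ := mem_copies.1 hg
    have hgn : ∀ i, g i < n := fun i => mem_range.1 (filter_subset _ _ (h1 i))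
    choose f hf hfg using fun i => hsurj (g i) (hgn i)
    refine ⟨f, mem_copies.2 ⟨fun i => (hmem _).2 ⟨hf i, (hfg i).symm ▸ h1 i⟩, fun i j hij =>
      ⟨fun hc => (h2 i j hij).1 (by rw [← hfg i, ← hfg j, hc]), ?_⟩⟩, funext hfg⟩
    rw [ordAdj_eq_one (hf i) (hf j), ← (h2 i j hij).2, ordAdj_eq_one (hgn i) (hgn j), hfg, hfg]
    rfl

end

theorem bitGraph_symm (x : Fin 6 → Bool) (i j : Fin 4) : bitGraph x i j = bitGraph x j i := by
  fin_cases i <;> fin_cases j <;> rfl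

theorem search_spec {p : Prog} {w n k Λ K : ℕ} {adj : ℕ → ℕ → Prop} {sep : ℕ → Prop}
    {conn : ℕ → ℕ → Prop} {s : State} (hI : IsInstance n k adj sep conn)
    (hbig : 2000 + 20 * n + 2 * (n * n) ≤ word w) (hs : HasInput s n adj sep)
    {d : (Fin 6 → Bool) → Cmd} {x : Fin 6 → Bool}
    (hx : ∀ i j : Fin 4, s.mem aH (4 * i + j) = (bitGraph x i j).toNat)
    (hd : ∃ F γ δ, d x = trials 11 F γ δ ∧ F.comp.cost ≤ K ∧
      ∀ B y, IsAdj B → (indCount (bitGraph x) B y : ZMod 24) = formula F γ δ B y)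
    (hmul : ∀ N, 0 < N → N ≤ 2 * k → N ≤ n → MulSpec p w N (Λ * N)) (hΛ : 2 * k ≤ Λ) :
    WP p w (search d) (2000 * ((n + 1) * (k + 1)) +
        (18 + (11 * (300001 * ((9000 + 5 * K) * (Λ + 1) * (n + 1))) + 20)))
      (fun s' => (s'.reg 0 = 0 ∨ s'.reg 0 = 1 ∧ ∃ f ∈ copies (bitGraph x) (ordAdj n adj id) (range n),
          ∀ i : Fin 4, s'.mem 0 i = f i) ∧
        ∀ t < 11, ((copies (bitGraph x) (ordAdj n adj id) (coinSet n s.coins t)).card : ZMod 24) ≠ 0 →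
          s'.reg 0 = 1) s := by
  have hw : 1 < word w := by omega
  refine (prepare_spec hI hbig (by omega) hs).seq hw ?_
  rintro s1 hf1 ho1 ⟨L, st, row, ord, hready, hl, hLk, hord, hsurj, hinj, hrnd⟩
  obtain ⟨F, γ, δ, hdx, hK, hF⟩ := hd
  refine dispatch_spec (x := x) (by omega) (by rw [hready.mem_h]; exact hx) ?_
  rw [hdx]
  refine WP.mono hw (trials_spec hl hbig hord (bitGraph_symm x) hx hF
    (fun N h1 h2 h3 => hmul N h1 (by omega) h3) (by omega) hready (m := 11) (by omega))
    (by gcongr) ?_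
  rintro s2 - - ⟨h1, h2⟩
  refine ⟨h1.imp_right fun ⟨h3, f, hf, hf'⟩ => ⟨h3, _, comp_mem_copies hord hinj subset_rfl
    (fun i hi => mem_range.2 (hord _ (mem_range.1 hi))) hf, hf'⟩, fun t ht hne => h2 t ht ?_⟩
  rwa [card_copies_rndSet hord hsurj hinj ht hrnd]

/-! ### From graphs on `Fin n` to relations on natural numbers. -/

section
variable {n k : ℕ} (G : SimpleGraph (Fin n)) (S : Finset (Fin n))

/-- Adjacency of the vertices with the given numbers. -/
def natAdj (u v : ℕ) : Prop := ∃ (hu : u < n) (hv : v < n), G.Adj ⟨u, hu⟩ ⟨v, hv⟩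

/-- Whether the vertex with the given number is in the separator. -/
def natSep (v : ℕ) : Prop := ∃ hv : v < n, (⟨v, hv⟩ : Fin n) ∈ S

open Classical in
/-- The connected component, outside of the separator, of the vertex with the given number. -/
noncomputable def natComp (v : ℕ) : Option (G.induce {v : Fin n | v ∉ S}).ConnectedComponent :=
  if h : ∃ hv : v < n, (⟨v, hv⟩ : Fin n) ∉ S then
    some ((G.induce {v : Fin n | v ∉ S}).connectedComponentMk ⟨⟨v, h.1⟩, h.2⟩)
  else none

variable {G S}

theorem natComp_eq {v : ℕ} (hv : v < n) (hS : (⟨v, hv⟩ : Fin n) ∉ S) : natComp G S v =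
    some ((G.induce {v : Fin n | v ∉ S}).connectedComponentMk ⟨⟨v, hv⟩, hS⟩) :=
  dif_pos ⟨hv, hS⟩

theorem sepCount_natSep : sepCount (natSep S) n = S.card := by
  classical
  rw [sepCount, ← card_map Fin.valEmbedding]
  congr 1
  ext v
  simp only [mem_filter, mem_range, natSep, mem_map, Fin.valEmbedding_apply]
  constructor
  · rintro ⟨-, hv, h⟩; exact ⟨_, h, rfl⟩
  · rintro ⟨u, hu, rfl⟩; exact ⟨u.2, u.2, hu⟩

/-- Connectedness is equality of components, hence an equivalence. All separator vertices share the
value `none`; this is harmless, as only vertices outside the separator are compared. -/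
theorem isInstance_of_isKSeparator (h : IsKSeparator G k S) :
    IsInstance n k (natAdj G) (natSep S) fun u v => natComp G S u = natComp G S v := by
  refine ⟨fun ⟨hu, hv, _⟩ => ⟨hu, hv⟩, fun ⟨hu, hv, h⟩ => ⟨hv, hu, h.symm⟩, fun ⟨_, _, h⟩ => h.ne rfl,
    ⟨fun _ => rfl, Eq.symm, Eq.trans⟩, ?_, ?_⟩
  · rintro u v ⟨hu, hv, huv⟩ hSu hSv
    rw [natComp_eq hu fun hc => hSu ⟨hu, hc⟩, natComp_eq hv fun hc => hSv ⟨hv, hc⟩]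
    congr 1
    exact SimpleGraph.ConnectedComponent.sound (SimpleGraph.Adj.reachable (by exact huv))
  · intro T hT hconn
    rw [sepCount_natSep]
    rcases T.eq_empty_or_nonempty with rfl | ⟨v₀, hv₀⟩
    · simpa using h.1
    obtain ⟨hlt₀, hS₀⟩ := hT v₀ hv₀
    have hS₀' : (⟨v₀, hlt₀⟩ : Fin n) ∉ S := fun hc => hS₀ ⟨hlt₀, hc⟩
    set K := (G.induce {v : Fin n | v ∉ S}).connectedComponentMk ⟨⟨v₀, hlt₀⟩, hS₀'⟩ with hK
    have hsub : (T : Set ℕ) ⊆ (fun x : {v : Fin n | v ∉ S} => ((x : Fin n) : ℕ)) '' K.supp := by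
      intro v hv
      obtain ⟨hlt, hS⟩ := hT v hv
      have hS' : (⟨v, hlt⟩ : Fin n) ∉ S := fun hc => hS ⟨hlt, hc⟩
      refine ⟨⟨⟨v, hlt⟩, hS'⟩, ?_, rfl⟩
      have := hconn v hv v₀ hv₀
      rw [natComp_eq hlt hS', natComp_eq hlt₀ hS₀'] at this
      exact Option.some.inj this
    have h1 : T.card ≤ K.supp.ncard := by
      rw [← Set.ncard_coe_finset]
      exact (Set.ncard_le_ncard hsub (Set.toFinite _)).trans (Set.ncard_image_le (Set.toFinite _))
    have h2 := h.2 K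
    have h3 := h.1
    omega

theorem isLists_of_isAdjacencyLists {off nbr : ℕ → ℕ} (h : IsAdjacencyLists G off nbr) :
    IsLists (natAdj G) n off nbr := by
  refine ⟨fun v hv => (h.2 ⟨v, hv⟩).1, fun v hv => ?_⟩
  convert (h.2 ⟨v, hv⟩).2 using 1
  ext u
  constructor
  · rintro ⟨_, hu, huv⟩; exact ⟨⟨u, hu⟩, huv, rfl⟩
  · rintro ⟨u, huv, rfl⟩; exact ⟨hv, u.2, huv⟩

/-- Vertex 0 is in the separator or in a component, and either way it is counted by k. Positivity of
k is needed to choose Λ and to absorb additive constants. -/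
theorem IsInstance.pos {adj : ℕ → ℕ → Prop} {sep : ℕ → Prop} {conn : ℕ → ℕ → Prop}
    (hI : IsInstance n k adj sep conn) (hn : 0 < n) : 0 < k := by
  classical
  by_cases h : sep 0
  · have h1 := hI.card_le ∅ (by simp) (by simp)
    have h2 : 0 < sepCount sep n := card_pos.2 ⟨0, mem_filter.2 ⟨mem_range.2 hn, h⟩⟩
    omega
  · have h1 := hI.card_le {0} (by simpa using ⟨hn, h⟩) (by simpa using hI.equiv.refl 0)
    simp at h1
    omega

end

open Classical in
/-- The bits of a graph on four vertices. -/
noncomputable def graphBits (H : SimpleGraph (Fin 4)) : Fin 6 → Bool :=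
  ![decide (H.Adj 0 1), decide (H.Adj 0 2), decide (H.Adj 1 2), decide (H.Adj 0 3),
    decide (H.Adj 1 3), decide (H.Adj 2 3)]

open Classical in
theorem bitGraph_graphBits (H : SimpleGraph (Fin 4)) (i j : Fin 4) :
    bitGraph (graphBits H) i j = decide (H.Adj i j) := by
  have h10 := H.adj_comm 1 0
  have h20 := H.adj_comm 2 0
  have h30 := H.adj_comm 3 0
  have h21 := H.adj_comm 2 1
  have h31 := H.adj_comm 3 1
  have h32 := H.adj_comm 3 2
  fin_cases i <;> fin_cases j <;> simp [bitGraph, graphBits, adj4, *]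

theorem exists_adj_of_ne_bot {V : Type*} {H : SimpleGraph V} (h : H ≠ ⊥) :
    ∃ i j, i ≠ j ∧ H.Adj i j := by
  obtain ⟨i, j, hij⟩ := SimpleGraph.ne_bot_iff_exists_adj.1 h
  exact ⟨i, j, hij.ne, hij⟩

theorem exists_not_adj_of_ne_top {V : Type*} {H : SimpleGraph V} (h : H ≠ ⊤) :
    ∃ i j, i ≠ j ∧ ¬ H.Adj i j := by
  by_contra! hc
  exact h (SimpleGraph.ext (by ext i j; exact ⟨fun hij => hij.ne, fun hij => hc i j hij⟩))

section
variable {n : ℕ} {G : SimpleGraph (Fin n)} {H : SimpleGraph (Fin 4)}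

theorem natAdj_val (u v : Fin n) : natAdj G u v ↔ G.Adj u v :=
  ⟨fun ⟨_, _, h⟩ => h, fun h => ⟨u.2, v.2, h⟩⟩

theorem mem_copies_of_embedding (f : H ↪g G) : (fun i => (f i : ℕ)) ∈
    copies (bitGraph (graphBits H)) (ordAdj n (natAdj G) id) (range n) := by
  classical
  refine mem_copies.2 ⟨fun i => mem_range.2 (f i).2, fun i j hij => ⟨fun hc =>
    hij (f.injective (Fin.ext hc)), ?_⟩⟩
  rw [ordAdj_eq_one (f i).2 (f j).2, id, id, natAdj_val, f.map_adj_iff, bitGraph_graphBits, decide_eq_true_eq]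

theorem exists_embedding {g : Fin 4 → ℕ}
    (hg : g ∈ copies (bitGraph (graphBits H)) (ordAdj n (natAdj G) id) (range n)) :
    ∃ f : H ↪g G, ∀ i, (f i : ℕ) = g i := by
  classical
  obtain ⟨h1, h2⟩ := mem_copies.1 hg
  have hn : ∀ i, g i < n := fun i => mem_range.1 (h1 i)
  refine ⟨⟨⟨fun i => ⟨g i, hn i⟩, fun i j hij => injective_of_mem_copies hg (Fin.mk.inj_iff.1 hij)⟩,
    fun {i j} => ?_⟩, fun i => rfl⟩
  by_cases hij : i = j
  · subst hij; simp
  · have := (h2 i j hij).2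
    rw [ordAdj_eq_one (hn i) (hn j), bitGraph_graphBits, decide_eq_true_eq] at this
    rw [← this]
    exact (natAdj_val (⟨g i, hn i⟩ : Fin n) ⟨g j, hn j⟩).symm

end

/-- The eleven additional factors are nine for the constant 2^9 and two for (n + 2)²; n + 2 ≥ 2 is
used for the former. -/
theorem word_bound {n c w : ℕ} (h : (n + 2) ^ (c + 11) ≤ 2 ^ w) :
    (n + 2) ^ c ≤ 2 ^ w ∧ 2000 + 20 * n + 2 * (n * n) ≤ word w := by
  refine ⟨(Nat.pow_le_pow_right (by omega) (by omega)).trans h, le_trans ?_ h⟩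
  calc 2000 + 20 * n + 2 * (n * n) ≤ 2 ^ 9 * (n + 2) ^ 2 := by nlinarith
    _ ≤ (n + 2) ^ 9 * (n + 2) ^ 2 := Nat.mul_le_mul_right _ (Nat.pow_le_pow_left (by omega) 9)
    _ = (n + 2) ^ 11 := by rw [← pow_add]
    _ ≤ (n + 2) ^ (c + 11) := Nat.pow_le_pow_right (by omega) (by omega)

theorem time_bound {n k Λ K : ℕ} (hn : 0 < n) (hk : 0 < k) (hΛ : 2 * k ≤ Λ) :
    2000 * ((n + 1) * (k + 1)) + (18 + (11 * (300001 * ((9000 + 5 * K) * (Λ + 1) * (n + 1))) + 20)) ≤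
      (20000000 * (9000 + 5 * K)) * (Λ * n) := by
  set D := 9000 + 5 * K with hD
  have h1 : (n + 1) * (k + 1) ≤ 2 * (Λ * n) := by
    calc (n + 1) * (k + 1) ≤ (2 * n) * Λ := Nat.mul_le_mul (by omega) (by omega)
      _ = 2 * (Λ * n) := by ring
  have h2 : D * (Λ + 1) * (n + 1) ≤ 4 * (D * (Λ * n)) := by
    calc D * (Λ + 1) * (n + 1) ≤ D * (2 * Λ) * (2 * n) :=
          Nat.mul_le_mul (Nat.mul_le_mul_left _ (by omega)) (by omega)
      _ = 4 * (D * (Λ * n)) := by ring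
  have h3 : 9000 * (Λ * n) ≤ D * (Λ * n) := Nat.mul_le_mul_right _ (by omega)
  have h4 : 0 < Λ * n := Nat.mul_pos (by omega) hn
  have h5 : 20000000 * D * (Λ * n) = 20000000 * (D * (Λ * n)) := mul_assoc _ _ _
  rw [h5]
  generalize D * (Λ * n) = X at *
  generalize Λ * n = Y at *
  linarith

end WordRAM

/-! ### The theorem. -/

open WordRAM in
theorem mainTheorem6 (ω : ℝ) (hω : IsMatMulExponent ω) :
    ∃ (p : Prog) (c : ℕ) (C : ℝ),
      ∀ (n k : ℕ) (G : SimpleGraph (Fin n)) (S : Finset (Fin n)) (H : SimpleGraph (Fin 4)),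
        0 < n → IsKSeparator G k S → H ≠ ⊤ → H ≠ ⊥ →
        ∀ (w : ℕ) (s : State), (n + 2) ^ c ≤ 2 ^ w → s.Fits w → HoldsInput s G S H →
          (∀ b : ℕ → Bool, ∃ (t : ℕ) (s' : State), Exec w p (s.setCoins b) t s' ∧
            (t : ℝ) ≤ C * ((k : ℝ) ^ (ω - 1) * n) ∧ (ReportsNone s' ∨ ReportsCopy s' G H)) ∧
          (H.IsIndContained G →
            1 / 2 ≤ coinMeasure {b : ℕ → Bool | ∃ (t : ℕ) (s' : State),
              Exec w p (s.setCoins b) t s' ∧ ReportsCopy s' G H}) := by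
  classical
  obtain ⟨p, c, C, hC, hmul⟩ := exists_mulSpec hω
  obtain ⟨d, K, hd⟩ := exists_cmds
  refine ⟨(search d).comp p, c + 11, (20000000 * (9000 + 5 * K) : ℕ) * C, ?_⟩
  intro n k G S H hn hS hH1 hH0 w s hw hfit ⟨hreg, hlists, hsep, hH⟩
  have hI := isInstance_of_isKSeparator hS
  have hk := hI.pos hn
  obtain ⟨hwc, hbig⟩ := word_bound hw
  obtain ⟨Λ, hΛ, hΛC, hmul⟩ := hmul k hk
  set x := graphBits H with hx
  have ht : ∃ i j, i ≠ j ∧ bitGraph x i j = true := by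
    obtain ⟨i, j, hij, h⟩ := exists_adj_of_ne_bot hH0
    exact ⟨i, j, hij, by rw [bitGraph_graphBits]; simpa using h⟩
  have hf : ∃ i j, i ≠ j ∧ bitGraph x i j = false := by
    obtain ⟨i, j, hij, h⟩ := exists_not_adj_of_ne_top hH1
    exact ⟨i, j, hij, by rw [bitGraph_graphBits]; simpa using h⟩
  -- For each fixed sequence of bits there is one run that answers correctly if it claims a copy,
  -- and that does claim one if some trial set has a nonzero count. Both parts of the theorem follow
  -- from it.
  have main : ∀ b : ℕ → Bool, ∃ (t : ℕ) (s' : State), Exec w ((search d).comp p) (s.setCoins b) t s' ∧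
      (t : ℝ) ≤ (20000000 * (9000 + 5 * K) : ℕ) * C * ((k : ℝ) ^ (ω - 1) * n) ∧
      (ReportsNone s' ∨ ReportsCopy s' G H) ∧ ∀ t < 11,
        ((copies (bitGraph x) (ordAdj n (natAdj G) id) (coinSet n b t)).card : ZMod 24) ≠ 0 →
          ReportsCopy s' G H := by
    intro b
    -- High-level register r is machine register 3r. In particular register 0, which carries the
    -- size and the answer, is the same in both.
    have hs : HasInput ⟨fun r => s.reg (3 * r), s.mem, b⟩ n (natAdj G) (natSep S) := by
      refine ⟨hreg, isLists_of_isAdjacencyLists hlists, fun v hv => ?_⟩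
      refine (hsep ⟨v, hv⟩).trans ?_
      by_cases h : (⟨v, hv⟩ : Fin n) ∈ S
      · rw [if_pos h, if_pos ⟨hv, h⟩]
      · rw [if_neg h, if_neg fun hc => h hc.2]
    obtain ⟨t, s', σ, hex, htime, hrep, -, h1, h2⟩ := search_spec (p := p) (d := d) (x := x) (K := K)
      hI hbig hs (fun i j => by
        refine (hH i j).trans ?_
        rw [bitGraph_graphBits]
        by_cases h : H.Adj i j <;> simp [h]) (hd x ht) (hmul w n hwc) hΛ (s.setCoins b)
      ⟨fun _ => rfl, rfl, rfl⟩ hfit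
    have e0 : s'.reg 0 = σ.reg 0 := hrep.reg 0
    have hcopy : σ.reg 0 = 1 → ReportsCopy s' G H := by
      intro h
      rcases h1 with h0 | ⟨-, g, hg, hg'⟩
      · omega
      · obtain ⟨f, hf⟩ := exists_embedding hg
        exact ⟨e0.trans h, f, fun i => by rw [hrep.mem, hg', hf]⟩
    refine ⟨t, s', hex, ?_, ?_, fun t ht hne => hcopy (h2 t ht hne)⟩
    · have h3 : (t : ℝ) ≤ (20000000 * (9000 + 5 * K) : ℕ) * (Λ * n) := by
        exact_mod_cast htime.trans (time_bound hn hk hΛ)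
      calc (t : ℝ) ≤ (20000000 * (9000 + 5 * K) : ℕ) * (Λ * n) := h3
        _ ≤ (20000000 * (9000 + 5 * K) : ℕ) * (C * (k : ℝ) ^ (ω - 1) * n) := by gcongr
        _ = _ := by ring
    · rcases h1 with h0 | ⟨h0, -⟩
      · exact Or.inl (e0.trans h0)
      · exact Or.inr (hcopy h0)
  refine ⟨fun b => ?_, fun ⟨f⟩ => ?_⟩
  · obtain ⟨t, s', h1, h2, h3, -⟩ := main b
    exact ⟨t, s', h1, h2, h3⟩
  · refine half_le_coinMeasure (mem_copies_of_embedding f) ht hf fun b t ht hne => ?_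
    obtain ⟨t', s', h1, -, -, h4⟩ := main b
    exact ⟨t', s', h1, h4 t ht hne⟩
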